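/- Let $d\ge 2$, let $\mathcal S=\{v\in\mathbb R^d_+:\sum_i v_i=1\}$, $\|v\|=\sum_i|v_i|$, and for a matrix $g$ with positive entries let $\|g\|=\sum_{i,j}g^{i,j}$ and $g\cdot v=gv/\|gv\|$. Let $\mu$ be the law of a random $d\times d$ matrix with (almost surely) strictly positive entries; $\operatorname{supp}\mu$ is its support in the set of such matrices. Assume **A1.** There is $c>1$ with $\max_{i,j}g^{i,j}\le c\,\min_{i,j}g^{i,j}$ for all $g\in\operatorname{supp}\mu$. Let $I_\mu^{+}=\{s\ge 0:\int\|g\|^s\mu(dg)<\infty\}$, $I_\mu^{-}=\{s\le 0:\int\|g\|^s\mu(dg)<\infty\}$ and $I=(I_\mu^+)^\circ\cup(I_\mu^-)^\circ$. Let $G_n=g_n\cdots g_1$ with $g_i$ i.i.d. of law $\mu$, and $\kappa(s)=\lim_n(\mathbb E\|G_n\|^s)^{1/n}$. Put $P_s\varphi(v)=\int\|gv\|^s\varphi(g\cdot v)\,\mu(dg)$ and $P_s^*\varphi(v)=\int\|g^{\rm T}v\|^s\varphi(g^{\rm T}\cdot v)\,\mu(dg)$. For $s\in I$ let $\nu_s,\nu_s^*$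 be probability measures on $\mathcal S$ with $\nu_sP_s=\kappa(s)\nu_s$, $\nu_s^*P_s^*=\kappa(s)\nu_s^*$, and $r_s(v)=\int\langle v,u\rangle^s\,\nu_s^*(du)$. For $\epsilon\in(0,1)$ let $\mathcal S_\epsilon=\{v\in\mathcal S:\langle f,v\rangle\ge\epsilon\ \forall f\in\mathcal S\}$; call $\epsilon$ *adapted* if $g\cdot\mathcal S\subseteq\mathcal S_\epsilon$ and $g^{\rm T}\cdot\mathcal S\subseteq\mathcal S_\epsilon$ for all $g\in\operatorname{supp}\mu$. With $m(u,v)=\sup\{t>0: t v_i\le u_i\ \forall i\}$ and $\mathbf d(u,v)=\frac{1-m(u,v)m(v,u)}{1+m(u,v)m(v,u)}$, let $\mathscr B_\gamma$ be the space of continuous $\varphi:\mathcal S_\epsilon\to\mathbb C$ with $\|\varphi\|_\gamma=\sup|\varphi|+\sup_{u\ne v}|\varphi(u)-\varphi(v)|/\mathbf d(u,v)^\gamma<\infty$. The symbol $\rho$ denotes the spectral radius of an operator on $\mathscr B_\gamma$. For $f\in\mathcal S$, $v\in\mathcal S_\epsilon$ put $$P_{s,f}\varphi(v)=\int\frac{\langle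 f,gv\rangle^s}{\langle f,v\rangle^s}\varphi(g\cdot v)\,\mu(dg),\quad r_{s,f}=\frac{r_s}{\langle f,\cdot\rangle^s},\quad \nu_{s,f}(\varphi)=\frac{\nu_s(\langle f,\cdot\rangle^s\varphi)}{\nu_s(r_s)},\quad \pi_{s,f}(\varphi)=\nu_{s,f}(\varphi\, r_{s,f}),$$ and, with $q=(\log\kappa)'(s)$ and $z\in\mathbb C$, $$R_{s,z,f}\varphi(v)=\int e^{z\left(\log\frac{\langle f,gv\rangle}{\langle f,v\rangle}-q\right)}\varphi(g\cdot v)\,\frac{\langle f,gv\rangle^s}{\kappa(s)\langle f,v\rangle^s}\frac{r_{s,f}(g\cdot v)}{r_{s,f}(v)}\,\mu(dg).$$ Then adapted $\epsilon$ exist, and for every adapted $\epsilon$ the following hold. 1. Let $s\in I$. The limit $\kappa(s)$ exists, $\nu_s$ and $\nu_s^*$ exist and are unique, $r_s$ is continuous and strictly positive on $\mathcal S$, and $P_sr_s=\kappa(s)r_s$. For all $0<\gamma\le\min\{|s|,1\}$ and $f\in\mathcal S$, $P_{s,f}$ is bounded on $\mathscr B_\gamma$ and, for all $n\ge1$, $$P_{s,f}^n=\kappa(s)^nM_{s,f}+L_{s,f}^n,$$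 where $M_{s,f}\varphi=\nu_{s,f}(\varphi)\,r_{s,f}$ is a rank-one projection, $L_{s,f}\varphi=\langle f,\cdot\rangle^{-s}L_s(\langle f,\cdot\rangle^s\varphi)$ with $L_s\varphi=P_s\varphi-\kappa(s)\frac{\nu_s(\varphi)}{\nu_s(r_s)}r_s$, both are bounded on $\mathscr B_\gamma$, $\nu_{s,f}(r_{s,f})=1$, $M_{s,f}L_{s,f}=L_{s,f}M_{s,f}=0$ and $\rho(L_{s,f})<\kappa(s)$. Moreover $\rho(P_{s,f})=\kappa(s)$, independently of $f$. 2. Let $J\subseteq I$ be compact and $0<\gamma\le\min\{|s|,1\}$ for all $s\in J$. There are $\delta>0$ and $a\in[0,1)$ such that for every $s\in J$: $s+\Re z\in I$ whenever $|z|<\delta$; $\kappa$ restricted to $(s-\delta,s+\delta)$ extends to an analytic function, still written $\kappa$, on $\{w\in\mathbb C:|w-s|<\delta\}$; $z\mapsto\lambda_{s,z}=e^{-qz}\kappa(s+z)/\kappa(s)$ is analytic on $B_\delta(0)=\{|z|<\delta\}$; and for every $f\in\mathcal S$ and $z\in B_\delta(0)$, $R_{s,z,f}$ is bounded on $\mathscr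 B_\gamma$ and, for all $n\ge1$, $$R_{s,z,f}^n=\lambda_{s,z}^n\Pi_{s,z,f}+N_{s,z,f}^n,$$ where $z\mapsto\Pi_{s,z,f}$ and $z\mapsto N_{s,z,f}$ are analytic from $B_\delta(0)$ to the bounded operators on $\mathscr B_\gamma$, $\Pi_{s,z,f}$ is a rank-one projection, $\Pi_{s,z,f}N_{s,z,f}=N_{s,z,f}\Pi_{s,z,f}=0$, $\Pi_{s,0,f}\varphi=\pi_{s,f}(\varphi)\,1$, and $\rho(N_{s,z,f})\le a<|\lambda_{s,z}|$. 3. Assume in addition **A3.** If $\nu$ is the $\mu$-stationary probability measure on $\mathcal S$ (that is, $\int\!\!\int\varphi(g\cdot v)\mu(dg)\nu(dv)=\nu(\varphi)$ for continuous $\varphi$), there do not exist $t>0$, $\theta\in[0,2\pi)$ and $\vartheta:\mathcal S\to\mathbb R$ with $\|gv\|^{it}e^{i\vartheta(g\cdot v)}=e^{i\theta}e^{i\vartheta(v)}$ for all $g\in\operatorname{supp}\mu$ and $v\in\operatorname{supp}\nu$. Let $J\subseteq I$ be compact, $0<\gamma\le\min\{|s|,1\}$ for all $s\in J$, and let $T\subseteq\mathbb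 R\setminus\{0\}$ be compact. Then the operators $R_{s,it,f}$ with $f\in\mathcal S$, $s\in J$, $t\in T$ are bounded on $\mathscr B_\gamma$, and $\sup_{f\in\mathcal S}\sup_{s\in J}\sup_{t\in T}\rho(R_{s,it,f})<1$. -/

import Mathlib

open MeasureTheory Filter Topology Set

noncomputable section

namespace PosMat

/-- The ambient space `ℝ^d` of column vectors. -/
abbrev Vec (d : ℕ) : Type := Fin d → ℝ

/-- Real `d × d` matrices. -/
abbrev Mat (d : ℕ) : Type := Matrix (Fin d) (Fin d) ℝ

/-- Matrices carry the product (equivalently Borel) `σ`-algebra of their entries. -/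
instance instMeasurableSpaceMat (d : ℕ) : MeasurableSpace (Matrix (Fin d) (Fin d) ℝ) :=
  inferInstanceAs (MeasurableSpace (Fin d → Fin d → ℝ))

/-- The simplex `𝒮` of nonnegative vectors of `L¹`-norm one. -/
abbrev simplex (d : ℕ) : Set (Vec d) := stdSimplex ℝ (Fin d)

/-- The `L¹`-norm of a vector. -/
def vecNorm {d : ℕ} (v : Vec d) : ℝ := ∑ i, |v i|

/-- The norm `‖g‖ = ∑ᵢⱼ gⁱʲ` of a matrix with nonnegative entries. -/
def matNorm {d : ℕ} (g : Mat d) : ℝ := ∑ i, ∑ j, g i j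

/-- All entries are strictly positive. -/
def IsPositive {d : ℕ} (g : Mat d) : Prop := ∀ i j, 0 < g i j

/-- The projective action `g · v = g v / ‖g v‖`. -/
def act {d : ℕ} (g : Mat d) (v : Vec d) : Vec d := (vecNorm (g.mulVec v))⁻¹ • g.mulVec v

/-- The support of `μ` as a measure on the (open) set of matrices with positive entries. -/
def supp {d : ℕ} (μ : Measure (Mat d)) : Set (Mat d) := μ.support ∩ {g | IsPositive g}

/-- The Furstenberg–Kesten condition: all entries of `g` are comparable, uniformly over the
support of `μ`. -/
def FurstenbergKesten {d : ℕ} (μ : Measure (Mat d)) : Prop :=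
  ∃ c : ℝ, 1 < c ∧ ∀ g ∈ supp μ, ∀ i j k l, g i j / g k l ≤ c

/-- `𝒮_ε`: the points `v` of the simplex with `⟨f, v⟩ ≥ ε` for all `f` in the simplex. -/
def simplexGe (d : ℕ) (ε : ℝ) : Set (Vec d) :=
  {v | v ∈ simplex d ∧ ∀ f ∈ simplex d, ε ≤ f ⬝ᵥ v}

/-- `g · 𝒮 ⊆ 𝒮_ε` and `gᵀ · 𝒮 ⊆ 𝒮_ε` for all `g` in the support of `μ`. -/
def Adapted {d : ℕ} (μ : Measure (Mat d)) (ε : ℝ) : Prop :=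
  ∀ g ∈ supp μ, ∀ v ∈ simplex d, act g v ∈ simplexGe d ε ∧ act g.transpose v ∈ simplexGe d ε

/-! ### The Hilbert cross-ratio metric and the Hölder space over `𝒮_ε` -/

/-- `m(u,v) = sup {t > 0 : t vᵢ ≤ uᵢ for all i}`. -/
def crossM {d : ℕ} (u v : Vec d) : ℝ := sSup {t : ℝ | 0 < t ∧ ∀ i, t * v i ≤ u i}

/-- The Hilbert cross-ratio metric on the simplex. -/
def hilbertDist {d : ℕ} (u v : Vec d) : ℝ :=
  (1 - crossM u v * crossM v u) / (1 + crossM u v * crossM v u)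

theorem crossM_nonneg {d : ℕ} (u v : Vec d) : 0 ≤ crossM u v :=
  Real.sSup_nonneg fun _ ht => ht.1.le

theorem crossM_le_one {d : ℕ} {u v : Vec d} (hu : u ∈ simplex d) (hv : v ∈ simplex d) :
    crossM u v ≤ 1 := by
  refine Real.sSup_le (fun t ht => ?_) zero_le_one
  have h := Finset.sum_le_sum fun i (_ : i ∈ Finset.univ) => ht.2 i
  rw [← Finset.mul_sum, hu.2, hv.2] at h
  simpa using h

theorem hilbertDist_nonneg {d : ℕ} {u v : Vec d} (hu : u ∈ simplex d) (hv : v ∈ simplex d) :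
    0 ≤ hilbertDist u v := by
  have h1 := crossM_nonneg u v
  have h2 := crossM_nonneg v u
  have h3 := mul_le_one₀ (crossM_le_one hu hv) h2 (crossM_le_one hv hu)
  exact div_nonneg (by linarith) (by positivity)

/-- The Hölder quotient `|φ(u) - φ(v)| / 𝐝(u,v)^γ`; it is zero for `u = v`. -/
def holderQuot {d : ℕ} {ε : ℝ} (γ : ℝ) (φ : simplexGe d ε → ℂ)
    (p : simplexGe d ε × simplexGe d ε) : ℝ :=
  ‖φ p.1 - φ p.2‖ / hilbertDist (p.1 : Vec d) (p.2 : Vec d) ^ γ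

theorem holderQuot_nonneg {d : ℕ} {ε : ℝ} (γ : ℝ) (φ : simplexGe d ε → ℂ)
    (p : simplexGe d ε × simplexGe d ε) : 0 ≤ holderQuot γ φ p :=
  div_nonneg (norm_nonneg _) (Real.rpow_nonneg (hilbertDist_nonneg p.1.2.1 p.2.2.1) _)

theorem holderQuot_add_le {d : ℕ} {ε : ℝ} (γ : ℝ) (φ ψ : simplexGe d ε → ℂ)
    (p : simplexGe d ε × simplexGe d ε) :
    holderQuot γ (φ + ψ) p ≤ holderQuot γ φ p + holderQuot γ ψ p := by
  unfold holderQuot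
  rw [← add_div]
  refine div_le_div_of_nonneg_right ?_
    (Real.rpow_nonneg (hilbertDist_nonneg p.1.2.1 p.2.2.1) _)
  have : (φ + ψ) p.1 - (φ + ψ) p.2 = (φ p.1 - φ p.2) + (ψ p.1 - ψ p.2) := by
    simp only [Pi.add_apply]; ring
  rw [this]
  exact norm_add_le _ _

theorem holderQuot_smul {d : ℕ} {ε : ℝ} (γ : ℝ) (c : ℂ) (φ : simplexGe d ε → ℂ)
    (p : simplexGe d ε × simplexGe d ε) :
    holderQuot γ (c • φ) p = ‖c‖ * holderQuot γ φ p := by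
  unfold holderQuot
  simp only [Pi.smul_apply, smul_eq_mul, ← mul_sub, norm_mul, mul_div_assoc]

/-- The continuous functions on `𝒮_ε` with `‖φ‖_∞ < ∞` and `[φ]_γ < ∞`. -/
def holderSubmodule (d : ℕ) (ε γ : ℝ) : Submodule ℂ (simplexGe d ε → ℂ) where
  carrier := {φ | Continuous φ ∧ BddAbove (range fun v => ‖φ v‖) ∧
    BddAbove (range (holderQuot γ φ))}
  zero_mem' := by
    refine ⟨continuous_const, ⟨0, ?_⟩, ⟨0, ?_⟩⟩ <;> rintro _ ⟨x, rfl⟩ <;> simp [holderQuot]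
  add_mem' := by
    rintro φ ψ ⟨hφ, ⟨A, hA⟩, ⟨B, hB⟩⟩ ⟨hψ, ⟨A', hA'⟩, ⟨B', hB'⟩⟩
    refine ⟨hφ.add hψ, ⟨A + A', ?_⟩, ⟨B + B', ?_⟩⟩
    · rintro _ ⟨v, rfl⟩
      exact (norm_add_le _ _).trans (add_le_add (hA ⟨v, rfl⟩) (hA' ⟨v, rfl⟩))
    · rintro _ ⟨p, rfl⟩
      exact (holderQuot_add_le γ φ ψ p).trans (add_le_add (hB ⟨p, rfl⟩) (hB' ⟨p, rfl⟩))
  smul_mem' := by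
    rintro c φ ⟨hφ, ⟨A, hA⟩, ⟨B, hB⟩⟩
    refine ⟨hφ.const_smul c, ⟨‖c‖ * A, ?_⟩, ⟨‖c‖ * B, ?_⟩⟩
    · rintro _ ⟨v, rfl⟩
      simp only [Pi.smul_apply, smul_eq_mul, norm_mul]
      exact mul_le_mul_of_nonneg_left (hA ⟨v, rfl⟩) (norm_nonneg c)
    · rintro _ ⟨p, rfl⟩
      rw [holderQuot_smul]
      exact mul_le_mul_of_nonneg_left (hB ⟨p, rfl⟩) (norm_nonneg c)

/-- The space `ℬ_γ` of complex `γ`-Hölder functions on `𝒮_ε` with respect to the Hilbert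
cross-ratio metric. -/
def HolderSpace (d : ℕ) (ε γ : ℝ) : Type := holderSubmodule d ε γ

namespace HolderSpace

variable {d : ℕ} {ε γ : ℝ}

instance instAddCommGroup : AddCommGroup (HolderSpace d ε γ) :=
  inferInstanceAs (AddCommGroup (holderSubmodule d ε γ))

instance instModule : Module ℂ (HolderSpace d ε γ) :=
  inferInstanceAs (Module ℂ (holderSubmodule d ε γ))

/-- The underlying function on `𝒮_ε`. -/
def toFun (φ : HolderSpace d ε γ) : simplexGe d ε → ℂ := φ.1

/-- The norm `‖φ‖_γ = ‖φ‖_∞ + [φ]_γ`. -/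
instance instNorm : Norm (HolderSpace d ε γ) :=
  ⟨fun φ => (⨆ v, ‖φ.toFun v‖) + ⨆ p, holderQuot γ φ.toFun p⟩

theorem norm_def (φ : HolderSpace d ε γ) :
    ‖φ‖ = (⨆ v, ‖φ.toFun v‖) + ⨆ p, holderQuot γ φ.toFun p := rfl

theorem core : NormedSpace.Core ℂ (HolderSpace d ε γ) where
  norm_nonneg φ := add_nonneg (Real.iSup_nonneg fun _ => norm_nonneg _)
    (Real.iSup_nonneg fun _ => holderQuot_nonneg _ _ _)
  norm_smul c φ := by
    have h1 : (c • φ).toFun = c • φ.toFun := rfl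
    rw [norm_def, norm_def, h1, mul_add, Real.mul_iSup_of_nonneg (norm_nonneg c),
      Real.mul_iSup_of_nonneg (norm_nonneg c)]
    simp only [holderQuot_smul, Pi.smul_apply, smul_eq_mul, norm_mul]
  norm_triangle φ ψ := by
    have h1 : (φ + ψ).toFun = φ.toFun + ψ.toFun := rfl
    rw [norm_def, norm_def, norm_def, h1]
    have e1 : (⨆ v, ‖(φ.toFun + ψ.toFun) v‖) ≤ (⨆ v, ‖φ.toFun v‖) + ⨆ v, ‖ψ.toFun v‖ := by
      refine Real.iSup_le (fun v => ?_) (add_nonneg (Real.iSup_nonneg fun _ => norm_nonneg _)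
        (Real.iSup_nonneg fun _ => norm_nonneg _))
      exact (norm_add_le _ _).trans
        (add_le_add (le_ciSup (f := fun v => ‖φ.toFun v‖) φ.2.2.1 v)
          (le_ciSup (f := fun v => ‖ψ.toFun v‖) ψ.2.2.1 v))
    have e2 : (⨆ p, holderQuot γ (φ.toFun + ψ.toFun) p) ≤
        (⨆ p, holderQuot γ φ.toFun p) + ⨆ p, holderQuot γ ψ.toFun p := by
      refine Real.iSup_le (fun p => ?_)
        (add_nonneg (Real.iSup_nonneg fun _ => holderQuot_nonneg _ _ _)
          (Real.iSup_nonneg fun _ => holderQuot_nonneg _ _ _))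
      exact (holderQuot_add_le γ _ _ p).trans
        (add_le_add (le_ciSup φ.2.2.2 p) (le_ciSup ψ.2.2.2 p))
    linarith
  norm_eq_zero_iff φ := by
    constructor
    · intro h
      rw [norm_def] at h
      have h1 : 0 ≤ ⨆ v, ‖φ.toFun v‖ := Real.iSup_nonneg fun _ => norm_nonneg _
      have h2 : 0 ≤ ⨆ p, holderQuot γ φ.toFun p :=
        Real.iSup_nonneg fun _ => holderQuot_nonneg _ _ _
      have h3 : (⨆ v, ‖φ.toFun v‖) = 0 := by linarith
      refine Subtype.ext (funext fun v => ?_)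
      have h4 := le_ciSup (f := fun v => ‖φ.toFun v‖) φ.2.2.1 v
      rw [h3] at h4
      exact norm_le_zero_iff.1 h4
    · rintro rfl
      have h1 : (0 : HolderSpace d ε γ).toFun = 0 := rfl
      rw [norm_def, h1]
      simp [holderQuot]

instance instNormedAddCommGroup : NormedAddCommGroup (HolderSpace d ε γ) :=
  NormedAddCommGroup.ofCore core

instance instNormedSpace : NormedSpace ℂ (HolderSpace d ε γ) :=
  NormedSpace.ofCore core

open Classical in
/-- Extension by zero to a function on `ℝ^d`. -/
def ext (φ : HolderSpace d ε γ) (v : Vec d) : ℂ :=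
  if h : v ∈ simplexGe d ε then φ.toFun ⟨v, h⟩ else 0

end HolderSpace

/-- The bounded operator `T` on `ℬ_γ` is given by the formula `A`. -/
def Represents {d : ℕ} {ε γ : ℝ} (T : HolderSpace d ε γ →L[ℂ] HolderSpace d ε γ)
    (A : (Vec d → ℂ) → Vec d → ℂ) : Prop :=
  ∀ φ : HolderSpace d ε γ, ∀ v : simplexGe d ε, (T φ).toFun v = A φ.ext v

/-- Rank-one projections. -/
def IsRankOneProjection {E : Type*} [NormedAddCommGroup E] [NormedSpace ℂ E]
    (M : E →L[ℂ] E) : Prop :=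
  M * M = M ∧ Module.finrank ℂ (LinearMap.range (M : E →ₗ[ℂ] E)) = 1

/-! ### Moments and the transfer operators of the norm cocycle -/

section Law

variable {d : ℕ} (μ : Measure (Mat d))

/-- `I_μ^+ = {s ≥ 0 : 𝔼 ‖g₁‖^s < ∞}`. -/
def IPlus : Set ℝ := {s | 0 ≤ s ∧ Integrable (fun g => matNorm g ^ s) μ}

/-- `I_μ^- = {s ≤ 0 : 𝔼 ‖g₁‖^s < ∞}`. -/
def IMinus : Set ℝ := {s | s ≤ 0 ∧ Integrable (fun g => matNorm g ^ s) μ}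

/-- The union of the interiors of `I_μ^+` and `I_μ^-`. -/
def IInt : Set ℝ := interior (IPlus μ) ∪ interior (IMinus μ)

/-- `𝔼 ‖Gₙ‖^s` with `Gₙ = gₙ ⋯ g₁`, the `gᵢ` being independent with law `μ`. -/
def normMoment (s : ℝ) (n : ℕ) : ℝ :=
  ∫ g : Fin n → Mat d, matNorm (List.ofFn g).reverse.prod ^ s ∂(Measure.pi fun _ => μ)

/-- `κ(s) = lim (𝔼 ‖Gₙ‖^s)^{1/n}`. -/
def kappa (s : ℝ) : ℝ := limUnder atTop fun n : ℕ => normMoment μ s n ^ (1 / (n : ℝ))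

/-- `q = Λ'(s)` with `Λ = log κ`. -/
def drift (s : ℝ) : ℝ := deriv (fun x => Real.log (kappa μ x)) s

/-- The transfer operator `P_s`. -/
def transferOp (s : ℝ) (φ : Vec d → ℂ) (v : Vec d) : ℂ :=
  ∫ g, (vecNorm (g.mulVec v) ^ s : ℝ) • φ (act g v) ∂μ

/-- The conjugate transfer operator `P_s^*`. -/
def transferOpStar (s : ℝ) (φ : Vec d → ℂ) (v : Vec d) : ℂ :=
  ∫ g, (vecNorm (g.transpose.mulVec v) ^ s : ℝ) • φ (act g.transpose v) ∂μ

/-- `ν` is a probability measure on the simplex with `ν P = k ν`. -/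
def IsEigenmeasure (P : (Vec d → ℂ) → Vec d → ℂ) (k : ℝ) (ν : Measure (Vec d)) : Prop :=
  IsProbabilityMeasure ν ∧ ν (simplex d)ᶜ = 0 ∧
    ∀ φ : Vec d → ℂ, Continuous φ → ∫ v, P φ v ∂ν = k * ∫ v, φ v ∂ν

open Classical in
/-- The probability eigenmeasure of `P` for the eigenvalue `k` (when it exists and is unique). -/
def eigenmeasure (P : (Vec d → ℂ) → Vec d → ℂ) (k : ℝ) : Measure (Vec d) :=
  if h : ∃ ν, IsEigenmeasure P k ν then h.choose else 0

/-- The eigenmeasure `ν_s` of `P_s`. -/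
def nuS (s : ℝ) : Measure (Vec d) := eigenmeasure (transferOp μ s) (kappa μ s)

/-- The eigenmeasure `ν_s^*` of `P_s^*`. -/
def nuStar (s : ℝ) : Measure (Vec d) := eigenmeasure (transferOpStar μ s) (kappa μ s)

/-- The eigenfunction `r_s(v) = ∫ ⟨v, u⟩^s ν_s^*(du)` of `P_s`. -/
def rS (s : ℝ) (v : Vec d) : ℝ := ∫ u, (v ⬝ᵥ u) ^ s ∂(nuStar μ s)

/-- `L_s = P_s - κ(s) M_s` with `M_s φ = (ν_s(φ) / ν_s(r_s)) r_s`. -/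
def opL (s : ℝ) (φ : Vec d → ℂ) (v : Vec d) : ℂ :=
  transferOp μ s φ v -
    kappa μ s * ((∫ u, φ u ∂(nuS μ s)) / ((∫ u, rS μ s u ∂(nuS μ s) : ℝ) : ℂ) * rS μ s v)

/-! ### The operators of the coefficients -/

/-- The transfer operator `P_{s,f}` of the coefficients. -/
def coeffOp (s : ℝ) (f : Vec d) (φ : Vec d → ℂ) (v : Vec d) : ℂ :=
  ∫ g, ((f ⬝ᵥ g.mulVec v) ^ s / (f ⬝ᵥ v) ^ s : ℝ) • φ (act g v) ∂μ

/-- `r_{s,f} = r_s / ⟨f, ·⟩^s`. -/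
def rSF (s : ℝ) (f v : Vec d) : ℝ := rS μ s v / (f ⬝ᵥ v) ^ s

/-- `ν_{s,f}(φ) = ν_s(⟨f, ·⟩^s φ) / ν_s(r_s)`. -/
def nuSF (s : ℝ) (f : Vec d) (φ : Vec d → ℂ) : ℂ :=
  (∫ v, ((f ⬝ᵥ v) ^ s : ℝ) • φ v ∂(nuS μ s)) / ((∫ v, rS μ s v ∂(nuS μ s) : ℝ) : ℂ)

/-- `M_{s,f} φ = ν_{s,f}(φ) r_{s,f}`. -/
def opM (s : ℝ) (f : Vec d) (φ : Vec d → ℂ) (v : Vec d) : ℂ := nuSF μ s f φ * rSF μ s f v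

/-- `L_{s,f} φ = ⟨f, ·⟩^{-s} L_s (⟨f, ·⟩^s φ)`. -/
def opLF (s : ℝ) (f : Vec d) (φ : Vec d → ℂ) (v : Vec d) : ℂ :=
  opL μ s (fun u => ((f ⬝ᵥ u) ^ s : ℝ) • φ u) v / ((f ⬝ᵥ v) ^ s : ℝ)

/-- `π_{s,f}(φ) = ν_{s,f}(φ r_{s,f})`. -/
def piSF (s : ℝ) (f : Vec d) (φ : Vec d → ℂ) : ℂ :=
  nuSF μ s f fun v => φ v * rSF μ s f v

/-- The density `q_{s,f,1}(g, v)` of the change of measure for the coefficients. -/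
def coeffKernel (s : ℝ) (f : Vec d) (g : Mat d) (v : Vec d) : ℝ :=
  (f ⬝ᵥ g.mulVec v) ^ s / (kappa μ s * (f ⬝ᵥ v) ^ s) * (rSF μ s f (act g v) / rSF μ s f v)

/-- The law of `g₁` under the changed measure `ℚ_{s,f}^v`. -/
def coeffLaw (s : ℝ) (f v : Vec d) : Measure (Mat d) :=
  μ.withDensity fun g => ENNReal.ofReal (coeffKernel μ s f g v)

/-- The perturbed operator `R_{s,z,f}`. -/
def perturbedOp (s : ℝ) (z : ℂ) (f : Vec d) (φ : Vec d → ℂ) (v : Vec d) : ℂ :=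
  ∫ g, Complex.exp (z * ((Real.log ((f ⬝ᵥ g.mulVec v) / (f ⬝ᵥ v)) - drift μ s : ℝ) : ℂ)) *
    φ (act g v) ∂(coeffLaw μ s f v)

/-- Non-arithmeticity: with `ν` the stationary measure of the chain `Gₙ · v`, there are no `t > 0`,
`θ ∈ [0, 2π)` and `ϑ : 𝒮 → ℝ` such that `‖g v‖^{it} e^{iϑ(g · v)} = e^{iθ} e^{iϑ(v)}` for all
`g ∈ supp μ` and `v ∈ supp ν`. -/
def NonArithmetic : Prop :=
  ∀ ν : Measure (Vec d), IsEigenmeasure (transferOp μ 0) 1 ν →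
    ¬ ∃ t : ℝ, 0 < t ∧ ∃ θ ∈ Ico 0 (2 * Real.pi), ∃ phase : Vec d → ℝ,
      ∀ g ∈ supp μ, ∀ v ∈ ν.support,
        (vecNorm (g.mulVec v) : ℂ) ^ ((t : ℂ) * Complex.I) *
            Complex.exp (Complex.I * phase (act g v)) =
          Complex.exp (Complex.I * θ) * Complex.exp (Complex.I * phase v)

end Law

end PosMat

end

/-!
Everything reduces to the operators `P_w φ(v) = ∫ ‖g v‖^w φ(g · v) μ(dg)` with complex exponent `w`
(`powOp`). Since `⟨f, g v⟩ = ‖g v‖ ⟨f, g · v⟩` and `⟨f, ·⟩ ≥ ε` on `𝒮_ε`, multiplication by a power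
of `⟨f, ·⟩` is invertible on `ℬ_γ`; it conjugates `P_{s,f}` to `P_s`, and, together with
multiplication by `r_s`, it conjugates `R_{s,z,f}` to `e^{-qz} κ(s)⁻¹ P_{s+z}`
(`LeadingData.coeffOp_split`, `LeadingData.exists_conj`). Spectral radii do not change under
conjugation, so that all bounds are uniform in `f`.

**The spectral gap of `P_s`.** If `ε` is adapted, then all matrices in the support contract the
Hilbert metric by a factor `contr ε < 1` (`Good.hilbertDist_act_le`). The normalised operators `φ ↦
P_s(h φ) / P_s(h)`, with `h` an iterate of the constant `1`, are Markov operators; their transition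
densities at two points of `𝒮_ε` are comparable, uniformly in the number of iterations, because `log
‖g v‖` is Lipschitz in `v` with a constant that does not depend on `g`. Hence a positive part of the
mass can be coupled, and some norm `osc + β [·]_γ` is contracted (`exists_contraction`). So `P_sⁿ φ
/ P_sⁿ 1` converges exponentially fast to a constant `ν(φ)`, which gives the eigenmeasure `ν_s` and
its uniqueness (`exists_rate`, `GoodLaw.exists_eigenLaw`, `GoodLaw.eigenLaw_unique`). The same
argument for the transposed law gives `ν_s^*`, duality turns it into the eigenfunction `r_s`
(`GoodLaw.transferReal_momentFun`), and the eigenvalue is `κ(s)` because `‖Gₙ v‖` and `‖Gₙ‖` are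
comparable (`GoodLaw.leading`). Conjugating by `r_s`, one obtains the gap on `ℬ_γ`
(`LeadingData.exists_split`).

**Exponents near the real axis.** On the interior of the domain of finite moments `w ↦ P_w` is
differentiable in operator norm (`analyticAt_powOp`), so that the dominating simple eigenvalue and
its projection depend analytically on `w` (`exists_analytic_split`); compactness of `J` makes the
disc and the gap uniform (`exists_splitsNearZero`).

**The imaginary axis.** Conjugated by `r_s` and divided by `κ(s)`, the operator `P_{s+it}` is a
Markov operator twisted by the character `‖g v‖^{it}`. It satisfies a Lasota–Yorke inequality
(`LeadingData.exists_twistOp_sub_le`), so by Arzelà–Ascoli a spectral value of modulus at least one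
is an eigenvalue (`exists_peripheral_eigenvector`). On the set `E` where an eigenfunction has
maximal modulus, equality in the triangle inequality forces it to solve the cohomological equation
of the non-arithmeticity condition; `E` is closed and invariant, hence contains the support of the
stationary measure (`support_nuS_subset`), a contradiction (`LeadingData.not_peripheral`). As the
spectral radius is upper semicontinuous, the bound is uniform on compact sets
(`exists_spectralRadius_perturbedOp_le`).
-/

noncomputable section

namespace PosMat

variable {d : ℕ} {ε γ : ℝ}

/-! ### The simplex and the positive matrices -/

theorem vecNorm_eq_sum {v : Vec d} (hv : ∀ i, 0 ≤ v i) : vecNorm v = ∑ i, v i :=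
  Finset.sum_congr rfl fun i _ => abs_of_nonneg (hv i)

theorem vecNorm_nonneg (v : Vec d) : 0 ≤ vecNorm v := Finset.sum_nonneg fun _ _ => abs_nonneg _

theorem mem_simplexGe_iff {v : Vec d} : v ∈ simplexGe d ε ↔ v ∈ simplex d ∧ ∀ i, ε ≤ v i := by
  constructor
  · rintro ⟨hv, h⟩
    refine ⟨hv, fun i => ?_⟩
    simpa using h (Pi.single i 1) (single_mem_stdSimplex ℝ i)
  · rintro ⟨hv, h⟩
    refine ⟨hv, fun f hf => ?_⟩
    calc ε = ∑ i, f i * ε := by rw [← Finset.sum_mul, hf.2, one_mul]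
      _ ≤ ∑ i, f i * v i :=
        Finset.sum_le_sum fun i _ => mul_le_mul_of_nonneg_left (h i) (hf.1 i)

theorem isCompact_simplexGe : IsCompact (simplexGe d ε) := by
  have h : simplexGe d ε = simplex d ∩ ⋂ i, {v : Vec d | ε ≤ v i} := by
    ext v; simp [mem_simplexGe_iff]
  rw [h]
  exact (isCompact_stdSimplex (𝕜 := ℝ) (Fin d)).inter_right
    (isClosed_iInter fun i => isClosed_le continuous_const (continuous_apply i))

instance : CompactSpace (simplexGe d ε) := isCompact_iff_compactSpace.1 isCompact_simplexGe

theorem measurableSet_simplexGe : MeasurableSet (simplexGe d ε) :=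
  isCompact_simplexGe.isClosed.measurableSet

theorem simplex_apply_le_one {v : Vec d} (hv : v ∈ simplex d) (i : Fin d) : v i ≤ 1 := by
  rw [← hv.2]
  exact Finset.single_le_sum (fun j _ => hv.1 j) (Finset.mem_univ i)

theorem dotProduct_nonneg_of_simplex {x v : Vec d} (hx : ∀ i, 0 ≤ x i) (hv : v ∈ simplex d) :
    0 ≤ x ⬝ᵥ v :=
  Finset.sum_nonneg fun i _ => mul_nonneg (hx i) (hv.1 i)

theorem dotProduct_le_one {f v : Vec d} (hf : f ∈ simplex d) (hv : v ∈ simplex d) :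
    f ⬝ᵥ v ≤ 1 := by
  calc f ⬝ᵥ v ≤ ∑ i, f i * 1 := Finset.sum_le_sum fun i _ =>
        mul_le_mul_of_nonneg_left (simplex_apply_le_one hv i) (hf.1 i)
    _ = 1 := by simpa using hf.2

theorem mulVec_nonneg {g : Mat d} (hg : IsPositive g) {v : Vec d} (hv : ∀ i, 0 ≤ v i) (i : Fin d) :
    0 ≤ g.mulVec v i := by
  rw [Matrix.mulVec, dotProduct]
  exact Finset.sum_nonneg fun j _ => mul_nonneg (hg i j).le (hv j)

theorem exists_simplex_pos {v : Vec d} (hv : v ∈ simplex d) : ∃ j, 0 < v j := by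
  by_contra! h
  have h1 := hv.2
  rw [Finset.sum_eq_zero fun i _ => le_antisymm (h i) (hv.1 i)] at h1
  exact zero_ne_one h1

theorem mulVec_pos {g : Mat d} (hg : IsPositive g) {v : Vec d} (hv : v ∈ simplex d) (i : Fin d) :
    0 < g.mulVec v i := by
  obtain ⟨j, hj⟩ := exists_simplex_pos hv
  exact Finset.sum_pos' (fun j _ => mul_nonneg (hg i j).le (hv.1 j))
    ⟨j, Finset.mem_univ j, mul_pos (hg i j) hj⟩

theorem vecNorm_mulVec {g : Mat d} (hg : IsPositive g) {v : Vec d} (hv : v ∈ simplex d) :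
    vecNorm (g.mulVec v) = ∑ i, g.mulVec v i :=
  vecNorm_eq_sum (mulVec_nonneg hg hv.1)

theorem vecNorm_mulVec_pos {g : Mat d} (hg : IsPositive g) {v : Vec d} (hv : v ∈ simplex d) :
    0 < vecNorm (g.mulVec v) := by
  obtain ⟨j, -⟩ := exists_simplex_pos hv
  rw [vecNorm_mulVec hg hv]
  exact Finset.sum_pos (fun i _ => mulVec_pos hg hv i) ⟨j, Finset.mem_univ j⟩

theorem act_mem_simplex {g : Mat d} (hg : IsPositive g) {v : Vec d} (hv : v ∈ simplex d) :
    act g v ∈ simplex d := by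
  have h := vecNorm_mulVec_pos hg hv
  refine ⟨fun i => mul_nonneg (inv_nonneg.2 h.le) (mulVec_nonneg hg hv.1 i), ?_⟩
  simp only [act, Pi.smul_apply, smul_eq_mul]
  rw [← Finset.mul_sum, ← vecNorm_mulVec hg hv, inv_mul_cancel₀ h.ne']

theorem mulVec_eq_smul_act {g : Mat d} (hg : IsPositive g) {v : Vec d} (hv : v ∈ simplex d) :
    g.mulVec v = vecNorm (g.mulVec v) • act g v := by
  rw [act, smul_smul, mul_inv_cancel₀ (vecNorm_mulVec_pos hg hv).ne', one_smul]

theorem dotProduct_mulVec_eq {g : Mat d} (hg : IsPositive g) {v : Vec d} (hv : v ∈ simplex d)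
    (f : Vec d) : f ⬝ᵥ g.mulVec v = vecNorm (g.mulVec v) * (f ⬝ᵥ act g v) := by
  conv_lhs => rw [mulVec_eq_smul_act hg hv]
  rw [dotProduct_smul, smul_eq_mul]

theorem IsPositive.mul {g h : Mat d} (hg : IsPositive g) (hh : IsPositive h) :
    IsPositive (g * h) := fun i j => by
  rw [Matrix.mul_apply]
  exact Finset.sum_pos (fun k _ => mul_pos (hg i k) (hh k j)) ⟨i, Finset.mem_univ i⟩

theorem IsPositive.transpose {g : Mat d} (hg : IsPositive g) : IsPositive g.transpose :=
  fun i j => hg j i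

theorem vecNorm_smul (c : ℝ) (v : Vec d) : vecNorm (c • v) = |c| * vecNorm v := by
  simp [vecNorm, Finset.mul_sum, abs_mul]

theorem vecNorm_mul_mulVec {g h : Mat d} (hh : IsPositive h)
    {v : Vec d} (hv : v ∈ simplex d) :
    vecNorm ((g * h).mulVec v) = vecNorm (h.mulVec v) * vecNorm (g.mulVec (act h v)) := by
  rw [← Matrix.mulVec_mulVec]
  conv_lhs => rw [mulVec_eq_smul_act hh hv]
  rw [Matrix.mulVec_smul, vecNorm_smul, abs_of_pos (vecNorm_mulVec_pos hh hv)]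

theorem act_mul {g h : Mat d} (hh : IsPositive h) {v : Vec d} (hv : v ∈ simplex d) :
    act (g * h) v = act g (act h v) := by
  have h1 := vecNorm_mulVec_pos hh hv
  rw [act, vecNorm_mul_mulVec hh hv, ← Matrix.mulVec_mulVec]
  have h2 : g.mulVec (h.mulVec v) = vecNorm (h.mulVec v) • g.mulVec (act h v) := by
    conv_lhs => rw [mulVec_eq_smul_act hh hv]
    rw [Matrix.mulVec_smul]
  rw [h2, smul_smul, act.eq_1 g, mul_inv, mul_comm (vecNorm (h.mulVec v))⁻¹, mul_assoc,
    inv_mul_cancel₀ h1.ne', mul_one]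

theorem vecNorm_mulVec_eq_dotProduct {g : Mat d} (hg : IsPositive g) {v : Vec d}
    (hv : v ∈ simplex d) : vecNorm (g.mulVec v) = (fun j => ∑ i, g i j) ⬝ᵥ v := by
  rw [vecNorm_mulVec hg hv]
  simp only [Matrix.mulVec, dotProduct, Finset.sum_mul]
  exact Finset.sum_comm

theorem matNorm_pos {g : Mat d} (hg : IsPositive g) (i : Fin d) : 0 < matNorm g :=
  Finset.sum_pos (fun i _ => Finset.sum_pos (fun j _ => hg i j) ⟨i, Finset.mem_univ i⟩)
    ⟨i, Finset.mem_univ i⟩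

theorem vecNorm_mulVec_le {g : Mat d} (hg : IsPositive g) {v : Vec d} (hv : v ∈ simplex d) :
    vecNorm (g.mulVec v) ≤ matNorm g := by
  rw [vecNorm_mulVec hg hv]
  refine Finset.sum_le_sum fun i _ => ?_
  rw [Matrix.mulVec, dotProduct]
  refine Finset.sum_le_sum fun j _ => ?_
  exact mul_le_of_le_one_right (hg i j).le (simplex_apply_le_one hv j)

/-- The positive matrices `g` with `g · 𝒮 ⊆ 𝒮_ε` and `gᵀ · 𝒮 ⊆ 𝒮_ε`; they form a semigroup. -/
structure Good (ε : ℝ) (g : Mat d) : Prop where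
  pos : IsPositive g
  act_mem : ∀ v ∈ simplex d, act g v ∈ simplexGe d ε
  act_transpose_mem : ∀ v ∈ simplex d, act g.transpose v ∈ simplexGe d ε

theorem Good.mul {g h : Mat d} (hg : Good ε g) (hh : Good ε h) : Good ε (g * h) := by
  refine ⟨hg.pos.mul hh.pos, fun v hv => ?_, fun v hv => ?_⟩
  · rw [act_mul hh.pos hv]
    exact hg.act_mem _ (act_mem_simplex hh.pos hv)
  · rw [Matrix.transpose_mul, act_mul hg.pos.transpose hv]
    exact hh.act_transpose_mem _ (act_mem_simplex hg.pos.transpose hv)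

theorem Good.transpose {g : Mat d} (hg : Good ε g) : Good ε g.transpose :=
  ⟨hg.pos.transpose, hg.act_transpose_mem, fun v hv => by simpa using hg.act_mem v hv⟩

theorem matNorm_transpose (g : Mat d) : matNorm g.transpose = matNorm g := Finset.sum_comm

theorem Good.le_vecNorm {g : Mat d} (hg : Good ε g) {v : Vec d} (hv : v ∈ simplex d) :
    ε * matNorm g ≤ vecNorm (g.mulVec v) := by
  obtain ⟨i0, -⟩ := exists_simplex_pos hv
  have hd : (0 : ℝ) < d := by exact_mod_cast i0.pos
  -- the column sums of `g` are a multiple of `gᵀ · e` for the barycentre `e`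
  set e : Vec d := fun _ => (d : ℝ)⁻¹ with he
  have hes : e ∈ simplex d := by
    refine ⟨fun i => inv_nonneg.2 hd.le, ?_⟩
    simp [he, hd.ne']
  have hpos := vecNorm_mulVec_pos hg.pos.transpose hes
  have hmem := (mem_simplexGe_iff.1 (hg.act_transpose_mem e hes)).2
  have hmul : ∀ j, g.transpose.mulVec e j = (∑ i, g i j) * (d : ℝ)⁻¹ := fun j => by
    simp [Matrix.mulVec, dotProduct, he, Finset.sum_mul]
  have hnorm : vecNorm (g.transpose.mulVec e) = matNorm g * (d : ℝ)⁻¹ := by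
    rw [vecNorm_mulVec hg.pos.transpose hes, ← matNorm_transpose, matNorm, Finset.sum_mul]
    exact Finset.sum_congr rfl fun j _ => hmul j
  have hcol : ∀ j, ε * matNorm g ≤ ∑ i, g i j := fun j => by
    have h1 := hmem j
    rw [act, Pi.smul_apply, smul_eq_mul, hmul, inv_mul_eq_div, le_div_iff₀ hpos, hnorm,
      ← mul_assoc] at h1
    exact le_of_mul_le_mul_right h1 (inv_pos.2 hd)
  rw [vecNorm_mulVec_eq_dotProduct hg.pos hv]
  calc ε * matNorm g = ∑ j, ε * matNorm g * v j := by rw [← Finset.mul_sum, hv.2, mul_one]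
    _ ≤ _ := Finset.sum_le_sum fun j _ => mul_le_mul_of_nonneg_right (hcol j) (hv.1 j)

/-! ### The Hilbert cross-ratio metric -/

theorem crossM_mul_le {u v : Vec d} (hu : u ∈ simplex d) (hv : v ∈ simplex d) (i : Fin d) :
    crossM u v * v i ≤ u i := by
  rcases (hv.1 i).eq_or_lt with h | h
  · rw [← h, mul_zero]; exact hu.1 i
  · rw [← le_div_iff₀ h]
    exact Real.sSup_le (fun t ht => (le_div_iff₀ h).2 (ht.2 i)) (div_nonneg (hu.1 i) h.le)

theorem le_crossM {u v : Vec d} (hu : u ∈ simplex d) (hv : v ∈ simplex d) {t : ℝ} (ht : 0 < t)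
    (h : ∀ i, t * v i ≤ u i) : t ≤ crossM u v := by
  refine le_csSup ⟨1, fun x hx => ?_⟩ ⟨ht, h⟩
  have h := Finset.sum_le_sum fun i (_ : i ∈ Finset.univ) => hx.2 i
  rw [← Finset.mul_sum, hu.2, hv.2] at h
  simpa using h

theorem hilbertDist_comm (u v : Vec d) : hilbertDist u v = hilbertDist v u := by
  rw [hilbertDist, hilbertDist, mul_comm]

theorem hilbertDist_le_one {u v : Vec d} : hilbertDist u v ≤ 1 := by
  have := mul_nonneg (crossM_nonneg u v) (crossM_nonneg v u)
  rw [hilbertDist, div_le_one (by linarith)]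
  linarith

theorem one_sub_crossM_le {u v : Vec d} (hu : u ∈ simplex d) (hv : v ∈ simplex d) :
    1 - crossM u v ≤ 2 * hilbertDist u v := by
  have h0 := mul_nonneg (crossM_nonneg u v) (crossM_nonneg v u)
  have h1 := mul_le_of_le_one_right (crossM_nonneg u v) (crossM_le_one hv hu)
  have h2 := crossM_le_one hu hv
  rw [hilbertDist, mul_div_assoc', le_div_iff₀ (by linarith)]
  nlinarith

/-- The Hilbert metric dominates the sup metric on the simplex. -/
theorem dist_le_hilbertDist {u v : Vec d} (hu : u ∈ simplex d) (hv : v ∈ simplex d) :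
    dist u v ≤ 2 * hilbertDist u v := by
  refine (dist_pi_le_iff (mul_nonneg zero_le_two (hilbertDist_nonneg hu hv))).2 fun i => ?_
  have key : ∀ {u v : Vec d}, u ∈ simplex d → v ∈ simplex d →
      v i - u i ≤ 2 * hilbertDist u v := fun {u v} hu hv => by
    have h1 := crossM_mul_le hu hv i
    have h2 := one_sub_crossM_le hu hv
    have h3 := crossM_le_one hu hv
    nlinarith [simplex_apply_le_one hv i, hv.1 i]
  rw [Real.dist_eq, abs_sub_le_iff]
  exact ⟨hilbertDist_comm u v ▸ key hv hu, key hu hv⟩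

theorem eq_of_hilbertDist_eq_zero {u v : Vec d} (hu : u ∈ simplex d) (hv : v ∈ simplex d)
    (h : hilbertDist u v = 0) : u = v := by
  have := dist_le_hilbertDist hu hv
  rw [h, mul_zero] at this
  exact dist_le_zero.1 this

theorem hilbertDist_self {v : Vec d} (hv : v ∈ simplex d) : hilbertDist v v = 0 := by
  have h1 : crossM v v = 1 := le_antisymm (crossM_le_one hv hv)
    (le_crossM hv hv one_pos fun i => by simp)
  simp [hilbertDist, h1]

theorem le_crossM_simplexGe (hε : 0 < ε) {u v : Vec d} (hu : u ∈ simplexGe d ε)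
    (hv : v ∈ simplex d) : ε ≤ crossM u v :=
  le_crossM hu.1 hv hε fun i => (mul_le_of_le_one_right hε.le (simplex_apply_le_one hv i)).trans
    ((mem_simplexGe_iff.1 hu).2 i)

/-- On `𝒮_ε` the Hilbert metric is Lipschitz for the sup metric. -/
theorem hilbertDist_le_dist (hε : 0 < ε) {u v : Vec d} (hu : u ∈ simplexGe d ε)
    (hv : v ∈ simplexGe d ε) : hilbertDist u v ≤ 2 / ε * dist u v := by
  have key : ∀ {u v : Vec d}, u ∈ simplexGe d ε → v ∈ simplexGe d ε →
      1 - dist u v / ε ≤ crossM u v := fun {u v} hu hv => by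
    rcases le_or_gt (1 - dist u v / ε) 0 with h | h
    · exact h.trans (crossM_nonneg _ _)
    refine le_crossM hu.1 hv.1 h fun i => ?_
    have h1 : v i - u i ≤ dist u v := by
      have := dist_le_pi_dist u v i
      rw [Real.dist_eq, abs_le] at this
      linarith [this.1]
    have h2 : dist u v ≤ dist u v / ε * v i := by
      rw [div_mul_eq_mul_div, le_div_iff₀ hε]
      exact mul_le_mul_of_nonneg_left ((mem_simplexGe_iff.1 hv).2 i) dist_nonneg
    linarith
  have h1 := key hu hv
  have h2 := key hv hu
  rw [dist_comm] at h2
  have h3 := mul_nonneg (crossM_nonneg u v) (crossM_nonneg v u)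
  have h4 := crossM_le_one hu.1 hv.1
  have h5 := crossM_le_one hv.1 hu.1
  have e : 2 / ε * dist u v = 2 * (dist u v / ε) := by ring
  have h7 : 0 ≤ dist u v / ε := div_nonneg dist_nonneg hε.le
  have h6 : 1 - crossM u v * crossM v u ≤ 2 * (dist u v / ε) := by
    nlinarith [crossM_nonneg u v, crossM_nonneg v u]
  rw [hilbertDist, div_le_iff₀ (by linarith), e]
  nlinarith

/-- Nonnegative linear forms are log-Lipschitz on `𝒮_ε`. -/
theorem dotProduct_le_exp_mul (hε : 0 < ε) {x u v : Vec d} (hx : ∀ i, 0 ≤ x i)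
    (hu : u ∈ simplexGe d ε) (hv : v ∈ simplexGe d ε) :
    x ⬝ᵥ u ≤ Real.exp (2 / ε * hilbertDist u v) * (x ⬝ᵥ v) := by
  have hm := le_crossM_simplexGe hε hv hu.1
  have hm0 : 0 < crossM v u := hε.trans_le hm
  have h1 : crossM v u * (x ⬝ᵥ u) ≤ x ⬝ᵥ v := by
    rw [dotProduct, dotProduct, Finset.mul_sum]
    refine Finset.sum_le_sum fun i _ => ?_
    have := mul_le_mul_of_nonneg_left (crossM_mul_le hv.1 hu.1 i) (hx i)
    linarith
  have h2 : 1 / crossM v u ≤ Real.exp (2 / ε * hilbertDist u v) := by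
    have h3 := Real.add_one_le_exp (2 / ε * hilbertDist u v)
    have h4 := one_sub_crossM_le hv.1 hu.1
    rw [hilbertDist_comm] at h4
    have h5 : 1 / crossM v u - 1 ≤ 2 / ε * hilbertDist u v := by
      have e : 1 / crossM v u - 1 = (1 - crossM v u) / crossM v u := by field_simp
      rw [e, div_le_iff₀ hm0]
      have h6 : 2 * hilbertDist u v ≤ 2 / ε * hilbertDist u v * crossM v u := by
        have e2 : 2 * hilbertDist u v = 2 / ε * hilbertDist u v * ε := by field_simp
        rw [e2]
        exact mul_le_mul_of_nonneg_left hm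
          (mul_nonneg (by positivity) (hilbertDist_nonneg hu.1 hv.1))
      linarith
    linarith
  calc x ⬝ᵥ u = 1 / crossM v u * (crossM v u * (x ⬝ᵥ u)) := by field_simp
    _ ≤ Real.exp (2 / ε * hilbertDist u v) * (x ⬝ᵥ v) :=
      mul_le_mul h2 h1 (mul_nonneg hm0.le (dotProduct_nonneg_of_simplex hx hu.1))
        (Real.exp_nonneg _)

theorem Good.le_mulVec {g : Mat d} (hg : Good ε g) {x : Vec d} (hx : ∀ i, 0 ≤ x i)
    (i j : Fin d) : ε * g.mulVec x i ≤ g.mulVec x j := by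
  rcases (Finset.sum_nonneg fun i (_ : i ∈ Finset.univ) => hx i).eq_or_lt with h0 | h0
  · have hx0 : x = 0 := funext fun i =>
      (Finset.sum_eq_zero_iff_of_nonneg fun i _ => hx i).1 h0.symm i (Finset.mem_univ i)
    simp [hx0]
  set c := ∑ i, x i with hc
  have hv : c⁻¹ • x ∈ simplex d := by
    refine ⟨fun i => mul_nonneg (inv_nonneg.2 h0.le) (hx i), ?_⟩
    simp only [Pi.smul_apply, smul_eq_mul]
    rw [← Finset.mul_sum, ← hc, inv_mul_cancel₀ h0.ne']
  have hxv : x = c • (c⁻¹ • x) := by rw [smul_smul, mul_inv_cancel₀ h0.ne', one_smul]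
  have hact := mem_simplexGe_iff.1 (hg.act_mem _ hv)
  have h1 : ε * act g (c⁻¹ • x) i ≤ act g (c⁻¹ • x) j := by
    have h2 := hact.2 j
    have h3 := simplex_apply_le_one hact.1 i
    have h4 := hact.1.1 i
    have h5 := hact.1.1 j
    rcases le_or_gt 0 ε with h | h
    · nlinarith
    · nlinarith
  rw [hxv, Matrix.mulVec_smul, mulVec_eq_smul_act hg.pos hv]
  simp only [Pi.smul_apply, smul_eq_mul]
  have h6 := mul_nonneg h0.le (vecNorm_mulVec_pos hg.pos hv).le
  calc ε * (c * (vecNorm (g.mulVec (c⁻¹ • x)) * act g (c⁻¹ • x) i))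
      = c * vecNorm (g.mulVec (c⁻¹ • x)) * (ε * act g (c⁻¹ • x) i) := by ring
    _ ≤ c * vecNorm (g.mulVec (c⁻¹ • x)) * act g (c⁻¹ • x) j := mul_le_mul_of_nonneg_left h1 h6
    _ = _ := by ring

/-- The contraction coefficient of the matrices in `Good ε` for the Hilbert metric. -/
def contr (ε : ℝ) : ℝ := (1 - ε ^ 2) / (1 + ε ^ 2)

theorem contr_nonneg (hε : 0 < ε) (hε1 : ε < 1) : 0 ≤ contr ε :=
  div_nonneg (by nlinarith) (by positivity)

theorem contr_lt_one (hε : 0 < ε) : contr ε < 1 := by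
  rw [contr, div_lt_one (by positivity)]
  nlinarith [pow_pos hε 2]

/-- The algebraic core of the Birkhoff contraction: the effect of `x ↦ (x + m) / (1 + m' x)` on
cross-ratios, in homogeneous coordinates. -/
theorem cross_ratio_contraction {m n a₁ a₂ b₁ b₂ : ℝ} (hε : 0 < ε) (hε1 : ε < 1) (hm : 0 ≤ m)
    (hn : 0 ≤ n)
    (hmn : m * n ≤ 1) (ha₁ : 0 ≤ a₁) (ha₂ : 0 ≤ a₂) (hb₁ : 0 ≤ b₁) (hb₂ : 0 ≤ b₂)
    (ha : ε * a₁ ≤ a₂) (hb : ε * b₂ ≤ b₁) :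
    (1 + ε ^ 2) * (1 + m * n) * ((a₁ + m * b₁) * (b₂ + n * a₂) - (a₂ + m * b₂) * (b₁ + n * a₁)) ≤
      (1 - ε ^ 2) * (1 - m * n) *
        ((a₁ + m * b₁) * (b₂ + n * a₂) + (a₂ + m * b₂) * (b₁ + n * a₁)) := by
  have h1 : ε ^ 2 * (a₁ * b₂) ≤ a₂ * b₁ := by
    have := mul_le_mul ha hb (mul_nonneg hε.le hb₂) ha₂
    nlinarith
  have e1 : (a₁ + m * b₁) * (b₂ + n * a₂) - (a₂ + m * b₂) * (b₁ + n * a₁)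
      = (1 - m * n) * (a₁ * b₂ - a₂ * b₁) := by ring
  have e2 : (a₁ + m * b₁) * (b₂ + n * a₂) + (a₂ + m * b₂) * (b₁ + n * a₁)
      = (1 + m * n) * (a₁ * b₂ + a₂ * b₁) + 2 * (n * (a₁ * a₂) + m * (b₁ * b₂)) := by ring
  rw [e1, e2]
  have h3 : 0 ≤ n * (a₁ * a₂) + m * (b₁ * b₂) := by positivity
  have h4 : 0 ≤ 1 - ε ^ 2 := by nlinarith
  have h5 : (1 + ε ^ 2) * (a₁ * b₂ - a₂ * b₁) ≤ (1 - ε ^ 2) * (a₁ * b₂ + a₂ * b₁) := by nlinarith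
  have h6 : 0 ≤ (1 + m * n) * (1 - m * n) :=
    mul_nonneg (by nlinarith [mul_nonneg hm hn]) (by linarith)
  have h7 := mul_le_mul_of_nonneg_left h5 h6
  have h8 : 0 ≤ (1 - ε ^ 2) * (1 - m * n) * (2 * (n * (a₁ * a₂) + m * (b₁ * b₂))) :=
    mul_nonneg (mul_nonneg h4 (by linarith)) (by linarith)
  nlinarith

theorem crossM_mul_crossM {u v : Vec d} {x y : Vec d} {p q : ℝ} (hp : 0 < p) (hq : 0 < q)
    (hu : u ∈ simplex d) (hv : v ∈ simplex d) (hx : x = p • u) (hy : y = q • v)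
    {i₀ : Fin d} {t : ℝ} (hypos : ∀ i, 0 < y i) (hxpos : ∀ i, 0 < x i)
    (h : ∀ i j, t * (y i * x j) ≤ x i * y j) : t ≤ crossM u v * crossM v u := by
  -- the best constants are attained at coordinates minimising `x / y` and `y / x`
  obtain ⟨i, -, hi⟩ := Finset.exists_min_image Finset.univ (fun i => x i / y i)
    ⟨i₀, Finset.mem_univ i₀⟩
  obtain ⟨j, -, hj⟩ := Finset.exists_min_image Finset.univ (fun i => y i / x i)
    ⟨i₀, Finset.mem_univ i₀⟩
  have hxi := hxpos i
  have hyi := hypos i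
  have hxj := hxpos j
  have hyj := hypos j
  have hu' : ∀ k, u k = x k / p := fun k => by rw [hx]; simp [hp.ne']
  have hv' : ∀ k, v k = y k / q := fun k => by rw [hy]; simp [hq.ne']
  have h1 : x i / y i * (q / p) ≤ crossM u v := by
    refine le_crossM hu hv (by positivity) fun k => ?_
    have := hi k (Finset.mem_univ k)
    rw [le_div_iff₀ (hypos k)] at this
    rw [hu', hv']
    calc x i / y i * (q / p) * (y k / q) = (x i / y i * y k) / p := by field_simp
      _ ≤ x k / p := div_le_div_of_nonneg_right this hp.le
  have h2 : y j / x j * (p / q) ≤ crossM v u := by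
    refine le_crossM hv hu (by positivity) fun k => ?_
    have := hj k (Finset.mem_univ k)
    rw [le_div_iff₀ (hxpos k)] at this
    rw [hu', hv']
    calc y j / x j * (p / q) * (x k / p) = (y j / x j * x k) / q := by field_simp
      _ ≤ y k / q := div_le_div_of_nonneg_right this hq.le
  calc t ≤ (x i * y j) / (y i * x j) := (le_div_iff₀ (mul_pos hyi hxj)).2 (h i j)
    _ = (x i / y i * (q / p)) * (y j / x j * (p / q)) := by field_simp
    _ ≤ _ := mul_le_mul h1 h2 (by positivity) (crossM_nonneg _ _)

/-- **Birkhoff contraction.** -/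
theorem Good.hilbertDist_act_le (hε : 0 < ε) (hε1 : ε < 1) {g : Mat d} (hg : Good ε g)
    {u v : Vec d} (hu : u ∈ simplex d) (hv : v ∈ simplex d) :
    hilbertDist (act g u) (act g v) ≤ contr ε * hilbertDist u v := by
  set m := crossM u v with hm
  set n := crossM v u with hn
  have hm0 : 0 ≤ m := crossM_nonneg u v
  have hn0 : 0 ≤ n := crossM_nonneg v u
  have hm1 : m ≤ 1 := crossM_le_one hu hv
  have hn1 : n ≤ 1 := crossM_le_one hv hu
  have hmn : m * n ≤ 1 := mul_le_one₀ hm1 hn0 hn1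
  have hc0 := contr_nonneg hε hε1
  have hc1 := contr_lt_one hε
  rcases hmn.eq_or_lt with hmn1 | hmn1
  · have h0 : hilbertDist u v = 0 := by rw [hilbertDist, ← hm, ← hn, hmn1]; simp
    rw [eq_of_hilbertDist_eq_zero hu hv h0, hilbertDist_self (act_mem_simplex hg.pos hv)]
    exact mul_nonneg hc0 (hilbertDist_nonneg hv hv)
  have hp := vecNorm_mulVec_pos hg.pos hu
  have hq := vecNorm_mulVec_pos hg.pos hv
  -- `u` and `v` lie in the cone spanned by `A = u - m v` and `B = v - n u`
  set a := g.mulVec (u - m • v) with ha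
  set b := g.mulVec (v - n • u) with hb
  have hA : ∀ i, 0 ≤ (u - m • v) i := fun i => sub_nonneg.2 (crossM_mul_le hu hv i)
  have hB : ∀ i, 0 ≤ (v - n • u) i := fun i => sub_nonneg.2 (crossM_mul_le hv hu i)
  have ha0 : ∀ i, 0 ≤ a i := mulVec_nonneg hg.pos hA
  have hb0 : ∀ i, 0 ≤ b i := mulVec_nonneg hg.pos hB
  have hau : ∀ i, a i + m * b i = (1 - m * n) * g.mulVec u i := fun i => by
    rw [ha, hb, Matrix.mulVec_sub, Matrix.mulVec_sub, Matrix.mulVec_smul, Matrix.mulVec_smul]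
    simp only [Pi.sub_apply, Pi.smul_apply, smul_eq_mul]; ring
  have hbv : ∀ i, b i + n * a i = (1 - m * n) * g.mulVec v i := fun i => by
    rw [ha, hb, Matrix.mulVec_sub, Matrix.mulVec_sub, Matrix.mulVec_smul, Matrix.mulVec_smul]
    simp only [Pi.sub_apply, Pi.smul_apply, smul_eq_mul]; ring
  obtain ⟨i₀, -⟩ := exists_simplex_pos hu
  have h1mn : 0 < 1 - m * n := by linarith
  have hmn0 := mul_nonneg hm0 hn0
  set k := contr ε * ((1 - m * n) / (1 + m * n)) with hk
  have hk0 : 0 ≤ k := mul_nonneg hc0 (div_nonneg h1mn.le (by linarith))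
  have hk1 : k < 1 := by
    refine mul_lt_one_of_nonneg_of_lt_one_left hc0 hc1 ?_
    rw [div_le_one (by linarith)]; linarith
  have hcr : (1 - k) / (1 + k) ≤ crossM (act g u) (act g v) * crossM (act g v) (act g u) := by
    refine crossM_mul_crossM hp hq (act_mem_simplex hg.pos hu) (act_mem_simplex hg.pos hv)
      (mulVec_eq_smul_act hg.pos hu) (mulVec_eq_smul_act hg.pos hv) (i₀ := i₀)
      (fun i => mulVec_pos hg.pos hv i)
      (fun i => mulVec_pos hg.pos hu i) fun i j => ?_
    have h1 := cross_ratio_contraction hε hε1 hm0 hn0 hmn (ha0 j) (ha0 i) (hb0 j) (hb0 i)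
      (hg.le_mulVec hA j i) (hg.le_mulVec hB i j)
    rw [hau, hau, hbv, hbv] at h1
    set X := g.mulVec u i * g.mulVec v j
    set Y := g.mulVec v i * g.mulVec u j
    have h2 : (1 + ε ^ 2) * (1 + m * n) * (Y - X) ≤ (1 - ε ^ 2) * (1 - m * n) * (Y + X) := by
      have h3 : 0 < (1 - m * n) ^ 2 := by positivity
      refine le_of_mul_le_mul_left ?_ h3
      simp only [X, Y]
      linarith
    have h4 : Y - X ≤ k * (Y + X) := by
      rw [hk, contr, div_mul_div_comm, div_mul_eq_mul_div, le_div_iff₀ (by positivity)]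
      linarith
    rw [div_mul_eq_mul_div, div_le_iff₀ (by linarith)]
    linarith
  have e : hilbertDist u v = (1 - m * n) / (1 + m * n) := rfl
  rw [e, ← hk]
  set t := crossM (act g u) (act g v) * crossM (act g v) (act g u) with ht
  have ht0 : 0 ≤ t := mul_nonneg (crossM_nonneg _ _) (crossM_nonneg _ _)
  rw [div_le_iff₀ (by linarith)] at hcr
  rw [hilbertDist, ← ht, div_le_iff₀ (by linarith)]
  linarith

/-! ### Hölder functions -/

/-- `F` is bounded by `B` on `𝒮_ε`, with `γ`-Hölder constant at most `H` for the Hilbert metric. -/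
def HolderBound (ε γ : ℝ) (F : Vec d → ℂ) (B H : ℝ) : Prop :=
  (∀ v ∈ simplexGe d ε, ‖F v‖ ≤ B) ∧
    ∀ u ∈ simplexGe d ε, ∀ v ∈ simplexGe d ε, ‖F u - F v‖ ≤ H * hilbertDist u v ^ γ

theorem HolderBound.mono {F : Vec d → ℂ} {B H B' H' : ℝ} (h : HolderBound ε γ F B H) (hB : B ≤ B')
    (hH : H ≤ H') : HolderBound ε γ F B' H' :=
  ⟨fun v hv => (h.1 v hv).trans hB, fun u hu v hv => (h.2 u hu v hv).trans
    (mul_le_mul_of_nonneg_right hH (Real.rpow_nonneg (hilbertDist_nonneg hu.1 hv.1) _))⟩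

theorem HolderBound.mul {F G : Vec d → ℂ} {B H B' H' : ℝ} (hB : 0 ≤ B)
    (h : HolderBound ε γ F B H) (h' : HolderBound ε γ G B' H') :
    HolderBound ε γ (fun v => F v * G v) (B * B') (B * H' + H * B') := by
  refine ⟨fun v hv => ?_, fun u hu v hv => ?_⟩
  · rw [norm_mul]
    exact mul_le_mul (h.1 v hv) (h'.1 v hv) (norm_nonneg _) hB
  · have e : F u * G u - F v * G v = F u * (G u - G v) + (F u - F v) * G v := by ring
    rw [e, add_mul, mul_assoc B, mul_right_comm H]
    refine (norm_add_le _ _).trans (add_le_add ?_ ?_)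
    · rw [norm_mul]
      exact mul_le_mul (h.1 u hu) (h'.2 u hu v hv) (norm_nonneg _) hB
    · rw [norm_mul]
      exact mul_le_mul (h.2 u hu v hv) (h'.1 v hv) (norm_nonneg _)
        ((norm_nonneg _).trans (h.2 u hu v hv))

theorem HolderBound.const (c : ℂ) : HolderBound ε γ (fun _ : Vec d => c) ‖c‖ 0 :=
  ⟨fun _ _ => le_rfl, fun _ _ _ _ => by simp⟩

/-- Lipschitz functions for the Hilbert metric are Hölder, as the metric is bounded by one. -/
theorem hilbertDist_le_rpow (hγ1 : γ ≤ 1) {u v : Vec d} (hu : u ∈ simplex d)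
    (hv : v ∈ simplex d) : hilbertDist u v ≤ hilbertDist u v ^ γ := by
  have h0 := hilbertDist_nonneg hu hv
  rcases h0.eq_or_lt with h | h
  · rw [← h]; exact Real.rpow_nonneg le_rfl _
  · conv_lhs => rw [← Real.rpow_one (hilbertDist u v)]
    exact Real.rpow_le_rpow_of_exponent_ge h hilbertDist_le_one hγ1

theorem hilbertDist_rpow_le_one (hγ : 0 ≤ γ) {u v : Vec d} (hu : u ∈ simplex d)
    (hv : v ∈ simplex d) : hilbertDist u v ^ γ ≤ 1 :=
  Real.rpow_le_one (hilbertDist_nonneg hu hv) hilbertDist_le_one hγ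

/-- Hölder continuity for the Hilbert metric implies continuity for the Euclidean topology. -/
theorem continuous_of_holder (hε : 0 < ε) (hγ : 0 < γ) {φ : simplexGe d ε → ℂ} {H : ℝ}
    (h : ∀ u v : simplexGe d ε, ‖φ u - φ v‖ ≤ H * hilbertDist (u : Vec d) (v : Vec d) ^ γ) :
    Continuous φ := by
  rw [continuous_iff_continuousAt]
  intro v
  rw [ContinuousAt, tendsto_iff_dist_tendsto_zero]
  have h1 : Tendsto (fun u : simplexGe d ε => |H| * (2 / ε * dist u v) ^ γ) (𝓝 v) (𝓝 0) := by
    have h2 : Continuous fun u : simplexGe d ε => |H| * (2 / ε * dist u v) ^ γ :=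
      continuous_const.mul (Continuous.rpow_const (by fun_prop) fun _ => Or.inr hγ.le)
    have := h2.tendsto v
    simpa [Real.zero_rpow hγ.ne'] using this
  refine squeeze_zero (fun _ => dist_nonneg) (fun u => ?_) h1
  rw [dist_eq_norm]
  have h3 := hilbertDist_nonneg u.2.1 v.2.1
  calc _ ≤ H * hilbertDist (u : Vec d) (v : Vec d) ^ γ := h u v
    _ ≤ |H| * hilbertDist (u : Vec d) (v : Vec d) ^ γ :=
      mul_le_mul_of_nonneg_right (le_abs_self H) (Real.rpow_nonneg h3 _)
    _ ≤ _ := mul_le_mul_of_nonneg_left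
      (Real.rpow_le_rpow h3 (hilbertDist_le_dist hε u.2 v.2) hγ.le) (abs_nonneg H)

namespace HolderSpace

theorem holderBound_range {φ : simplexGe d ε → ℂ} {H : ℝ} (hH : 0 ≤ H)
    (h : ∀ u v : simplexGe d ε, ‖φ u - φ v‖ ≤ H * hilbertDist (u : Vec d) (v : Vec d) ^ γ)
    (p : simplexGe d ε × simplexGe d ε) : holderQuot γ φ p ≤ H := by
  have h0 := Real.rpow_nonneg (hilbertDist_nonneg p.1.2.1 p.2.2.1) γ
  rcases h0.eq_or_lt with h1 | h1
  · rw [holderQuot, ← h1, div_zero]; exact hH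
  · rw [holderQuot, div_le_iff₀ h1]; exact h _ _

/-- The element of `ℬ_γ` given by a function on `ℝ^d` that is Hölder on `𝒮_ε`. -/
def mk (hε : 0 < ε) (hγ : 0 < γ) (F : Vec d → ℂ) (h : ∃ B H, HolderBound ε γ F B H) :
    HolderSpace d ε γ :=
  ⟨fun v => F v, by
    obtain ⟨B, H, hB⟩ := h
    refine ⟨continuous_of_holder hε hγ fun u v => hB.2 u u.2 v v.2, ⟨B, ?_⟩, ⟨|H|, ?_⟩⟩
    · rintro _ ⟨v, rfl⟩
      exact hB.1 v v.2
    · rintro _ ⟨p, rfl⟩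
      exact holderBound_range (abs_nonneg H)
        (fun u v => (hB.mono le_rfl (le_abs_self H)).2 u u.2 v v.2) p⟩

@[simp] theorem mk_toFun (hε : 0 < ε) (hγ : 0 < γ) (F : Vec d → ℂ)
    (h : ∃ B H, HolderBound ε γ F B H) (v : simplexGe d ε) : (mk hε hγ F h).toFun v = F v := rfl

theorem ext_apply (φ : HolderSpace d ε γ) {v : Vec d} (hv : v ∈ simplexGe d ε) :
    φ.ext v = φ.toFun ⟨v, hv⟩ := by rw [ext, dif_pos hv]

theorem ext_coe (φ : HolderSpace d ε γ) (v : simplexGe d ε) : φ.ext v = φ.toFun v :=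
  φ.ext_apply v.2

theorem mk_ext (hε : 0 < ε) (hγ : 0 < γ) (F : Vec d → ℂ)
    (h : ∃ B H, HolderBound ε γ F B H) {v : Vec d} (hv : v ∈ simplexGe d ε) :
    (mk hε hγ F h).ext v = F v := by rw [ext_apply _ hv]; rfl

theorem toFun_injective {φ ψ : HolderSpace d ε γ} (h : ∀ v, φ.toFun v = ψ.toFun v) : φ = ψ :=
  Subtype.ext (funext h)

@[simp] theorem toFun_add (φ ψ : HolderSpace d ε γ) (v) :
    (φ + ψ).toFun v = φ.toFun v + ψ.toFun v := rfl

@[simp] theorem toFun_sub (φ ψ : HolderSpace d ε γ) (v) :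
    (φ - ψ).toFun v = φ.toFun v - ψ.toFun v := rfl

@[simp] theorem toFun_smul (c : ℂ) (φ : HolderSpace d ε γ) (v) :
    (c • φ).toFun v = c * φ.toFun v := rfl

theorem holderQuot_le (φ : HolderSpace d ε γ) (u v : simplexGe d ε) (hγ : 0 < γ) :
    ‖φ.toFun u - φ.toFun v‖ ≤
      (⨆ p, holderQuot γ φ.toFun p) * hilbertDist (u : Vec d) (v : Vec d) ^ γ := by
  have h0 := hilbertDist_nonneg u.2.1 v.2.1
  rcases h0.eq_or_lt with h1 | h1
  · have h2 : u = v := Subtype.ext (eq_of_hilbertDist_eq_zero u.2.1 v.2.1 h1.symm)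
    rw [← h1, Real.zero_rpow hγ.ne', h2]; simp
  · rw [← div_le_iff₀ (Real.rpow_pos_of_pos h1 _)]
    exact le_ciSup (f := holderQuot γ φ.toFun) φ.2.2.2 (u, v)

/-- The sup norm of an element of `ℬ_γ`. -/
def supNorm (φ : HolderSpace d ε γ) : ℝ := ⨆ v, ‖φ.toFun v‖

/-- The Hölder seminorm of an element of `ℬ_γ`. -/
def semi (φ : HolderSpace d ε γ) : ℝ := ⨆ p, holderQuot γ φ.toFun p

theorem norm_eq (φ : HolderSpace d ε γ) : ‖φ‖ = φ.supNorm + φ.semi := rfl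

theorem supNorm_nonneg (φ : HolderSpace d ε γ) : 0 ≤ φ.supNorm :=
  Real.iSup_nonneg fun _ => norm_nonneg _

theorem semi_nonneg (φ : HolderSpace d ε γ) : 0 ≤ φ.semi :=
  Real.iSup_nonneg fun _ => holderQuot_nonneg _ _ _

theorem norm_toFun_le_supNorm (φ : HolderSpace d ε γ) (v : simplexGe d ε) :
    ‖φ.toFun v‖ ≤ φ.supNorm := le_ciSup (f := fun v => ‖φ.toFun v‖) φ.2.2.1 v

theorem holderBound_supNorm_semi (hγ : 0 < γ) (φ : HolderSpace d ε γ) :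
    HolderBound ε γ φ.ext φ.supNorm φ.semi := by
  refine ⟨fun v hv => ?_, fun u hu v hv => ?_⟩
  · rw [φ.ext_apply hv]; exact φ.norm_toFun_le_supNorm _
  · rw [φ.ext_apply hu, φ.ext_apply hv]; exact φ.holderQuot_le ⟨u, hu⟩ ⟨v, hv⟩ hγ

theorem holderBound (hγ : 0 < γ) (φ : HolderSpace d ε γ) : HolderBound ε γ φ.ext ‖φ‖ ‖φ‖ :=
  (φ.holderBound_supNorm_semi hγ).mono (le_add_of_nonneg_right φ.semi_nonneg)
    (le_add_of_nonneg_left φ.supNorm_nonneg)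

theorem norm_toFun_le (φ : HolderSpace d ε γ) (v : simplexGe d ε) : ‖φ.toFun v‖ ≤ ‖φ‖ :=
  (φ.norm_toFun_le_supNorm v).trans (le_add_of_nonneg_right φ.semi_nonneg)

theorem supNorm_le {φ : HolderSpace d ε γ} {B : ℝ} (hB : 0 ≤ B) (h : ∀ v, ‖φ.toFun v‖ ≤ B) :
    φ.supNorm ≤ B := Real.iSup_le h hB

theorem semi_le {φ : HolderSpace d ε γ} {H : ℝ} (hH : 0 ≤ H)
    (h : ∀ u v : simplexGe d ε,
      ‖φ.toFun u - φ.toFun v‖ ≤ H * hilbertDist (u : Vec d) (v : Vec d) ^ γ) : φ.semi ≤ H :=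
  Real.iSup_le (holderBound_range hH h) hH

theorem norm_le_of_holderBound {φ : HolderSpace d ε γ} {F : Vec d → ℂ} {B H : ℝ} (hB : 0 ≤ B)
    (hH : 0 ≤ H) (hF : ∀ v : simplexGe d ε, φ.toFun v = F v) (h : HolderBound ε γ F B H) :
    ‖φ‖ ≤ B + H :=
  add_le_add (supNorm_le hB fun v => by rw [hF]; exact h.1 v v.2)
    (semi_le hH fun u v => by rw [hF, hF]; exact h.2 u u.2 v v.2)

/-- Evaluation at a point, as a bounded functional. -/
def evalCLM (v : simplexGe d ε) : HolderSpace d ε γ →L[ℂ] ℂ :=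
  LinearMap.mkContinuous
    { toFun := fun φ => φ.toFun v, map_add' := fun _ _ => rfl, map_smul' := fun _ _ => rfl } 1
    fun φ => by rw [one_mul]; exact φ.norm_toFun_le v

theorem completeSpace (hε : 0 < ε) (hγ : 0 < γ) : CompleteSpace (HolderSpace d ε γ) := by
  refine Metric.complete_of_cauchySeq_tendsto fun u hu => ?_
  have hpt : ∀ v : simplexGe d ε, ∃ z, Tendsto (fun n => (u n).toFun v) atTop (𝓝 z) := fun v =>
    cauchySeq_tendsto_of_complete (hu.map (evalCLM v).uniformContinuous)
  choose F hF using hpt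
  have hdiff : ∀ r > 0, ∃ N, ∀ n ≥ N, (∀ v, ‖(u n).toFun v - F v‖ ≤ r) ∧
      ∀ v w : simplexGe d ε, ‖((u n).toFun v - F v) - ((u n).toFun w - F w)‖ ≤
        r * hilbertDist (v : Vec d) (w : Vec d) ^ γ := fun r hr => by
    obtain ⟨N, hN⟩ := Metric.cauchySeq_iff.1 hu r hr
    refine ⟨N, fun n hn => ⟨fun v => ?_, fun v w => ?_⟩⟩
    · refine le_of_tendsto ((tendsto_const_nhds (x := (u n).toFun v)).sub (hF v)).norm ?_
      filter_upwards [eventually_ge_atTop N] with k hk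
      have h1 := hN n hn k hk
      rw [dist_eq_norm] at h1
      exact ((u n - u k).norm_toFun_le v).trans h1.le
    · refine le_of_tendsto (((tendsto_const_nhds (x := (u n).toFun v)).sub (hF v)).sub
        ((tendsto_const_nhds (x := (u n).toFun w)).sub (hF w))).norm ?_
      filter_upwards [eventually_ge_atTop N] with k hk
      have h1 := hN n hn k hk
      rw [dist_eq_norm] at h1
      have h2 := ((u n - u k).holderBound hγ).2 v v.2 w w.2
      rw [ext_coe, ext_coe] at h2
      exact h2.trans (mul_le_mul_of_nonneg_right h1.le
        (Real.rpow_nonneg (hilbertDist_nonneg v.2.1 w.2.1) _))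
  -- the pointwise limit differs from some `u N` by a Hölder function
  obtain ⟨N, hN⟩ := hdiff 1 one_pos
  obtain ⟨h1, h2⟩ := hN N le_rfl
  classical
  set G : Vec d → ℂ := fun v => if h : v ∈ simplexGe d ε then (u N).toFun ⟨v, h⟩ - F ⟨v, h⟩ else 0
    with hG
  have hGv : ∀ v : simplexGe d ε, G v = (u N).toFun v - F v := fun v => by
    rw [hG]; exact dif_pos v.2
  set D : HolderSpace d ε γ := mk hε hγ G ⟨1, 1, fun v hv => by
      rw [hGv ⟨v, hv⟩]; exact h1 _, fun v hv w hw => by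
      rw [hGv ⟨v, hv⟩, hGv ⟨w, hw⟩]; exact h2 _ _⟩ with hD
  have hlim : ∀ v, (u N - D).toFun v = F v := fun v => by
    rw [toFun_sub, hD, mk_toFun, hGv]; ring
  refine ⟨u N - D, Metric.tendsto_atTop.2 fun r hr => ?_⟩
  obtain ⟨M, hM⟩ := hdiff (r / 3) (by positivity)
  refine ⟨M, fun n hn => ?_⟩
  obtain ⟨h3, h4⟩ := hM n hn
  rw [dist_eq_norm]
  have h5 : ‖u n - (u N - D)‖ ≤ r / 3 + r / 3 :=
    add_le_add (supNorm_le (by positivity) fun v => by rw [toFun_sub, hlim]; exact h3 v)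
      (semi_le (by positivity) fun v w => by
        rw [toFun_sub (u n), toFun_sub (u n), hlim, hlim]; exact h4 v w)
  linarith

/-- The bounded operator on `ℬ_γ` given by the formula `A`; zero if there is none. -/
def opOf (ε γ : ℝ) (A : (Vec d → ℂ) → Vec d → ℂ) : HolderSpace d ε γ →L[ℂ] HolderSpace d ε γ := by
  classical exact if h : ∃ T, Represents (ε := ε) (γ := γ) T A then h.choose else 0

theorem represents_opOf {A : (Vec d → ℂ) → Vec d → ℂ}
    (h : ∃ T, Represents (ε := ε) (γ := γ) T A) : Represents (opOf ε γ A) A := by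
  rw [opOf, dif_pos h]; exact h.choose_spec

theorem represents_unique {A : (Vec d → ℂ) → Vec d → ℂ}
    {T T' : HolderSpace d ε γ →L[ℂ] HolderSpace d ε γ} (h : Represents T A) (h' : Represents T' A) :
    T = T' :=
  ContinuousLinearMap.ext fun φ => toFun_injective fun v => by rw [h, h']

/-- A formula that is linear and bounded on `ℬ_γ` defines a bounded operator. -/
theorem exists_represents (hε : 0 < ε) (hγ : 0 < γ) {A : (Vec d → ℂ) → Vec d → ℂ} {C : ℝ}
    (hC : 0 ≤ C)
    (hadd : ∀ φ ψ : HolderSpace d ε γ, ∀ v ∈ simplexGe d ε,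
      A (φ + ψ).ext v = A φ.ext v + A ψ.ext v)
    (hsmul : ∀ (c : ℂ) (φ : HolderSpace d ε γ), ∀ v ∈ simplexGe d ε,
      A (c • φ).ext v = c * A φ.ext v)
    (hbd : ∀ φ : HolderSpace d ε γ, HolderBound ε γ (A φ.ext) (C * ‖φ‖) (C * ‖φ‖)) :
    ∃ T : HolderSpace d ε γ →L[ℂ] HolderSpace d ε γ, Represents T A ∧ ‖T‖ ≤ 2 * C := by
  let T : HolderSpace d ε γ →ₗ[ℂ] HolderSpace d ε γ :=
    { toFun := fun φ => mk hε hγ (A φ.ext) ⟨_, _, hbd φ⟩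
      map_add' := fun φ ψ => toFun_injective fun v => hadd φ ψ v v.2
      map_smul' := fun c φ => toFun_injective fun v => hsmul c φ v v.2 }
  have hT : ∀ φ, ‖T φ‖ ≤ 2 * C * ‖φ‖ := fun φ => by
    have h0 : 0 ≤ C * ‖φ‖ := mul_nonneg hC (norm_nonneg φ)
    have := norm_le_of_holderBound (φ := T φ) h0 h0 (fun v => rfl) (hbd φ)
    linarith
  exact ⟨T.mkContinuous (2 * C) hT, fun φ v => rfl, T.mkContinuous_norm_le (by positivity) hT⟩

theorem ext_add (φ ψ : HolderSpace d ε γ) (v : Vec d) : (φ + ψ).ext v = φ.ext v + ψ.ext v := by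
  by_cases h : v ∈ simplexGe d ε
  · rw [ext_apply _ h, ext_apply _ h, ext_apply _ h]; rfl
  · simp [ext, h]

theorem ext_smul (c : ℂ) (φ : HolderSpace d ε γ) (v : Vec d) : (c • φ).ext v = c * φ.ext v := by
  by_cases h : v ∈ simplexGe d ε
  · rw [ext_apply _ h, ext_apply _ h]; rfl
  · simp [ext, h]

theorem measurable_ext (φ : HolderSpace d ε γ) : Measurable φ.ext := by
  refine measurable_of_restrict_of_restrict_compl (measurableSet_simplexGe (ε := ε)) ?_ ?_
  · have h : (simplexGe d ε).domRestrict φ.ext = φ.toFun := funext φ.ext_coe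
    rw [h]
    exact φ.2.1.measurable
  · have h : (simplexGe d ε)ᶜ.domRestrict φ.ext = fun _ => 0 := funext fun v => by
      simp only [domRestrict_apply, ext]
      exact dif_neg v.2
    rw [h]
    exact measurable_const

/-- Multiplication by a Hölder function, as a bounded operator. -/
theorem exists_mul (hε : 0 < ε) (hγ : 0 < γ) {F : Vec d → ℂ}
    (hF : ∃ B H, HolderBound ε γ F B H) : ∃ T : HolderSpace d ε γ →L[ℂ] HolderSpace d ε γ,
      Represents T (fun φ v => F v * φ v) := by
  obtain ⟨B, H, hF⟩ := hF
  have hF' := hF.mono (le_abs_self B) (le_abs_self H)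
  obtain ⟨T, hT, -⟩ := exists_represents (A := fun φ v => F v * φ v) hε hγ
    (add_nonneg (abs_nonneg B) (abs_nonneg H))
    (fun φ ψ v _ => by simp only [ext_add, mul_add])
    (fun c φ v _ => by simp only [ext_smul]; ring) fun φ => by
    refine (hF'.mul (abs_nonneg B) (φ.holderBound hγ)).mono ?_ (by linarith)
    exact mul_le_mul_of_nonneg_right (by linarith [abs_nonneg H]) (norm_nonneg φ)
  exact ⟨T, hT⟩

end HolderSpace

/-! ### Laws of positive matrices and their transfer operators -/

instance : BorelSpace (Mat d) := inferInstanceAs (BorelSpace (Fin d → Fin d → ℝ))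

theorem measurable_entry (i j : Fin d) : Measurable fun g : Mat d => g i j :=
  (measurable_pi_apply j).comp (measurable_pi_apply i)

theorem measurable_matNorm : Measurable (matNorm : Mat d → ℝ) :=
  Finset.measurable_fun_sum _ fun i _ => Finset.measurable_fun_sum _ fun j _ => measurable_entry i j

theorem measurable_mulVec : Measurable fun p : Mat d × Vec d => p.1.mulVec p.2 :=
  measurable_pi_lambda _ fun i => by
    simp only [Matrix.mulVec, dotProduct]
    exact Finset.measurable_fun_sum _ fun j _ =>
      ((measurable_entry i j).comp measurable_fst).mul ((measurable_pi_apply j).comp measurable_snd)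

theorem measurable_vecNorm : Measurable (vecNorm : Vec d → ℝ) :=
  Finset.measurable_fun_sum _ fun i _ => (measurable_pi_apply i).abs

theorem measurable_act : Measurable fun p : Mat d × Vec d => act p.1 p.2 :=
  (measurable_vecNorm.comp measurable_mulVec).inv.smul measurable_mulVec

theorem measurable_vecNorm_mulVec : Measurable fun p : Mat d × Vec d => vecNorm (p.1.mulVec p.2) :=
  measurable_vecNorm.comp measurable_mulVec

theorem measurable_act_left (v : Vec d) : Measurable fun g : Mat d => act g v :=
  Measurable.comp (g := fun p : Mat d × Vec d => act p.1 p.2) (f := fun g => (g, v))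
    measurable_act measurable_prodMk_right

theorem measurable_vecNorm_left (v : Vec d) : Measurable fun g : Mat d => vecNorm (g.mulVec v) :=
  Measurable.comp (g := fun p : Mat d × Vec d => vecNorm (p.1.mulVec p.2)) (f := fun g => (g, v))
    measurable_vecNorm_mulVec measurable_prodMk_right

theorem measurable_matrix_mul : Measurable fun p : Mat d × Mat d => p.1 * p.2 :=
  measurable_pi_lambda _ fun i => measurable_pi_lambda _ fun j => by
    simp only [Matrix.mul_apply]
    exact Finset.measurable_fun_sum _ fun k _ =>
      ((measurable_entry i k).comp measurable_fst).mul ((measurable_entry k j).comp measurable_snd)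

theorem measurable_transpose : Measurable fun g : Mat d => g.transpose :=
  measurable_pi_lambda _ fun i => measurable_pi_lambda _ fun j => measurable_entry j i

/-- A law on matrices that is carried by `Good ε`, contracts the Hilbert metric by the factor `α`,
and has a finite moment of order `s`. -/
structure GoodLaw (ε s α : ℝ) (m : Measure (Mat d)) : Prop where
  good : ∀ᵐ g ∂m, Good ε g
  contracts : ∀ᵐ g ∂m, ∀ u ∈ simplex d, ∀ v ∈ simplex d,
    hilbertDist (act g u) (act g v) ≤ α * hilbertDist u v
  integrable : Integrable (fun g => matNorm g ^ s) m

/-- The set of matrices for which, in cross-multiplied form, `𝐝(g · u, g · v) ≤ α 𝐝(u, v)`. This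
form is a closed condition on `g`, which makes the contraction property measurable. -/
def crossContracts (α : ℝ) : Set (Mat d) :=
  {g | ∀ u ∈ simplex d, ∀ v ∈ simplex d, ∀ i j,
    (1 - α * hilbertDist u v) * (g.mulVec v i * g.mulVec u j) ≤
      (1 + α * hilbertDist u v) * (g.mulVec u i * g.mulVec v j)}

theorem continuous_mulVec_apply (v : Vec d) (i : Fin d) :
    Continuous fun g : Mat d => g.mulVec v i := by fun_prop

theorem isClosed_crossContracts (α : ℝ) : IsClosed (crossContracts α : Set (Mat d)) := by
  simp only [crossContracts, ofPred_forall]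
  refine isClosed_iInter fun u => isClosed_iInter fun _ => isClosed_iInter fun v =>
    isClosed_iInter fun _ => isClosed_iInter fun i => isClosed_iInter fun j => ?_
  exact isClosed_le
    (continuous_const.mul ((continuous_mulVec_apply v i).mul (continuous_mulVec_apply u j)))
    (continuous_const.mul ((continuous_mulVec_apply u i).mul (continuous_mulVec_apply v j)))

theorem crossContracts_iff {α : ℝ} {g : Mat d} (hg : IsPositive g) (hα : 0 ≤ α) :
    g ∈ crossContracts α ↔ ∀ u ∈ simplex d, ∀ v ∈ simplex d,
      hilbertDist (act g u) (act g v) ≤ α * hilbertDist u v := by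
  refine forall₂_congr fun u hu => forall₂_congr fun v hv => ?_
  have hc := mul_nonneg hα (hilbertDist_nonneg hu hv)
  set c := α * hilbertDist u v
  have hp := vecNorm_mulVec_pos hg hu
  have hq := vecNorm_mulVec_pos hg hv
  have hau := act_mem_simplex hg hu
  have hav := act_mem_simplex hg hv
  set m := crossM (act g u) (act g v) with hm
  set n := crossM (act g v) (act g u) with hn
  have hm0 : 0 ≤ m := crossM_nonneg _ _
  have hn0 : 0 ≤ n := crossM_nonneg _ _
  have hmn := mul_nonneg hm0 hn0
  have e : hilbertDist (act g u) (act g v) ≤ c ↔ (1 - c) / (1 + c) ≤ m * n := by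
    rw [hilbertDist, ← hm, ← hn, div_le_iff₀ (by linarith), div_le_iff₀ (by linarith)]
    constructor <;> intro h <;> linarith
  rw [e]
  obtain ⟨i₀, -⟩ := exists_simplex_pos hu
  constructor
  · intro h
    refine crossM_mul_crossM hp hq hau hav (mulVec_eq_smul_act hg hu) (mulVec_eq_smul_act hg hv)
      (i₀ := i₀) (mulVec_pos hg hv) (mulVec_pos hg hu) fun i j => ?_
    rw [div_mul_eq_mul_div, div_le_iff₀ (by linarith)]
    linarith [h i j]
  · intro h i j
    rw [div_le_iff₀ (by linarith)] at h
    have h1 := mul_le_mul (crossM_mul_le hau hav i) (crossM_mul_le hav hau j)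
      (mul_nonneg hn0 (hau.1 j)) (hau.1 i)
    have h2 : m * n * (act g v i * act g u j) ≤ act g u i * act g v j := by
      rw [← hm, ← hn] at h1; linarith
    have h3 : (1 - c) * (act g v i * act g u j) ≤ (1 + c) * (act g u i * act g v j) := by
      have h4 := mul_le_mul_of_nonneg_right h (mul_nonneg (hav.1 i) (hau.1 j))
      have h5 := mul_le_mul_of_nonneg_left h2 (show (0 : ℝ) ≤ 1 + c by linarith)
      linarith
    rw [mulVec_eq_smul_act hg hu, mulVec_eq_smul_act hg hv]
    simp only [Pi.smul_apply, smul_eq_mul]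
    have h6 := mul_le_mul_of_nonneg_left h3 (mul_pos hp hq).le
    linarith

theorem measurableSet_isPositive : MeasurableSet {g : Mat d | IsPositive g} := by
  simp only [IsPositive, ofPred_forall]
  exact MeasurableSet.iInter fun i => MeasurableSet.iInter fun j =>
    measurableSet_lt measurable_const (measurable_entry i j)

theorem continuous_vecNorm : Continuous (vecNorm : Vec d → ℝ) :=
  continuous_finsetSum _ fun i _ => (continuous_apply i).abs

theorem continuous_vecNorm_mulVec (v : Vec d) : Continuous fun g : Mat d => vecNorm (g.mulVec v) :=
  continuous_vecNorm.comp (by fun_prop)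

theorem act_mem_simplexGe_iff {g : Mat d} (hg : IsPositive g) {v : Vec d} (hv : v ∈ simplex d) :
    act g v ∈ simplexGe d ε ↔ ∀ i, ε * vecNorm (g.mulVec v) ≤ g.mulVec v i := by
  rw [mem_simplexGe_iff, and_iff_right (act_mem_simplex hg hv)]
  refine forall_congr' fun i => ?_
  rw [act, Pi.smul_apply, smul_eq_mul, inv_mul_eq_div, le_div_iff₀ (vecNorm_mulVec_pos hg hv)]

theorem measurableSet_good : MeasurableSet {g : Mat d | Good ε g} := by
  have hcl : IsClosed {g : Mat d | ∀ v ∈ simplex d, ∀ i,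
      ε * vecNorm (g.mulVec v) ≤ g.mulVec v i} := by
    simp only [ofPred_forall]
    exact isClosed_iInter fun v => isClosed_iInter fun _ => isClosed_iInter fun i =>
      isClosed_le (continuous_const.mul (continuous_vecNorm_mulVec v)) (continuous_mulVec_apply v i)
  have h : {g : Mat d | Good ε g} = {g | IsPositive g} ∩
      ({g : Mat d | ∀ v ∈ simplex d, ∀ i, ε * vecNorm (g.mulVec v) ≤ g.mulVec v i} ∩
        Matrix.transpose ⁻¹' {g : Mat d | ∀ v ∈ simplex d, ∀ i,
          ε * vecNorm (g.mulVec v) ≤ g.mulVec v i}) := by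
    ext g
    constructor
    · intro hg
      exact ⟨hg.pos, fun v hv => (act_mem_simplexGe_iff hg.pos hv).1 (hg.act_mem v hv),
        fun v hv => (act_mem_simplexGe_iff hg.pos.transpose hv).1 (hg.act_transpose_mem v hv)⟩
    · rintro ⟨h1, h2, h3⟩
      exact ⟨h1, fun v hv => (act_mem_simplexGe_iff h1 hv).2 (h2 v hv),
        fun v hv => (act_mem_simplexGe_iff h1.transpose hv).2 (h3 v hv)⟩
  rw [h]
  exact measurableSet_isPositive.inter
    (hcl.measurableSet.inter (measurable_transpose hcl.measurableSet))

theorem rpow_le_of_comparable {a x y : ℝ} (s : ℝ) (ha : 0 < a) (hx : 0 < x)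
    (h1 : a * x ≤ y) (h2 : y ≤ x / a) : y ^ s ≤ a ^ (-|s|) * x ^ s := by
  have hy : 0 < y := (mul_pos ha hx).trans_le h1
  rcases le_total 0 s with h | h
  · rw [abs_of_nonneg h, Real.rpow_neg ha.le, inv_mul_eq_div, ← Real.div_rpow hx.le ha.le]
    exact Real.rpow_le_rpow hy.le h2 h
  · rw [abs_of_nonpos h, neg_neg, ← Real.mul_rpow ha.le hx.le]
    exact Real.rpow_le_rpow_of_nonpos (mul_pos ha hx) h1 h

theorem Good.vecNorm_rpow_le (s : ℝ) (hε : 0 < ε) (hε1 : ε < 1) {g : Mat d} (hg : Good ε g)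
    {v : Vec d} (hv : v ∈ simplex d) :
    vecNorm (g.mulVec v) ^ s ≤ ε ^ (-|s|) * matNorm g ^ s := by
  obtain ⟨i, -⟩ := exists_simplex_pos hv
  have h0 := matNorm_pos hg.pos i
  refine rpow_le_of_comparable s hε h0 (hg.le_vecNorm hv) ((vecNorm_mulVec_le hg.pos hv).trans ?_)
  rw [le_div_iff₀ hε]
  nlinarith

theorem Good.matNorm_rpow_le (s : ℝ) (hε : 0 < ε) (hε1 : ε < 1) {g : Mat d} (hg : Good ε g)
    {v : Vec d} (hv : v ∈ simplex d) :
    matNorm g ^ s ≤ ε ^ (-|s|) * vecNorm (g.mulVec v) ^ s := by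
  have h0 := vecNorm_mulVec_pos hg.pos hv
  refine rpow_le_of_comparable s hε h0 ?_ ?_
  · exact (mul_le_of_le_one_left h0.le hε1.le).trans (vecNorm_mulVec_le hg.pos hv)
  · rw [le_div_iff₀ hε, mul_comm]; exact hg.le_vecNorm hv

theorem measurable_transfer_integrand {φ : Vec d → ℂ} (hφ : Measurable φ) (s : ℝ) :
    Measurable fun p : Mat d × Vec d => (vecNorm (p.1.mulVec p.2) ^ s : ℝ) • φ (act p.1 p.2) :=
  (measurable_vecNorm_mulVec.pow_const s).smul (hφ.comp measurable_act)

theorem measurable_transfer_integrand_left {φ : Vec d → ℂ} (hφ : Measurable φ) (s : ℝ)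
    (v : Vec d) : Measurable fun g : Mat d => (vecNorm (g.mulVec v) ^ s : ℝ) • φ (act g v) :=
  ((measurable_vecNorm_left v).pow_const s).smul (hφ.comp (measurable_act_left v))

section Transfer

variable {s α : ℝ} {m : Measure (Mat d)}

theorem GoodLaw.integrable_transfer (hε : 0 < ε) (hε1 : ε < 1) (hm : GoodLaw ε s α m)
    {φ : Vec d → ℂ} (hφ : Measurable φ) {B : ℝ} (hB : ∀ v ∈ simplexGe d ε, ‖φ v‖ ≤ B)
    {v : Vec d} (hv : v ∈ simplex d) :
    Integrable (fun g => (vecNorm (g.mulVec v) ^ s : ℝ) • φ (act g v)) m := by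
  refine Integrable.mono' ((hm.integrable.const_mul (ε ^ (-|s|))).mul_const B)
    (measurable_transfer_integrand_left hφ s v).aestronglyMeasurable ?_
  filter_upwards [hm.good] with g hg
  have h0 := Real.rpow_nonneg (vecNorm_mulVec_pos hg.pos hv).le s
  rw [norm_smul, Real.norm_eq_abs, abs_of_nonneg h0]
  exact mul_le_mul (hg.vecNorm_rpow_le s hε hε1 hv) (hB _ (hg.act_mem v hv)) (norm_nonneg _)
    (h0.trans (hg.vecNorm_rpow_le s hε hε1 hv))

theorem GoodLaw.transferOp_congr (hm : GoodLaw ε s α m) {φ ψ : Vec d → ℂ}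
    (h : ∀ v ∈ simplexGe d ε, φ v = ψ v) {v : Vec d} (hv : v ∈ simplex d) (t : ℝ) :
    transferOp m t φ v = transferOp m t ψ v := by
  refine integral_congr_ae ?_
  filter_upwards [hm.good] with g hg
  simp only [h _ (hg.act_mem v hv)]

theorem measurable_transferOp [SFinite m] {φ : Vec d → ℂ} (hφ : Measurable φ) (t : ℝ) :
    Measurable (transferOp m t φ) := by
  have h : StronglyMeasurable fun p : Vec d × Mat d =>
      (vecNorm (p.2.mulVec p.1) ^ t : ℝ) • φ (act p.2 p.1) :=
    ((measurable_transfer_integrand hφ t).comp measurable_swap).stronglyMeasurable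
  exact h.integral_prod_right'.measurable

/-- The total mass `∫ ‖g‖^s` controls the transfer operator. -/
theorem GoodLaw.norm_transferOp_le (hε : 0 < ε) (hε1 : ε < 1) (hm : GoodLaw ε s α m)
    {φ : Vec d → ℂ} {B : ℝ} (hB : ∀ v ∈ simplexGe d ε, ‖φ v‖ ≤ B)
    {v : Vec d} (hv : v ∈ simplex d) :
    ‖transferOp m s φ v‖ ≤ ε ^ (-|s|) * (∫ g, matNorm g ^ s ∂m) * B := by
  rw [← integral_const_mul, ← integral_mul_const]
  refine norm_integral_le_of_norm_le ((hm.integrable.const_mul (ε ^ (-|s|))).mul_const B) ?_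
  filter_upwards [hm.good] with g hg
  have h0 := Real.rpow_nonneg (vecNorm_mulVec_pos hg.pos hv).le s
  rw [norm_smul, Real.norm_eq_abs, abs_of_nonneg h0]
  exact mul_le_mul (hg.vecNorm_rpow_le s hε hε1 hv) (hB _ (hg.act_mem v hv)) (norm_nonneg _)
    (h0.trans (hg.vecNorm_rpow_le s hε hε1 hv))

/-- The law of `g h` for independent `g` of law `m₁` and `h` of law `m₂`. -/
def mulLaw (m₁ m₂ : Measure (Mat d)) : Measure (Mat d) := (m₁.prod m₂).map fun p => p.1 * p.2

theorem Good.matNorm_mul_rpow_le (s : ℝ) (hε : 0 < ε) {g h : Mat d} (hg : Good ε g)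
    (hh : Good ε h) {v : Vec d} (hv : v ∈ simplex d) :
    matNorm (g * h) ^ s ≤ (ε ^ 2) ^ (-|s|) * (matNorm g ^ s * matNorm h ^ s) := by
  obtain ⟨i, -⟩ := exists_simplex_pos hv
  have h1 := matNorm_pos hg.pos i
  have h2 := matNorm_pos hh.pos i
  rw [← Real.mul_rpow h1.le h2.le]
  have e := vecNorm_mul_mulVec (g := g) hh.pos hv
  have hact := act_mem_simplex hh.pos hv
  have l1 := hg.le_vecNorm hact
  have l2 := hh.le_vecNorm hv
  have u1 := vecNorm_mulVec_le hg.pos hact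
  have u2 := vecNorm_mulVec_le hh.pos hv
  have l3 := (hg.mul hh).le_vecNorm hv
  have u3 := vecNorm_mulVec_le (hg.mul hh).pos hv
  have h3 := matNorm_pos (hg.mul hh).pos i
  have p1 := mul_le_mul l2 l1 (mul_pos hε h1).le ((mul_pos hε h2).le.trans l2)
  have p2 := mul_le_mul u2 u1 (vecNorm_mulVec_pos hg.pos hact).le h2.le
  refine rpow_le_of_comparable s (by positivity) (mul_pos h1 h2) ?_ ?_
  · nlinarith
  · rw [le_div_iff₀ (by positivity)]
    nlinarith [mul_pos hε h3]

variable {s' α' : ℝ} {m' : Measure (Mat d)}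

theorem GoodLaw.mulLaw [IsProbabilityMeasure m] [IsProbabilityMeasure m'] (hε : 0 < ε)
    (hα : 0 ≤ α) (hα' : 0 ≤ α') (hm : GoodLaw ε s α m) (hm' : GoodLaw ε s α' m') :
    GoodLaw ε s (α * α') (mulLaw m m') := by
  have ae1 : ∀ᵐ p ∂(m.prod m'), Good ε p.1 := Measure.quasiMeasurePreserving_fst.ae hm.good
  have ae2 : ∀ᵐ p ∂(m.prod m'), Good ε p.2 := Measure.quasiMeasurePreserving_snd.ae hm'.good
  have hgood : ∀ᵐ g ∂(PosMat.mulLaw m m'), Good ε g := by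
    refine (ae_map_iff measurable_matrix_mul.aemeasurable measurableSet_good).2 ?_
    filter_upwards [ae1, ae2] with p h1 h2 using h1.mul h2
  refine ⟨hgood, ?_, ?_⟩
  · have hcross : ∀ᵐ g ∂(PosMat.mulLaw m m'), g ∈ crossContracts (α * α') := by
      refine (ae_map_iff measurable_matrix_mul.aemeasurable
        (isClosed_crossContracts (α * α')).measurableSet).2 ?_
      filter_upwards [ae1, ae2, Measure.quasiMeasurePreserving_fst.ae hm.contracts,
        Measure.quasiMeasurePreserving_snd.ae hm'.contracts] with p h1 h2 h3 h4
      refine (crossContracts_iff (h1.pos.mul h2.pos) (mul_nonneg hα hα')).2 fun u hu v hv => ?_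
      rw [act_mul h2.pos hu, act_mul h2.pos hv, mul_assoc]
      exact (h3 _ (act_mem_simplex h2.pos hu) _ (act_mem_simplex h2.pos hv)).trans
        (mul_le_mul_of_nonneg_left (h4 u hu v hv) hα)
    filter_upwards [hgood, hcross] with g h1 h2
    exact (crossContracts_iff h1.pos (mul_nonneg hα hα')).1 h2
  · rw [PosMat.mulLaw, integrable_map_measure
      (measurable_matNorm.pow_const s).aestronglyMeasurable measurable_matrix_mul.aemeasurable]
    by_cases hd : Nonempty (Fin d)
    · obtain ⟨i⟩ := hd
      refine Integrable.mono' ((hm.integrable.mul_prod hm'.integrable).const_mul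
        ((ε ^ 2) ^ (-|s|))) (((measurable_matNorm.pow_const s).comp
          measurable_matrix_mul).aestronglyMeasurable) ?_
      filter_upwards [ae1, ae2] with p h1 h2
      have := h1.matNorm_mul_rpow_le s hε h2 (single_mem_stdSimplex ℝ i)
      simp only [Function.comp_apply]
      rwa [Real.norm_of_nonneg (Real.rpow_nonneg (matNorm_pos (h1.mul h2).pos i).le _)]
    · have : IsEmpty (Fin d) := not_nonempty_iff.1 hd
      have e : (fun g : Mat d => matNorm g ^ s) = fun _ => (0 : ℝ) ^ s := by
        funext g; simp [matNorm]
      rw [e]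
      exact integrable_const _

theorem GoodLaw.transferOp_mulLaw [IsProbabilityMeasure m] [IsProbabilityMeasure m'] (hε : 0 < ε)
    (hε1 : ε < 1) (hα : 0 ≤ α) (hα' : 0 ≤ α') (hm : GoodLaw ε s α m) (hm' : GoodLaw ε s α' m')
    {φ : Vec d → ℂ} (hφ : Measurable φ) {B : ℝ} (hB : ∀ v ∈ simplexGe d ε, ‖φ v‖ ≤ B)
    {v : Vec d} (hv : v ∈ simplex d) :
    transferOp (PosMat.mulLaw m m') s φ v = transferOp m' s (transferOp m s φ) v := by
  have hint := (hm.mulLaw hε hα hα' hm').integrable_transfer hε hε1 hφ hB hv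
  have hmeas := measurable_transfer_integrand_left hφ s v
  rw [PosMat.mulLaw, integrable_map_measure hmeas.aestronglyMeasurable
    measurable_matrix_mul.aemeasurable] at hint
  rw [transferOp, PosMat.mulLaw, integral_map measurable_matrix_mul.aemeasurable
    hmeas.aestronglyMeasurable]
  refine (integral_prod_symm _ hint).trans ?_
  refine integral_congr_ae ?_
  filter_upwards [hm'.good] with h hh
  rw [transferOp, ← integral_smul]
  refine integral_congr_ae (Eventually.of_forall fun g => ?_)
  simp only [Function.comp_apply]
  rw [act_mul hh.pos hv, vecNorm_mul_mulVec hh.pos hv, Real.mul_rpow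
    (vecNorm_mulVec_pos hh.pos hv).le (vecNorm_nonneg _), mul_smul]

end Transfer

/-- The law of `Gₙ = gₙ ⋯ g₁`. -/
def prodLaw (μ : Measure (Mat d)) (n : ℕ) : Measure (Mat d) :=
  (Measure.pi fun _ : Fin n => μ).map fun g => (List.ofFn g).reverse.prod

theorem measurable_ofFn_prod (n : ℕ) :
    Measurable fun g : Fin n → Mat d => (List.ofFn g).reverse.prod := by
  induction n with
  | zero => simp
  | succ n ih =>
    have e : (fun g : Fin (n + 1) → Mat d => (List.ofFn g).reverse.prod) =
        fun g => (List.ofFn fun i : Fin n => g i.succ).reverse.prod * g 0 := by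
      funext g; simp [List.ofFn_succ]
    rw [e]
    have h1 : Measurable fun (g : Fin (n + 1) → Mat d) (i : Fin n) => g i.succ :=
      measurable_pi_lambda _ fun i => measurable_pi_apply _
    have h2 : Measurable fun g : Fin (n + 1) → Mat d => g 0 := measurable_pi_apply 0
    exact Measurable.comp (g := fun p : Mat d × Mat d => p.1 * p.2)
      (f := fun g : Fin (n + 1) → Mat d =>
        ((List.ofFn fun i : Fin n => g i.succ).reverse.prod, g 0))
      measurable_matrix_mul ((ih.comp h1).prodMk h2)

instance {μ : Measure (Mat d)} [IsProbabilityMeasure μ] (n : ℕ) :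
    IsProbabilityMeasure (prodLaw μ n) :=
  Measure.isProbabilityMeasure_map (measurable_ofFn_prod n).aemeasurable

theorem prodLaw_succ (μ : Measure (Mat d)) [IsProbabilityMeasure μ] (n : ℕ) :
    prodLaw μ (n + 1) = mulLaw (prodLaw μ n) μ := by
  have hp := (measurePreserving_piFinSuccAbove (fun _ : Fin (n + 1) => μ) 0).map_eq
  have e : (fun g : Fin (n + 1) → Mat d => (List.ofFn g).reverse.prod) =
      (fun p : Mat d × (Fin n → Mat d) => (List.ofFn p.2).reverse.prod * p.1) ∘
        MeasurableEquiv.piFinSuccAbove (fun _ => Mat d) 0 := by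
    funext g
    simp [List.ofFn_succ, MeasurableEquiv.piFinSuccAbove, Fin.insertNthEquiv]
    rfl
  have hm2 : Measurable fun p : Mat d × (Fin n → Mat d) => (List.ofFn p.2).reverse.prod * p.1 :=
    measurable_matrix_mul.comp (((measurable_ofFn_prod n).comp measurable_snd).prodMk
      measurable_fst)
  rw [prodLaw, e, ← Measure.map_map hm2 (MeasurableEquiv.measurable _), hp, mulLaw, prodLaw]
  have e2 : (fun p : Mat d × (Fin n → Mat d) => (List.ofFn p.2).reverse.prod * p.1) =
      (fun p : Mat d × Mat d => p.1 * p.2) ∘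
        (Prod.map (fun g : Fin n → Mat d => (List.ofFn g).reverse.prod) id) ∘ Prod.swap := rfl
  rw [e2, ← Measure.map_map measurable_matrix_mul
    (((measurable_ofFn_prod n).prodMap measurable_id).comp measurable_swap),
    ← Measure.map_map ((measurable_ofFn_prod n).prodMap measurable_id) measurable_swap,
    Measure.prod_swap, ← Measure.map_prod_map _ _ (measurable_ofFn_prod n) measurable_id,
    Measure.map_id]

theorem prodLaw_zero (μ : Measure (Mat d)) [IsProbabilityMeasure μ] :
    prodLaw μ 0 = Measure.dirac 1 := by
  simp [prodLaw, Measure.map_const]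

theorem prodLaw_one (μ : Measure (Mat d)) [IsProbabilityMeasure μ] : prodLaw μ 1 = μ := by
  rw [prodLaw_succ, prodLaw_zero, mulLaw, Measure.dirac_prod,
    Measure.map_map measurable_matrix_mul measurable_prodMk_left]
  simp [Function.comp_def]

theorem GoodLaw.prodLaw {s α : ℝ} {μ : Measure (Mat d)} [IsProbabilityMeasure μ] (hε : 0 < ε)
    (hα : 0 ≤ α) (hμ : GoodLaw ε s α μ) (n : ℕ) :
    GoodLaw ε s (α ^ (n + 1)) (prodLaw μ (n + 1)) := by
  induction n with
  | zero => rwa [prodLaw_one, zero_add, pow_one]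
  | succ n ih =>
    rw [prodLaw_succ, pow_succ]
    exact ih.mulLaw hε (pow_nonneg hα _) hα hμ

theorem GoodLaw.transferOp_prodLaw {s α : ℝ} {μ : Measure (Mat d)} [IsProbabilityMeasure μ]
    (hε : 0 < ε) (hε1 : ε < 1) (hα : 0 ≤ α) (hμ : GoodLaw ε s α μ) {φ : Vec d → ℂ}
    (hφ : Measurable φ) {B : ℝ} (hB : ∀ v ∈ simplexGe d ε, ‖φ v‖ ≤ B) (n : ℕ)
    {v : Vec d} (hv : v ∈ simplex d) :
    transferOp (PosMat.prodLaw μ (n + 1)) s φ v = (transferOp μ s)^[n + 1] φ v := by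
  induction n generalizing v with
  | zero => rw [prodLaw_one]; rfl
  | succ n ih =>
    rw [prodLaw_succ, (hμ.prodLaw hε hα n).transferOp_mulLaw hε hε1 (pow_nonneg hα _) hα hμ hφ
      hB hv,
      Function.iterate_succ_apply']
    exact hμ.transferOp_congr (fun w hw => ih hw.1) hv s

/-! ### Contraction of normalised transfer operators -/

theorem integral_pos_of_ae_pos {Ω : Type*} [MeasurableSpace Ω] {m : Measure Ω}
    [IsProbabilityMeasure m] {f : Ω → ℝ} (hf : ∀ᵐ x ∂m, 0 < f x) (hi : Integrable f m) :
    0 < ∫ x, f x ∂m := by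
  have h0 : 0 ≤ᵐ[m] f := hf.mono fun x hx => hx.le
  refine (integral_nonneg_of_ae h0).lt_of_ne fun h => ?_
  obtain ⟨x, h1, h2⟩ := (hf.and ((integral_eq_zero_iff_of_nonneg_ae h0 hi).1 h.symm)).exists
  exact h1.ne' h2

/-- A complex function of diameter `O` is, against a signed density of total mass zero, as good as
one bounded by `O / 2`. The sharp constant `1 / 2` is what makes the coupling estimate contract. -/
theorem norm_integral_smul_le_of_integral_eq_zero {Ω : Type*} [MeasurableSpace Ω] {m : Measure Ω}
    {σ : Ω → ℝ} {H : Ω → ℂ} {K : Set ℂ} {O : ℝ} (hO : 0 ≤ O) (hσ : Integrable σ m)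
    (hσ0 : ∫ x, σ x ∂m = 0) (hi : Integrable (fun x => σ x • H x) m) (hK : ∀ᵐ x ∂m, H x ∈ K)
    (hd : ∀ a ∈ K, ∀ b ∈ K, ‖a - b‖ ≤ O) :
    ‖∫ x, σ x • H x ∂m‖ ≤ (∫ x, |σ x| ∂m) * (O / 2) := by
  set Z := ∫ x, σ x • H x ∂m with hZ
  rcases eq_or_ne Z 0 with h0 | h0
  · rw [h0, norm_zero]
    exact mul_nonneg (integral_nonneg fun _ => abs_nonneg _) (by linarith)
  set c : ℂ := (starRingEnd ℂ Z) / ‖Z‖ with hc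
  have hZn : (‖Z‖ : ℂ) ≠ 0 := by simpa using h0
  have hcn : ‖c‖ = 1 := by
    rw [hc, norm_div, RCLike.norm_conj, Complex.norm_real, norm_norm, div_self (by simpa using h0)]
  have hcZ : c * Z = ‖Z‖ := by
    rw [hc, div_mul_eq_mul_div, mul_comm, Complex.mul_conj, Complex.normSq_eq_norm_sq,
      div_eq_iff hZn]
    push_cast; ring
  have hre : ∀ a ∈ K, ∀ b ∈ K, (c * a).re - (c * b).re ≤ O := fun a ha b hb => by
    rw [← Complex.sub_re, ← mul_sub]
    calc (c * (a - b)).re ≤ ‖c * (a - b)‖ := Complex.re_le_norm _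
      _ = ‖a - b‖ := by rw [norm_mul, hcn, one_mul]
      _ ≤ O := hd a ha b hb
  -- the real parts lie in an interval of length `O`, with midpoint `μ₀`
  obtain ⟨μ₀, hμ₀⟩ : ∃ μ₀ : ℝ, ∀ a ∈ K, |(c * a).re - μ₀| ≤ O / 2 := by
    rcases K.eq_empty_or_nonempty with hK0 | hK0
    · exact ⟨0, fun a ha => by rw [hK0] at ha; exact absurd ha (notMem_empty a)⟩
    refine ⟨sInf ((fun a => (c * a).re) '' K) + O / 2, fun a ha => ?_⟩
    have hbdd : BddBelow ((fun a => (c * a).re) '' K) := by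
      refine ⟨(c * a).re - O, ?_⟩
      rintro _ ⟨b, hb, rfl⟩
      have := hre a ha b hb
      simp only
      linarith
    have h1 : sInf ((fun a => (c * a).re) '' K) ≤ (c * a).re := csInf_le hbdd ⟨a, ha, rfl⟩
    have h2 : (c * a).re - O ≤ sInf ((fun a => (c * a).re) '' K) := by
      refine le_csInf (hK0.image _) ?_
      rintro _ ⟨b, hb, rfl⟩
      have := hre a ha b hb
      simp only
      linarith
    rw [abs_le]
    constructor <;> linarith
  have h1 : ‖Z‖ = ∫ x, σ x * ((c * H x).re - μ₀) ∂m := by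
    have hi2 : Integrable (fun x => σ x * (c * H x).re) m := by
      have := (hi.const_mul c).re
      refine this.congr (Eventually.of_forall fun x => ?_)
      simp only [RCLike.re_to_complex, Complex.real_smul]
      rw [mul_left_comm, Complex.re_ofReal_mul]
    have h2 : ‖Z‖ = ∫ x, σ x * (c * H x).re ∂m := by
      have h3 : (c * Z).re = ‖Z‖ := by rw [hcZ, Complex.ofReal_re]
      rw [← h3, hZ, ← integral_const_mul]
      have h4 := integral_re (hi.const_mul c)
      simp only [RCLike.re_to_complex] at h4
      rw [← h4]
      refine integral_congr_ae (Eventually.of_forall fun x => ?_)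
      simp only [Complex.real_smul]
      rw [mul_left_comm, Complex.re_ofReal_mul]
    simp only [mul_sub]
    rw [integral_sub hi2 (hσ.mul_const μ₀), integral_mul_const, hσ0, zero_mul, sub_zero, h2]
  rw [h1, ← integral_mul_const]
  refine (le_abs_self _).trans ?_
  rw [← Real.norm_eq_abs]
  refine norm_integral_le_of_norm_le (hσ.abs.mul_const _) ?_
  filter_upwards [hK] with x hx
  rw [norm_mul]
  exact mul_le_mul_of_nonneg_left (hμ₀ _ hx) (norm_nonneg _)

/-- The coupling estimate: `τ` bounds the total variation distance between the probability
densities `p` and `q`. -/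
theorem norm_integral_smul_sub_le {Ω : Type*} [MeasurableSpace Ω] {m : Measure Ω}
    {p q : Ω → ℝ} {F G : Ω → ℂ} {K : Set ℂ} {B τ O : ℝ} (hO : 0 ≤ O) (hp : Integrable p m)
    (hq : Integrable q m) (hp0 : ∀ᵐ x ∂m, 0 ≤ p x) (hp1 : ∫ x, p x ∂m = 1)
    (hq1 : ∫ x, q x ∂m = 1) (hpq : ∫ x, |p x - q x| ∂m ≤ 2 * τ)
    (hpF : Integrable (fun x => p x • F x) m) (hpG : Integrable (fun x => p x • G x) m)
    (hqG : Integrable (fun x => q x • G x) m) (hFG : ∀ᵐ x ∂m, ‖F x - G x‖ ≤ B)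
    (hK : ∀ᵐ x ∂m, G x ∈ K) (hd : ∀ a ∈ K, ∀ b ∈ K, ‖a - b‖ ≤ O) :
    ‖(∫ x, p x • F x ∂m) - ∫ x, q x • G x ∂m‖ ≤ B + τ * O := by
  have e : (∫ x, p x • F x ∂m) - ∫ x, q x • G x ∂m =
      (∫ x, p x • (F x - G x) ∂m) + ∫ x, (p x - q x) • G x ∂m := by
    simp only [smul_sub, sub_smul]
    rw [integral_sub hpF hpG, integral_sub hpG hqG]
    ring
  rw [e]
  refine (norm_add_le _ _).trans (add_le_add ?_ ?_)
  · calc _ ≤ ∫ x, p x * B ∂m := by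
          refine norm_integral_le_of_norm_le (hp.mul_const B) ?_
          filter_upwards [hp0, hFG] with x h1 h2
          rw [norm_smul, Real.norm_of_nonneg h1]
          exact mul_le_mul_of_nonneg_left h2 h1
      _ = B := by rw [integral_mul_const, hp1, one_mul]
  · refine (norm_integral_smul_le_of_integral_eq_zero (σ := fun x => p x - q x) hO (hp.sub hq)
      (by rw [integral_sub hp hq, hp1, hq1, sub_self]) ?_ hK hd).trans ?_
    · have h := hpG.sub hqG
      simp only [sub_smul]
      exact h
    · nlinarith

/-- `h` is positive on `𝒮_ε` and `log h` is `D`-Lipschitz for the Hilbert metric. -/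
structure LogLip (ε D : ℝ) (h : Vec d → ℝ) : Prop where
  pos : ∀ v ∈ simplexGe d ε, 0 < h v
  le : ∀ u ∈ simplexGe d ε, ∀ v ∈ simplexGe d ε, h u ≤ Real.exp (D * hilbertDist u v) * h v

/-- The transfer operator on real functions. -/
def transferReal (m : Measure (Mat d)) (s : ℝ) (h : Vec d → ℝ) (v : Vec d) : ℝ :=
  ∫ g, vecNorm (g.mulVec v) ^ s * h (act g v) ∂m

theorem transferOp_ofReal (m : Measure (Mat d)) (s : ℝ) (h : Vec d → ℝ) (v : Vec d) :
    transferOp m s (fun u => (h u : ℂ)) v = transferReal m s h v := by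
  rw [transferReal, ← integral_complex_ofReal, transferOp]
  simp [Complex.real_smul]

theorem LogLip.mono {D D' : ℝ} {h : Vec d → ℝ} (hh : LogLip ε D h) (hD : D ≤ D') :
    LogLip ε D' h :=
  ⟨hh.pos, fun u hu v hv => (hh.le u hu v hv).trans (mul_le_mul_of_nonneg_right
    (Real.exp_le_exp.2 (mul_le_mul_of_nonneg_right hD (hilbertDist_nonneg hu.1 hv.1)))
    (hh.pos v hv).le)⟩

theorem LogLip.bounded {D : ℝ} {h : Vec d → ℝ} (hh : LogLip ε D h) :
    ∃ B, ∀ v ∈ simplexGe d ε, ‖(h v : ℂ)‖ ≤ B := by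
  rcases (simplexGe d ε).eq_empty_or_nonempty with h0 | ⟨w, hw⟩
  · exact ⟨0, fun v hv => by rw [h0] at hv; exact absurd hv (notMem_empty v)⟩
  refine ⟨Real.exp |D| * h w, fun v hv => ?_⟩
  rw [Complex.norm_real, Real.norm_of_nonneg (hh.pos v hv).le]
  refine (hh.le v hv w hw).trans (mul_le_mul_of_nonneg_right (Real.exp_le_exp.2 ?_)
    (hh.pos w hw).le)
  have h1 := hilbertDist_nonneg hv.1 hw.1
  have h2 : hilbertDist v w ≤ 1 := hilbertDist_le_one
  nlinarith [le_abs_self D, abs_nonneg D]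

theorem logLip_one : LogLip ε 0 (fun _ : Vec d => 1) :=
  ⟨fun _ _ => one_pos, fun _ _ _ _ => by simp⟩

theorem vecNorm_mulVec_rpow_le (hε : 0 < ε) (s : ℝ) {g : Mat d} (hg : IsPositive g) {u v : Vec d}
    (hu : u ∈ simplexGe d ε) (hv : v ∈ simplexGe d ε) :
    vecNorm (g.mulVec u) ^ s ≤
      Real.exp (|s| * (2 / ε) * hilbertDist u v) * vecNorm (g.mulVec v) ^ s := by
  have hc : ∀ j, 0 ≤ ∑ i, g i j := fun j => Finset.sum_nonneg fun i _ => (hg i j).le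
  have h1 := dotProduct_le_exp_mul hε hc hu hv
  have h2 := dotProduct_le_exp_mul hε hc hv hu
  rw [← vecNorm_mulVec_eq_dotProduct hg hu.1, ← vecNorm_mulVec_eq_dotProduct hg hv.1] at h1 h2
  rw [hilbertDist_comm v u] at h2
  set t := 2 / ε * hilbertDist u v with ht
  have h3 := rpow_le_of_comparable (a := Real.exp (-t)) (x := vecNorm (g.mulVec v))
    (y := vecNorm (g.mulVec u)) s (Real.exp_pos _) (vecNorm_mulVec_pos hg hv.1)
    (by rw [Real.exp_neg, inv_mul_eq_div, div_le_iff₀ (Real.exp_pos _)]; linarith)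
    (by rw [Real.exp_neg, div_inv_eq_mul]; linarith)
  rw [← Real.exp_mul] at h3
  convert h3 using 3
  rw [ht]; ring

section

variable {s α D : ℝ} {m : Measure (Mat d)} {h : Vec d → ℝ}

theorem GoodLaw.integrable_transferReal (hε : 0 < ε) (hε1 : ε < 1) (hm : GoodLaw ε s α m)
    (hmeas : Measurable h) (hh : LogLip ε D h) {v : Vec d} (hv : v ∈ simplex d) :
    Integrable (fun g => vecNorm (g.mulVec v) ^ s * h (act g v)) m := by
  obtain ⟨B, hB⟩ := hh.bounded
  have := (hm.integrable_transfer hε hε1 (Complex.measurable_ofReal.comp hmeas) hB hv).re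
  simpa using this

theorem GoodLaw.transferReal_pos [IsProbabilityMeasure m] (hε : 0 < ε) (hε1 : ε < 1)
    (hm : GoodLaw ε s α m) (hmeas : Measurable h) (hh : LogLip ε D h) {v : Vec d}
    (hv : v ∈ simplex d) : 0 < transferReal m s h v := by
  refine integral_pos_of_ae_pos ?_ (hm.integrable_transferReal hε hε1 hmeas hh hv)
  filter_upwards [hm.good] with g hg
  exact mul_pos (Real.rpow_pos_of_pos (vecNorm_mulVec_pos hg.pos hv) _)
    (hh.pos _ (hg.act_mem v hv))

/-- The densities `‖g v‖^s h(g · v)` at two points of `𝒮_ε` are comparable. -/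
theorem GoodLaw.density_le (hε : 0 < ε) (hm : GoodLaw ε s α m) (hD : 0 ≤ D) (hh : LogLip ε D h)
    {u v : Vec d} (hu : u ∈ simplexGe d ε) (hv : v ∈ simplexGe d ε) :
    ∀ᵐ g ∂m, vecNorm (g.mulVec u) ^ s * h (act g u) ≤
      Real.exp ((|s| * (2 / ε) + α * D) * hilbertDist u v) *
        (vecNorm (g.mulVec v) ^ s * h (act g v)) := by
  filter_upwards [hm.good, hm.contracts] with g hg hc
  have hau := hg.act_mem u hu.1
  have hav := hg.act_mem v hv.1
  have h1 := vecNorm_mulVec_rpow_le hε s hg.pos hu hv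
  have h2 := hh.le _ hau _ hav
  have h3 : Real.exp (D * hilbertDist (act g u) (act g v)) ≤
      Real.exp (α * D * hilbertDist u v) := Real.exp_le_exp.2 (by nlinarith [hc u hu.1 v hv.1])
  have h4 := h2.trans (mul_le_mul_of_nonneg_right h3 (hh.pos _ hav).le)
  have h5 := mul_le_mul h1 h4 (hh.pos _ hau).le (mul_nonneg (Real.exp_nonneg _)
    (Real.rpow_nonneg (vecNorm_nonneg _) _))
  rw [add_mul, Real.exp_add]
  linarith

theorem GoodLaw.logLip_transferReal [IsProbabilityMeasure m] (hε : 0 < ε) (hε1 : ε < 1)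
    (hm : GoodLaw ε s α m) (hD : 0 ≤ D) (hmeas : Measurable h) (hh : LogLip ε D h) :
    LogLip ε (|s| * (2 / ε) + α * D) (transferReal m s h) := by
  refine ⟨fun v hv => hm.transferReal_pos hε hε1 hmeas hh hv.1, fun u hu v hv => ?_⟩
  rw [transferReal, transferReal, ← integral_const_mul]
  exact integral_mono_ae (hm.integrable_transferReal hε hε1 hmeas hh hu.1)
    ((hm.integrable_transferReal hε hε1 hmeas hh hv.1).const_mul _) (hm.density_le hε hD hh hu hv)

/-- The Markov operator `φ ↦ P_s(h φ) / P_s(h)`. -/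
def normOp (m : Measure (Mat d)) (s : ℝ) (h : Vec d → ℝ) (φ : Vec d → ℂ) (v : Vec d) : ℂ :=
  transferOp m s (fun u => h u * φ u) v / (transferReal m s h v : ℂ)

/-- The oscillation of `φ` on `𝒮_ε` is at most `O` and its Hölder seminorm at most `H`. -/
def HasMod (ε γ : ℝ) (φ : Vec d → ℂ) (O H : ℝ) : Prop :=
  ∀ u ∈ simplexGe d ε, ∀ v ∈ simplexGe d ε,
    ‖φ u - φ v‖ ≤ O ∧ ‖φ u - φ v‖ ≤ H * hilbertDist u v ^ γ

/-- The coupling estimate for the normalised operators: a coupled part of the mass contributes the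
contracted Hölder term, and the rest, which is small for close points, the oscillation. -/
theorem GoodLaw.normOp_sub_le [IsProbabilityMeasure m] (hε : 0 < ε) (hε1 : ε < 1) (hγ : 0 < γ)
    (hα : 0 ≤ α) (hα1 : α ≤ 1) (hm : GoodLaw ε s α m) (hD : 0 ≤ D) (hmeas : Measurable h)
    (hh : LogLip ε D h) {φ : Vec d → ℂ} (hφ : Measurable φ) {O H : ℝ} (hO : 0 ≤ O) (hH : 0 ≤ H)
    (hφm : HasMod ε γ φ O H) {u v : Vec d}
    (hu : u ∈ simplexGe d ε) (hv : v ∈ simplexGe d ε) :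
    ‖normOp m s h φ u - normOp m s h φ v‖ ≤ α ^ γ * hilbertDist u v ^ γ * H +
      (1 - Real.exp (-(2 * (|s| * (2 / ε) + D)) * hilbertDist u v)) * O := by
  set x := (|s| * (2 / ε) + D) * hilbertDist u v with hx
  have hd0 := hilbertDist_nonneg hu.1 hv.1
  set W : Vec d → Mat d → ℝ := fun w g => vecNorm (g.mulVec w) ^ s * h (act g w) with hW
  have hWi : ∀ {w}, w ∈ simplexGe d ε → Integrable (W w) m := fun {w} hw =>
    hm.integrable_transferReal hε hε1 hmeas hh hw.1
  have hWpos : ∀ {w}, w ∈ simplexGe d ε → ∀ᵐ g ∂m, 0 < W w g := fun {w} hw => by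
    filter_upwards [hm.good] with g hg
    exact mul_pos (Real.rpow_pos_of_pos (vecNorm_mulVec_pos hg.pos hw.1) _)
      (hh.pos _ (hg.act_mem w hw.1))
  have hZ : ∀ {w}, w ∈ simplexGe d ε → 0 < transferReal m s h w := fun {w} hw =>
    hm.transferReal_pos hε hε1 hmeas hh hw.1
  have hle : ∀ {u v}, u ∈ simplexGe d ε → v ∈ simplexGe d ε → ∀ᵐ g ∂m,
      W u g ≤ Real.exp ((|s| * (2 / ε) + D) * hilbertDist u v) * W v g := fun {u v} hu hv => by
    filter_upwards [hm.density_le hε hD hh hu hv, hWpos hv] with g hg hg2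
    refine hg.trans (mul_le_mul_of_nonneg_right (Real.exp_le_exp.2
      (mul_le_mul_of_nonneg_right ?_ (hilbertDist_nonneg hu.1 hv.1))) hg2.le)
    nlinarith
  have hZle : ∀ {u v}, u ∈ simplexGe d ε → v ∈ simplexGe d ε → transferReal m s h u ≤
      Real.exp ((|s| * (2 / ε) + D) * hilbertDist u v) * transferReal m s h v :=
    fun {u v} hu hv => by
    rw [transferReal, transferReal, ← integral_const_mul]
    exact integral_mono_ae (hWi hu) ((hWi hv).const_mul _) (hle hu hv)
  obtain ⟨B, hB⟩ : ∃ B, ∀ w ∈ simplexGe d ε, ‖φ w‖ ≤ B := ⟨‖φ u‖ + O, fun w hw => by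
    have h1 := (hφm w hw u hu).1
    have h2 := norm_sub_norm_le (φ w) (φ u)
    linarith⟩
  have hsm : ∀ {w y}, w ∈ simplexGe d ε → y ∈ simplexGe d ε →
      Integrable (fun g => (W w g / transferReal m s h w) • φ (act g y)) m := fun {w y} hw hy => by
    refine Integrable.mono' (((hWi hw).div_const
      (transferReal m s h w)).norm.mul_const B) ?_ ?_
    · exact ((hWi hw).div_const _).aestronglyMeasurable.smul
        (hφ.comp (measurable_act_left y)).aestronglyMeasurable
    · filter_upwards [hm.good] with g hg
      rw [norm_smul]
      exact mul_le_mul_of_nonneg_left (hB _ (hg.act_mem y hy.1)) (norm_nonneg _)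
  have hnorm : ∀ {w}, w ∈ simplexGe d ε →
      normOp m s h φ w = ∫ g, (W w g / transferReal m s h w) • φ (act g w) ∂m := fun {w} hw => by
    rw [normOp, transferOp, ← integral_div]
    refine integral_congr_ae (Eventually.of_forall fun g => ?_)
    simp only [hW, Complex.real_smul]
    push_cast
    ring
  have hint1 : ∀ {w}, w ∈ simplexGe d ε → ∫ g, W w g / transferReal m s h w ∂m = 1 :=
    fun {w} hw => by
    rw [integral_div]
    exact div_self (hZ hw).ne'
  rw [hnorm hu, hnorm hv, mul_comm _ H, ← mul_assoc]
  refine (norm_integral_smul_sub_le (K := φ '' simplexGe d ε) hO ((hWi hu).div_const _)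
    ((hWi hv).div_const _) ?_ (hint1 hu) (hint1 hv) (τ := 1 - Real.exp (-(2 * x))) ?_
    (hsm hu hu) (hsm hu hv) (hsm hv hv) (B := H * α ^ γ * hilbertDist u v ^ γ) ?_ ?_ ?_).trans ?_
  · filter_upwards [hWpos hu] with g hg using (div_pos hg (hZ hu)).le
  · -- the two densities differ by a factor at most `exp (2 x)`
    have hcmp : ∀ {u v}, u ∈ simplexGe d ε → v ∈ simplexGe d ε → ∀ᵐ g ∂m,
        Real.exp (-(2 * ((|s| * (2 / ε) + D) * hilbertDist u v))) *
          (W u g / transferReal m s h u) ≤ W v g / transferReal m s h v := fun {u v} hu hv => by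
      have hZuv := hZle hv hu
      rw [hilbertDist_comm] at hZuv
      set y := (|s| * (2 / ε) + D) * hilbertDist u v
      filter_upwards [hle hu hv, hWpos hv] with g h1 h2
      have e2 : Real.exp (-(2 * y)) = (Real.exp y * Real.exp y)⁻¹ := by
        rw [← Real.exp_add, ← Real.exp_neg]; ring_nf
      rw [e2, inv_mul_eq_div, div_div, div_le_div_iff₀ (mul_pos (hZ hu) (by positivity)) (hZ hv)]
      calc W u g * transferReal m s h v
          ≤ (Real.exp y * W v g) * (Real.exp y * transferReal m s h u) :=
            mul_le_mul h1 hZuv (hZ hv).le (mul_nonneg (Real.exp_nonneg _) h2.le)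
        _ = _ := by ring
    have hi1 := (hWi hu).div_const (transferReal m s h u)
    have hi2 := (hWi hv).div_const (transferReal m s h v)
    calc ∫ g, |W u g / transferReal m s h u - W v g / transferReal m s h v| ∂m
        ≤ ∫ g, (1 - Real.exp (-(2 * x))) *
            (W u g / transferReal m s h u + W v g / transferReal m s h v) ∂m := by
          refine integral_mono_ae (hi1.sub hi2).abs ((hi1.add hi2).const_mul _) ?_
          have hcm := hcmp hv hu
          rw [hilbertDist_comm] at hcm
          filter_upwards [hcmp hu hv, hcm, hWpos hu, hWpos hv] with g h1 h2 h3 h4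
          have h5 := div_pos h3 (hZ hu)
          have h6 := div_pos h4 (hZ hv)
          have h7 : Real.exp (-(2 * x)) ≤ 1 := Real.exp_le_one_iff.2 (by
            have : 0 ≤ |s| * (2 / ε) := mul_nonneg (abs_nonneg s) (by positivity)
            have : 0 ≤ x := mul_nonneg (by linarith) hd0
            linarith)
          rw [← hx] at h1 h2
          rw [abs_le]
          constructor <;> nlinarith
      _ = 2 * (1 - Real.exp (-(2 * x))) := by
          rw [integral_const_mul, integral_add hi1 hi2, hint1 hu, hint1 hv]; ring
  · filter_upwards [hm.good, hm.contracts] with g hg hc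
    refine (hφm _ (hg.act_mem u hu.1) _ (hg.act_mem v hv.1)).2.trans ?_
    rw [mul_assoc, ← Real.mul_rpow hα hd0]
    exact mul_le_mul_of_nonneg_left (Real.rpow_le_rpow (hilbertDist_nonneg
      (hg.act_mem u hu.1).1 (hg.act_mem v hv.1).1) (hc u hu.1 v hv.1) hγ.le) hH
  · filter_upwards [hm.good] with g hg using ⟨_, hg.act_mem v hv.1, rfl⟩
  · rintro _ ⟨a, ha, rfl⟩ _ ⟨b, hb, rfl⟩
    exact (hφm a ha b hb).1
  · rw [hx, neg_mul, mul_assoc 2]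

theorem GoodLaw.hasMod_normOp [IsProbabilityMeasure m] (hε : 0 < ε) (hε1 : ε < 1) (hγ : 0 < γ)
    (hγ1 : γ ≤ 1) (hα : 0 ≤ α) (hα1 : α ≤ 1) (hm : GoodLaw ε s α m) (hD : 0 ≤ D)
    (hmeas : Measurable h) (hh : LogLip ε D h) {φ : Vec d → ℂ} (hφ : Measurable φ) {O H : ℝ}
    (hO : 0 ≤ O) (hH : 0 ≤ H) (hφm : HasMod ε γ φ O H) :
    HasMod ε γ (normOp m s h φ) (α ^ γ * H + (1 - Real.exp (-(2 * (|s| * (2 / ε) + D)))) * O)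
      (α ^ γ * H + 2 * (|s| * (2 / ε) + D) * O) := by
  intro u hu v hv
  have h1 := hm.normOp_sub_le hε hε1 hγ hα hα1 hD hmeas hh hφ hO hH hφm hu hv
  have hE : 0 ≤ 2 * (|s| * (2 / ε) + D) := by
    have : 0 ≤ |s| * (2 / ε) := mul_nonneg (abs_nonneg s) (by positivity)
    linarith
  set E := 2 * (|s| * (2 / ε) + D)
  have hd0 := hilbertDist_nonneg hu.1 hv.1
  have hd1 : hilbertDist u v ≤ 1 := hilbertDist_le_one
  have hdγ := hilbertDist_rpow_le_one hγ.le hu.1 hv.1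
  have hdγ0 := Real.rpow_nonneg hd0 γ
  have haγ := Real.rpow_nonneg hα γ
  refine ⟨h1.trans (add_le_add ?_ (mul_le_mul_of_nonneg_right ?_ hO)), h1.trans ?_⟩
  · exact mul_le_mul_of_nonneg_right (mul_le_of_le_one_right haγ hdγ) hH
  · have : Real.exp (-E) ≤ Real.exp (-E * hilbertDist u v) := Real.exp_le_exp.2 (by nlinarith)
    linarith
  · have h2 : 1 - Real.exp (-E * hilbertDist u v) ≤ E * hilbertDist u v ^ γ := by
      have h3 := Real.add_one_le_exp (-E * hilbertDist u v)
      have h4 := mul_le_mul_of_nonneg_left (hilbertDist_le_rpow hγ1 hu.1 hv.1) hE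
      linarith
    have h5 := mul_le_mul_of_nonneg_right h2 hO
    linarith

end

/-! ### Exponential loss of memory -/

theorem HasMod.mono {φ : Vec d → ℂ} {O H O' H' : ℝ} (h : HasMod ε γ φ O H) (hO : O ≤ O')
    (hH : H ≤ H') : HasMod ε γ φ O' H' := fun u hu v hv =>
  ⟨(h u hu v hv).1.trans hO, (h u hu v hv).2.trans (mul_le_mul_of_nonneg_right hH
    (Real.rpow_nonneg (hilbertDist_nonneg hu.1 hv.1) _))⟩

theorem HasMod.congr {φ ψ : Vec d → ℂ} {O H : ℝ} (h : HasMod ε γ φ O H)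
    (e : ∀ v ∈ simplexGe d ε, ψ v = φ v) : HasMod ε γ ψ O H := fun u hu v hv => by
  rw [e u hu, e v hv]; exact h u hu v hv

theorem HasMod.bounded {φ : Vec d → ℂ} {O H : ℝ} (h : HasMod ε γ φ O H) :
    ∃ B, ∀ v ∈ simplexGe d ε, ‖φ v‖ ≤ B := by
  rcases (simplexGe d ε).eq_empty_or_nonempty with h0 | ⟨w, hw⟩
  · exact ⟨0, fun v hv => by rw [h0] at hv; exact absurd hv (notMem_empty v)⟩
  refine ⟨‖φ w‖ + O, fun v hv => ?_⟩
  have h1 := (h v hv w hw).1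
  have h2 := norm_sub_norm_le (φ v) (φ w)
  linarith

theorem transferOp_ofReal_fun (m : Measure (Mat d)) (s : ℝ) (h : Vec d → ℝ) :
    transferOp m s (fun u => (h u : ℂ)) = fun v => (transferReal m s h v : ℂ) :=
  funext fun v => transferOp_ofReal m s h v

theorem iterate_transferOp_ofReal (m : Measure (Mat d)) (s : ℝ) (h : Vec d → ℝ) (n : ℕ) :
    (transferOp m s)^[n] (fun u => (h u : ℂ)) = fun v => ((transferReal m s)^[n] h v : ℂ) := by
  induction n generalizing h with
  | zero => rfl
  | succ n ih => rw [Function.iterate_succ_apply, transferOp_ofReal_fun, ih]; rfl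

section

variable {s α : ℝ} {m : Measure (Mat d)}

theorem measurable_transferReal [SFinite m] {h : Vec d → ℝ} (hh : Measurable h) (t : ℝ) :
    Measurable (transferReal m t h) := by
  have h1 := Complex.measurable_re.comp
    (measurable_transferOp (m := m) (Complex.measurable_ofReal.comp hh) t)
  have h2 : Complex.re ∘ transferOp m t (Complex.ofReal ∘ h) = transferReal m t h := by
    have := transferOp_ofReal_fun m t h
    funext v
    have := congrFun this v
    simp only [Function.comp_def]
    rw [this, Complex.ofReal_re]
  rwa [h2] at h1

theorem measurable_iterate_transferOp [SFinite m] {φ : Vec d → ℂ} (hφ : Measurable φ) (t : ℝ)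
    (n : ℕ) : Measurable ((transferOp m t)^[n] φ) := by
  induction n with
  | zero => exact hφ
  | succ n ih => rw [Function.iterate_succ_apply']; exact measurable_transferOp ih t

theorem measurable_iterate_transferReal [SFinite m] {h : Vec d → ℝ} (hh : Measurable h) (t : ℝ)
    (n : ℕ) : Measurable ((transferReal m t)^[n] h) := by
  induction n with
  | zero => exact hh
  | succ n ih => rw [Function.iterate_succ_apply']; exact measurable_transferReal ih t

theorem GoodLaw.bounded_iterate (hε : 0 < ε) (hε1 : ε < 1) (hm : GoodLaw ε s α m) {φ : Vec d → ℂ}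
    (hB : ∃ B, ∀ v ∈ simplexGe d ε, ‖φ v‖ ≤ B) (n : ℕ) :
    ∃ B, ∀ v ∈ simplexGe d ε, ‖(transferOp m s)^[n] φ v‖ ≤ B := by
  induction n with
  | zero => exact hB
  | succ n ih =>
    obtain ⟨B, hB⟩ := ih
    refine ⟨ε ^ (-|s|) * (∫ g, matNorm g ^ s ∂m) * B, fun v hv => ?_⟩
    rw [Function.iterate_succ_apply']
    exact hm.norm_transferOp_le hε hε1 hB hv.1

theorem GoodLaw.iterate_congr (hm : GoodLaw ε s α m) {φ ψ : Vec d → ℂ}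
    (h : ∀ v ∈ simplexGe d ε, φ v = ψ v) (n : ℕ) :
    ∀ v ∈ simplexGe d ε, (transferOp m s)^[n] φ v = (transferOp m s)^[n] ψ v := by
  induction n with
  | zero => exact h
  | succ n ih =>
    intro v hv
    rw [Function.iterate_succ_apply', Function.iterate_succ_apply']
    exact hm.transferOp_congr ih hv.1 s

/-- `P_s(h φ) / P_s(h)` is an average of the values of `φ`. -/
theorem GoodLaw.norm_normOp_sub_le [IsProbabilityMeasure m] (hε : 0 < ε) (hε1 : ε < 1)
    (hm : GoodLaw ε s α m) {h : Vec d → ℝ} {D : ℝ} (hmeas : Measurable h) (hh : LogLip ε D h)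
    {φ : Vec d → ℂ} (hφ : Measurable φ) {c : ℂ} {R : ℝ}
    (hR : ∀ v ∈ simplexGe d ε, ‖φ v - c‖ ≤ R) {v : Vec d} (hv : v ∈ simplex d) :
    ‖normOp m s h φ v - c‖ ≤ R := by
  have hpos := hm.transferReal_pos hε hε1 hmeas hh hv
  have hi := hm.integrable_transferReal hε hε1 hmeas hh hv
  obtain ⟨B, hB⟩ := hh.bounded
  have hB2 : ∀ v ∈ simplexGe d ε, ‖(h v : ℂ) * φ v‖ ≤ B * (R + ‖c‖) := fun w hw => by
    rw [norm_mul]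
    refine mul_le_mul (hB w hw) ?_ (norm_nonneg _) ((norm_nonneg _).trans (hB w hw))
    have h1 := norm_sub_norm_le (φ w) c
    linarith [hR w hw]
  have hmeas2 : Measurable fun u => (h u : ℂ) * φ u :=
    (Complex.measurable_ofReal.comp hmeas).mul hφ
  have hi2 := hm.integrable_transfer hε hε1 hmeas2 hB2 hv
  have hi3 : Integrable (fun g => c * ((vecNorm (g.mulVec v) ^ s * h (act g v) : ℝ) : ℂ)) m :=
    hi.ofReal.const_mul c
  have hne : ((transferReal m s h v : ℝ) : ℂ) ≠ 0 := by exact_mod_cast hpos.ne'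
  have e : normOp m s h φ v - c =
      (∫ g, ((vecNorm (g.mulVec v) ^ s * h (act g v) : ℝ) : ℂ) * (φ (act g v) - c) ∂m) /
        (transferReal m s h v : ℂ) := by
    rw [normOp, eq_div_iff hne, sub_mul, div_mul_cancel₀ _ hne, transferReal,
      ← integral_complex_ofReal, ← integral_const_mul, transferOp, ← integral_sub hi2 hi3]
    refine integral_congr_ae (Eventually.of_forall fun g => ?_)
    simp only [Complex.real_smul]
    push_cast
    ring
  rw [e, norm_div, Complex.norm_real, Real.norm_of_nonneg hpos.le, div_le_iff₀ hpos, transferReal,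
    ← integral_const_mul]
  refine norm_integral_le_of_norm_le (hi.const_mul R) ?_
  filter_upwards [hm.good] with g hg
  have h0 := mul_nonneg (Real.rpow_nonneg (vecNorm_nonneg (g.mulVec v)) s)
    (hh.pos _ (hg.act_mem v hv)).le
  rw [norm_mul, Complex.norm_real, Real.norm_of_nonneg h0, mul_comm]
  exact mul_le_mul_of_nonneg_right (hR _ (hg.act_mem v hv)) h0

end

/-- The log-Lipschitz constant that is preserved by strongly contracting laws. -/
def distortion (ε s : ℝ) : ℝ := 2 * (|s| * (2 / ε))

theorem distortion_nonneg (hε : 0 < ε) (s : ℝ) : 0 ≤ distortion ε s :=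
  mul_nonneg zero_le_two (mul_nonneg (abs_nonneg s) (by positivity))

/-- After sufficiently many steps the normalised transfer operators contract the norm
`osc + β · [·]_γ`, with constants depending on `ε`, `γ` and `s` only. -/
theorem exists_contraction (hε : 0 < ε) (hε1 : ε < 1) (hγ : 0 < γ) (hγ1 : γ ≤ 1) (s : ℝ) :
    ∃ n : ℕ, contr ε ^ (n + 1) ≤ 1 / 2 ∧ ∃ β : ℝ, 0 < β ∧ ∃ θ : ℝ, 0 ≤ θ ∧ θ < 1 ∧
      ∀ m : Measure (Mat d), IsProbabilityMeasure m → GoodLaw ε s (contr ε ^ (n + 1)) m →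
      ∀ h : Vec d → ℝ, Measurable h → LogLip ε (distortion ε s) h →
      ∀ φ : Vec d → ℂ, Measurable φ → ∀ O H : ℝ, 0 ≤ O → 0 ≤ H → HasMod ε γ φ O H →
        ∃ O' H' : ℝ, 0 ≤ O' ∧ 0 ≤ H' ∧ O' + β * H' ≤ θ * (O + β * H) ∧
          HasMod ε γ (normOp m s h φ) O' H' := by
  set D := distortion ε s with hD
  have hD0 : 0 ≤ D := distortion_nonneg hε s
  set E := 2 * (|s| * (2 / ε) + D) with hE
  have hE0 : 0 ≤ E := by
    have : 0 ≤ |s| * (2 / ε) := mul_nonneg (abs_nonneg s) (by positivity)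
    linarith
  set η := Real.exp (-E) with hη
  have hη0 : 0 < η := Real.exp_pos _
  have hη1 : η ≤ 1 := Real.exp_le_one_iff.2 (by linarith)
  -- `β` is small enough for the oscillation, `n` large enough for the Hölder seminorm
  set β := η / (2 * (E + 1)) with hβ
  have hβ0 : 0 < β := by positivity
  have hβE : β * E ≤ η / 2 := by
    rw [hβ, div_mul_eq_mul_div, div_le_div_iff₀ (by positivity) (by positivity)]
    nlinarith
  have hc0 := contr_nonneg hε hε1
  have hc1 := contr_lt_one hε
  have hlim : Tendsto (fun n : ℕ => contr ε ^ (n + 1)) atTop (𝓝 0) :=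
    (tendsto_pow_atTop_nhds_zero_of_lt_one hc0 hc1).comp (tendsto_add_atTop_nat 1)
  have hlim2 : Tendsto (fun n : ℕ => (1 + β) * (contr ε ^ (n + 1)) ^ γ) atTop (𝓝 0) := by
    have := (hlim.rpow_const (p := γ) (Or.inr hγ.le)).const_mul (1 + β)
    simpa [Real.zero_rpow hγ.ne'] using this
  have hpos : 0 < (1 - η / 2) * β := mul_pos (by linarith) hβ0
  obtain ⟨n, hn1, hn2⟩ := ((hlim.eventually (gt_mem_nhds (show (0 : ℝ) < 1 / 2 by norm_num))).and
    (hlim2.eventually (gt_mem_nhds hpos))).exists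
  refine ⟨n, hn1.le, β, hβ0, 1 - η / 2, by linarith, by linarith, ?_⟩
  intro m _ hm h hmeas hh φ hφ O H hO hH hφm
  have hα0 : 0 ≤ contr ε ^ (n + 1) := pow_nonneg hc0 _
  have hαγ : 0 ≤ (contr ε ^ (n + 1)) ^ γ := Real.rpow_nonneg hα0 _
  refine ⟨_, _, ?_, ?_, ?_, hm.hasMod_normOp hε hε1 hγ hγ1 hα0 (by linarith) hD0 hmeas hh hφ hO hH
    hφm⟩
  · rw [← hE, ← hη]
    exact add_nonneg (mul_nonneg hαγ hH) (mul_nonneg (by linarith) hO)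
  · exact add_nonneg (mul_nonneg hαγ hH) (mul_nonneg hE0 hO)
  · rw [← hE, ← hη]
    have h1 := mul_le_mul_of_nonneg_right hn2.le hH
    have h2 := mul_le_mul_of_nonneg_right hβE hO
    nlinarith

/-- The normalised iterates `P_s^n(h φ) / P_s^n(h)`. -/
def normIter (μ : Measure (Mat d)) (s : ℝ) (h : Vec d → ℝ) (φ : Vec d → ℂ) (n : ℕ) (v : Vec d) :
    ℂ :=
  (transferOp μ s)^[n] (fun u => h u * φ u) v / ((transferReal μ s)^[n] h v : ℂ)

theorem normIter_zero {s : ℝ} {μ : Measure (Mat d)} {h : Vec d → ℝ} {φ : Vec d → ℂ}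
    (hh : LogLip ε (distortion ε s) h) {v : Vec d}
    (hv : v ∈ simplexGe d ε) : normIter μ s h φ 0 v = φ v := by
  rw [normIter, Function.iterate_zero, Function.iterate_zero]
  exact mul_div_cancel_left₀ _ (by exact_mod_cast (hh.pos v hv).ne')

section

variable {s : ℝ} {μ : Measure (Mat d)} [IsProbabilityMeasure μ] {h : Vec d → ℝ} {φ : Vec d → ℂ}

theorem GoodLaw.transferReal_prodLaw (hε : 0 < ε) (hε1 : ε < 1)
    (hμ : GoodLaw ε s (contr ε) μ) (hmeas : Measurable h) {D : ℝ} (hh : LogLip ε D h) (n : ℕ)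
    {v : Vec d} (hv : v ∈ simplex d) :
    transferReal (PosMat.prodLaw μ (n + 1)) s h v = (transferReal μ s)^[n + 1] h v := by
  obtain ⟨B, hB⟩ := hh.bounded
  have h1 := hμ.transferOp_prodLaw hε hε1 (contr_nonneg hε hε1)
    (Complex.measurable_ofReal.comp hmeas) hB n hv
  have h2 := congrFun (iterate_transferOp_ofReal μ s h (n + 1)) v
  have h3 := transferOp_ofReal (PosMat.prodLaw μ (n + 1)) s h v
  simp only [Function.comp_def] at h1
  rw [h3, h2] at h1
  exact_mod_cast h1

theorem GoodLaw.logLip_iterate (hε : 0 < ε) (hε1 : ε < 1) (hμ : GoodLaw ε s (contr ε) μ)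
    (hmeas : Measurable h) (hh : LogLip ε (distortion ε s) h) {n : ℕ}
    (hn : contr ε ^ (n + 1) ≤ 1 / 2) (j : ℕ) :
    LogLip ε (distortion ε s) ((transferReal μ s)^[(n + 1) * j] h) := by
  induction j with
  | zero => exact hh
  | succ j ih =>
    have hm := measurable_iterate_transferReal (m := μ) hmeas s ((n + 1) * j)
    have h1 := (hμ.prodLaw hε (contr_nonneg hε hε1) n).logLip_transferReal hε hε1
      (distortion_nonneg hε s) hm ih
    have h2 := h1.mono (D' := distortion ε s) (by
      have := mul_le_mul_of_nonneg_right hn (distortion_nonneg hε s)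
      rw [distortion] at this ⊢
      linarith)
    have e : ∀ v ∈ simplexGe d ε, (transferReal μ s)^[(n + 1) * (j + 1)] h v =
        transferReal (PosMat.prodLaw μ (n + 1)) s ((transferReal μ s)^[(n + 1) * j] h) v :=
      fun v hv => by
      rw [hμ.transferReal_prodLaw hε hε1 hm ih n hv.1, ← Function.iterate_add_apply,
        show (n + 1) * (j + 1) = n + 1 + (n + 1) * j by ring]
    exact ⟨fun v hv => by rw [e v hv]; exact h2.pos v hv, fun u hu v hv => by
      rw [e u hu, e v hv]; exact h2.le u hu v hv⟩

theorem measurable_normIter (hmeas : Measurable h) (hφ : Measurable φ) (n : ℕ) :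
    Measurable (normIter μ s h φ n) :=
  (measurable_iterate_transferOp ((Complex.measurable_ofReal.comp hmeas).mul hφ) s n).div
    (Complex.measurable_ofReal.comp (measurable_iterate_transferReal hmeas s n))

/-- The normalised iterates are obtained from each other by Markov operators. -/
theorem GoodLaw.normIter_succ (hε : 0 < ε) (hε1 : ε < 1) (hμ : GoodLaw ε s (contr ε) μ)
    (hmeas : Measurable h) (hh : LogLip ε (distortion ε s) h) (hφ : Measurable φ)
    (hφB : ∃ B, ∀ v ∈ simplexGe d ε, ‖φ v‖ ≤ B) {n : ℕ}
    (hn : contr ε ^ (n + 1) ≤ 1 / 2) (j : ℕ) {v : Vec d} (hv : v ∈ simplex d) :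
    normIter μ s h φ ((n + 1) * (j + 1)) v =
      normOp (PosMat.prodLaw μ (n + 1)) s ((transferReal μ s)^[(n + 1) * j] h)
        (normIter μ s h φ ((n + 1) * j)) v := by
  have hlip := hμ.logLip_iterate hε hε1 hmeas hh hn j
  have hm := measurable_iterate_transferReal (m := μ) hmeas s ((n + 1) * j)
  have hm2 := measurable_iterate_transferOp (m := μ)
    ((Complex.measurable_ofReal.comp hmeas).mul hφ) s ((n + 1) * j)
  have hprod : ∃ B, ∀ v ∈ simplexGe d ε, ‖(h v : ℂ) * φ v‖ ≤ B := by
    obtain ⟨B, hB⟩ := hφB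
    obtain ⟨B', hB'⟩ := hh.bounded
    exact ⟨B' * B, fun v hv => by
      rw [norm_mul]
      exact mul_le_mul (hB' v hv) (hB v hv) (norm_nonneg _) ((norm_nonneg _).trans (hB' v hv))⟩
  obtain ⟨B, hB⟩ := hμ.bounded_iterate hε hε1 hprod ((n + 1) * j)
  have hgl := hμ.prodLaw hε (contr_nonneg hε hε1) n
  rw [normOp, hμ.transferReal_prodLaw hε hε1 hm hlip n hv, ← Function.iterate_add_apply, normIter]
  have e1 : transferOp (PosMat.prodLaw μ (n + 1)) s (fun u =>
      ((transferReal μ s)^[(n + 1) * j] h u : ℂ) * normIter μ s h φ ((n + 1) * j) u) v =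
      transferOp (PosMat.prodLaw μ (n + 1)) s
        ((transferOp μ s)^[(n + 1) * j] fun u => h u * φ u) v :=
    hgl.transferOp_congr (fun w hw => by
      rw [normIter, mul_div_cancel₀]
      exact_mod_cast (hlip.pos w hw).ne') hv s
  rw [e1]
  have e2 := hμ.transferOp_prodLaw hε hε1 (contr_nonneg hε hε1) hm2 hB n hv
  have e3 : (transferOp μ s)^[n + 1] ((transferOp μ s)^[(n + 1) * j] fun u => h u * φ u) =
      (transferOp μ s)^[(n + 1) * (j + 1)] fun u => h u * φ u := by
    rw [← Function.iterate_add_apply, show (n + 1) * (j + 1) = n + 1 + (n + 1) * j by ring]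
  have e4 : n + 1 + (n + 1) * j = (n + 1) * (j + 1) := by ring
  rw [e4, ← e3]
  congr 1
  exact e2.symm

end

/-- Loss of memory: the normalised iterates become constant exponentially fast in the Hölder norm.
The step `n + 1` and the rate do not depend on the law. -/
theorem exists_rate (d : ℕ) (hε : 0 < ε) (hε1 : ε < 1) (hγ : 0 < γ) (hγ1 : γ ≤ 1) (s : ℝ) :
    ∃ n : ℕ, contr ε ^ (n + 1) ≤ 1 / 2 ∧ ∃ C : ℝ, 0 ≤ C ∧ ∃ θ : ℝ, 0 ≤ θ ∧ θ < 1 ∧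
      ∀ μ : Measure (Mat d), IsProbabilityMeasure μ → GoodLaw ε s (contr ε) μ →
      ∀ h : Vec d → ℝ, Measurable h → LogLip ε (distortion ε s) h →
      ∀ φ : Vec d → ℂ, Measurable φ → ∀ O H : ℝ, 0 ≤ O → 0 ≤ H → HasMod ε γ φ O H → ∀ j : ℕ,
        HasMod ε γ (normIter μ s h φ ((n + 1) * j)) (C * θ ^ j * (O + H))
          (C * θ ^ j * (O + H)) := by
  obtain ⟨n, hn, β, hβ, θ, hθ0, hθ1, hc⟩ := exists_contraction (d := d) hε hε1 hγ hγ1 s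
  refine ⟨n, hn, (1 + β) * (1 + 1 / β), by positivity, θ, hθ0, hθ1, ?_⟩
  intro μ _ hμ h hmeas hh φ hφ O H hO hH hφm j
  have key : ∃ O' H' : ℝ, 0 ≤ O' ∧ 0 ≤ H' ∧ O' + β * H' ≤ θ ^ j * (O + β * H) ∧
      HasMod ε γ (normIter μ s h φ ((n + 1) * j)) O' H' := by
    induction j with
    | zero => exact ⟨O, H, hO, hH, by simp, hφm.congr fun v hv => normIter_zero hh hv⟩
    | succ j ih =>
      obtain ⟨O₁, H₁, hO₁, hH₁, hle, hmod⟩ := ih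
      obtain ⟨O₂, H₂, hO₂, hH₂, hle₂, hmod₂⟩ := hc _ inferInstance
        (hμ.prodLaw hε (contr_nonneg hε hε1) n) _
        (measurable_iterate_transferReal (m := μ) hmeas s ((n + 1) * j))
        (hμ.logLip_iterate hε hε1 hmeas hh hn j) _
        (measurable_normIter (μ := μ) (s := s) hmeas hφ ((n + 1) * j)) O₁ H₁ hO₁ hH₁ hmod
      refine ⟨O₂, H₂, hO₂, hH₂, hle₂.trans ?_, hmod₂.congr fun v hv =>
        hμ.normIter_succ hε hε1 hmeas hh hφ hφm.bounded hn j hv.1⟩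
      rw [pow_succ, mul_comm (θ ^ j) θ, mul_assoc]
      exact mul_le_mul_of_nonneg_left hle hθ0
  obtain ⟨O', H', hO', hH', hle, hmod⟩ := key
  have hθj : 0 ≤ θ ^ j := pow_nonneg hθ0 j
  have h1 : O + β * H ≤ (1 + β) * (O + H) := by nlinarith
  have h2 : θ ^ j * (O + β * H) ≤ θ ^ j * ((1 + β) * (O + H)) := mul_le_mul_of_nonneg_left h1 hθj
  have h3 : 0 ≤ θ ^ j * ((1 + β) * (O + H)) := by positivity
  have e : (1 + β) * (1 + 1 / β) * θ ^ j * (O + H) =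
      θ ^ j * ((1 + β) * (O + H)) + θ ^ j * ((1 + β) * (O + H)) / β := by field_simp
  have h4 : 0 ≤ θ ^ j * ((1 + β) * (O + H)) / β := by positivity
  refine hmod.mono ?_ ?_
  · rw [e]; nlinarith
  · rw [e]
    have : H' ≤ θ ^ j * ((1 + β) * (O + H)) / β := by
      rw [le_div_iff₀ hβ]; nlinarith
    linarith

/-! ### Operators with kernels depending on `log ‖g v‖` -/

theorem HolderBound.congr {F F' : Vec d → ℂ} {B H : ℝ} (h : HolderBound ε γ F B H)
    (e : ∀ v ∈ simplexGe d ε, F' v = F v) : HolderBound ε γ F' B H :=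
  ⟨fun v hv => by rw [e v hv]; exact h.1 v hv, fun u hu v hv => by
    rw [e u hu, e v hv]; exact h.2 u hu v hv⟩

/-- The operator `φ ↦ ∫ G(log ‖g v‖) φ(g · v) m(dg)`. For `G = exp(w ·)` it is the transfer operator
with complex exponent `w`. -/
def profileOp (m : Measure (Mat d)) (G : ℝ → ℂ) (φ : Vec d → ℂ) (v : Vec d) : ℂ :=
  ∫ g, G (Real.log (vecNorm (g.mulVec v))) * φ (act g v) ∂m

/-- `b` dominates the profile `G` and its derivative `G'` at all possible values of `log ‖g v‖`. -/
structure Dominates (ε : ℝ) (m : Measure (Mat d)) (G G' : ℝ → ℂ) (b : Mat d → ℝ) : Prop where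
  deriv : ∀ y, HasDerivAt G (G' y) y
  integrable : Integrable b m
  bound : ∀ᵐ g ∂m, ∀ y, Real.log (ε * matNorm g) ≤ y → y ≤ Real.log (matNorm g) →
    ‖G y‖ ≤ b g ∧ ‖G' y‖ ≤ b g

theorem abs_log_vecNorm_sub_le (hε : 0 < ε) {g : Mat d} (hg : IsPositive g) {u v : Vec d}
    (hu : u ∈ simplexGe d ε) (hv : v ∈ simplexGe d ε) :
    |Real.log (vecNorm (g.mulVec u)) - Real.log (vecNorm (g.mulVec v))| ≤
      2 / ε * hilbertDist u v := by
  have key : ∀ {u v : Vec d}, u ∈ simplexGe d ε → v ∈ simplexGe d ε →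
      Real.log (vecNorm (g.mulVec u)) - Real.log (vecNorm (g.mulVec v)) ≤
        2 / ε * hilbertDist u v := fun {u v} hu hv => by
    have h := vecNorm_mulVec_rpow_le hε 1 hg hu hv
    have h1 := vecNorm_mulVec_pos hg hu.1
    have h2 := vecNorm_mulVec_pos hg hv.1
    rw [Real.rpow_one, Real.rpow_one, abs_one, one_mul] at h
    have h3 := Real.log_le_log h1 h
    rw [Real.log_mul (Real.exp_pos _).ne' h2.ne', Real.log_exp] at h3
    linarith
  rw [abs_le]
  have := key hv hu
  rw [hilbertDist_comm] at this
  exact ⟨by linarith, key hu hv⟩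

theorem Good.log_vecNorm_mem (hε : 0 < ε) {g : Mat d} (hg : Good ε g) {v : Vec d}
    (hv : v ∈ simplex d) : Real.log (ε * matNorm g) ≤ Real.log (vecNorm (g.mulVec v)) ∧
      Real.log (vecNorm (g.mulVec v)) ≤ Real.log (matNorm g) := by
  obtain ⟨i, -⟩ := exists_simplex_pos hv
  exact ⟨Real.log_le_log (mul_pos hε (matNorm_pos hg.pos i)) (hg.le_vecNorm hv),
    Real.log_le_log (vecNorm_mulVec_pos hg.pos hv) (vecNorm_mulVec_le hg.pos hv)⟩

theorem exp_mul_le_matNorm_rpow (hε : 0 < ε) (hε1 : ε < 1) {g : Mat d} (hg : 0 < matNorm g) (σ : ℝ)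
    {y : ℝ} (h1 : Real.log (ε * matNorm g) ≤ y) (h2 : y ≤ Real.log (matNorm g)) :
    Real.exp (σ * y) ≤ ε ^ (-|σ|) * matNorm g ^ σ := by
  rw [mul_comm, Real.exp_mul]
  rw [Real.log_le_iff_le_exp (mul_pos hε hg)] at h1
  rw [Real.le_log_iff_exp_le hg] at h2
  refine rpow_le_of_comparable σ hε hg h1 (h2.trans ?_)
  rw [le_div_iff₀ hε]
  nlinarith [hε1, hg]

section

variable {m : Measure (Mat d)} {G G' : ℝ → ℂ} {b : Mat d → ℝ}

theorem measurable_profile (hG : Measurable G) {φ : Vec d → ℂ} (hφ : Measurable φ) (v : Vec d) :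
    Measurable fun g : Mat d => G (Real.log (vecNorm (g.mulVec v))) * φ (act g v) := by
  have h1 : Measurable fun g : Mat d => Real.log (vecNorm (g.mulVec v)) :=
    Real.measurable_log.comp (measurable_vecNorm_left v)
  exact (hG.comp h1).mul (hφ.comp (measurable_act_left v))

theorem Dominates.measurable (h : Dominates ε m G G' b) : Measurable G :=
  (continuous_iff_continuousAt.2 fun y => (h.deriv y).continuousAt).measurable

theorem Dominates.norm_le (hε : 0 < ε) (hm : ∀ᵐ g ∂m, Good ε g) (h : Dominates ε m G G' b)
    {φ : Vec d → ℂ} {B : ℝ} (hB : ∀ v ∈ simplexGe d ε, ‖φ v‖ ≤ B) {v : Vec d} (hv : v ∈ simplex d) :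
    ∀ᵐ g ∂m, ‖G (Real.log (vecNorm (g.mulVec v))) * φ (act g v)‖ ≤ b g * B := by
  filter_upwards [hm, h.bound] with g hg hb
  obtain ⟨h1, h2⟩ := hg.log_vecNorm_mem hε hv
  have h3 := (hb _ h1 h2).1
  rw [norm_mul]
  exact mul_le_mul h3 (hB _ (hg.act_mem v hv)) (norm_nonneg _) ((norm_nonneg _).trans h3)

theorem Dominates.integrable_profile (hε : 0 < ε) (hm : ∀ᵐ g ∂m, Good ε g)
    (h : Dominates ε m G G' b) {φ : Vec d → ℂ} (hφ : Measurable φ) {B : ℝ}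
    (hB : ∀ v ∈ simplexGe d ε, ‖φ v‖ ≤ B) {v : Vec d} (hv : v ∈ simplex d) :
    Integrable (fun g => G (Real.log (vecNorm (g.mulVec v))) * φ (act g v)) m :=
  Integrable.mono' (h.integrable.mul_const B)
    (measurable_profile h.measurable hφ v).aestronglyMeasurable (h.norm_le hε hm hB hv)

theorem Dominates.holderBound (hε : 0 < ε) (hε1 : ε < 1) (hγ : 0 < γ) (hγ1 : γ ≤ 1)
    (hm : ∀ᵐ g ∂m, Good ε g) (h : Dominates ε m G G' b) {φ : Vec d → ℂ} (hφ : Measurable φ)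
    {B H : ℝ} (hφB : HolderBound ε γ φ B H) :
    HolderBound ε γ (profileOp m G φ) ((∫ g, b g ∂m) * B) ((∫ g, b g ∂m) * (2 / ε * B + H)) := by
  refine ⟨fun v hv => ?_, fun u hu v hv => ?_⟩
  · rw [← integral_mul_const]
    exact norm_integral_le_of_norm_le (h.integrable.mul_const B) (h.norm_le hε hm hφB.1 hv.1)
  · rw [profileOp, profileOp, ← integral_sub (h.integrable_profile hε hm hφ hφB.1 hu.1)
      (h.integrable_profile hε hm hφ hφB.1 hv.1), mul_assoc, ← integral_mul_const]
    refine norm_integral_le_of_norm_le (h.integrable.mul_const _) ?_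
    filter_upwards [hm, h.bound] with g hg hb
    obtain ⟨h1, h2⟩ := hg.log_vecNorm_mem hε hu.1
    obtain ⟨h3, h4⟩ := hg.log_vecNorm_mem hε hv.1
    have hG : ‖G (Real.log (vecNorm (g.mulVec u))) - G (Real.log (vecNorm (g.mulVec v)))‖ ≤
        b g * (2 / ε * hilbertDist u v) := by
      have := (convex_Icc (Real.log (ε * matNorm g))
        (Real.log (matNorm g))).norm_image_sub_le_of_norm_hasDerivWithin_le
        (f := G) (f' := G') (C := b g) (fun y _ => (h.deriv y).hasDerivWithinAt)
        (fun y hy => (hb y hy.1 hy.2).2) ⟨h3, h4⟩ ⟨h1, h2⟩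
      refine this.trans (mul_le_mul_of_nonneg_left ?_ ((norm_nonneg _).trans (hb _ h1 h2).1))
      exact abs_log_vecNorm_sub_le hε hg.pos hu hv
    have hau := hg.act_mem u hu.1
    have hav := hg.act_mem v hv.1
    have hd := hilbertDist_le_rpow hγ1 hu.1 hv.1
    have hd0 := hilbertDist_nonneg hu.1 hv.1
    have hd2 : hilbertDist (act g u) (act g v) ^ γ ≤ hilbertDist u v ^ γ :=
      Real.rpow_le_rpow (hilbertDist_nonneg hau.1 hav.1)
        ((hg.hilbertDist_act_le hε hε1 hu.1 hv.1).trans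
          (mul_le_of_le_one_left hd0 (contr_lt_one hε).le)) hγ.le
    have hb0 : 0 ≤ b g := (norm_nonneg _).trans (hb _ h1 h2).1
    have hB0 : 0 ≤ B := (norm_nonneg _).trans (hφB.1 _ hau)
    have hφd : ‖φ (act g u) - φ (act g v)‖ ≤ H * hilbertDist u v ^ γ := by
      rcases le_or_gt 0 H with hH | hH
      · exact (hφB.2 _ hau _ hav).trans (mul_le_mul_of_nonneg_left hd2 hH)
      · have h5 := hφB.2 _ hau _ hav
        have h6 := (norm_nonneg _).trans (hφB.2 _ hu _ hv)
        have h7 : H * hilbertDist (act g u) (act g v) ^ γ ≤ 0 :=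
          mul_nonpos_of_nonpos_of_nonneg hH.le
            (Real.rpow_nonneg (hilbertDist_nonneg hau.1 hav.1) _)
        linarith
    have e : G (Real.log (vecNorm (g.mulVec u))) * φ (act g u) -
        G (Real.log (vecNorm (g.mulVec v))) * φ (act g v) =
        (G (Real.log (vecNorm (g.mulVec u))) - G (Real.log (vecNorm (g.mulVec v)))) * φ (act g u) +
          G (Real.log (vecNorm (g.mulVec v))) * (φ (act g u) - φ (act g v)) := by ring
    rw [e]
    refine (norm_add_le _ _).trans ?_
    rw [norm_mul, norm_mul]
    have h8 := mul_le_mul hG (hφB.1 _ hau) (norm_nonneg _)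
      (mul_nonneg hb0 (mul_nonneg (by positivity) hd0))
    have h9 := mul_le_mul (hb _ h3 h4).1 hφd (norm_nonneg _) hb0
    have h10 : b g * (2 / ε * hilbertDist u v) * B ≤
        b g * (2 / ε * B * hilbertDist u v ^ γ) := by
      rw [mul_assoc]
      refine mul_le_mul_of_nonneg_left ?_ hb0
      have := mul_le_mul_of_nonneg_left hd (show 0 ≤ 2 / ε * B by positivity)
      linarith
    nlinarith

/-- A dominated profile defines a bounded operator on `ℬ_γ`, with an explicit bound. -/
theorem Dominates.exists_represents (hε : 0 < ε) (hε1 : ε < 1) (hγ : 0 < γ) (hγ1 : γ ≤ 1)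
    (hm : ∀ᵐ g ∂m, Good ε g) (h : Dominates ε m G G' b) :
    ∃ T : HolderSpace d ε γ →L[ℂ] HolderSpace d ε γ, Represents T (profileOp m G) ∧
      ‖T‖ ≤ 2 * ((2 / ε + 1) * |∫ g, b g ∂m|) := by
  have hb0 := le_abs_self (∫ g, b g ∂m)
  have hε2 : 0 < 2 / ε := by positivity
  refine HolderSpace.exists_represents hε hγ (by positivity) (fun φ ψ v hv => ?_)
    (fun c φ v hv => ?_) fun φ => ?_
  · rw [profileOp, profileOp, profileOp, ← integral_add
      (h.integrable_profile hε hm φ.measurable_ext (φ.holderBound hγ).1 hv.1)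
      (h.integrable_profile hε hm ψ.measurable_ext (ψ.holderBound hγ).1 hv.1)]
    simp only [HolderSpace.ext_add, mul_add]
  · rw [profileOp, profileOp, ← integral_const_mul]
    simp only [HolderSpace.ext_smul]
    exact integral_congr_ae (Eventually.of_forall fun g => by ring)
  · have hn := norm_nonneg φ
    refine (h.holderBound hε hε1 hγ hγ1 hm φ.measurable_ext (φ.holderBound hγ)).mono ?_ ?_
    · refine mul_le_mul_of_nonneg_right ?_ hn
      nlinarith [abs_nonneg (∫ g, b g ∂m)]
    · rw [mul_comm (2 / ε + 1), mul_assoc, add_mul, one_mul]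
      exact mul_le_mul_of_nonneg_right hb0 (by positivity)

end

theorem transferOp_eq_profileOp {m : Measure (Mat d)} (hm : ∀ᵐ g ∂m, Good ε g) (s : ℝ)
    (φ : Vec d → ℂ) {v : Vec d} (hv : v ∈ simplex d) :
    transferOp m s φ v = profileOp m (fun y => Complex.exp (s * y)) φ v := by
  refine integral_congr_ae ?_
  filter_upwards [hm] with g hg
  have h := vecNorm_mulVec_pos hg.pos hv
  simp only [Complex.real_smul]
  rw [Real.rpow_def_of_pos h, mul_comm (Real.log _)]
  push_cast
  rfl

theorem dominates_exp (hε : 0 < ε) (hε1 : ε < 1) {m : Measure (Mat d)} (hm : ∀ᵐ g ∂m, Good ε g)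
    (hd : 0 < d) (w : ℂ) (hi : Integrable (fun g => matNorm g ^ w.re) m) :
    Dominates ε m (fun y : ℝ => Complex.exp (w * y)) (fun y => w * Complex.exp (w * y))
      (fun g => (1 + ‖w‖) * (ε ^ (-|w.re|) * matNorm g ^ w.re)) := by
  refine ⟨fun y => ?_, (hi.const_mul _).const_mul _, ?_⟩
  · have h1 : HasDerivAt (fun y : ℝ => w * (y : ℂ)) (w * 1) y :=
      (Complex.ofRealCLM.hasDerivAt (x := y)).const_mul w
    have := h1.cexp
    rw [mul_one, mul_comm] at this
    exact this
  · filter_upwards [hm] with g hg y h1 h2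
    have h3 := exp_mul_le_matNorm_rpow hε hε1 (matNorm_pos hg.pos ⟨0, hd⟩) w.re h1 h2
    have h4 : ‖Complex.exp (w * y)‖ = Real.exp (w.re * y) := by
      rw [Complex.norm_exp, Complex.re_mul_ofReal]
    have h5 := Real.exp_pos (w.re * y)
    have h6 := norm_nonneg w
    rw [norm_mul, h4]
    constructor <;> nlinarith

theorem GoodLaw.dominates {s α : ℝ} {m : Measure (Mat d)} (hε : 0 < ε) (hε1 : ε < 1) (hd : 0 < d)
    (hm : GoodLaw ε s α m) :
    Dominates ε m (fun y : ℝ => Complex.exp (s * y)) (fun y => s * Complex.exp (s * y))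
      (fun g => (1 + ‖(s : ℂ)‖) * (ε ^ (-|s|) * matNorm g ^ s)) := by
  simpa using dominates_exp hε hε1 hm.good hd (s : ℂ) (by simpa using hm.integrable)

/-- Transfer operators preserve Hölder functions. -/
theorem GoodLaw.holderBound_transferOp {s α : ℝ} {m : Measure (Mat d)} (hε : 0 < ε) (hε1 : ε < 1)
    (hd : 0 < d) (hγ : 0 < γ) (hγ1 : γ ≤ 1) (hm : GoodLaw ε s α m) {φ : Vec d → ℂ}
    (hφ : Measurable φ) (hφB : ∃ B H, HolderBound ε γ φ B H) :
    ∃ B H, HolderBound ε γ (transferOp m s φ) B H := by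
  obtain ⟨B, H, hφB⟩ := hφB
  have h := (hm.dominates hε hε1 hd).holderBound hε hε1 hγ hγ1 hm.good hφ hφB
  exact ⟨_, _, h.congr fun v hv => transferOp_eq_profileOp hm.good s φ hv.1⟩

/-! ### Density of Hölder functions -/

/-- The star subalgebra of Hölder functions in the continuous functions on `𝒮_ε`. -/
def holderAlgebra (d : ℕ) (ε γ : ℝ) : StarSubalgebra ℂ C(simplexGe d ε, ℂ) where
  carrier := {φ | ∃ B H : ℝ, 0 ≤ B ∧ 0 ≤ H ∧ (∀ v, ‖φ v‖ ≤ B) ∧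
    ∀ u v : simplexGe d ε, ‖φ u - φ v‖ ≤ H * hilbertDist (u : Vec d) (v : Vec d) ^ γ}
  mul_mem' := by
    rintro φ ψ ⟨B, H, hB0, hH0, hB, hH⟩ ⟨B', H', hB0', hH0', hB', hH'⟩
    refine ⟨B * B', B * H' + H * B', by positivity, by positivity, fun v => ?_, fun u v => ?_⟩
    · rw [ContinuousMap.mul_apply, norm_mul]
      exact mul_le_mul (hB v) (hB' v) (norm_nonneg _) hB0
    · have e : (φ * ψ) u - (φ * ψ) v = φ u * (ψ u - ψ v) + (φ u - φ v) * ψ v := by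
        simp only [ContinuousMap.mul_apply]; ring
      rw [e, add_mul, mul_assoc B, mul_right_comm H]
      refine (norm_add_le _ _).trans (add_le_add ?_ ?_)
      · rw [norm_mul]
        exact mul_le_mul (hB u) (hH' u v) (norm_nonneg _) hB0
      · rw [norm_mul]
        exact mul_le_mul (hH u v) (hB' v) (norm_nonneg _) ((norm_nonneg _).trans (hH u v))
  add_mem' := by
    rintro φ ψ ⟨B, H, hB0, hH0, hB, hH⟩ ⟨B', H', hB0', hH0', hB', hH'⟩
    refine ⟨B + B', H + H', by positivity, by positivity, fun v => ?_, fun u v => ?_⟩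
    · exact (norm_add_le _ _).trans (add_le_add (hB v) (hB' v))
    · have e : (φ + ψ) u - (φ + ψ) v = (φ u - φ v) + (ψ u - ψ v) := by
        simp only [ContinuousMap.add_apply]; ring
      rw [e, add_mul]
      exact (norm_add_le _ _).trans (add_le_add (hH u v) (hH' u v))
  algebraMap_mem' c := ⟨‖c‖, 0, norm_nonneg c, le_rfl, fun v => by simp, fun u v => by simp⟩
  star_mem' := by
    rintro φ ⟨B, H, hB0, hH0, hB, hH⟩
    refine ⟨B, H, hB0, hH0, fun v => ?_, fun u v => ?_⟩
    · rw [ContinuousMap.star_apply, norm_star]; exact hB v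
    · rw [ContinuousMap.star_apply, ContinuousMap.star_apply, ← star_sub, norm_star]; exact hH u v

theorem holderAlgebra_separatesPoints (hγ1 : γ ≤ 1) :
    (holderAlgebra d ε γ).toSubalgebra.SeparatesPoints := by
  intro u v huv
  obtain ⟨i, hi⟩ : ∃ i, (u : Vec d) i ≠ (v : Vec d) i := by
    by_contra! h
    exact huv (Subtype.ext (funext h))
  refine ⟨fun w : simplexGe d ε => (((w : Vec d) i : ℝ) : ℂ),
    ⟨⟨fun w : simplexGe d ε => (((w : Vec d) i : ℝ) : ℂ),
      Complex.continuous_ofReal.comp ((continuous_apply i).comp continuous_subtype_val)⟩,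
      ⟨1, 2, zero_le_one, zero_le_two, fun w => ?_, fun w x => ?_⟩, rfl⟩, ?_⟩
  · simp only [ContinuousMap.coe_mk, Complex.norm_real, Real.norm_eq_abs]
    rw [abs_of_nonneg (w.2.1.1 i)]
    exact simplex_apply_le_one w.2.1 i
  · simp only [ContinuousMap.coe_mk]
    rw [← Complex.ofReal_sub, Complex.norm_real, ← dist_eq_norm]
    refine (dist_le_pi_dist _ _ i).trans ((dist_le_hilbertDist w.2.1 x.2.1).trans ?_)
    exact mul_le_mul_of_nonneg_left (hilbertDist_le_rpow hγ1 w.2.1 x.2.1) zero_le_two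
  · simpa using hi

/-- Continuous functions on `𝒮_ε` are uniform limits of Hölder functions. -/
theorem exists_holderSpace_near (hγ1 : γ ≤ 1) {φ : Vec d → ℂ}
    (hφ : ContinuousOn φ (simplexGe d ε)) {η : ℝ} (hη : 0 < η) :
    ∃ ψ : HolderSpace d ε γ, ∀ v ∈ simplexGe d ε, ‖φ v - ψ.ext v‖ ≤ η := by
  have h := ContinuousMap.starSubalgebra_topologicalClosure_eq_top_of_separatesPoints
    (holderAlgebra d ε γ) (holderAlgebra_separatesPoints hγ1)
  set F : C(simplexGe d ε, ℂ) := ⟨fun v => φ v, continuousOn_iff_continuous_domRestrict.1 hφ⟩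
    with hF
  have hmem : F ∈ (holderAlgebra d ε γ).topologicalClosure := by rw [h]; trivial
  obtain ⟨ψ, ⟨B, H, hB0, hH0, hB, hH⟩, hψ⟩ := Metric.mem_closure_iff.1 hmem η hη
  let ψ' : HolderSpace d ε γ := ⟨ψ, ψ.continuous, ⟨B, by rintro _ ⟨v, rfl⟩; exact hB v⟩,
    ⟨H, by rintro _ ⟨p, rfl⟩; exact HolderSpace.holderBound_range hH0 hH p⟩⟩
  refine ⟨ψ', fun v hv => ?_⟩
  rw [ψ'.ext_apply hv, ← dist_eq_norm]
  exact (ContinuousMap.dist_apply_le_dist (f := F) (g := ψ) ⟨v, hv⟩).trans hψ.le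

/-! ### Eigenmeasures -/

/-- The normalised functional `φ ↦ P_s φ(v) / P_s 1(v)` is integration against a probability measure
on `𝒮_ε`. -/
theorem GoodLaw.exists_normalized_measure {s α : ℝ} {m : Measure (Mat d)} [IsProbabilityMeasure m]
    (hε : 0 < ε) (hε1 : ε < 1) (hm : GoodLaw ε s α m) {v : Vec d} (hv : v ∈ simplex d) :
    ∃ ν : ProbabilityMeasure (simplexGe d ε), ∀ φ : Vec d → ℂ, Measurable φ →
      ∫ x, φ x ∂(ν : Measure (simplexGe d ε)) =
        transferOp m s φ v / (transferReal m s (fun _ => 1) v : ℂ) := by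
  have hmeas := measurable_act_left v
  set F : Mat d → ℝ := fun g => s * Real.log (vecNorm (g.mulVec v)) with hF
  have hexp : (fun g => Real.exp (F g)) =ᵐ[m]
      fun g => vecNorm (g.mulVec v) ^ s * (fun _ : Vec d => (1 : ℝ)) (act g v) := by
    filter_upwards [hm.good] with g hg
    simp only [hF]
    rw [mul_one, mul_comm, ← Real.rpow_def_of_pos (vecNorm_mulVec_pos hg.pos hv)]
  have hint : Integrable (fun g => Real.exp (F g)) m :=
    (integrable_congr hexp).2 (hm.integrable_transferReal hε hε1 measurable_const logLip_one hv)
  have hZ : ∫ g, Real.exp (F g) ∂m = transferReal m s (fun _ => 1) v := integral_congr_ae hexp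
  have := isProbabilityMeasure_tilted hint
  set τ := (m.tilted F).map (fun g => act g v) with hτ
  have hτp : IsProbabilityMeasure τ := Measure.isProbabilityMeasure_map hmeas.aemeasurable
  have hS : MeasurableSet (simplexGe d ε) := measurableSet_simplexGe
  have hτS : ∀ᵐ w ∂τ, w ∈ simplexGe d ε := by
    refine (ae_map_iff hmeas.aemeasurable hS).2 ?_
    filter_upwards [(tilted_absolutelyContinuous m F).ae_le hm.good] with g hg
    exact hg.act_mem v hv
  have hp : IsProbabilityMeasure (τ.comap ((↑) : simplexGe d ε → Vec d)) := by
    refine ⟨?_⟩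
    rw [comap_subtype_coe_apply hS, image_univ, Subtype.range_coe, prob_compl_eq_zero_iff hS |>.1
      hτS]
  refine ⟨⟨_, hp⟩, fun φ hφ => ?_⟩
  rw [ProbabilityMeasure.coe_mk, integral_subtype_comap hS, Measure.restrict_eq_self_of_ae_mem hτS,
    hτ, integral_map hmeas.aemeasurable hφ.aestronglyMeasurable, integral_tilted, hZ, transferOp,
    div_eq_mul_inv, ← integral_mul_const]
  refine integral_congr_ae ?_
  filter_upwards [hexp] with g hg
  rw [hg, mul_one]
  simp only [Complex.real_smul]
  push_cast
  ring

theorem HolderSpace.hasMod (hγ : 0 < γ) (φ : HolderSpace d ε γ) :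
    HasMod ε γ φ.ext (2 * ‖φ‖) ‖φ‖ := fun u hu v hv =>
  ⟨(norm_sub_le _ _).trans (by linarith [(φ.holderBound hγ).1 u hu, (φ.holderBound hγ).1 v hv]),
    (φ.holderBound hγ).2 u hu v hv⟩

theorem HolderBound.hasMod {F : Vec d → ℂ} {B H : ℝ} (h : HolderBound ε γ F B H) :
    HasMod ε γ F (2 * B) H := fun u hu v hv =>
  ⟨(norm_sub_le _ _).trans (by linarith [h.1 u hu, h.1 v hv]), h.2 u hu v hv⟩

theorem simplexGe_nonempty_of_good {m : Measure (Mat d)} [IsProbabilityMeasure m]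
    (hm : ∀ᵐ g ∂m, Good ε g) (hd : 0 < d) : (simplexGe d ε).Nonempty := by
  obtain ⟨g, hg⟩ := hm.exists
  exact ⟨_, hg.act_mem _ (single_mem_stdSimplex ℝ (⟨0, hd⟩ : Fin d))⟩

/-- There is a probability measure on `𝒮_ε` to which the normalised iterates converge
exponentially fast. -/
theorem GoodLaw.exists_limit_measure {s : ℝ} {μ : Measure (Mat d)} [IsProbabilityMeasure μ]
    (hε : 0 < ε) (hε1 : ε < 1) (hd : 0 < d) (hμ : GoodLaw ε s (contr ε) μ) :
    ∃ ν : Measure (Vec d), IsProbabilityMeasure ν ∧ (∀ᵐ v ∂ν, v ∈ simplexGe d ε) ∧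
      ∃ n : ℕ, contr ε ^ (n + 1) ≤ 1 / 2 ∧ ∃ C : ℝ, 0 ≤ C ∧ ∃ θ : ℝ, 0 ≤ θ ∧ θ < 1 ∧
        ∀ φ : Vec d → ℂ, Measurable φ → ∀ O H : ℝ, 0 ≤ O → 0 ≤ H → HasMod ε 1 φ O H → ∀ j : ℕ,
          ∀ v ∈ simplexGe d ε, ‖normIter μ s (fun _ => 1) φ ((n + 1) * j) v - ∫ u, φ u ∂ν‖ ≤
            C * θ ^ j * (O + H) := by
  obtain ⟨w, hw⟩ := simplexGe_nonempty_of_good hμ.good hd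
  obtain ⟨n, hn, C, hC, θ, hθ0, hθ1, hrate⟩ := exists_rate d hε hε1 one_pos le_rfl s
  have h1lip : LogLip ε (distortion ε s) (fun _ : Vec d => (1 : ℝ)) :=
    logLip_one.mono (distortion_nonneg hε s)
  choose ν hν using fun j : ℕ =>
    (hμ.prodLaw hε (contr_nonneg hε hε1) ((n + 1) * j + n)).exists_normalized_measure hε hε1 hw.1
  have hν' : ∀ (φ : Vec d → ℂ), Measurable φ → (∃ B, ∀ v ∈ simplexGe d ε, ‖φ v‖ ≤ B) → ∀ j,
      ∫ x, φ x ∂(ν j : Measure (simplexGe d ε)) =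
        normIter μ s (fun _ => 1) φ ((n + 1) * (j + 1)) w := by
    intro φ hφ ⟨B, hB⟩ j
    rw [hν j φ hφ, hμ.transferReal_prodLaw hε hε1 measurable_const h1lip _ hw.1,
      hμ.transferOp_prodLaw hε hε1 (contr_nonneg hε hε1) hφ hB _ hw.1, normIter,
      show (n + 1) * (j + 1) = (n + 1) * j + n + 1 by ring]
    simp
  obtain ⟨νl, -, hlim⟩ := isCompact_univ.ultrafilter_le_nhds' ((hyperfilter ℕ).map ν) univ_mem
  have hlim' : Tendsto ν (hyperfilter ℕ : Filter ℕ) (𝓝 νl) := hlim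
  rw [ProbabilityMeasure.tendsto_iff_forall_integral_rclike_tendsto ℂ] at hlim'
  have hS : MeasurableSet (simplexGe d ε) := measurableSet_simplexGe
  have hemb : MeasurableEmbedding ((↑) : simplexGe d ε → Vec d) := .subtype_coe hS
  refine ⟨(νl : Measure (simplexGe d ε)).map (↑),
    Measure.isProbabilityMeasure_map measurable_subtype_coe.aemeasurable, ?_,
    n, hn, C, hC, θ, hθ0, hθ1, ?_⟩
  · refine (ae_map_iff measurable_subtype_coe.aemeasurable hS).2 ?_
    exact Eventually.of_forall fun v => v.2
  intro φ hφ O H hO hH hφm j v hv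
  have hosc : ∀ i v', v' ∈ simplexGe d ε → ‖normIter μ s (fun _ => 1) φ ((n + 1) * (j + i)) v' -
      normIter μ s (fun _ => 1) φ ((n + 1) * j) v‖ ≤ C * θ ^ j * (O + H) := by
    intro i
    induction i with
    | zero => exact fun v' hv' =>
        (hrate μ inferInstance hμ _ measurable_const h1lip φ hφ O H hO hH hφm j v' hv' v hv).1
    | succ i ih =>
      intro v' hv'
      rw [← add_assoc, hμ.normIter_succ hε hε1 measurable_const h1lip hφ hφm.bounded hn (j + i)
        hv'.1]
      exact (hμ.prodLaw hε (contr_nonneg hε hε1) n).norm_normOp_sub_le hε hε1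
        (measurable_iterate_transferReal measurable_const s _)
        (hμ.logLip_iterate hε hε1 measurable_const h1lip hn _)
        (measurable_normIter measurable_const hφ _) ih hv'.1
  have hcont : Continuous fun x : simplexGe d ε => φ x :=
    continuous_of_holder hε one_pos fun u v => (hφm u u.2 v v.2).2
  have ht := hlim' ⟨⟨fun x : simplexGe d ε => φ x, hcont⟩,
    (BoundedContinuousFunction.mkOfCompact ⟨_, hcont⟩).map_bounded'⟩
  rw [hemb.integral_map, norm_sub_rev]
  refine le_of_tendsto (ht.sub_const _).norm ?_
  have hev : ∀ᶠ i in (hyperfilter ℕ : Filter ℕ), j ≤ i :=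
    (Nat.hyperfilter_le_atTop) (eventually_ge_atTop j)
  filter_upwards [hev] with i hi
  obtain ⟨k, rfl⟩ := Nat.exists_eq_add_of_le hi
  have h1 := hosc (k + 1) w hw
  rw [← add_assoc, ← hν' φ hφ hφm.bounded] at h1
  exact h1

/-- The measure `ν P_s`. -/
def pushLaw (μ : Measure (Mat d)) (s : ℝ) (ν : Measure (Vec d)) : Measure (Vec d) :=
  ((μ.prod ν).withDensity fun p => ENNReal.ofReal (vecNorm (p.1.mulVec p.2) ^ s)).map
    fun p => act p.1 p.2

section

variable {s α : ℝ} {μ : Measure (Mat d)} [IsProbabilityMeasure μ] {ν : Measure (Vec d)}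
  [IsProbabilityMeasure ν]

omit [IsProbabilityMeasure μ] [IsProbabilityMeasure ν] in
theorem GoodLaw.ae_prod (hμ : GoodLaw ε s α μ) (hν : ∀ᵐ v ∂ν, v ∈ simplex d) :
    ∀ᵐ p ∂(μ.prod ν), Good ε p.1 ∧ p.2 ∈ simplex d :=
  (Measure.quasiMeasurePreserving_fst.ae hμ.good).and
    (Measure.quasiMeasurePreserving_snd.ae hν)

omit [IsProbabilityMeasure μ] in
theorem GoodLaw.integrable_prod_smul (hε : 0 < ε) (hε1 : ε < 1) (hμ : GoodLaw ε s α μ)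
    (hν : ∀ᵐ v ∂ν, v ∈ simplex d) {φ : Vec d → ℂ} (hφ : Measurable φ) {B : ℝ}
    (hB : ∀ v ∈ simplexGe d ε, ‖φ v‖ ≤ B) :
    Integrable (fun p : Mat d × Vec d => (vecNorm (p.1.mulVec p.2) ^ s : ℝ) • φ (act p.1 p.2))
      (μ.prod ν) := by
  have h1 : Integrable (fun p : Mat d × Vec d => matNorm p.1 ^ s) (μ.prod ν) :=
    hμ.integrable.comp_fst ν
  refine Integrable.mono' ((h1.const_mul (ε ^ (-|s|))).mul_const B)
    (measurable_transfer_integrand hφ s).aestronglyMeasurable ?_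
  filter_upwards [hμ.ae_prod hν] with p ⟨hg, hv⟩
  have h0 := Real.rpow_nonneg (vecNorm_mulVec_pos hg.pos hv).le s
  rw [norm_smul, Real.norm_eq_abs, abs_of_nonneg h0]
  exact mul_le_mul (hg.vecNorm_rpow_le s hε hε1 hv) (hB _ (hg.act_mem _ hv)) (norm_nonneg _)
    (h0.trans (hg.vecNorm_rpow_le s hε hε1 hv))

theorem measurable_density (s : ℝ) : Measurable fun p : Mat d × Vec d =>
    ENNReal.ofReal (vecNorm (p.1.mulVec p.2) ^ s) :=
  ENNReal.measurable_ofReal.comp (measurable_vecNorm_mulVec.pow_const s)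

omit [IsProbabilityMeasure μ] in
theorem GoodLaw.isFiniteMeasure_pushLaw (hε : 0 < ε) (hε1 : ε < 1) (hμ : GoodLaw ε s α μ)
    (hν : ∀ᵐ v ∂ν, v ∈ simplex d) : IsFiniteMeasure (pushLaw μ s ν) := by
  have h := (hμ.integrable_prod_smul hε hε1 hν (φ := fun _ => 1) measurable_const
    (B := 1) (by simp)).re
  have h2 : Integrable (fun p : Mat d × Vec d => vecNorm (p.1.mulVec p.2) ^ s) (μ.prod ν) := by
    simpa using h
  have := isFiniteMeasure_withDensity_ofReal h2.2
  unfold pushLaw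
  infer_instance

omit [IsProbabilityMeasure μ] [IsProbabilityMeasure ν] in
theorem GoodLaw.ae_pushLaw (hμ : GoodLaw ε s α μ) (hν : ∀ᵐ v ∂ν, v ∈ simplex d) :
    ∀ᵐ v ∂(pushLaw μ s ν), v ∈ simplexGe d ε := by
  refine (ae_map_iff measurable_act.aemeasurable measurableSet_simplexGe).2 ?_
  filter_upwards [(withDensity_absolutelyContinuous _ _).ae_le (hμ.ae_prod hν)] with p hp
  exact hp.1.act_mem _ hp.2

theorem GoodLaw.integral_pushLaw (hε : 0 < ε) (hε1 : ε < 1) (hμ : GoodLaw ε s α μ)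
    (hν : ∀ᵐ v ∂ν, v ∈ simplex d) {φ : Vec d → ℂ} (hφ : Measurable φ) {B : ℝ}
    (hB : ∀ v ∈ simplexGe d ε, ‖φ v‖ ≤ B) :
    ∫ v, φ v ∂(pushLaw μ s ν) = ∫ v, transferOp μ s φ v ∂ν := by
  rw [pushLaw, integral_map measurable_act.aemeasurable hφ.aestronglyMeasurable,
    integral_withDensity_eq_integral_toReal_smul (measurable_density s)
      (Eventually.of_forall fun _ => ENNReal.ofReal_lt_top)]
  have e : (fun p : Mat d × Vec d =>
      (ENNReal.ofReal (vecNorm (p.1.mulVec p.2) ^ s)).toReal • φ (act p.1 p.2)) =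
      fun p => (vecNorm (p.1.mulVec p.2) ^ s : ℝ) • φ (act p.1 p.2) := funext fun p => by
    rw [ENNReal.toReal_ofReal (Real.rpow_nonneg (vecNorm_nonneg _) _)]
  rw [e, integral_prod_symm _ (hμ.integrable_prod_smul hε hε1 hν hφ hB)]
  rfl

end

/-- Finite measures on `𝒮_ε` are determined by the integrals of Hölder functions. -/
theorem measure_ext_of_holder (hγ1 : γ ≤ 1) {m₁ m₂ : Measure (Vec d)} [IsFiniteMeasure m₁]
    [IsFiniteMeasure m₂] (h₁ : ∀ᵐ v ∂m₁, v ∈ simplexGe d ε) (h₂ : ∀ᵐ v ∂m₂, v ∈ simplexGe d ε)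
    (hγ : 0 < γ)
    (h : ∀ φ : HolderSpace d ε γ, ∫ v, φ.ext v ∂m₁ = ∫ v, φ.ext v ∂m₂) : m₁ = m₂ := by
  refine ext_of_forall_integral_eq_of_IsFiniteMeasure fun f => ?_
  have key : ∀ η > 0, ‖∫ v, (f v : ℂ) ∂m₁ - ∫ v, (f v : ℂ) ∂m₂‖ ≤
      η * (m₁.real univ + m₂.real univ) := fun η hη => by
    obtain ⟨ψ, hψ⟩ := exists_holderSpace_near (ε := ε) hγ1
      (Complex.continuous_ofReal.comp f.continuous).continuousOn hη
    have hbd : ∀ {m : Measure (Vec d)} [IsFiniteMeasure m], (∀ᵐ v ∂m, v ∈ simplexGe d ε) →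
        ‖∫ v, (f v : ℂ) ∂m - ∫ v, ψ.ext v ∂m‖ ≤ η * m.real univ := fun {m} _ hm => by
      have i1 : Integrable (fun v => (f v : ℂ)) m := (f.integrable m).ofReal
      have i2 : Integrable ψ.ext m := by
        refine Integrable.mono' (integrable_const ‖ψ‖) ψ.measurable_ext.aestronglyMeasurable ?_
        filter_upwards [hm] with v hv using (ψ.holderBound hγ).1 v hv
      rw [← integral_sub i1 i2]
      refine norm_integral_le_of_norm_le_const ?_
      filter_upwards [hm] with v hv using hψ v hv
    have e : ∫ v, (f v : ℂ) ∂m₁ - ∫ v, (f v : ℂ) ∂m₂ =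
        (∫ v, (f v : ℂ) ∂m₁ - ∫ v, ψ.ext v ∂m₁) - (∫ v, (f v : ℂ) ∂m₂ - ∫ v, ψ.ext v ∂m₂) := by
      rw [h]; ring
    rw [e, mul_add]
    exact (norm_sub_le _ _).trans (add_le_add (hbd h₁) (hbd h₂))
  have h0 : ‖∫ v, (f v : ℂ) ∂m₁ - ∫ v, (f v : ℂ) ∂m₂‖ ≤ 0 := by
    have hlim : Tendsto (fun η : ℝ => η * (m₁.real univ + m₂.real univ)) (𝓝[>] 0) (𝓝 0) := by
      have : Continuous fun η : ℝ => η * (m₁.real univ + m₂.real univ) := by fun_prop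
      simpa using (this.tendsto 0).mono_left nhdsWithin_le_nhds
    exact ge_of_tendsto hlim (eventually_nhdsWithin_of_forall key)
  have h1 := sub_eq_zero.1 (norm_le_zero_iff.1 h0)
  rw [integral_complex_ofReal, integral_complex_ofReal] at h1
  exact_mod_cast h1

/-- `ν` is a probability measure on the simplex with `ν P_s = k ν`, as an identity of measures. -/
structure IsEigenLaw (μ : Measure (Mat d)) (s k : ℝ) (ν : Measure (Vec d)) : Prop where
  prob : IsProbabilityMeasure ν
  mem : ∀ᵐ v ∂ν, v ∈ simplex d
  pos : 0 < k
  eq : pushLaw μ s ν = ENNReal.ofReal k • ν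

section

variable {s k : ℝ} {μ : Measure (Mat d)} [IsProbabilityMeasure μ] {ν : Measure (Vec d)}

omit [IsProbabilityMeasure μ] in
theorem IsEigenLaw.ae_mem {α : ℝ} (hμ : GoodLaw ε s α μ) (h : IsEigenLaw μ s k ν) :
    ∀ᵐ v ∂ν, v ∈ simplexGe d ε := by
  have := h.prob
  have h1 := hμ.ae_pushLaw h.mem
  rw [h.eq, ae_iff, Measure.smul_apply, smul_eq_mul, mul_eq_zero] at h1
  exact h1.resolve_left (ENNReal.ofReal_pos.2 h.pos).ne'

theorem IsEigenLaw.integral_transferOp {α : ℝ} (hε : 0 < ε) (hε1 : ε < 1) (hμ : GoodLaw ε s α μ)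
    (h : IsEigenLaw μ s k ν) {φ : Vec d → ℂ} (hφ : Measurable φ)
    (hB : ∃ B, ∀ v ∈ simplexGe d ε, ‖φ v‖ ≤ B) :
    ∫ v, transferOp μ s φ v ∂ν = k * ∫ v, φ v ∂ν := by
  have := h.prob
  obtain ⟨B, hB⟩ := hB
  rw [← hμ.integral_pushLaw hε hε1 h.mem hφ hB, h.eq, integral_smul_measure,
    ENNReal.toReal_ofReal h.pos.le, Complex.real_smul]

theorem IsEigenLaw.integral_iterate {α : ℝ} (hε : 0 < ε) (hε1 : ε < 1) (hμ : GoodLaw ε s α μ)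
    (h : IsEigenLaw μ s k ν) {φ : Vec d → ℂ} (hφ : Measurable φ)
    (hB : ∃ B, ∀ v ∈ simplexGe d ε, ‖φ v‖ ≤ B) (n : ℕ) :
    ∫ v, (transferOp μ s)^[n] φ v ∂ν = k ^ n * ∫ v, φ v ∂ν := by
  induction n with
  | zero => simp
  | succ n ih =>
    rw [Function.iterate_succ_apply', h.integral_transferOp hε hε1 hμ
      (measurable_iterate_transferOp hφ s n) (hμ.bounded_iterate hε hε1 hB n), ih, pow_succ]
    ring

theorem transferReal_one_ge {α : ℝ} (hε : 0 < ε) (hε1 : ε < 1) (hd : 0 < d)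
    (hμ : GoodLaw ε s α μ) : ∃ c > 0, ∀ v ∈ simplex d, c ≤ transferReal μ s (fun _ => 1) v := by
  refine ⟨(ε ^ (-|s|))⁻¹ * ∫ g, matNorm g ^ s ∂μ, mul_pos
    (inv_pos.2 (Real.rpow_pos_of_pos hε _)) (integral_pos_of_ae_pos ?_ hμ.integrable),
    fun v hv => ?_⟩
  · filter_upwards [hμ.good] with g hg using Real.rpow_pos_of_pos (matNorm_pos hg.pos ⟨0, hd⟩) _
  · rw [transferReal, ← integral_const_mul]
    refine integral_mono_ae (hμ.integrable.const_mul _)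
      (hμ.integrable_transferReal hε hε1 measurable_const logLip_one hv) ?_
    filter_upwards [hμ.good] with g hg
    rw [mul_one, inv_mul_le_iff₀ (Real.rpow_pos_of_pos hε _)]
    exact hg.matNorm_rpow_le s hε hε1 hv

theorem integrable_of_bounded [IsFiniteMeasure ν] (hν : ∀ᵐ v ∂ν, v ∈ simplexGe d ε)
    {φ : Vec d → ℂ} (hφ : Measurable φ) (hB : ∃ B, ∀ v ∈ simplexGe d ε, ‖φ v‖ ≤ B) :
    Integrable φ ν := by
  obtain ⟨B, hB⟩ := hB
  refine Integrable.mono' (integrable_const B) hφ.aestronglyMeasurable ?_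
  filter_upwards [hν] with v hv using hB v hv

theorem GoodLaw.isEigenLaw_of_isEigenmeasure {α : ℝ} (hε : 0 < ε) (hε1 : ε < 1) (hd : 0 < d)
    (hμ : GoodLaw ε s α μ) (h : IsEigenmeasure (transferOp μ s) k ν) : IsEigenLaw μ s k ν := by
  obtain ⟨hp, hS, h⟩ := h
  have hmem : ∀ᵐ v ∂ν, v ∈ simplex d := hS
  have hfin := hμ.isFiniteMeasure_pushLaw hε hε1 hmem
  obtain ⟨c, hc, hle⟩ := transferReal_one_ge hε hε1 hd hμ
  have hk : 0 < k := by
    have h1 := h (fun _ => 1) continuous_const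
    have h2 : transferOp μ s (fun _ => 1) = fun v => (transferReal μ s (fun _ => 1) v : ℂ) := by
      have := transferOp_ofReal_fun μ s (fun _ => 1)
      simpa using this
    rw [h2, integral_complex_ofReal] at h1
    simp only [integral_const, probReal_univ, one_smul, mul_one] at h1
    have h3 : ∫ v, transferReal μ s (fun _ => 1) v ∂ν = k := by exact_mod_cast h1
    rw [← h3]
    have i1 : Integrable (transferReal μ s (fun _ => 1)) ν := by
      have hm := measurable_transferReal (m := μ) (measurable_const (a := (1 : ℝ))) s
      refine Integrable.mono' (integrable_const (ε ^ (-|s|) * (∫ g, matNorm g ^ s ∂μ) * 1))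
        hm.aestronglyMeasurable ?_
      filter_upwards [hmem] with v hv
      have := hμ.norm_transferOp_le hε hε1 (φ := fun _ => 1) (B := 1) (by simp) hv
      rw [h2, Complex.norm_real] at this
      exact this
    calc 0 < c := hc
      _ = ∫ _, c ∂ν := by simp
      _ ≤ _ := by
        refine integral_mono_ae (integrable_const c) i1 ?_
        filter_upwards [hmem] with v hv using hle v hv
  have hfin2 : IsFiniteMeasure (ENNReal.ofReal k • ν) := ν.smul_finite ENNReal.ofReal_ne_top
  refine ⟨hp, hmem, hk, ext_of_forall_integral_eq_of_IsFiniteMeasure fun f => ?_⟩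
  have hc : Continuous fun v => (f v : ℂ) := Complex.continuous_ofReal.comp f.continuous
  have h1 := h _ hc
  rw [← hμ.integral_pushLaw hε hε1 hmem hc.measurable (B := ‖f‖) (fun v _ => by
      rw [Complex.norm_real]; exact f.norm_coe_le_norm v), integral_complex_ofReal,
    integral_complex_ofReal] at h1
  rw [integral_smul_measure, ENNReal.toReal_ofReal hk.le, smul_eq_mul]
  exact_mod_cast h1

theorem IsEigenLaw.isEigenmeasure {α : ℝ} (hε : 0 < ε) (hε1 : ε < 1)
    (hμ : GoodLaw ε s α μ) (h : IsEigenLaw μ s k ν) : IsEigenmeasure (transferOp μ s) k ν :=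
  ⟨h.prob, h.mem, fun φ hφ => h.integral_transferOp hε hε1 hμ hφ.measurable (by
    obtain ⟨B, hB⟩ := isCompact_simplexGe.exists_bound_of_continuousOn
      (hφ.continuousOn (s := simplexGe d ε))
    exact ⟨B, hB⟩)⟩

end

theorem HolderBound.of_real_one : HolderBound ε γ (fun _ : Vec d => (1 : ℂ)) 1 0 := by
  simpa using HolderBound.const (ε := ε) (γ := γ) (d := d) 1

section

variable {s : ℝ} {μ : Measure (Mat d)} [IsProbabilityMeasure μ]

/-- `P_s^N P_s φ / P_s^N 1` factors through the Markov operator with weight `P_s^N 1`. -/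
theorem GoodLaw.normIter_transferOp (hε : 0 < ε) (hε1 : ε < 1) (hμ : GoodLaw ε s (contr ε) μ)
    {φ : Vec d → ℂ} {n : ℕ} (hn : contr ε ^ (n + 1) ≤ 1 / 2) (j : ℕ) {v : Vec d}
    (hv : v ∈ simplexGe d ε) :
    normIter μ s (fun _ => 1) (transferOp μ s φ) ((n + 1) * j) v =
      normOp μ s ((transferReal μ s)^[(n + 1) * j] fun _ => 1)
        (normIter μ s (fun _ => 1) φ ((n + 1) * j)) v *
      normIter μ s (fun _ => 1) (transferOp μ s fun _ => 1) ((n + 1) * j) v := by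
  have h1lip : LogLip ε (distortion ε s) (fun _ : Vec d => (1 : ℝ)) :=
    logLip_one.mono (distortion_nonneg hε s)
  have hlip := hμ.logLip_iterate hε hε1 measurable_const h1lip hn j
  have hm := measurable_iterate_transferReal (m := μ) (measurable_const (a := (1 : ℝ))) s
    ((n + 1) * j)
  have hT := hμ.transferReal_pos hε hε1 hm hlip hv.1
  have hR := hlip.pos v hv
  set N := (n + 1) * j with hN
  set R := (transferReal μ s)^[N] fun _ => 1 with hRdef
  have e1 : transferOp μ s (fun u => (R u : ℂ) * normIter μ s (fun _ => 1) φ N u) v =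
      transferOp μ s ((transferOp μ s)^[N] φ) v :=
    hμ.transferOp_congr (fun w hw => by
      rw [normIter, mul_div_cancel₀ _ (by exact_mod_cast (hlip.pos w hw).ne')]
      simp) hv.1 s
  have e2 : (transferOp μ s)^[N] (fun u => ((1 : ℝ) : ℂ) * transferOp μ s (fun _ => 1) u) v =
      (transferReal μ s R v : ℂ) := by
    have h := congrFun (iterate_transferOp_ofReal μ s (fun _ => 1) (N + 1)) v
    rw [Function.iterate_succ_apply, Function.iterate_succ_apply'] at h
    simpa using h
  have e3 : (transferOp μ s)^[N] (fun u => ((1 : ℝ) : ℂ) * transferOp μ s φ u) v =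
      transferOp μ s ((transferOp μ s)^[N] φ) v := by
    rw [← Function.iterate_succ_apply' (transferOp μ s), Function.iterate_succ_apply]
    simp
  have hT' : (transferReal μ s R v : ℂ) ≠ 0 := by exact_mod_cast hT.ne'
  rw [normOp, e1, normIter, e3, normIter, e2, ← hRdef]
  field_simp

omit [IsProbabilityMeasure μ] in
theorem GoodLaw.hasMod_transferOp (hε : 0 < ε) (hε1 : ε < 1) (hd : 0 < d)
    (hμ : GoodLaw ε s (contr ε) μ) {φ : Vec d → ℂ} (hφ : Measurable φ)
    (hB : ∃ B H, HolderBound ε 1 φ B H) :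
    ∃ O H, 0 ≤ O ∧ 0 ≤ H ∧ HasMod ε 1 (transferOp μ s φ) O H := by
  obtain ⟨B, H, h⟩ := hμ.holderBound_transferOp hε hε1 hd one_pos le_rfl hφ hB
  exact ⟨2 * |B|, |H|, by positivity, by positivity,
    (h.mono (le_abs_self B) (le_abs_self H)).hasMod⟩

theorem tendsto_of_geometric {x : ℕ → ℂ} {y : ℂ} {C θ A : ℝ} (hθ0 : 0 ≤ θ) (hθ1 : θ < 1)
    (h : ∀ j, ‖x j - y‖ ≤ C * θ ^ j * A) : Tendsto x atTop (𝓝 y) := by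
  rw [tendsto_iff_norm_sub_tendsto_zero]
  refine squeeze_zero (fun _ => norm_nonneg _) h ?_
  simpa using ((tendsto_pow_atTop_nhds_zero_of_lt_one hθ0 hθ1).const_mul C).mul_const A

/-- Existence of an eigenmeasure, for an eigenvalue that is the mass gained in one step. -/
theorem GoodLaw.exists_eigenLaw (hε : 0 < ε) (hε1 : ε < 1) (hd : 0 < d)
    (hμ : GoodLaw ε s (contr ε) μ) : ∃ k ν, IsEigenLaw μ s k ν := by
  obtain ⟨ν, hp, hmem, n, hn, C, hC, θ, hθ0, hθ1, hlim⟩ := hμ.exists_limit_measure hε hε1 hd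
  obtain ⟨w, hw⟩ := simplexGe_nonempty_of_good hμ.good hd
  have h1lip : LogLip ε (distortion ε s) (fun _ : Vec d => (1 : ℝ)) :=
    logLip_one.mono (distortion_nonneg hε s)
  have hmem' : ∀ᵐ v ∂ν, v ∈ simplex d := hmem.mono fun v hv => hv.1
  set k := ∫ v, transferReal μ s (fun _ => 1) v ∂ν with hk
  have e1 : transferOp μ s (fun _ => 1) = fun v => (transferReal μ s (fun _ => 1) v : ℂ) := by
    simpa using transferOp_ofReal_fun μ s (fun _ => 1)
  have hkC : ∫ v, transferOp μ s (fun _ => 1) v ∂ν = k := by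
    rw [e1, integral_complex_ofReal]
  have hone : ∃ B H, HolderBound ε 1 (fun _ : Vec d => (1 : ℂ)) B H := ⟨1, 0, .of_real_one⟩
  have key : ∀ φ : HolderSpace d ε 1, ∫ v, transferOp μ s φ.ext v ∂ν = k * ∫ v, φ.ext v ∂ν := by
    intro φ
    obtain ⟨O, H, hO, hH, hmod⟩ := hμ.hasMod_transferOp hε hε1 hd φ.measurable_ext
      ⟨_, _, φ.holderBound one_pos⟩
    obtain ⟨O₁, H₁, hO₁, hH₁, hmod₁⟩ := hμ.hasMod_transferOp hε hε1 hd measurable_const hone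
    have ha := tendsto_of_geometric hθ0 hθ1 fun j =>
      hlim _ (measurable_transferOp φ.measurable_ext s) O H hO hH hmod j w hw
    have hb := tendsto_of_geometric hθ0 hθ1 fun j =>
      hlim _ (measurable_transferOp measurable_const s) O₁ H₁ hO₁ hH₁ hmod₁ j w hw
    have hc := tendsto_of_geometric (y := ∫ u, φ.ext u ∂ν) hθ0 hθ1 fun j =>
      hμ.norm_normOp_sub_le hε hε1 (measurable_iterate_transferReal measurable_const s _)
        (hμ.logLip_iterate hε hε1 measurable_const h1lip hn j)
        (measurable_normIter measurable_const φ.measurable_ext _)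
        (hlim _ φ.measurable_ext _ _ (by positivity) (norm_nonneg _) (φ.hasMod one_pos) j) hw.1
    -- `P^{N+1} φ / P^N 1 = (P^{N+1} φ / P^{N+1} 1) (P^{N+1} 1 / P^N 1)`; the limits are compared
    have hcb := hc.mul hb
    simp only [← hμ.normIter_transferOp hε hε1 hn _ hw] at hcb
    rw [tendsto_nhds_unique ha hcb, hkC, mul_comm]
  have hkpos : 0 < k := by
    obtain ⟨c, hc, hle⟩ := transferReal_one_ge hε hε1 hd hμ
    have i1 : Integrable (transferReal μ s (fun _ => 1)) ν := by
      have := (integrable_of_bounded hmem (measurable_transferOp measurable_const s)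
        (hμ.bounded_iterate hε hε1 (φ := fun _ => 1) ⟨1, by simp⟩ 1)).re
      rw [e1] at this
      simpa using this
    calc 0 < c := hc
      _ = ∫ _, c ∂ν := by simp
      _ ≤ _ := by
        refine integral_mono_ae (integrable_const c) i1 ?_
        filter_upwards [hmem'] with v hv using hle v hv
  have hfin := hμ.isFiniteMeasure_pushLaw hε hε1 hmem'
  have hfin2 : IsFiniteMeasure (ENNReal.ofReal k • ν) := ν.smul_finite ENNReal.ofReal_ne_top
  refine ⟨k, ν, hp, hmem', hkpos, measure_ext_of_holder le_rfl (hμ.ae_pushLaw hmem')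
    (Measure.ae_smul_measure hmem _) one_pos fun φ => ?_⟩
  rw [hμ.integral_pushLaw hε hε1 hmem' φ.measurable_ext (φ.holderBound one_pos).1, key,
    integral_smul_measure, ENNReal.toReal_ofReal hkpos.le, Complex.real_smul]

/-- Uniqueness of the eigenmeasure, whatever the eigenvalue: integrating the exponential convergence
of the normalised iterates against `P_s^N 1` identifies any eigenmeasure with their limit. -/
theorem GoodLaw.eigenLaw_unique (hε : 0 < ε) (hε1 : ε < 1) (hd : 0 < d)
    (hμ : GoodLaw ε s (contr ε) μ) {k k' : ℝ} {ν ν' : Measure (Vec d)} (h : IsEigenLaw μ s k ν)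
    (h' : IsEigenLaw μ s k' ν') : ν = ν' := by
  obtain ⟨ν₀, hp, hmem, n, hn, C, hC, θ, hθ0, hθ1, hlim⟩ := hμ.exists_limit_measure hε hε1 hd
  have h1lip : LogLip ε (distortion ε s) (fun _ : Vec d => (1 : ℝ)) :=
    logLip_one.mono (distortion_nonneg hε s)
  have key : ∀ {k : ℝ} {ν : Measure (Vec d)}, IsEigenLaw μ s k ν → ν = ν₀ := fun {k ν} h => by
    have := h.prob
    refine measure_ext_of_holder (γ := 1) le_rfl (h.ae_mem hμ) hmem one_pos fun φ => ?_
    refine tendsto_nhds_unique (tendsto_const_nhds (f := (atTop : Filter ℕ)))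
      (tendsto_of_geometric (C := C) (A := 2 * ‖φ‖ + ‖φ‖) hθ0 hθ1 fun j => ?_)
    have hl := hlim _ φ.measurable_ext _ _ (by positivity) (norm_nonneg _) (φ.hasMod one_pos) j
    set N := (n + 1) * j
    have hlip := hμ.logLip_iterate hε hε1 measurable_const h1lip hn j
    have hm := measurable_iterate_transferReal (m := μ) (measurable_const (a := (1 : ℝ))) s N
    set R := (transferReal μ s)^[N] fun _ => 1
    have hφB : ∃ B, ∀ v ∈ simplexGe d ε, ‖φ.ext v‖ ≤ B := ⟨_, (φ.holderBound one_pos).1⟩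
    have e1 := h.integral_iterate hε hε1 hμ φ.measurable_ext hφB N
    have e2 := h.integral_iterate hε hε1 hμ (φ := fun _ => ((1 : ℝ) : ℂ)) measurable_const
      ⟨1, by simp⟩ N
    have i1 := integrable_of_bounded (h.ae_mem hμ)
      (measurable_iterate_transferOp φ.measurable_ext s N)
      (hμ.bounded_iterate hε hε1 hφB N)
    have i2 := integrable_of_bounded (h.ae_mem hμ)
      (measurable_iterate_transferOp (measurable_const (a := ((1 : ℝ) : ℂ))) s N)
      (hμ.bounded_iterate hε hε1 ⟨1, by simp⟩ N)
    rw [iterate_transferOp_ofReal] at e2 i2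
    have i3 : Integrable R ν := by simpa using i2.re
    rw [integral_complex_ofReal] at e2
    simp only [Complex.ofReal_one, integral_const, probReal_univ, one_smul, mul_one] at e2
    have e3 : ∫ v, R v ∂ν = k ^ N := by exact_mod_cast e2
    have hkN : 0 < k ^ N := pow_pos h.pos N
    have e4 : ((k ^ N : ℝ) : ℂ) * (∫ v, φ.ext v ∂ν - ∫ v, φ.ext v ∂ν₀) =
        ∫ v, ((transferOp μ s)^[N] φ.ext v - (∫ u, φ.ext u ∂ν₀) * R v) ∂ν := by
      rw [integral_sub i1 (i2.const_mul _), e1, integral_const_mul, integral_complex_ofReal, e3]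
      push_cast; ring
    have e5 : k ^ N * ‖∫ v, φ.ext v ∂ν - ∫ v, φ.ext v ∂ν₀‖ ≤
        k ^ N * (C * θ ^ j * (2 * ‖φ‖ + ‖φ‖)) := by
      rw [← Real.norm_of_nonneg hkN.le, ← Complex.norm_real, ← norm_mul, e4, Complex.norm_real,
        Real.norm_of_nonneg hkN.le, ← e3, ← integral_mul_const]
      refine norm_integral_le_of_norm_le (i3.mul_const _) ?_
      filter_upwards [h.ae_mem hμ] with v hv
      have hR := hlip.pos v hv
      have e6 : (transferOp μ s)^[N] φ.ext v =
          normIter μ s (fun _ => 1) φ.ext N v * (R v : ℂ) := by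
        rw [normIter, div_mul_cancel₀ _ (by exact_mod_cast hR.ne')]
        simp
      rw [e6, ← sub_mul, norm_mul, Complex.norm_real, Real.norm_of_nonneg hR.le, mul_comm]
      exact mul_le_mul_of_nonneg_left (hl v hv) hR.le
    exact le_of_mul_le_mul_left e5 hkN
  rw [key h, key h']

/-! ### The dual eigenmeasure and the eigenfunction -/

/-- The law of the transposed matrices. -/
def transposeLaw (μ : Measure (Mat d)) : Measure (Mat d) := μ.map Matrix.transpose

instance : IsProbabilityMeasure (transposeLaw μ) :=
  Measure.isProbabilityMeasure_map measurable_transpose.aemeasurable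

omit [IsProbabilityMeasure μ] in
theorem GoodLaw.transposeLaw (hε : 0 < ε) (hε1 : ε < 1) (hμ : GoodLaw ε s (contr ε) μ) :
    GoodLaw ε s (contr ε) (transposeLaw μ) := by
  have hg : ∀ᵐ g ∂(PosMat.transposeLaw μ), Good ε g := by
    refine (ae_map_iff measurable_transpose.aemeasurable measurableSet_good).2 ?_
    filter_upwards [hμ.good] with g hg using hg.transpose
  refine ⟨hg, ?_, ?_⟩
  · filter_upwards [hg] with g hg u hu v hv using hg.hilbertDist_act_le hε hε1 hu hv
  · refine (integrable_map_measure (measurable_matNorm.pow_const s).aestronglyMeasurable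
      measurable_transpose.aemeasurable).2 ?_
    simpa only [Function.comp_def, matNorm_transpose] using hμ.integrable

omit [IsProbabilityMeasure μ] in
theorem transferOpStar_eq {φ : Vec d → ℂ} (hφ : Measurable φ) :
    transferOpStar μ s φ = transferOp (transposeLaw μ) s φ := funext fun v => by
  rw [transferOp, transposeLaw, integral_map measurable_transpose.aemeasurable
    (measurable_transfer_integrand_left hφ s v).aestronglyMeasurable]
  rfl

omit [IsProbabilityMeasure μ] in
theorem isEigenmeasure_star_iff {k : ℝ} {ν : Measure (Vec d)} :
    IsEigenmeasure (transferOpStar μ s) k ν ↔ IsEigenmeasure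
      (transferOp (transposeLaw μ) s) k ν := by
  refine and_congr_right fun _ => and_congr_right fun _ => forall_congr' fun φ =>
    forall_congr' fun hφ => ?_
  rw [transferOpStar_eq hφ.measurable]

end

/-- The function `v ↦ ∫ ⟨v, u⟩^s ν(du)`. -/
def momentFun (s : ℝ) (ν : Measure (Vec d)) (v : Vec d) : ℝ := ∫ u, (v ⬝ᵥ u) ^ s ∂ν

section

variable {s : ℝ} {ν : Measure (Vec d)} [IsProbabilityMeasure ν]

theorem dotProduct_mem_Icc {u v : Vec d} (hv : v ∈ simplex d) (hu : u ∈ simplexGe d ε) :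
    v ⬝ᵥ u ∈ Icc ε 1 := ⟨hu.2 v hv, dotProduct_le_one hv hu.1⟩

theorem rpow_mem_Icc (hε : 0 < ε) {x : ℝ} (hx : x ∈ Icc ε 1) (s : ℝ) :
    x ^ s ∈ Icc (ε ^ |s|) (ε ^ (-|s|)) := by
  have h1 : 1 * x ≤ x := (one_mul x).le
  have hx0 : 0 < x := hε.trans_le hx.1
  constructor
  · have := rpow_le_of_comparable (a := ε) (x := x) (y := 1) s hε hx0 (by nlinarith [hx.2, hx.1])
      (by rw [le_div_iff₀ hε]; linarith [hx.1])
    rw [Real.one_rpow, Real.rpow_neg hε.le, ← div_eq_inv_mul,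
      le_div_iff₀ (Real.rpow_pos_of_pos hε _), one_mul] at this
    exact this
  · have := rpow_le_of_comparable (a := ε) (x := 1) (y := x) s hε one_pos (by linarith [hx.1])
      (by rw [le_div_iff₀ hε]; nlinarith [hx.1, hx.2])
    simpa using this

theorem measurable_dotProduct_rpow (v : Vec d) (s : ℝ) : Measurable fun u : Vec d => (v ⬝ᵥ u) ^ s :=
  (Continuous.measurable (by unfold dotProduct; fun_prop) :
    Measurable fun u : Vec d => v ⬝ᵥ u).pow_const s

theorem integrable_dotProduct_rpow (hε : 0 < ε) (hν : ∀ᵐ u ∂ν, u ∈ simplexGe d ε) {v : Vec d}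
    (hv : v ∈ simplex d) : Integrable (fun u => (v ⬝ᵥ u) ^ s) ν := by
  refine Integrable.mono' (integrable_const (ε ^ (-|s|)))
    (measurable_dotProduct_rpow v s).aestronglyMeasurable ?_
  filter_upwards [hν] with u hu
  have h := rpow_mem_Icc hε (dotProduct_mem_Icc hv hu) s
  rw [Real.norm_of_nonneg ((Real.rpow_nonneg hε.le _).trans h.1)]
  exact h.2

theorem momentFun_mem_Icc (hε : 0 < ε) (hν : ∀ᵐ u ∂ν, u ∈ simplexGe d ε) {v : Vec d}
    (hv : v ∈ simplex d) : momentFun s ν v ∈ Icc (ε ^ |s|) (ε ^ (-|s|)) := by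
  have hi := integrable_dotProduct_rpow (s := s) hε hν hv
  constructor
  · calc ε ^ |s| = ∫ _, ε ^ |s| ∂ν := by simp
      _ ≤ _ := integral_mono_ae (integrable_const _) hi (hν.mono fun u hu =>
        (rpow_mem_Icc hε (dotProduct_mem_Icc hv hu) s).1)
  · calc momentFun s ν v ≤ ∫ _, ε ^ (-|s|) ∂ν := integral_mono_ae hi (integrable_const _)
          (hν.mono fun u hu => (rpow_mem_Icc hε (dotProduct_mem_Icc hv hu) s).2)
      _ = _ := by simp

theorem momentFun_pos (hε : 0 < ε) (hν : ∀ᵐ u ∂ν, u ∈ simplexGe d ε) {v : Vec d}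
    (hv : v ∈ simplex d) : 0 < momentFun s ν v :=
  (Real.rpow_pos_of_pos hε _).trans_le (momentFun_mem_Icc hε hν hv).1

theorem measurable_momentFun : Measurable (momentFun s ν) := by
  have h : StronglyMeasurable fun p : Vec d × Vec d => (p.1 ⬝ᵥ p.2) ^ s :=
    ((Continuous.measurable (by unfold dotProduct; fun_prop) :
      Measurable fun p : Vec d × Vec d => p.1 ⬝ᵥ p.2).pow_const s).stronglyMeasurable
  exact h.integral_prod_right'.measurable

theorem continuousOn_momentFun (hε : 0 < ε) (hν : ∀ᵐ u ∂ν, u ∈ simplexGe d ε) :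
    ContinuousOn (momentFun s ν) (simplex d) := by
  refine continuousOn_of_dominated (bound := fun _ => ε ^ (-|s|))
    (fun v _ => (measurable_dotProduct_rpow v s).aestronglyMeasurable) (fun v hv => ?_)
    (integrable_const _) ?_
  · filter_upwards [hν] with u hu
    have h := rpow_mem_Icc hε (dotProduct_mem_Icc hv hu) s
    rw [Real.norm_of_nonneg ((Real.rpow_nonneg hε.le _).trans h.1)]
    exact h.2
  · filter_upwards [hν] with u hu
    refine ContinuousOn.rpow_const (Continuous.continuousOn (by unfold dotProduct; fun_prop))
      fun v hv => Or.inl (hε.trans_le (hu.2 v hv)).ne'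

theorem logLip_dotProduct_rpow (hε : 0 < ε) {x : Vec d} (hx : x ∈ simplex d) (s : ℝ) :
    LogLip ε (|s| * (2 / ε)) (fun v => (x ⬝ᵥ v) ^ s) := by
  have hpos : ∀ v ∈ simplexGe d ε, 0 < x ⬝ᵥ v := fun v hv => hε.trans_le (hv.2 x hx)
  refine ⟨fun v hv => Real.rpow_pos_of_pos (hpos v hv) _, fun u hu v hv => ?_⟩
  have h1 := dotProduct_le_exp_mul hε hx.1 hu hv
  have h2 := dotProduct_le_exp_mul hε hx.1 hv hu
  rw [hilbertDist_comm v u] at h2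
  set t := 2 / ε * hilbertDist u v with ht
  have h3 := rpow_le_of_comparable (a := Real.exp (-t)) (x := x ⬝ᵥ v) (y := x ⬝ᵥ u) s
    (Real.exp_pos _) (hpos v hv)
    (by rw [Real.exp_neg, inv_mul_eq_div, div_le_iff₀ (Real.exp_pos _)]; linarith)
    (by rw [Real.exp_neg, div_inv_eq_mul]; linarith)
  rw [← Real.exp_mul] at h3
  convert h3 using 3
  rw [ht]; ring

theorem logLip_momentFun (hε : 0 < ε) (hν : ∀ᵐ u ∂ν, u ∈ simplexGe d ε) :
    LogLip ε (|s| * (2 / ε)) (momentFun s ν) := by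
  refine ⟨fun v hv => momentFun_pos hε hν hv.1, fun u hu v hv => ?_⟩
  rw [momentFun, momentFun, ← integral_const_mul]
  refine integral_mono_ae (integrable_dotProduct_rpow hε hν hu.1)
    ((integrable_dotProduct_rpow hε hν hv.1).const_mul _) ?_
  filter_upwards [hν] with x hx
  have := (logLip_dotProduct_rpow hε hx.1 s).le u hu v hv
  simpa only [dotProduct_comm x] using this

end

section

variable {s k : ℝ} {μ : Measure (Mat d)}

theorem transferReal_transposeLaw {ψ : Vec d → ℝ} (hψ : Measurable ψ) (u : Vec d) :
    transferReal (transposeLaw μ) s ψ u =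
      ∫ g, vecNorm (g.transpose.mulVec u) ^ s * ψ (act g.transpose u) ∂μ := by
  have hm : Measurable fun g : Mat d => vecNorm (g.mulVec u) ^ s * ψ (act g u) :=
    ((measurable_vecNorm_left u).pow_const s).mul (hψ.comp (measurable_act_left u))
  rw [transferReal, transposeLaw, integral_map measurable_transpose.aemeasurable
    hm.aestronglyMeasurable]

variable [IsProbabilityMeasure μ]

theorem IsEigenLaw.integral_transferReal {α : ℝ} {ν : Measure (Vec d)} (hε : 0 < ε) (hε1 : ε < 1)
    (hμ : GoodLaw ε s α μ) (h : IsEigenLaw μ s k ν) {ψ : Vec d → ℝ} (hψ : Measurable ψ)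
    (hB : ∃ B, ∀ v ∈ simplexGe d ε, ‖(ψ v : ℂ)‖ ≤ B) :
    ∫ v, transferReal μ s ψ v ∂ν = k * ∫ v, ψ v ∂ν := by
  have h1 := h.integral_transferOp hε hε1 hμ (Complex.measurable_ofReal.comp hψ) hB
  simp only [Function.comp_def] at h1
  rw [transferOp_ofReal_fun, integral_complex_ofReal, integral_complex_ofReal] at h1
  exact_mod_cast h1

/-- The dual eigenmeasure gives an eigenfunction: by duality,
`P_s (⟨·, u⟩^s) (v) = P_s^* (⟨v, ·⟩^s) (u)`. -/
theorem GoodLaw.transferReal_momentFun (hε : 0 < ε) (hε1 : ε < 1) (hμ : GoodLaw ε s (contr ε) μ)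
    {ν : Measure (Vec d)} (h : IsEigenLaw (PosMat.transposeLaw μ) s k ν) {v : Vec d}
    (hv : v ∈ simplex d) : transferReal μ s (momentFun s ν) v = k * momentFun s ν v := by
  have hp := h.prob
  have hT := hμ.transposeLaw hε hε1
  have hmem := h.ae_mem hT
  have hψ := measurable_dotProduct_rpow v s
  have hbd : ∃ B, ∀ u ∈ simplexGe d ε, ‖(((v ⬝ᵥ u) ^ s : ℝ) : ℂ)‖ ≤ B := ⟨ε ^ (-|s|), fun u hu => by
    have h := rpow_mem_Icc hε (dotProduct_mem_Icc hv hu) s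
    rw [Complex.norm_real, Real.norm_of_nonneg ((Real.rpow_nonneg hε.le _).trans h.1)]
    exact h.2⟩
  rw [momentFun, ← h.integral_transferReal hε hε1 hT hψ hbd, transferReal]
  have e1 : ∀ g : Mat d, vecNorm (g.mulVec v) ^ s * momentFun s ν (act g v) =
      ∫ u, vecNorm (g.mulVec v) ^ s * (act g v ⬝ᵥ u) ^ s ∂ν := fun g => by
    rw [integral_const_mul]; rfl
  simp only [e1]
  have hmeas : Measurable fun p : Mat d × Vec d =>
      vecNorm (p.1.mulVec v) ^ s * (act p.1 v ⬝ᵥ p.2) ^ s := by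
    have hdot : Measurable fun p : Vec d × Vec d => (p.1 ⬝ᵥ p.2) ^ s :=
      (Continuous.measurable (by unfold dotProduct; fun_prop) :
        Measurable fun p : Vec d × Vec d => p.1 ⬝ᵥ p.2).pow_const s
    have h1 : Measurable fun p : Mat d × Vec d => (act p.1 v, p.2) :=
      ((measurable_act_left v).comp measurable_fst).prodMk measurable_snd
    have h2 : Measurable fun p : Mat d × Vec d => vecNorm (p.1.mulVec v) ^ s :=
      ((measurable_vecNorm_left v).comp measurable_fst).pow_const s
    exact h2.mul (Measurable.comp (g := fun p : Vec d × Vec d => (p.1 ⬝ᵥ p.2) ^ s)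
      (f := fun p : Mat d × Vec d => (act p.1 v, p.2)) hdot h1)
  have hae : ∀ᵐ p ∂(μ.prod ν), Good ε p.1 ∧ p.2 ∈ simplexGe d ε :=
    (Measure.quasiMeasurePreserving_fst.ae hμ.good).and
      (Measure.quasiMeasurePreserving_snd.ae hmem)
  have hint : Integrable (fun p : Mat d × Vec d =>
      vecNorm (p.1.mulVec v) ^ s * (act p.1 v ⬝ᵥ p.2) ^ s) (μ.prod ν) := by
    have h1 : Integrable (fun p : Mat d × Vec d => matNorm p.1 ^ s) (μ.prod ν) :=
      hμ.integrable.comp_fst ν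
    refine Integrable.mono' ((h1.const_mul (ε ^ (-|s|))).mul_const (ε ^ (-|s|)))
      hmeas.aestronglyMeasurable ?_
    filter_upwards [hae] with p ⟨hg, hu⟩
    have h2 := rpow_mem_Icc hε (dotProduct_mem_Icc (hg.act_mem v hv).1 hu) s
    have h3 := (Real.rpow_nonneg hε.le |s|).trans h2.1
    have h0 := Real.rpow_nonneg (vecNorm_nonneg (p.1.mulVec v)) s
    rw [Real.norm_of_nonneg (mul_nonneg h0 h3)]
    exact mul_le_mul (hg.vecNorm_rpow_le s hε hε1 hv) h2.2 h3
      (h0.trans (hg.vecNorm_rpow_le s hε hε1 hv))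
  rw [integral_integral_swap hint]
  refine integral_congr_ae ?_
  filter_upwards [hmem] with u hu
  rw [transferReal_transposeLaw hψ]
  refine integral_congr_ae ?_
  filter_upwards [hμ.good] with g hg
  have h1 := vecNorm_mulVec_pos hg.pos hv
  have h2 := vecNorm_mulVec_pos hg.pos.transpose hu.1
  rw [← Real.mul_rpow h1.le (hε.le.trans (hu.2 _ (hg.act_mem v hv).1)),
    ← Real.mul_rpow h2.le (hε.le.trans ((hg.act_transpose_mem u hu.1).2 v hv)),
    ← dotProduct_mulVec_eq hg.pos.transpose hu.1, dotProduct_comm (act g v),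
    ← dotProduct_mulVec_eq hg.pos hv, Matrix.dotProduct_mulVec, Matrix.mulVec_transpose,
    dotProduct_comm]

/-- The leading spectral data of `P_s`: the eigenvalue `k`, the eigenmeasure `ν` and the positive
eigenfunction `r`. -/
structure LeadingData (ε s : ℝ) (μ : Measure (Mat d)) (k : ℝ) (ν : Measure (Vec d))
    (r : Vec d → ℝ) : Prop where
  law : IsEigenLaw μ s k ν
  measurable : Measurable r
  logLip : LogLip ε (|s| * (2 / ε)) r
  mem : ∀ v ∈ simplex d, r v ∈ Icc (ε ^ |s|) (ε ^ (-|s|))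
  eigen : ∀ v ∈ simplex d, transferReal μ s r v = k * r v

omit [IsProbabilityMeasure μ] in
theorem LeadingData.logLip' {ν : Measure (Vec d)} {r : Vec d → ℝ} (hε : 0 < ε)
    (h : LeadingData ε s μ k ν r) : LogLip ε (distortion ε s) r :=
  h.logLip.mono (by
    have : 0 ≤ |s| * (2 / ε) := mul_nonneg (abs_nonneg s) (by positivity)
    rw [distortion]; linarith)

omit [IsProbabilityMeasure μ] in
theorem LeadingData.pos {ν : Measure (Vec d)} {r : Vec d → ℝ} (hε : 0 < ε)
    (h : LeadingData ε s μ k ν r) {v : Vec d} (hv : v ∈ simplex d) : 0 < r v :=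
  (Real.rpow_pos_of_pos hε _).trans_le (h.mem v hv).1

omit [IsProbabilityMeasure μ] in
theorem LeadingData.integral_pos {α : ℝ} {ν : Measure (Vec d)} {r : Vec d → ℝ} (hε : 0 < ε)
    (hμ : GoodLaw ε s α μ) (h : LeadingData ε s μ k ν r) : 0 < ∫ v, r v ∂ν := by
  have := h.law.prob
  refine integral_pos_of_ae_pos (h.law.mem.mono fun v hv => h.pos hε hv) ?_
  have := (integrable_of_bounded (h.law.ae_mem hμ) (Complex.measurable_ofReal.comp h.measurable)
    h.logLip.bounded).re
  simpa using this

theorem GoodLaw.exists_leadingData (hε : 0 < ε) (hε1 : ε < 1) (hd : 0 < d)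
    (hμ : GoodLaw ε s (contr ε) μ) : ∃ k ν ν', IsEigenLaw (PosMat.transposeLaw μ) s k ν' ∧
      LeadingData ε s μ k ν (momentFun s ν') := by
  obtain ⟨k, ν, h⟩ := hμ.exists_eigenLaw hε hε1 hd
  have hT := hμ.transposeLaw hε hε1
  obtain ⟨k', ν', h'⟩ := hT.exists_eigenLaw hε hε1 hd
  have hp := h.prob
  have hp' := h'.prob
  have hm' := h'.ae_mem hT
  have hlip : LogLip ε _ (momentFun s ν') := logLip_momentFun (s := s) hε hm'
  have heig : ∀ v ∈ simplex d, transferReal μ s (momentFun s ν') v = k' * momentFun s ν' v :=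
    fun v hv => hμ.transferReal_momentFun hε hε1 h' hv
  -- both eigenvalues are computed by integrating the eigenfunction against the eigenmeasure
  have hk : k = k' := by
    have h1 := h.integral_transferReal hε hε1 hμ measurable_momentFun hlip.bounded
    have h2 : ∫ v, transferReal μ s (momentFun s ν') v ∂ν = k' * ∫ v, momentFun s ν' v ∂ν := by
      rw [← integral_const_mul]
      refine integral_congr_ae ?_
      filter_upwards [h.mem] with v hv using heig v hv
    have h3 : 0 < ∫ v, momentFun s ν' v ∂ν := by
      refine integral_pos_of_ae_pos (h.mem.mono fun v hv => momentFun_pos hε hm' hv) ?_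
      have := (integrable_of_bounded (h.ae_mem hμ)
        (Complex.measurable_ofReal.comp measurable_momentFun) hlip.bounded).re
      simpa using this
    exact mul_right_cancel₀ h3.ne' (h1.symm.trans h2)
  subst hk
  exact ⟨k, ν, ν', h', h, measurable_momentFun, hlip, fun v hv => momentFun_mem_Icc hε hm' hv, heig⟩

omit [IsProbabilityMeasure μ] in
theorem GoodLaw.transferReal_congr {α : ℝ} (hμ : GoodLaw ε s α μ) {h₁ h₂ : Vec d → ℝ}
    (h : ∀ v ∈ simplexGe d ε, h₁ v = h₂ v) {v : Vec d} (hv : v ∈ simplex d) :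
    transferReal μ s h₁ v = transferReal μ s h₂ v := by
  refine integral_congr_ae ?_
  filter_upwards [hμ.good] with g hg
  rw [h _ (hg.act_mem v hv)]

omit [IsProbabilityMeasure μ] in
theorem LeadingData.iterate {α : ℝ} {ν : Measure (Vec d)} {r : Vec d → ℝ} (hμ : GoodLaw ε s α μ)
    (h : LeadingData ε s μ k ν r) (n : ℕ) {v : Vec d} (hv : v ∈ simplex d) :
    (transferReal μ s)^[n] r v = k ^ n * r v := by
  induction n generalizing v with
  | zero => simp
  | succ n ih =>
    rw [Function.iterate_succ_apply', hμ.transferReal_congr (h₂ := fun v => k ^ n * r v)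
      (fun w hw => ih hw.1) hv, pow_succ, mul_assoc, ← h.eigen v hv, transferReal, transferReal,
      ← integral_const_mul]
    refine integral_congr_ae (Eventually.of_forall fun g => by ring)

/-- `𝔼 ‖Gₙ‖^s` is comparable to `k^n`, since `𝔼 ‖Gₙ v‖^s r(Gₙ · v) = k^n r(v)`, where `r` is bounded
above and below and `‖Gₙ v‖` is comparable to `‖Gₙ‖`. -/
theorem LeadingData.normMoment_mem {ν : Measure (Vec d)} {r : Vec d → ℝ} (hε : 0 < ε)
    (hε1 : ε < 1) (hd : 0 < d) (hμ : GoodLaw ε s (contr ε) μ) (h : LeadingData ε s μ k ν r)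
    (n : ℕ) :
    (ε ^ |s|) ^ 3 * k ^ (n + 1) ≤ normMoment μ s (n + 1) ∧
      (ε ^ |s|) ^ 3 * normMoment μ s (n + 1) ≤ k ^ (n + 1) := by
  have e0 : normMoment μ s (n + 1) = ∫ g, matNorm g ^ s ∂(prodLaw μ (n + 1)) := by
    rw [prodLaw, integral_map (measurable_ofFn_prod _).aemeasurable
      (measurable_matNorm.pow_const s).aestronglyMeasurable]
    rfl
  set v : Vec d := Pi.single ⟨0, hd⟩ 1
  have hv : v ∈ simplex d := single_mem_stdSimplex ℝ _
  have hm := hμ.prodLaw hε (contr_nonneg hε hε1) n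
  have e1 := hμ.transferReal_prodLaw hε hε1 h.measurable h.logLip n hv
  rw [h.iterate hμ _ hv] at e1
  set c := ε ^ |s| with hc
  have hc0 : 0 < c := Real.rpow_pos_of_pos hε _
  have hcinv : ε ^ (-|s|) = c⁻¹ := Real.rpow_neg hε.le _
  have hi := hm.integrable_transferReal hε hε1 h.measurable h.logLip hv
  have hkn : 0 < k ^ (n + 1) := pow_pos h.law.pos _
  have hr := h.mem v hv
  rw [hcinv] at hr
  have b1 : c ^ 2 * normMoment μ s (n + 1) ≤ k ^ (n + 1) * r v := by
    rw [← e1, e0, ← integral_const_mul]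
    refine integral_mono_ae (hm.integrable.const_mul _) hi ?_
    filter_upwards [hm.good] with g hg
    have h1 := hg.matNorm_rpow_le s hε hε1 hv
    rw [hcinv, inv_mul_eq_div, le_div_iff₀ hc0] at h1
    have h2 := (h.mem _ (hg.act_mem v hv).1).1
    have h3 := mul_le_mul h1 h2 hc0.le (Real.rpow_nonneg (vecNorm_nonneg _) _)
    calc c ^ 2 * matNorm g ^ s = matNorm g ^ s * c * c := by ring
      _ ≤ _ := h3
  have b2 : c ^ 2 * (k ^ (n + 1) * r v) ≤ normMoment μ s (n + 1) := by
    rw [← e1, e0, transferReal, ← integral_const_mul]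
    refine integral_mono_ae (hi.const_mul _) hm.integrable ?_
    filter_upwards [hm.good] with g hg
    have h1 := hg.vecNorm_rpow_le s hε hε1 hv
    rw [hcinv, inv_mul_eq_div, le_div_iff₀ hc0] at h1
    have h2 := (h.mem _ (hg.act_mem v hv).1).2
    rw [hcinv, inv_eq_one_div, le_div_iff₀ hc0] at h2
    have h4 := Real.rpow_nonneg (vecNorm_nonneg (g.mulVec v)) s
    have h3 := mul_le_mul h1 h2 (mul_nonneg (h.pos hε (hg.act_mem v hv).1).le hc0.le)
      ((mul_nonneg h4 hc0.le).trans h1)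
    calc c ^ 2 * (vecNorm (g.mulVec v) ^ s * r (act g v)) =
        vecNorm (g.mulVec v) ^ s * c * (r (act g v) * c) := by ring
      _ ≤ _ := h3.trans_eq (mul_one _)
  have hr2 : r v * c ≤ 1 := by
    have := hr.2
    rwa [inv_eq_one_div, le_div_iff₀ hc0] at this
  constructor
  · calc c ^ 3 * k ^ (n + 1) = c ^ 2 * (k ^ (n + 1) * c) := by ring
      _ ≤ c ^ 2 * (k ^ (n + 1) * r v) := by gcongr; exact hr.1
      _ ≤ _ := b2
  · calc c ^ 3 * normMoment μ s (n + 1) = c * (c ^ 2 * normMoment μ s (n + 1)) := by ring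
      _ ≤ c * (k ^ (n + 1) * r v) := by gcongr
      _ = k ^ (n + 1) * (r v * c) := by ring
      _ ≤ _ := mul_le_of_le_one_right hkn.le hr2

theorem LeadingData.tendsto_normMoment {ν : Measure (Vec d)} {r : Vec d → ℝ} (hε : 0 < ε)
    (hε1 : ε < 1) (hd : 0 < d) (hμ : GoodLaw ε s (contr ε) μ) (h : LeadingData ε s μ k ν r) :
    Tendsto (fun n : ℕ => normMoment μ s n ^ (1 / (n : ℝ))) atTop (𝓝 k) := by
  have hk := h.law.pos
  have hc0 : 0 < (ε ^ |s|) ^ 3 := pow_pos (Real.rpow_pos_of_pos hε _) 3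
  set c := (ε ^ |s|) ^ 3
  have hroot : ∀ a : ℝ, 0 < a →
      Tendsto (fun n : ℕ => (a * k ^ n) ^ (1 / (n : ℝ))) atTop (𝓝 k) := fun a ha => by
    have h1 : Tendsto (fun n : ℕ => a ^ (1 / (n : ℝ)) * k) atTop (𝓝 (a ^ (0 : ℝ) * k)) :=
      ((Real.continuousAt_const_rpow ha.ne').tendsto.comp
        tendsto_one_div_atTop_nhds_zero_nat).mul_const k
    rw [Real.rpow_zero, one_mul] at h1
    refine h1.congr' ?_
    filter_upwards [eventually_ge_atTop 1] with n hn
    have hn0 : (n : ℝ) ≠ 0 := by positivity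
    rw [Real.mul_rpow ha.le (pow_nonneg hk.le n), ← Real.rpow_natCast k n, ← Real.rpow_mul hk.le,
      mul_one_div_cancel hn0, Real.rpow_one]
  refine tendsto_of_tendsto_of_tendsto_of_le_of_le' (hroot c hc0) (hroot c⁻¹ (inv_pos.2 hc0)) ?_ ?_
  · filter_upwards [eventually_ge_atTop 1] with n hn
    obtain ⟨n, rfl⟩ := Nat.exists_eq_add_of_le' hn
    exact Real.rpow_le_rpow (mul_nonneg hc0.le (pow_nonneg hk.le _))
      (h.normMoment_mem hε hε1 hd hμ n).1 (by positivity)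
  · filter_upwards [eventually_ge_atTop 1] with n hn
    obtain ⟨n, rfl⟩ := Nat.exists_eq_add_of_le' hn
    obtain ⟨h1, h2⟩ := h.normMoment_mem hε hε1 hd hμ n
    refine Real.rpow_le_rpow ((mul_nonneg hc0.le (pow_nonneg hk.le _)).trans h1) ?_ (by positivity)
    rw [inv_mul_eq_div, le_div_iff₀ hc0]
    linarith

theorem eigenmeasure_eq {P : (Vec d → ℂ) → Vec d → ℂ} {ν : Measure (Vec d)}
    (h : IsEigenmeasure P k ν) (huniq : ∀ ν', IsEigenmeasure P k ν' → ν' = ν) :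
    eigenmeasure P k = ν := by
  have hex : ∃ ν, IsEigenmeasure P k ν := ⟨ν, h⟩
  rw [eigenmeasure, dif_pos hex]
  exact huniq _ hex.choose_spec

/-- The numbers, measures and functions `κ(s)`, `ν_s`, `ν_s^*`, `r_s` are the leading spectral data
of `P_s`. -/
theorem GoodLaw.leading (hε : 0 < ε) (hε1 : ε < 1) (hd : 0 < d) (hμ : GoodLaw ε s (contr ε) μ) :
    Tendsto (fun n : ℕ => normMoment μ s n ^ (1 / (n : ℝ))) atTop (𝓝 (kappa μ s)) ∧
    LeadingData ε s μ (kappa μ s) (nuS μ s) (rS μ s) ∧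
    IsEigenLaw (PosMat.transposeLaw μ) s (kappa μ s) (nuStar μ s) := by
  obtain ⟨k, ν, ν', h', h⟩ := hμ.exists_leadingData hε hε1 hd
  have hT := hμ.transposeLaw hε hε1
  have hlim := h.tendsto_normMoment hε hε1 hd hμ
  have hk : kappa μ s = k := hlim.limUnder_eq
  have h1 : nuS μ s = ν := eigenmeasure_eq (by rw [hk]; exact h.law.isEigenmeasure hε hε1 hμ)
    fun ν₁ hν₁ => hμ.eigenLaw_unique hε hε1 hd (hμ.isEigenLaw_of_isEigenmeasure hε hε1 hd hν₁) h.law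
  have h2 : nuStar μ s = ν' := eigenmeasure_eq
    (by rw [hk]; exact isEigenmeasure_star_iff.2 (h'.isEigenmeasure hε hε1 hT)) fun ν₁ hν₁ =>
      hT.eigenLaw_unique hε hε1 hd
        (hT.isEigenLaw_of_isEigenmeasure hε hε1 hd (isEigenmeasure_star_iff.1 hν₁)) h'
  have h3 : rS μ s = momentFun s ν' := by
    funext v; rw [rS, h2]; rfl
  rw [hk, h1, h2, h3]
  exact ⟨hlim, h, h'⟩

end

/-! ### Spectral splittings of bounded operators -/

section Abstract

variable {E : Type*} [NormedAddCommGroup E] [NormedSpace ℂ E]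

theorem spectralRadius_le_of_norm_pow_le [CompleteSpace E] {T : E →L[ℂ] E} {n : ℕ} {b : ℝ}
    (hb : 0 ≤ b) (h : ‖T ^ (n + 1)‖ ≤ b ^ (n + 1)) : spectralRadius ℂ T ≤ ENNReal.ofReal b := by
  refine iSup₂_le fun k hk => ?_
  have h1 := spectrum.norm_le_norm_mul_of_mem (spectrum.pow_mem_pow T (n + 1) hk)
  have h2 : ‖(1 : E →L[ℂ] E)‖ ≤ 1 := ContinuousLinearMap.norm_id_le
  have h3 : ‖k‖ ^ (n + 1) ≤ b ^ (n + 1) := by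
    rw [← norm_pow]
    exact h1.trans ((mul_le_of_le_one_right (norm_nonneg _) h2).trans h)
  change ‖k‖ₑ ≤ _
  rw [← ofReal_norm]
  exact ENNReal.ofReal_le_ofReal (le_of_pow_le_pow_left₀ n.succ_ne_zero hb h3)

theorem exists_norm_pow_lt [CompleteSpace E] {T : E →L[ℂ] E} {b : ℝ}
    (h : spectralRadius ℂ T < ENNReal.ofReal b) : ∃ n : ℕ, ‖T ^ (n + 1)‖ < b ^ (n + 1) := by
  have hb : 0 < b := ENNReal.ofReal_pos.1 (bot_le.trans_lt h)
  obtain ⟨N, h1, h2⟩ := (((spectrum.pow_norm_pow_one_div_tendsto_nhds_spectralRadius T).eventually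
    (gt_mem_nhds h)).and (eventually_ge_atTop 1)).exists
  obtain ⟨n, rfl⟩ := Nat.exists_eq_add_of_le' h2
  refine ⟨n, ?_⟩
  rw [ENNReal.ofReal_lt_ofReal_iff hb] at h1
  have h3 := pow_lt_pow_left₀ h1 (Real.rpow_nonneg (norm_nonneg _) _) n.succ_ne_zero
  rwa [← Real.rpow_natCast, ← Real.rpow_mul (norm_nonneg _), one_div_mul_cancel (by positivity),
    Real.rpow_one] at h3

/-- Conjugation by an invertible operator. -/
def conjOp (D : (E →L[ℂ] E)ˣ) (T : E →L[ℂ] E) : E →L[ℂ] E :=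
  ((D⁻¹ : (E →L[ℂ] E)ˣ) : E →L[ℂ] E) * T * (D : E →L[ℂ] E)

theorem conjOp_mul (D : (E →L[ℂ] E)ˣ) (S T : E →L[ℂ] E) :
    conjOp D S * conjOp D T = conjOp D (S * T) := by
  simp only [conjOp, mul_assoc, Units.mul_inv_cancel_left]

/-- `A = κ M + L`, where `M` is a rank-one projection that is annihilated by `L` on both sides. -/
structure SpectralSplit (A : E →L[ℂ] E) (κ : ℂ) (M L : E →L[ℂ] E) : Prop where
  eq : A = κ • M + L
  rank : ∃ (ℓ : E →L[ℂ] ℂ) (e : E), ℓ e = 1 ∧ M = ℓ.smulRight e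
  proj_mul : M * L = 0
  mul_proj : L * M = 0

theorem isRankOneProjection_smulRight {ℓ : E →L[ℂ] ℂ} {e : E} (h : ℓ e = 1) :
    IsRankOneProjection (ℓ.smulRight e) := by
  have he : e ≠ 0 := fun h0 => by simp [h0] at h
  refine ⟨ContinuousLinearMap.ext fun x => by simp [h], ?_⟩
  have hr : LinearMap.range ((ℓ.smulRight e : E →L[ℂ] E) : E →ₗ[ℂ] E) = Submodule.span ℂ {e} := by
    ext x
    rw [Submodule.mem_span_singleton]
    constructor
    · rintro ⟨y, rfl⟩
      exact ⟨ℓ y, rfl⟩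
    · rintro ⟨c, rfl⟩
      exact ⟨c • e, by simp [h]⟩
  rw [hr, finrank_span_singleton he]

namespace SpectralSplit

variable {A M L : E →L[ℂ] E} {κ : ℂ}

theorem isRankOneProjection (h : SpectralSplit A κ M L) : IsRankOneProjection M := by
  obtain ⟨ℓ, e, he, rfl⟩ := h.rank
  exact isRankOneProjection_smulRight he

theorem idem (h : SpectralSplit A κ M L) : M * M = M := h.isRankOneProjection.1

theorem pow (h : SpectralSplit A κ M L) {n : ℕ} (hn : 1 ≤ n) : A ^ n = κ ^ n • M + L ^ n := by
  induction n, hn using Nat.le_induction with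
  | base => simpa using h.eq
  | succ n hn ih =>
    obtain ⟨m, rfl⟩ := Nat.exists_eq_add_of_le' hn
    have h1 : L ^ (m + 1) * M = 0 := by rw [pow_succ, mul_assoc, h.mul_proj, mul_zero]
    rw [pow_succ, ih, h.eq, add_mul, mul_add, mul_add, smul_mul_smul_comm, h.idem,
      smul_mul_assoc, h.proj_mul, mul_smul_comm, h1, smul_zero, smul_zero, add_zero, zero_add,
      pow_succ L (m + 1), ← pow_succ]

theorem mul_proj_eq (h : SpectralSplit A κ M L) : A * M = κ • M := by
  rw [h.eq, add_mul, h.mul_proj, smul_mul_assoc, h.idem, add_zero]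

theorem proj_mul_eq (h : SpectralSplit A κ M L) : M * A = κ • M := by
  rw [h.eq, mul_add, h.proj_mul, mul_smul_comm, h.idem, add_zero]

theorem proj_ne_zero (h : SpectralSplit A κ M L) : M ≠ 0 := by
  obtain ⟨ℓ, e, he, rfl⟩ := h.rank
  intro h0
  have := congrArg ℓ (DFunLike.congr_fun h0 e)
  simp [he] at this

/-- Off the spectrum of `L`, the only spectral value of `κ M + L` is `κ`. -/
theorem isUnit_sub (h : SpectralSplit A κ M L) {z : ℂ} (hz : z ≠ 0) (hzκ : z ≠ κ)
    (hL : IsUnit (algebraMap ℂ (E →L[ℂ] E) z - L)) : IsUnit (algebraMap ℂ (E →L[ℂ] E) z - A) := by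
  have hzκ' : z - κ ≠ 0 := sub_ne_zero.2 hzκ
  have h1 : IsUnit (algebraMap ℂ (E →L[ℂ] E) z - κ • M) := by
    have e1 : κ / (z - κ) - z⁻¹ * κ - z⁻¹ * (κ / (z - κ)) * κ = 0 := by field_simp; ring
    have e2 := congrArg (fun c : ℂ => c • M) e1
    simp only [zero_smul] at e2
    refine isUnit_iff_exists.2 ⟨z⁻¹ • (1 + (κ / (z - κ)) • M), ?_, ?_⟩
    all_goals
      rw [Algebra.algebraMap_eq_smul_one]
      simp only [mul_add, add_mul, sub_mul, mul_sub, smul_mul_assoc, mul_smul_comm, one_mul,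
        mul_one, h.idem, smul_add, smul_sub, smul_smul, mul_inv_cancel₀ hz, inv_mul_cancel₀ hz,
        one_smul]
    · rw [mul_right_comm z⁻¹ _ z, inv_mul_cancel₀ hz, one_mul]
      rw [← sub_eq_zero]
      refine Eq.trans ?_ e2
      module
    · rw [← mul_assoc z, mul_inv_cancel₀ hz, one_mul]
      rw [← sub_eq_zero]
      refine Eq.trans ?_ e2
      module
  have h2 : (algebraMap ℂ (E →L[ℂ] E) z - κ • M) * (algebraMap ℂ (E →L[ℂ] E) z - L) =
      z • (algebraMap ℂ (E →L[ℂ] E) z - A) := by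
    rw [h.eq, Algebra.algebraMap_eq_smul_one]
    simp only [mul_sub, sub_mul, smul_mul_assoc, mul_smul_comm, one_mul, mul_one, h.proj_mul,
      smul_zero, smul_sub, smul_add]
    abel
  have h3 := h1.mul hL
  rw [h2] at h3
  exact (isUnit_smul_iff (Units.mk0 z hz) _).1 h3

/-- Above `ρ(L)`, the only spectral value of `κ M + L` is `κ`. -/
theorem notMem_spectrum (h : SpectralSplit A κ M L) {z : ℂ} (hzκ : z ≠ κ)
    (hz : spectralRadius ℂ L < ‖z‖₊) : z ∉ spectrum ℂ A := by
  have hz0 : z ≠ 0 := fun h0 => by simp [h0] at hz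
  have h1 := spectrum.mem_resolventSet_of_spectralRadius_lt hz
  exact spectrum.notMem_iff.2 (h.isUnit_sub hz0 hzκ h1)

theorem mem_spectrum (h : SpectralSplit A κ M L) : κ ∈ spectrum ℂ A := by
  intro hu
  have h1 : (algebraMap ℂ (E →L[ℂ] E) κ - A) * M = 0 := by
    rw [sub_mul, h.mul_proj_eq, Algebra.algebraMap_eq_smul_one, smul_mul_assoc, one_mul, sub_self]
  exact h.proj_ne_zero ((IsUnit.mul_right_eq_zero hu).1 h1)

theorem spectralRadius_eq (h : SpectralSplit A κ M L) (hL : spectralRadius ℂ L < ‖κ‖₊) :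
    spectralRadius ℂ A = ‖κ‖₊ := by
  refine le_antisymm (iSup₂_le fun z hz => ?_)
    (le_iSup₂ (α := ENNReal) (f := fun z (_ : z ∈ spectrum ℂ A) => (‖z‖₊ : ENNReal)) κ
      h.mem_spectrum)
  by_contra! hlt
  exact h.notMem_spectrum (fun h0 => by simp [h0] at hlt) (hL.trans hlt) hz

/-- The leading eigenvalue and eigenprojection are determined by the operator. -/
theorem unique {κ' : ℂ} {M' L' : E →L[ℂ] E} (h : SpectralSplit A κ M L)
    (h' : SpectralSplit A κ' M' L') (hL : spectralRadius ℂ L < ‖κ‖₊)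
    (hL' : spectralRadius ℂ L' < ‖κ'‖₊) : κ = κ' ∧ M = M' := by
  have hn : (‖κ‖₊ : ENNReal) = ‖κ'‖₊ := (h.spectralRadius_eq hL).symm.trans
    (h'.spectralRadius_eq hL')
  have hκ : κ = κ' := by
    by_contra hne
    exact h'.notMem_spectrum hne (hn ▸ hL') h.mem_spectrum
  subst hκ
  have hu : IsUnit (algebraMap ℂ (E →L[ℂ] E) κ - L) :=
    spectrum.mem_resolventSet_of_spectralRadius_lt hL
  have hu' : IsUnit (algebraMap ℂ (E →L[ℂ] E) κ - L') :=
    spectrum.mem_resolventSet_of_spectralRadius_lt hL'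
  refine ⟨rfl, ?_⟩
  have h1 : M * (1 - M') = 0 := by
    have e : M * (1 - M') * (algebraMap ℂ (E →L[ℂ] E) κ - L') = 0 := by
      have e1 : M * L' = κ • M - κ • (M * M') := by
        have : L' = A - κ • M' := by rw [h'.eq]; abel
        rw [this, mul_sub, h.proj_mul_eq, mul_smul_comm]
      rw [Algebra.algebraMap_eq_smul_one]
      simp only [mul_sub, sub_mul, mul_one, mul_smul_comm, mul_assoc, h'.proj_mul, mul_zero, e1]
      module
    exact (IsUnit.mul_left_eq_zero hu').1 e
  have h2 : (1 - M) * M' = 0 := by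
    have e : (algebraMap ℂ (E →L[ℂ] E) κ - L) * ((1 - M) * M') = 0 := by
      have e1 : L * M' = κ • M' - κ • (M * M') := by
        have : L = A - κ • M := by rw [h.eq]; abel
        rw [this, sub_mul, h'.mul_proj_eq, smul_mul_assoc]
      rw [Algebra.algebraMap_eq_smul_one]
      simp only [mul_sub, sub_mul, one_mul, smul_mul_assoc, ← mul_assoc, h.mul_proj, zero_mul, e1]
      module
    exact (IsUnit.mul_right_eq_zero hu).1 e
  rw [mul_sub, mul_one, sub_eq_zero] at h1
  rw [sub_mul, one_mul, sub_eq_zero] at h2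
  exact h1.trans h2.symm

theorem conj (h : SpectralSplit A κ M L) (D : (E →L[ℂ] E)ˣ) :
    SpectralSplit (conjOp D A) κ (conjOp D M) (conjOp D L) := by
  obtain ⟨ℓ, e, he, hM⟩ := h.rank
  have hD : ∀ x, (D : E →L[ℂ] E) (((D⁻¹ : (E →L[ℂ] E)ˣ) : E →L[ℂ] E) x) = x := fun x =>
    DFunLike.congr_fun (D.mul_inv) x
  refine ⟨by rw [h.eq]; simp only [conjOp, mul_add, add_mul, mul_smul_comm, smul_mul_assoc],
    ⟨ℓ ∘L (D : E →L[ℂ] E), ((D⁻¹ : (E →L[ℂ] E)ˣ) : E →L[ℂ] E) e, ?_, ?_⟩, ?_, ?_⟩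
  · rw [ContinuousLinearMap.comp_apply, hD, he]
  · ext x
    rw [hM, conjOp]
    simp
  · rw [conjOp_mul, h.proj_mul, conjOp, mul_zero, zero_mul]
  · rw [conjOp_mul, h.mul_proj, conjOp, mul_zero, zero_mul]

theorem smul (h : SpectralSplit A κ M L) (c : ℂ) : SpectralSplit (c • A) (c * κ) M (c • L) :=
  ⟨by rw [h.eq, smul_add, smul_smul], h.rank, by rw [mul_smul_comm, h.proj_mul, smul_zero],
    by rw [smul_mul_assoc, h.mul_proj, smul_zero]⟩

end SpectralSplit

theorem spectralRadius_conj (T : E →L[ℂ] E) (D : (E →L[ℂ] E)ˣ) :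
    spectralRadius ℂ (conjOp D T) = spectralRadius ℂ T := by
  rw [conjOp, spectralRadius, spectralRadius, spectrum.units_conjugate']

theorem spectralRadius_smul_le [CompleteSpace E] (c : ℂ) {T : E →L[ℂ] E} {b : ℝ} (hb : 0 ≤ b)
    (h : spectralRadius ℂ T ≤ ENNReal.ofReal b) :
    spectralRadius ℂ (c • T) ≤ ENNReal.ofReal (‖c‖ * b) := by
  refine iSup₂_le fun k hk => ?_
  change ‖k‖ₑ ≤ _
  rw [← ofReal_norm]
  refine ENNReal.ofReal_le_ofReal ?_
  rcases eq_or_ne c 0 with rfl | hc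
  · rw [zero_smul] at hk
    have h1 := spectrum.norm_le_norm_mul_of_mem hk
    simpa using h1
  · have h2 : (Units.mk0 c hc) • T = c • T := rfl
    rw [← h2, spectrum.unit_smul_eq_smul] at hk
    obtain ⟨w, hw, rfl⟩ := hk
    have h3 : (‖w‖₊ : ENNReal) ≤ ENNReal.ofReal b :=
      (le_iSup₂ (α := ENNReal) (f := fun z (_ : z ∈ spectrum ℂ T) => (‖z‖₊ : ENNReal)) w hw).trans h
    change ‖w‖ₑ ≤ _ at h3
    rw [← ofReal_norm, ENNReal.ofReal_le_ofReal_iff hb] at h3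
    change ‖c * w‖ ≤ _
    rw [norm_mul]
    exact mul_le_mul_of_nonneg_left h3 (norm_nonneg c)

/-- Analytic perturbation of a dominating simple eigenvalue. The eigenvalue `λ` is the solution of
`κ ℓ((λ - (A(w) - κ M))⁻¹ e) = 1`, where `M = ℓ ⊗ e`, and with `R = (λ - (A(w) - κ M))⁻¹` the
eigenprojection is the normalisation of `R M R`. -/
theorem exists_analytic_split [CompleteSpace E] {A : ℂ → E →L[ℂ] E} {w₀ : ℂ}
    (hA : AnalyticAt ℂ A w₀) {κ : ℂ} {M L : E →L[ℂ] E} (h : SpectralSplit (A w₀) κ M L) {b : ℝ}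
    (hb : spectralRadius ℂ L < ENNReal.ofReal b) (hbκ : b < ‖κ‖) :
    ∃ (lam : ℂ → ℂ) (Q N : ℂ → E →L[ℂ] E), AnalyticAt ℂ lam w₀ ∧ AnalyticAt ℂ Q w₀ ∧
      AnalyticAt ℂ N w₀ ∧ ∀ᶠ w in 𝓝 w₀, SpectralSplit (A w) (lam w) (Q w) (N w) ∧
        spectralRadius ℂ (N w) ≤ ENNReal.ofReal b ∧ b < ‖lam w‖ := by
  have hb0 : 0 < b := ENNReal.ofReal_pos.1 (bot_le.trans_lt hb)
  have hκ : κ ≠ 0 := fun h0 => by rw [h0, norm_zero] at hbκ; linarith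
  obtain ⟨ℓ, e, he, hM⟩ := h.rank
  have hLκ : spectralRadius ℂ L < ‖κ‖₊ := by
    refine hb.trans ?_
    change _ < ‖κ‖ₑ
    rw [← ofReal_norm]
    exact (ENNReal.ofReal_lt_ofReal_iff (hb0.trans hbκ)).2 hbκ
  -- `τ(T) = ℓ(T e)`, so that compressing `T` to the range of `M` gives `τ(T) M`
  set τ : (E →L[ℂ] E) →L[ℂ] ℂ := ℓ ∘L ContinuousLinearMap.apply ℂ E e with hτ
  have hMTM : ∀ T : E →L[ℂ] E, M * T * M = τ T • M := fun T => by
    ext x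
    rw [hM]
    simp [hτ, mul_comm, smul_smul]
  set B : ℂ → E →L[ℂ] E := fun w => A w - κ • M with hB
  have hB0 : B w₀ = L := by rw [hB]; simp only; rw [h.eq]; abel
  have hBan : AnalyticAt ℂ B w₀ := hA.sub analyticAt_const
  -- the resolvent of `B(w)` at `z`, jointly analytic near `(w₀, κ)`
  set G : ℂ × ℂ → E →L[ℂ] E := fun p => Ring.inverse (p.2 • 1 - B p.1) with hG
  have hunit : ∀ᶠ z in 𝓝 κ, IsUnit (z • (1 : E →L[ℂ] E) - L) := by
    have : IsUnit (κ • (1 : E →L[ℂ] E) - L) := by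
      rw [← Algebra.algebraMap_eq_smul_one]
      exact spectrum.mem_resolventSet_of_spectralRadius_lt hLκ
    have hc : ContinuousAt (fun z : ℂ => z • (1 : E →L[ℂ] E) - L) κ := by fun_prop
    exact hc.eventually (Units.isOpen.mem_nhds this)
  have hu0 : IsUnit (κ • (1 : E →L[ℂ] E) - L) := hunit.self_of_nhds
  have harg : AnalyticAt ℂ (fun p : ℂ × ℂ => p.2 • (1 : E →L[ℂ] E) - B p.1) (w₀, κ) :=
    (analyticAt_snd.smul analyticAt_const).sub
      (AnalyticAt.fun_comp (g := B) (f := Prod.fst) hBan analyticAt_fst)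
  have hGan : AnalyticAt ℂ G (w₀, κ) := by
    have h1 : AnalyticAt ℂ Ring.inverse (κ • (1 : E →L[ℂ] E) - B w₀) := by
      rw [hB0]
      obtain ⟨u, hu⟩ := hu0
      rw [← hu]
      exact analyticAt_inverse u
    exact AnalyticAt.fun_comp (g := Ring.inverse) h1 harg
  -- the eigenvalue solves `F(w, z) = 1`; at `w = w₀` the function is `κ / z`, with derivative `≠ 0`
  set F : ℂ × ℂ → ℂ := fun p => κ * τ (G p) with hF
  have hFan : AnalyticAt ℂ F (w₀, κ) :=
    analyticAt_const.mul (AnalyticAt.fun_comp (g := τ) (τ.analyticAt _) hGan)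
  have hRM : ∀ z : ℂ, z ≠ 0 → IsUnit (z • (1 : E →L[ℂ] E) - L) →
      Ring.inverse (z • (1 : E →L[ℂ] E) - L) * M = z⁻¹ • M ∧
      M * Ring.inverse (z • (1 : E →L[ℂ] E) - L) = z⁻¹ • M := fun z hz hu => by
    have h1 : (z • (1 : E →L[ℂ] E) - L) * M = z • M := by
      rw [sub_mul, h.mul_proj, smul_mul_assoc, one_mul, sub_zero]
    have h2 : M * (z • (1 : E →L[ℂ] E) - L) = z • M := by
      rw [mul_sub, h.proj_mul, mul_smul_comm, mul_one, sub_zero]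
    constructor
    · rw [← Ring.inverse_mul_cancel_left _ (z⁻¹ • M) hu, mul_smul_comm, h1, inv_smul_smul₀ hz]
    · rw [← Ring.mul_inverse_cancel_right _ (z⁻¹ • M) hu, smul_mul_assoc, h2, inv_smul_smul₀ hz]
  have hτM : τ M = 1 := by rw [hM, hτ]; simp [he]
  have hτR : ∀ T : E →L[ℂ] E, τ (T * M) = τ T := fun T => by rw [hM, hτ]; simp [he]
  have hFκ : ∀ᶠ z in 𝓝 κ, F (w₀, z) = κ / z := by
    filter_upwards [hunit, eventually_ne_nhds hκ] with z hz hz0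
    rw [hF]
    simp only [hG, hB0]
    rw [← hτR, (hRM z hz0 hz).1, map_smul, hτM, smul_eq_mul, mul_one, div_eq_mul_inv]
  have hF1 : F (w₀, κ) = 1 := by rw [hFκ.self_of_nhds, div_self hκ]
  have hcd : ContDiffAt ℂ 1 F (w₀, κ) := hFan.contDiffAt
  have hderiv : (fderiv ℂ F (w₀, κ) ∘L ContinuousLinearMap.inr ℂ ℂ ℂ) 1 = -κ⁻¹ := by
    have h1 : HasFDerivAt F (fderiv ℂ F (w₀, κ)) (w₀, κ) := hFan.differentiableAt.hasFDerivAt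
    have h2 : HasFDerivAt (fun z : ℂ => (w₀, z)) (ContinuousLinearMap.inr ℂ ℂ ℂ) κ :=
      hasFDerivAt_prodMk_right w₀ κ
    have h3 := (h1.comp κ h2).hasDerivAt
    have h4 : HasDerivAt (fun z : ℂ => κ / z) (-κ⁻¹) κ := by
      have := (hasDerivAt_inv hκ).const_mul κ
      have e : -κ⁻¹ = κ * -(κ ^ 2)⁻¹ := by field_simp
      simp only [div_eq_mul_inv]
      rw [e]
      exact this
    exact (h3.congr_of_eventuallyEq (hFκ.mono fun z hz => hz.symm)).unique h4
  have hinv : (fderiv ℂ F (w₀, κ) ∘L ContinuousLinearMap.inr ℂ ℂ ℂ).IsInvertible := by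
    have hne : -κ⁻¹ ≠ 0 := neg_ne_zero.2 (inv_ne_zero hκ)
    refine ⟨ContinuousLinearEquiv.unitsEquivAut ℂ (Units.mk0 _ hne), ?_⟩
    ext
    rw [hderiv]
    simp
  set lam := hcd.implicitFunction one_ne_zero hinv with hlam
  have hlam0 : lam w₀ = κ := hcd.implicitFunction_apply_self one_ne_zero hinv
  have hlamF : ∀ᶠ w in 𝓝 w₀, F (w, lam w) = 1 := by
    have := hcd.eventually_apply_implicitFunction one_ne_zero hinv
    rwa [hF1] at this
  -- the implicit function is `C¹` near `w₀`, hence analytic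
  have hlaman : AnalyticAt ℂ lam w₀ := by
    have hc1 : ContDiffAt ℂ 1 lam w₀ := hcd.contDiffAt_implicitFunction one_ne_zero hinv
    refine Complex.analyticAt_iff_eventually_differentiableAt.2 ?_
    filter_upwards [hc1.eventually (by simp)] with w hw using hw.differentiableAt one_ne_zero
  have hpair : AnalyticAt ℂ (fun w => (w, lam w)) w₀ := analyticAt_id.prod hlaman
  set R : ℂ → E →L[ℂ] E := fun w => G (w, lam w) with hR
  have hRan : AnalyticAt ℂ R w₀ :=
    AnalyticAt.fun_comp (g := G) (f := fun w => (w, lam w)) (by rw [hlam0]; exact hGan) hpair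
  have hR0 : R w₀ = Ring.inverse (κ • (1 : E →L[ℂ] E) - L) := by
    simp only [hR, hG, hlam0, hB0]
  have hRM0 := hRM κ hκ hu0
  have hτan : AnalyticAt ℂ (fun w => τ (R w * R w)) w₀ :=
    AnalyticAt.fun_comp (g := τ) (τ.analyticAt _) (hRan.mul hRan)
  have hτ0 : τ (R w₀ * R w₀) = κ⁻¹ * κ⁻¹ := by
    rw [← hτR, mul_assoc, hR0, hRM0.1, mul_smul_comm, hRM0.1, map_smul, map_smul, hτM]
    simp
  have hτne : τ (R w₀ * R w₀) ≠ 0 := by rw [hτ0]; simp [hκ]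
  set Q : ℂ → E →L[ℂ] E := fun w => (τ (R w * R w))⁻¹ • (R w * M * R w) with hQ
  have hQan : AnalyticAt ℂ Q w₀ :=
    (hτan.inv hτne).smul ((hRan.mul analyticAt_const).mul hRan)
  have hQ0 : Q w₀ = M := by
    simp only [hQ, hτ0]
    rw [hR0, hRM0.1, smul_mul_assoc, hRM0.2, smul_smul, smul_smul, mul_assoc,
      inv_mul_cancel₀ (by simp [hκ]), one_smul]
  set N : ℂ → E →L[ℂ] E := fun w => A w - lam w • Q w with hN
  have hNan : AnalyticAt ℂ N w₀ := hA.sub (hlaman.smul hQan)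
  have hN0 : N w₀ = L := by
    simp only [hN, hQ0, hlam0]; rw [h.eq]; abel
  obtain ⟨n, hn⟩ := exists_norm_pow_lt hb
  refine ⟨lam, Q, N, hlaman, hQan, hNan, ?_⟩
  have hev1 : ∀ᶠ w in 𝓝 w₀, ‖N w ^ (n + 1)‖ < b ^ (n + 1) := by
    have hc : ContinuousAt (fun w => ‖N w ^ (n + 1)‖) w₀ := (hNan.continuousAt.pow _).norm
    exact hc.eventually (gt_mem_nhds (by simp only [hN0]; exact hn))
  have hev2 : ∀ᶠ w in 𝓝 w₀, b < ‖lam w‖ :=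
    hlaman.continuousAt.norm.eventually (lt_mem_nhds (by simp only [hlam0]; exact hbκ))
  have hev3 : ∀ᶠ w in 𝓝 w₀, IsUnit (lam w • (1 : E →L[ℂ] E) - B w) := by
    have hc : ContinuousAt (fun w => lam w • (1 : E →L[ℂ] E) - B w) w₀ :=
      (hlaman.continuousAt.smul continuousAt_const).sub hBan.continuousAt
    exact hc.eventually (Units.isOpen.mem_nhds (by simp only [hlam0, hB0]; exact hu0))
  filter_upwards [hev1, hev2, hev3, hlamF, hτan.continuousAt.eventually_ne hτne]
    with w h1 h2 h3 h4 h5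
  refine ⟨?_, spectralRadius_le_of_norm_pow_le hb0.le h1.le, h2⟩
  -- `R(w) e` and `ℓ ∘ R(w)` are right and left eigenvectors of `A(w)`
  have hAB : A w = B w + κ • M := by simp only [hB]; abel
  have hκτ : κ * τ (R w) = 1 := h4
  have hRl : R w * (lam w • 1 - B w) = 1 := Ring.inverse_mul_cancel _ h3
  have hRr : (lam w • 1 - B w) * R w = 1 := Ring.mul_inverse_cancel _ h3
  have hBR : B w * R w = lam w • R w - 1 := by
    rw [← hRr, sub_mul (lam w • 1) (B w), smul_mul_assoc, one_mul]; abel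
  have hRB : R w * B w = lam w • R w - 1 := by
    rw [← hRl, mul_sub (R w) (lam w • 1), mul_smul_comm, mul_one]; abel
  have hARM : A w * (R w * M) = lam w • (R w * M) := by
    rw [hAB, add_mul, ← mul_assoc, hBR, smul_mul_assoc, ← mul_assoc, hMTM, smul_smul, hκτ, one_smul,
      sub_mul, smul_mul_assoc, one_mul, sub_add_cancel]
  have hMRA : M * R w * A w = lam w • (M * R w) := by
    rw [hAB, mul_add, mul_assoc, hRB, mul_smul_comm, hMTM, smul_smul, hκτ, one_smul, mul_sub,
      mul_smul_comm, mul_one, sub_add_cancel]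
  have hAQ : A w * Q w = lam w • Q w := by
    simp only [hQ]
    rw [mul_smul_comm, ← mul_assoc, hARM, smul_mul_assoc, smul_comm]
  have hQA : Q w * A w = lam w • Q w := by
    simp only [hQ]
    rw [smul_mul_assoc, mul_assoc (R w), mul_assoc (R w), hMRA, mul_smul_comm, smul_comm]
  have hQQ : Q w * Q w = Q w := by
    simp only [hQ]
    have e1 : R w * M * R w * (R w * M * R w) = R w * (M * (R w * R w) * M) * R w := by
      simp only [mul_assoc]
    rw [smul_mul_smul_comm, e1, hMTM, mul_smul_comm, smul_mul_assoc, smul_smul, mul_assoc,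
      inv_mul_cancel₀ h5, mul_one]
  refine ⟨by simp only [hN]; abel, ⟨(τ (R w * R w))⁻¹ • (ℓ ∘L R w), R w e, ?_, ?_⟩, ?_, ?_⟩
  · have : τ (R w * R w) = ℓ (R w (R w e)) := rfl
    simp only [FunLike.coe_smul, ContinuousLinearMap.comp_apply, Pi.smul_apply, smul_eq_mul]
    rw [← this, inv_mul_cancel₀ h5]
  · ext x
    simp only [hQ]
    rw [hM]
    simp [smul_smul]
  · simp only [hN]
    rw [mul_sub, hQA, mul_smul_comm, hQQ, sub_self]
  · simp only [hN]
    rw [sub_mul, hAQ, smul_mul_assoc, hQQ, sub_self]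

end Abstract

/-! ### The spectral gap of the transfer operator -/

theorem LogLip.inv {D : ℝ} {h : Vec d → ℝ} (hh : LogLip ε D h) : LogLip ε D fun v => (h v)⁻¹ := by
  refine ⟨fun v hv => inv_pos.2 (hh.pos v hv), fun u hu v hv => ?_⟩
  have h1 := hh.le v hv u hu
  rw [hilbertDist_comm] at h1
  rw [← div_eq_mul_inv, le_div_iff₀ (hh.pos v hv), inv_mul_le_iff₀ (hh.pos u hu), mul_comm]
  exact h1

theorem LogLip.holderBound {D : ℝ} {h : Vec d → ℝ} (hh : LogLip ε D h) (hD : 0 ≤ D) (hγ1 : γ ≤ 1) :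
    ∃ B H, 0 ≤ B ∧ 0 ≤ H ∧ HolderBound ε γ (fun v => (h v : ℂ)) B H := by
  obtain ⟨B, hB⟩ := hh.bounded
  have hle : B ≤ |B| := le_abs_self B
  refine ⟨|B|, D * Real.exp D * |B|, abs_nonneg B, by positivity, fun v hv => (hB v hv).trans hle,
    fun u hu v hv => ?_⟩
  have key : ∀ {u v : Vec d}, u ∈ simplexGe d ε → v ∈ simplexGe d ε →
      h u - h v ≤ D * Real.exp D * |B| * hilbertDist u v := fun {u v} hu hv => by
    have h0 := hilbertDist_nonneg hu.1 hv.1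
    have h1 : hilbertDist u v ≤ 1 := hilbertDist_le_one
    set x := D * hilbertDist u v with hx
    have hx0 : 0 ≤ x := by positivity
    have h2 : Real.exp x - 1 ≤ x * Real.exp x := by
      have h3 := Real.add_one_le_exp (-x)
      have h4 : Real.exp x * Real.exp (-x) = 1 := by rw [← Real.exp_add]; simp
      nlinarith [Real.exp_pos x]
    have h3 : Real.exp x ≤ Real.exp D := Real.exp_le_exp.2 (by nlinarith)
    have h4 := hh.le u hu v hv
    have h5 := hB v hv
    have h6 := hh.pos v hv
    rw [Complex.norm_real, Real.norm_of_nonneg h6.le] at h5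
    calc h u - h v ≤ (Real.exp x - 1) * h v := by linarith
      _ ≤ (x * Real.exp D) * |B| := by
        refine mul_le_mul (h2.trans (mul_le_mul_of_nonneg_left h3 hx0)) (h5.trans hle) h6.le
          (by positivity)
      _ = _ := by rw [hx]; ring
  have h1 : ‖(h u : ℂ) - h v‖ ≤ D * Real.exp D * |B| * hilbertDist u v := by
    rw [← Complex.ofReal_sub, Complex.norm_real, Real.norm_eq_abs, abs_le]
    have := key hv hu
    rw [hilbertDist_comm] at this
    exact ⟨by linarith, key hu hv⟩
  exact h1.trans (mul_le_mul_of_nonneg_left (hilbertDist_le_rpow hγ1 hu.1 hv.1) (by positivity))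

/-- Multiplication by a Hölder function whose reciprocal is Hölder is an invertible operator. -/
theorem exists_weight (hε : 0 < ε) (hγ : 0 < γ) {F F' : Vec d → ℂ}
    (hF : ∃ B H, HolderBound ε γ F B H) (hF' : ∃ B H, HolderBound ε γ F' B H)
    (hinv : ∀ v ∈ simplexGe d ε, F v * F' v = 1) :
    ∃ D : (HolderSpace d ε γ →L[ℂ] HolderSpace d ε γ)ˣ,
      (∀ φ v, ((D : HolderSpace d ε γ →L[ℂ] HolderSpace d ε γ) φ).toFun v = F v * φ.toFun v) ∧
      ∀ φ v, (((D⁻¹ : (HolderSpace d ε γ →L[ℂ] HolderSpace d ε γ)ˣ) :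
        HolderSpace d ε γ →L[ℂ] HolderSpace d ε γ) φ).toFun v = F' v * φ.toFun v := by
  obtain ⟨T, hT⟩ := HolderSpace.exists_mul hε hγ hF
  obtain ⟨T', hT'⟩ := HolderSpace.exists_mul hε hγ hF'
  have h1 : ∀ φ v, (T φ).toFun v = F v * φ.toFun v := fun φ v =>
    (hT φ v).trans (by simp only [HolderSpace.ext_coe])
  have h2 : ∀ φ v, (T' φ).toFun v = F' v * φ.toFun v := fun φ v =>
    (hT' φ v).trans (by simp only [HolderSpace.ext_coe])
  refine ⟨⟨T, T', ?_, ?_⟩, h1, h2⟩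
  · refine ContinuousLinearMap.ext fun φ => HolderSpace.toFun_injective fun v => ?_
    change (T (T' φ)).toFun v = φ.toFun v
    rw [h1, h2, ← mul_assoc, hinv v v.2, one_mul]
  · refine ContinuousLinearMap.ext fun φ => HolderSpace.toFun_injective fun v => ?_
    change (T' (T φ)).toFun v = φ.toFun v
    rw [h2, h1, ← mul_assoc, mul_comm (F' v), hinv v v.2, one_mul]

theorem Represents.congr {T : HolderSpace d ε γ →L[ℂ] HolderSpace d ε γ}
    {A A' : (Vec d → ℂ) → Vec d → ℂ} (h : Represents T A)
    (e : ∀ φ : HolderSpace d ε γ, ∀ v ∈ simplexGe d ε, A φ.ext v = A' φ.ext v) :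
    Represents T A' := fun φ v => by rw [h φ v, e φ v v.2]

section

variable {s : ℝ} {μ : Measure (Mat d)}

/-- The operator on `ℬ_γ` with kernel `exp(w log ‖g v‖)`. -/
def powOp (ε γ : ℝ) (μ : Measure (Mat d)) (w : ℂ) : HolderSpace d ε γ →L[ℂ] HolderSpace d ε γ :=
  HolderSpace.opOf ε γ (profileOp μ fun y => Complex.exp (w * y))

theorem represents_powOp (hε : 0 < ε) (hε1 : ε < 1) (hd : 0 < d) (hγ : 0 < γ) (hγ1 : γ ≤ 1)
    (hμ : ∀ᵐ g ∂μ, Good ε g) {w : ℂ} (hi : Integrable (fun g => matNorm g ^ w.re) μ) :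
    Represents (powOp ε γ μ w) (profileOp μ fun y => Complex.exp (w * y)) := by
  obtain ⟨T, hT, -⟩ := (dominates_exp hε hε1 hμ hd w hi).exists_represents hε hε1 hγ hγ1 hμ
  exact HolderSpace.represents_opOf ⟨T, hT⟩

theorem GoodLaw.represents_powOp {α : ℝ} (hε : 0 < ε) (hε1 : ε < 1) (hd : 0 < d) (hγ : 0 < γ)
    (hγ1 : γ ≤ 1) (hμ : GoodLaw ε s α μ) : Represents (powOp ε γ μ s) (transferOp μ s) :=
  (PosMat.represents_powOp hε hε1 hd hγ hγ1 hμ.good (by simpa using hμ.integrable)).congr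
    fun φ v hv => (transferOp_eq_profileOp hμ.good s _ hv.1).symm

theorem GoodLaw.powOp_pow {α : ℝ} (hε : 0 < ε) (hε1 : ε < 1) (hd : 0 < d) (hγ : 0 < γ)
    (hγ1 : γ ≤ 1) (hμ : GoodLaw ε s α μ) (n : ℕ) (φ : HolderSpace d ε γ) (v : simplexGe d ε) :
    ((powOp ε γ μ s ^ n) φ).toFun v = (transferOp μ s)^[n] φ.ext v := by
  induction n generalizing v with
  | zero => exact (φ.ext_coe v).symm
  | succ n ih =>
    rw [pow_succ', Function.iterate_succ_apply']
    change (powOp ε γ μ s ((powOp ε γ μ s ^ n) φ)).toFun v = _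
    rw [hμ.represents_powOp hε hε1 hd hγ hγ1]
    refine hμ.transferOp_congr (fun w hw => ?_) v.2.1 s
    rw [HolderSpace.ext_apply _ hw, ih]

/-- Integration against a probability measure on `𝒮_ε`, as a bounded functional. -/
theorem exists_integralCLM (hγ : 0 < γ) {ν : Measure (Vec d)} [IsProbabilityMeasure ν]
    (hν : ∀ᵐ v ∂ν, v ∈ simplexGe d ε) :
    ∃ ℓ : HolderSpace d ε γ →L[ℂ] ℂ, ∀ φ, ℓ φ = ∫ v, φ.ext v ∂ν := by
  have hi : ∀ φ : HolderSpace d ε γ, Integrable φ.ext ν := fun φ =>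
    integrable_of_bounded hν φ.measurable_ext ⟨_, (φ.holderBound hγ).1⟩
  refine ⟨LinearMap.mkContinuous
    { toFun := fun φ => ∫ v, φ.ext v ∂ν
      map_add' := fun φ ψ => by
        simp only [HolderSpace.ext_add]
        exact integral_add (hi φ) (hi ψ)
      map_smul' := fun c φ => by
        simp only [HolderSpace.ext_smul]
        exact integral_const_mul _ _ } 1 fun φ => ?_, fun φ => rfl⟩
  rw [one_mul]
  refine (norm_integral_le_of_norm_le_const (C := ‖φ‖) ?_).trans (by simp)
  filter_upwards [hν] with v hv using (φ.holderBound hγ).1 v hv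

variable [IsProbabilityMeasure μ] {k : ℝ} {ν : Measure (Vec d)} {r : Vec d → ℝ}

/-- The difference of the normalised iterates and their limit, weighted by the eigenfunction. -/
theorem LeadingData.normIter_holderBound {α : ℝ} (hε : 0 < ε) (hε1 : ε < 1) (hμ : GoodLaw ε s α μ)
    (h : LeadingData ε s μ k ν r) {φ : Vec d → ℂ} (hφ : Measurable φ)
    (hφB : ∃ B, ∀ v ∈ simplexGe d ε, ‖(r v : ℂ) * φ v‖ ≤ B) {N : ℕ} {δ : ℝ}
    (hmod : HasMod ε γ (normIter μ s r φ N) δ δ) :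
    HolderBound ε γ (fun v => normIter μ s r φ N v -
      (∫ u, (r u : ℂ) * φ u ∂ν) / ((∫ u, r u ∂ν : ℝ) : ℂ)) δ δ := by
  have hp := h.law.prob
  have hmem := h.law.ae_mem hμ
  have hrpos := h.integral_pos hε hμ
  have hrm : Measurable fun u => (r u : ℂ) * φ u :=
    (Complex.measurable_ofReal.comp h.measurable).mul hφ
  have hkN : (k : ℂ) ^ N ≠ 0 := pow_ne_zero _ (by exact_mod_cast h.law.pos.ne')
  have e0 : ∀ v ∈ simplexGe d ε, (r v : ℂ) * normIter μ s r φ N v =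
      ((k : ℂ) ^ N)⁻¹ * (transferOp μ s)^[N] (fun u => (r u : ℂ) * φ u) v := fun v hv => by
    have hrv : (r v : ℂ) ≠ 0 := by exact_mod_cast (h.pos hε hv.1).ne'
    rw [normIter, h.iterate hμ N hv.1]
    push_cast
    field_simp
  have e1 : ∫ v, (r v : ℂ) * normIter μ s r φ N v ∂ν = ∫ u, (r u : ℂ) * φ u ∂ν := by
    rw [integral_congr_ae (hmem.mono e0), integral_const_mul,
      h.law.integral_iterate hε hε1 hμ hrm hφB, inv_mul_cancel_left₀ hkN]
  have ir : Integrable r ν := by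
    have := (integrable_of_bounded hmem (Complex.measurable_ofReal.comp h.measurable)
      h.logLip.bounded).re
    simpa using this
  have i1 : Integrable (fun v => (r v : ℂ) * normIter μ s r φ N v) ν := by
    refine (integrable_congr (hmem.mono e0)).2 (Integrable.const_mul ?_ _)
    exact integrable_of_bounded hmem (measurable_iterate_transferOp hrm s N)
      (hμ.bounded_iterate hε hε1 hφB N)
  refine ⟨fun v hv => ?_, fun u hu v hv => ?_⟩
  · have hne : ((∫ u, r u ∂ν : ℝ) : ℂ) ≠ 0 := by exact_mod_cast hrpos.ne'
    have e2 : ((∫ u, r u ∂ν : ℝ) : ℂ) * (normIter μ s r φ N v -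
        (∫ u, (r u : ℂ) * φ u ∂ν) / ((∫ u, r u ∂ν : ℝ) : ℂ)) =
        ∫ u, (r u : ℂ) * (normIter μ s r φ N v - normIter μ s r φ N u) ∂ν := by
      have i2 : Integrable (fun u => (r u : ℂ) * normIter μ s r φ N v) ν := ir.ofReal.mul_const _
      simp only [mul_sub]
      rw [mul_div_cancel₀ _ hne, integral_sub i2 i1, e1, integral_mul_const,
        integral_complex_ofReal]
    have h2 : (∫ u, r u ∂ν) * ‖normIter μ s r φ N v -
        (∫ u, (r u : ℂ) * φ u ∂ν) / ((∫ u, r u ∂ν : ℝ) : ℂ)‖ ≤ (∫ u, r u ∂ν) * δ := by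
      have e3 : ∀ x : ℂ, (∫ u, r u ∂ν) * ‖x‖ = ‖((∫ u, r u ∂ν : ℝ) : ℂ) * x‖ := fun x => by
        rw [norm_mul, Complex.norm_real, Real.norm_of_nonneg hrpos.le]
      rw [e3, e2, ← integral_mul_const]
      refine norm_integral_le_of_norm_le (ir.mul_const δ) ?_
      filter_upwards [hmem] with u hu
      have hr := (h.pos hε hu.1).le
      rw [norm_mul, Complex.norm_real, Real.norm_of_nonneg hr]
      exact mul_le_mul_of_nonneg_left (hmod v hv u hu).1 hr
    exact le_of_mul_le_mul_left h2 hrpos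
  · rw [sub_sub_sub_cancel_right]
    exact (hmod u hu v hv).2

/-- The spectral gap: on `ℬ_γ` the transfer operator is `k M + L`, where
`M φ = (ν(φ) / ν(r)) r` and `ρ(L) < k`. -/
theorem LeadingData.exists_split (hε : 0 < ε) (hε1 : ε < 1) (hd : 0 < d) (hγ : 0 < γ) (hγ1 : γ ≤ 1)
    (hμ : GoodLaw ε s (contr ε) μ) (h : LeadingData ε s μ k ν r) :
    ∃ M L : HolderSpace d ε γ →L[ℂ] HolderSpace d ε γ,
      Represents M (fun φ v => (∫ u, φ u ∂ν) / ((∫ u, r u ∂ν : ℝ) : ℂ) * r v) ∧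
      SpectralSplit (powOp ε γ μ s) k M L ∧
      ∃ b, 0 < b ∧ b < k ∧ spectralRadius ℂ L ≤ ENNReal.ofReal b := by
  have hcs := HolderSpace.completeSpace (d := d) hε hγ
  have hp := h.law.prob
  have hmem := h.law.ae_mem hμ
  have hk := h.law.pos
  have hrpos := h.integral_pos hε hμ
  have hne : ((∫ u, r u ∂ν : ℝ) : ℂ) ≠ 0 := by exact_mod_cast hrpos.ne'
  have hD0 : 0 ≤ |s| * (2 / ε) := mul_nonneg (abs_nonneg s) (by positivity)
  obtain ⟨B, H, hB0, hH0, hBH⟩ := h.logLip.holderBound (γ := γ) hD0 hγ1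
  obtain ⟨B', H', hB0', hH0', hBH'⟩ := h.logLip.inv.holderBound (γ := γ) hD0 hγ1
  obtain ⟨ℓ, hℓ⟩ := exists_integralCLM (d := d) (ε := ε) hγ hmem
  set R : HolderSpace d ε γ := HolderSpace.mk hε hγ (fun v => (r v : ℂ)) ⟨B, H, hBH⟩ with hR
  set c : ℂ := ((∫ u, r u ∂ν : ℝ) : ℂ) with hc
  have hℓR : ℓ R = c := by
    rw [hℓ, hc, ← integral_complex_ofReal]
    exact integral_congr_ae (hmem.mono fun v hv => HolderSpace.mk_ext hε hγ _ _ hv)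
  set M : HolderSpace d ε γ →L[ℂ] HolderSpace d ε γ := ℓ.smulRight (c⁻¹ • R) with hM
  have hMφ : ∀ φ v, (M φ).toFun v = ℓ φ / c * r v := fun φ v => by
    rw [hM, ContinuousLinearMap.smulRight_apply, HolderSpace.toFun_smul, HolderSpace.toFun_smul, hR,
      HolderSpace.mk_toFun]
    ring
  set T := powOp ε γ μ s with hT
  have hTrep := hμ.represents_powOp hε hε1 hd hγ hγ1
  have hℓ1 : ℓ (c⁻¹ • R) = 1 := by rw [map_smul, hℓR, smul_eq_mul, inv_mul_cancel₀ hne]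
  have hTR : T R = (k : ℂ) • R := HolderSpace.toFun_injective fun v => by
    rw [hTrep, hμ.transferOp_congr (ψ := fun v => (r v : ℂ))
      (fun w hw => HolderSpace.mk_ext hε hγ _ _ hw) v.2.1, transferOp_ofReal, h.eigen v v.2.1,
      HolderSpace.toFun_smul, hR, HolderSpace.mk_toFun]
    push_cast; rfl
  have hℓT : ∀ φ, ℓ (T φ) = k * ℓ φ := fun φ => by
    rw [hℓ, hℓ, ← h.law.integral_transferOp hε hε1 hμ φ.measurable_ext ⟨_, (φ.holderBound hγ).1⟩]
    refine integral_congr_ae (hmem.mono fun v hv => ?_)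
    rw [HolderSpace.ext_apply _ hv]
    exact hTrep φ ⟨v, hv⟩
  have hMM : M * M = M := (isRankOneProjection_smulRight hℓ1).1
  have hTM : T * M = (k : ℂ) • M := ContinuousLinearMap.ext fun φ => by
    change T (M φ) = (k : ℂ) • M φ
    rw [hM, ContinuousLinearMap.smulRight_apply, map_smul, map_smul, hTR]
    module
  have hMT : M * T = (k : ℂ) • M := ContinuousLinearMap.ext fun φ => by
    change M (T φ) = (k : ℂ) • M φ
    rw [hM, ContinuousLinearMap.smulRight_apply, ContinuousLinearMap.smulRight_apply, hℓT]
    module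
  have hsplit : SpectralSplit T k M (T - (k : ℂ) • M) :=
    ⟨by abel, ⟨ℓ, _, hℓ1, hM⟩, by rw [mul_sub, hMT, mul_smul_comm, hMM, sub_self],
      by rw [sub_mul, hTM, smul_mul_assoc, hMM, sub_self]⟩
  refine ⟨M, T - (k : ℂ) • M, fun φ v => by rw [hMφ, hℓ], hsplit, ?_⟩
  obtain ⟨n, hn, C, hC, θ, hθ0, hθ1, hrate⟩ := exists_rate d hε hε1 hγ hγ1 s
  -- the norm of `L ^ ((n + 1) j)` decays faster than the powers of `k`
  set C' := (B + (B + H)) * (C * (2 * B' + (B' + H'))) with hC'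
  have hpow : ∀ j : ℕ, 1 ≤ j →
      ‖(T - (k : ℂ) • M) ^ ((n + 1) * j)‖ ≤ k ^ ((n + 1) * j) * (C' * θ ^ j) := by
    intro j hj
    set N := (n + 1) * j with hN
    have hN1 : 1 ≤ N := Nat.mul_pos n.succ_pos hj
    have hkN : 0 ≤ k ^ N := pow_nonneg hk.le N
    refine ContinuousLinearMap.opNorm_le_bound _ (by positivity) fun φ => ?_
    have hφ0 := norm_nonneg φ
    set ψ : Vec d → ℂ := fun v => ((r v)⁻¹ : ℝ) * φ.ext v with hψ
    have hψm : Measurable ψ :=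
      (Complex.measurable_ofReal.comp h.measurable.inv).mul φ.measurable_ext
    have hψB : HolderBound ε γ ψ (B' * ‖φ‖) ((B' + H') * ‖φ‖) :=
      (hBH'.mul hB0' (φ.holderBound hγ)).mono le_rfl (by linarith)
    have hrψ : ∀ v ∈ simplexGe d ε, (r v : ℂ) * ψ v = φ.ext v := fun v hv => by
      have : (r v : ℂ) ≠ 0 := by exact_mod_cast (h.pos hε hv.1).ne'
      rw [hψ]
      push_cast
      rw [mul_inv_cancel_left₀ this]
    set δ := C * θ ^ j * (2 * (B' * ‖φ‖) + (B' + H') * ‖φ‖) with hδ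
    have hmod := hrate μ inferInstance hμ r h.measurable (h.logLip' hε) ψ hψm _ _ (by positivity)
      (by positivity) hψB.hasMod j
    have hkey := h.normIter_holderBound hε hε1 hμ hψm ⟨‖φ‖, fun v hv => by
      rw [hrψ v hv]; exact (φ.holderBound hγ).1 v hv⟩ hmod
    have hprod := (HolderBound.const (ε := ε) (γ := γ) (d := d) ((k : ℂ) ^ N)).mul (norm_nonneg _)
      (hBH.mul hB0 hkey)
    have hδ0 : 0 ≤ δ := by positivity
    refine (HolderSpace.norm_le_of_holderBound ?_ ?_ (fun v => ?_) hprod).trans ?_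
    · positivity
    · positivity
    · have e1 := hsplit.pow hN1
      have e2 : ((T - (k : ℂ) • M) ^ N) φ = (T ^ N) φ - ((k : ℂ) ^ N) • M φ := by
        rw [e1]; simp
      have e3 : (∫ u, (r u : ℂ) * ψ u ∂ν) = ℓ φ := by
        rw [hℓ]; exact integral_congr_ae (hmem.mono hrψ)
      have hrv : (r v : ℂ) ≠ 0 := by exact_mod_cast (h.pos hε v.2.1).ne'
      have hkN' : (k : ℂ) ^ N ≠ 0 := pow_ne_zero _ (by exact_mod_cast hk.ne')
      rw [e2, HolderSpace.toFun_sub, HolderSpace.toFun_smul, hMφ, hμ.powOp_pow hε hε1 hd hγ hγ1, e3,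
        normIter, h.iterate hμ N v.2.1, hμ.iterate_congr hrψ N v v.2, ← hc]
      push_cast
      field_simp
    · rw [norm_pow, Complex.norm_real, Real.norm_of_nonneg hk.le, hC']
      apply le_of_eq
      ring
  have hC'0 : 0 ≤ C' := by positivity
  have hlim : Tendsto (fun j : ℕ => C' * θ ^ j) atTop (𝓝 0) := by
    simpa using (tendsto_pow_atTop_nhds_zero_of_lt_one hθ0 hθ1).const_mul C'
  obtain ⟨j, hj1, hj2⟩ := ((hlim.eventually (gt_mem_nhds (show (0 : ℝ) < 1 / 2 by norm_num))).and
    (eventually_ge_atTop 1)).exists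
  obtain ⟨N, hN⟩ := Nat.exists_eq_add_of_le' (Nat.mul_pos n.succ_pos hj2 : 1 ≤ (n + 1) * j)
  set q : ℝ := (1 / 2) ^ (1 / ((N : ℝ) + 1)) with hq
  have hq0 : 0 < q := by positivity
  have hq1 : q < 1 := Real.rpow_lt_one (by norm_num) (by norm_num) (by positivity)
  have hqN : q ^ (N + 1) = 1 / 2 := by
    rw [hq, ← Real.rpow_natCast, ← Real.rpow_mul (by norm_num)]
    push_cast
    rw [one_div_mul_cancel (by positivity), Real.rpow_one]
  refine ⟨k * q, by positivity, mul_lt_of_lt_one_right hk hq1,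
    spectralRadius_le_of_norm_pow_le (n := N) (by positivity) ?_⟩
  rw [mul_pow, hqN, ← hN]
  exact (hpow j hj2).trans (mul_le_mul_of_nonneg_left hj1.le (pow_nonneg hk.le _))

end

/-! ### Analytic dependence of the transfer operator on the exponent -/

section

variable {μ : Measure (Mat d)}

theorem sq_mul_exp_le {η : ℝ} (hη : 0 < η) (y : ℝ) :
    |y| ≤ η⁻¹ * Real.exp (η * |y|) ∧ |y| ^ 2 ≤ 2 * (η⁻¹ ^ 2 * Real.exp (η * |y|)) := by
  have hy : 0 ≤ η * |y| := by positivity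
  have h := Real.quadratic_le_exp_of_nonneg hy
  constructor
  · rw [inv_mul_eq_div, le_div_iff₀ hη]
    nlinarith
  · rw [← mul_assoc, inv_pow, ← div_eq_mul_inv, div_mul_eq_mul_div, le_div_iff₀ (by positivity)]
    nlinarith

theorem exp_mul_abs_le (σ η y : ℝ) :
    Real.exp (σ * y) * Real.exp (η * |y|) ≤ Real.exp ((σ + η) * y) + Real.exp ((σ - η) * y) := by
  rw [← Real.exp_add]
  rcases abs_cases y with ⟨h, -⟩ | ⟨h, -⟩
  · rw [h, show σ * y + η * y = (σ + η) * y by ring]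
    exact le_add_of_nonneg_right (Real.exp_pos _).le
  · rw [h, show σ * y + η * -y = (σ - η) * y by ring]
    exact le_add_of_nonneg_left (Real.exp_pos _).le

/-- A profile bounded, with its derivative, by a multiple of `e^{(σ+η)y} + e^{(σ-η)y}` is
dominated. -/
theorem dominates_of_le_exp (hε : 0 < ε) (hε1 : ε < 1) (hμ : ∀ᵐ g ∂μ, Good ε g) (hd : 0 < d)
    {G G' : ℝ → ℂ} (hG : ∀ y, HasDerivAt G (G' y) y) {C σ η : ℝ} (hC : 0 ≤ C)
    (h1 : Integrable (fun g => matNorm g ^ (σ + η)) μ)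
    (h2 : Integrable (fun g => matNorm g ^ (σ - η)) μ)
    (hb : ∀ y, ‖G y‖ ≤ C * (Real.exp (σ * y) * Real.exp (η * |y|)) ∧
      ‖G' y‖ ≤ C * (Real.exp (σ * y) * Real.exp (η * |y|))) :
    Dominates ε μ G G' fun g => C * (ε ^ (-|σ + η|) * matNorm g ^ (σ + η) +
      ε ^ (-|σ - η|) * matNorm g ^ (σ - η)) := by
  refine ⟨hG, ((h1.const_mul _).add (h2.const_mul _)).const_mul C, ?_⟩
  filter_upwards [hμ] with g hg y hy1 hy2
  have hg0 := matNorm_pos hg.pos ⟨0, hd⟩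
  have h3 := mul_le_mul_of_nonneg_left ((exp_mul_abs_le σ η y).trans (add_le_add
    (exp_mul_le_matNorm_rpow hε hε1 hg0 (σ + η) hy1 hy2)
    (exp_mul_le_matNorm_rpow hε hε1 hg0 (σ - η) hy1 hy2))) hC
  exact ⟨(hb y).1.trans h3, (hb y).2.trans h3⟩

theorem hasDerivAt_cexp_mul (w : ℂ) (y : ℝ) :
    HasDerivAt (fun y : ℝ => Complex.exp (w * y)) (w * Complex.exp (w * y)) y := by
  have h1 : HasDerivAt (fun y : ℝ => w * (y : ℂ)) (w * 1) y :=
    (Complex.ofRealCLM.hasDerivAt (x := y)).const_mul w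
  have := h1.cexp
  rw [mul_one, mul_comm] at this
  exact this

theorem hasDerivAt_mul_cexp_mul (w : ℂ) (y : ℝ) :
    HasDerivAt (fun y : ℝ => (y : ℂ) * Complex.exp (w * y))
      (Complex.exp (w * y) + y * (w * Complex.exp (w * y))) y := by
  have h1 : HasDerivAt (fun y : ℝ => (y : ℂ)) 1 y := Complex.ofRealCLM.hasDerivAt (x := y)
  exact (h1.fun_mul (hasDerivAt_cexp_mul w y)).congr_deriv (by rw [one_mul])

theorem norm_exp_sub_one_le (x : ℂ) : ‖Complex.exp x - 1‖ ≤ ‖x‖ * Real.exp ‖x‖ := by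
  simpa using Complex.norm_exp_sub_sum_le_norm_mul_exp x 1

theorem norm_exp_sub_one_sub_le (x : ℂ) :
    ‖Complex.exp x - 1 - x‖ ≤ ‖x‖ ^ 2 * Real.exp ‖x‖ := by
  simpa [Finset.sum_range_succ, sub_sub] using Complex.norm_exp_sub_sum_le_norm_mul_exp x 2

/-- The second-order remainder `e^{(w+h)y} - e^{wy} - h y e^{wy}` and its derivative are
`O(|h|²)`. -/
theorem norm_remainder_le {η : ℝ} (hη : 0 < η) (w : ℂ) {h : ℂ} (hh : ‖h‖ ≤ η) (y : ℝ) :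
    ‖Complex.exp ((w + h) * y) - Complex.exp (w * y) - h * (y * Complex.exp (w * y))‖ ≤
        ‖h‖ ^ 2 * ((1 + ‖w‖) * (2 * η⁻¹ ^ 2) + η⁻¹) *
          (Real.exp (w.re * y) * Real.exp (2 * η * |y|)) ∧
    ‖(w + h) * Complex.exp ((w + h) * y) - w * Complex.exp (w * y) -
        h * (Complex.exp (w * y) + y * (w * Complex.exp (w * y)))‖ ≤
        ‖h‖ ^ 2 * ((1 + ‖w‖) * (2 * η⁻¹ ^ 2) + η⁻¹) *
          (Real.exp (w.re * y) * Real.exp (2 * η * |y|)) := by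
  have e0 : Complex.exp ((w + h) * y) = Complex.exp (w * y) * Complex.exp (h * y) := by
    rw [← Complex.exp_add]; ring_nf
  have hn : ‖h * (y : ℂ)‖ = ‖h‖ * |y| := by rw [norm_mul, Complex.norm_real, Real.norm_eq_abs]
  have hexp : ‖Complex.exp (w * y)‖ = Real.exp (w.re * y) := by
    rw [Complex.norm_exp, Complex.re_mul_ofReal]
  have h1 := norm_exp_sub_one_le (h * y)
  have h2 := norm_exp_sub_one_sub_le (h * y)
  obtain ⟨h3, h4⟩ := sq_mul_exp_le hη y
  have h5 : Real.exp (‖h‖ * |y|) ≤ Real.exp (η * |y|) :=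
    Real.exp_le_exp.2 (mul_le_mul_of_nonneg_right hh (abs_nonneg y))
  have h6 : Real.exp (2 * η * |y|) = Real.exp (η * |y|) * Real.exp (η * |y|) := by
    rw [← Real.exp_add]; ring_nf
  rw [hn] at h1 h2
  have hw := norm_nonneg w
  have hh0 := norm_nonneg h
  set E := Real.exp (η * |y|) with hE
  have hE0 : 0 < E := Real.exp_pos _
  have hη0 : 0 < η⁻¹ := inv_pos.2 hη
  -- bounds for the two factors
  have h7 : ‖Complex.exp (h * y) - 1‖ ≤ ‖h‖ * (η⁻¹ * (E * E)) := by
    refine h1.trans ?_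
    rw [mul_assoc]
    refine mul_le_mul_of_nonneg_left ?_ hh0
    rw [← mul_assoc]
    exact mul_le_mul h3 h5 (Real.exp_pos _).le (by positivity)
  have h8 : ‖Complex.exp (h * y) - 1 - h * y‖ ≤ ‖h‖ ^ 2 * (2 * η⁻¹ ^ 2 * (E * E)) := by
    refine h2.trans ?_
    rw [mul_pow, mul_assoc]
    refine mul_le_mul_of_nonneg_left ?_ (by positivity)
    have := mul_le_mul h4 h5 (Real.exp_pos _).le (by positivity)
    linarith
  set W := Real.exp (w.re * y) with hW
  have hW0 : 0 < W := Real.exp_pos _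
  have e1 : Complex.exp ((w + h) * y) - Complex.exp (w * y) - h * (y * Complex.exp (w * y)) =
      Complex.exp (w * y) * (Complex.exp (h * y) - 1 - h * y) := by rw [e0]; ring
  have e2 : (w + h) * Complex.exp ((w + h) * y) - w * Complex.exp (w * y) -
        h * (Complex.exp (w * y) + y * (w * Complex.exp (w * y))) =
      Complex.exp (w * y) * (w * (Complex.exp (h * y) - 1 - h * y) +
        h * (Complex.exp (h * y) - 1)) := by rw [e0]; ring
  have key : ∀ {x : ℂ} {c : ℝ}, ‖x‖ ≤ ‖h‖ ^ 2 * (c * (E * E)) →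
      c ≤ (1 + ‖w‖) * (2 * η⁻¹ ^ 2) + η⁻¹ →
      ‖Complex.exp (w * y) * x‖ ≤ ‖h‖ ^ 2 * ((1 + ‖w‖) * (2 * η⁻¹ ^ 2) + η⁻¹) * (W * (E * E)) := by
    intro x c hx hc
    rw [norm_mul, hexp, mul_left_comm]
    refine mul_le_mul_of_nonneg_left (hx.trans ?_) hW0.le
    rw [mul_assoc]
    exact mul_le_mul_of_nonneg_left (mul_le_mul_of_nonneg_right hc (by positivity))
      (by positivity)
  have hp : 0 < 2 * η⁻¹ ^ 2 := by positivity
  rw [e1, e2, h6]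
  refine ⟨key h8 (by nlinarith), key (c := ‖w‖ * (2 * η⁻¹ ^ 2) + η⁻¹) ?_ (by nlinarith)⟩
  refine (norm_add_le _ _).trans ?_
  rw [norm_mul, norm_mul]
  have h9 := mul_le_mul_of_nonneg_left h8 hw
  have h10 := mul_le_mul_of_nonneg_left h7 hh0
  nlinarith

/-- Differentiability in operator norm: the Taylor remainder of `w ↦ e^{wy}` is a dominated profile
of size `O(|h|²)`. -/
theorem differentiableAt_powOp (hε : 0 < ε) (hε1 : ε < 1) (hd : 0 < d) (hγ : 0 < γ) (hγ1 : γ ≤ 1)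
    (hμ : ∀ᵐ g ∂μ, Good ε g) {w : ℂ}
    (hi : ∀ᶠ σ in 𝓝 w.re, Integrable (fun g => matNorm g ^ σ) μ) :
    DifferentiableAt ℂ (powOp ε γ μ) w := by
  obtain ⟨η₀, hη₀, hball⟩ := Metric.eventually_nhds_iff.1 hi
  set η := η₀ / 3 with hηdef
  have hη : 0 < η := by positivity
  have hint : ∀ σ, |σ - w.re| ≤ 2 * η → Integrable (fun g => matNorm g ^ σ) μ := fun σ hσ =>
    hball (by rw [Real.dist_eq]; linarith)
  have i0 : Integrable (fun g => matNorm g ^ w.re) μ := hint _ (by simpa using hη.le)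
  have i1 : Integrable (fun g => matNorm g ^ (w.re + 2 * η)) μ :=
    hint _ (by rw [add_sub_cancel_left, abs_of_pos (by positivity)])
  have i2 : Integrable (fun g => matNorm g ^ (w.re - 2 * η)) μ :=
    hint _ (by rw [sub_sub_cancel_left, abs_neg, abs_of_pos (by positivity)])
  have hw := norm_nonneg w
  have hη0 : 0 < η⁻¹ := inv_pos.2 hη
  -- the operator with profile `y e^{wy}` is the derivative
  have hD : Dominates ε μ (fun y : ℝ => (y : ℂ) * Complex.exp (w * y))
      (fun y => Complex.exp (w * y) + y * (w * Complex.exp (w * y))) _ :=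
    dominates_of_le_exp hε hε1 hμ hd (hasDerivAt_mul_cexp_mul w) (σ := w.re) (η := 2 * η)
      (C := 1 + (1 + ‖w‖) * η⁻¹) (by positivity) i1 i2 fun y => by
        have hexp : ‖Complex.exp (w * y)‖ = Real.exp (w.re * y) := by
          rw [Complex.norm_exp, Complex.re_mul_ofReal]
        obtain ⟨h3, -⟩ := sq_mul_exp_le hη y
        have h4 : Real.exp (η * |y|) ≤ Real.exp (2 * η * |y|) :=
          Real.exp_le_exp.2 (by nlinarith [abs_nonneg y])
        have h5 : 1 ≤ Real.exp (2 * η * |y|) := Real.one_le_exp (by positivity)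
        have h6 : |y| ≤ η⁻¹ * Real.exp (2 * η * |y|) :=
          h3.trans (mul_le_mul_of_nonneg_left h4 hη0.le)
        have hW := Real.exp_pos (w.re * y)
        have h7 : |y| * Real.exp (w.re * y) ≤
            η⁻¹ * (Real.exp (w.re * y) * Real.exp (2 * η * |y|)) := by
          have := mul_le_mul_of_nonneg_right h6 hW.le
          linarith
        have h8 : Real.exp (w.re * y) ≤ Real.exp (w.re * y) * Real.exp (2 * η * |y|) :=
          le_mul_of_one_le_right hW.le h5
        have h9 := mul_le_mul_of_nonneg_left h7 hw
        have h10 : 0 ≤ η⁻¹ * (Real.exp (w.re * y) * Real.exp (2 * η * |y|)) := by positivity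
        constructor
        · rw [norm_mul, Complex.norm_real, Real.norm_eq_abs, hexp]
          nlinarith
        · refine (norm_add_le _ _).trans ?_
          rw [norm_mul, norm_mul, Complex.norm_real, Real.norm_eq_abs, hexp]
          nlinarith
  obtain ⟨T, hT, -⟩ := hD.exists_represents hε hε1 hγ hγ1 hμ
  set C := (1 + ‖w‖) * (2 * η⁻¹ ^ 2) + η⁻¹ with hC
  have hC0 : 0 ≤ C := by positivity
  set b₁ : Mat d → ℝ := fun g => ε ^ (-|w.re + 2 * η|) * matNorm g ^ (w.re + 2 * η) +
      ε ^ (-|w.re - 2 * η|) * matNorm g ^ (w.re - 2 * η) with hb₁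
  have hrem : ∀ h : ℂ, ‖h‖ ≤ η → ‖powOp ε γ μ (w + h) - powOp ε γ μ w - h • T‖ ≤
      2 * ((2 / ε + 1) * (C * |∫ g, b₁ g ∂μ|)) * ‖h‖ ^ 2 := by
    intro h hh
    have ih : Integrable (fun g => matNorm g ^ (w + h).re) μ := hint _ (by
      rw [Complex.add_re, add_sub_cancel_left]
      linarith [Complex.abs_re_le_norm h])
    have hR : Dominates ε μ (fun y : ℝ => Complex.exp ((w + h) * y) - Complex.exp (w * y) -
          h * (y * Complex.exp (w * y)))
        (fun y => (w + h) * Complex.exp ((w + h) * y) - w * Complex.exp (w * y) -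
          h * (Complex.exp (w * y) + y * (w * Complex.exp (w * y)))) _ :=
      dominates_of_le_exp hε hε1 hμ hd (fun y => ((hasDerivAt_cexp_mul (w + h) y).sub
        (hasDerivAt_cexp_mul w y)).sub ((hasDerivAt_mul_cexp_mul w y).const_mul h))
        (σ := w.re) (η := 2 * η) (C := ‖h‖ ^ 2 * C) (by positivity) i1 i2
        (norm_remainder_le hη w hh)
    obtain ⟨S, hS, hSn⟩ := hR.exists_represents hε hε1 hγ hγ1 hμ
    have e : powOp ε γ μ (w + h) - powOp ε γ μ w - h • T = S := by
      refine HolderSpace.represents_unique (fun φ v => ?_) hS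
      change (powOp ε γ μ (w + h) φ - powOp ε γ μ w φ - h • T φ).toFun v = _
      rw [HolderSpace.toFun_sub, HolderSpace.toFun_sub, HolderSpace.toFun_smul,
        represents_powOp hε hε1 hd hγ hγ1 hμ ih φ v, represents_powOp hε hε1 hd hγ hγ1 hμ i0 φ v,
        hT φ v]
      have hφ := φ.measurable_ext
      have hB := (φ.holderBound hγ).1
      have j1 := (dominates_exp hε hε1 hμ hd (w + h) ih).integrable_profile hε hμ hφ hB v.2.1
      have j2 := (dominates_exp hε hε1 hμ hd w i0).integrable_profile hε hμ hφ hB v.2.1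
      have j3 := hD.integrable_profile hε hμ hφ hB v.2.1
      simp only [profileOp]
      rw [← integral_sub j1 j2, ← integral_const_mul]
      refine (integral_sub (j1.sub j2) (j3.const_mul h)).symm.trans
        (integral_congr_ae (Eventually.of_forall fun g => ?_))
      simp only [Pi.sub_apply]
      ring
    rw [e]
    refine hSn.trans (le_of_eq ?_)
    rw [integral_const_mul, abs_mul, abs_of_nonneg (show 0 ≤ ‖h‖ ^ 2 * C by positivity)]
    ring
  refine HasDerivAt.differentiableAt (f' := T) ?_
  rw [hasDerivAt_iff_isLittleO_nhds_zero]
  refine (Asymptotics.IsBigO.of_bound (g := fun h : ℂ => ‖h‖ ^ 2)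
    (2 * ((2 / ε + 1) * (C * |∫ g, b₁ g ∂μ|))) ?_).trans_isLittleO ?_
  · filter_upwards [Metric.closedBall_mem_nhds (0 : ℂ) hη] with h hh
    rw [Real.norm_of_nonneg (by positivity)]
    exact hrem h (by simpa using hh)
  · exact Asymptotics.isLittleO_norm_pow_id one_lt_two

/-- The transfer operators form an analytic family on the interior of the domain of moments. -/
theorem analyticAt_powOp (hε : 0 < ε) (hε1 : ε < 1) (hd : 0 < d) (hγ : 0 < γ) (hγ1 : γ ≤ 1)
    (hμ : ∀ᵐ g ∂μ, Good ε g) {w : ℂ}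
    (hi : ∀ᶠ σ in 𝓝 w.re, Integrable (fun g => matNorm g ^ σ) μ) :
    AnalyticAt ℂ (powOp ε γ μ) w := by
  have := HolderSpace.completeSpace (d := d) hε hγ
  refine Complex.analyticAt_iff_eventually_differentiableAt.2 ?_
  filter_upwards [Complex.continuous_re.continuousAt.eventually (eventually_eventually_nhds.2 hi)]
    with z hz using differentiableAt_powOp hε hε1 hd hγ hγ1 hμ hz

end

/-! ### Operators of the coefficients as conjugates of transfer operators -/

theorem holderBound_log_dotProduct (hε : 0 < ε) (hγ1 : γ ≤ 1) {f : Vec d} (hf : f ∈ simplex d) :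
    ∃ B H, HolderBound ε γ (fun v => (Real.log (f ⬝ᵥ v) : ℂ)) B H := by
  refine ⟨-Real.log ε, 2 / ε, fun v hv => ?_, fun u hu v hv => ?_⟩
  · obtain ⟨h1, h2⟩ := dotProduct_mem_Icc hf hv
    have h3 := Real.log_le_log hε h1
    rw [Complex.norm_real, Real.norm_eq_abs, abs_of_nonpos
      (Real.log_nonpos (hε.le.trans h1) h2)]
    linarith
  · have key : ∀ {u v : Vec d}, u ∈ simplexGe d ε → v ∈ simplexGe d ε →
        Real.log (f ⬝ᵥ u) - Real.log (f ⬝ᵥ v) ≤ 2 / ε * hilbertDist u v := fun {u v} hu hv => by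
      have h := dotProduct_le_exp_mul hε hf.1 hu hv
      have h1 := hε.trans_le (hu.2 f hf)
      have h2 := hε.trans_le (hv.2 f hf)
      have h3 := Real.log_le_log h1 h
      rw [Real.log_mul (Real.exp_pos _).ne' h2.ne', Real.log_exp] at h3
      linarith
    have h1 : ‖(Real.log (f ⬝ᵥ u) : ℂ) - Real.log (f ⬝ᵥ v)‖ ≤ 2 / ε * hilbertDist u v := by
      rw [← Complex.ofReal_sub, Complex.norm_real, Real.norm_eq_abs, abs_le]
      have := key hv hu
      rw [hilbertDist_comm] at this
      exact ⟨by linarith, key hu hv⟩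
    exact h1.trans (mul_le_mul_of_nonneg_left (hilbertDist_le_rpow hγ1 hu.1 hv.1) (by positivity))

/-- The exponential of a multiplication operator is multiplication by the exponential. -/
theorem exp_mul_toFun (hε : 0 < ε) (hγ : 0 < γ)
    {T : HolderSpace d ε γ →L[ℂ] HolderSpace d ε γ} {F : Vec d → ℂ}
    (hT : ∀ φ v, (T φ).toFun v = F v * φ.toFun v) (φ : HolderSpace d ε γ) (v : simplexGe d ε) :
    ((NormedSpace.exp T) φ).toFun v = Complex.exp (F v) * φ.toFun v := by
  have := HolderSpace.completeSpace (d := d) hε hγ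
  have hpow : ∀ n : ℕ, ∀ w, ((T ^ n) φ).toFun w = F w ^ n * φ.toFun w := fun n => by
    induction n with
    | zero => intro w; simp
    | succ n ih =>
      intro w
      rw [pow_succ']
      change (T ((T ^ n) φ)).toFun w = _
      rw [hT, ih, pow_succ']
      ring
  have h1 := NormedSpace.exp_series_hasSum_exp' (𝕂 := ℂ) T
  have h2 := (HolderSpace.evalCLM v).hasSum
    ((ContinuousLinearMap.apply ℂ (HolderSpace d ε γ) φ).hasSum h1)
  have h3 := (NormedSpace.exp_series_hasSum_exp' (𝕂 := ℂ) (F v)).mul_right (φ.toFun v)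
  rw [← Complex.exp_eq_exp_ℂ] at h3
  refine h2.unique (h3.congr_fun fun n => ?_)
  change ((n.factorial : ℂ)⁻¹ • (T ^ n) φ).toFun v = _
  rw [HolderSpace.toFun_smul, hpow, smul_eq_mul, mul_assoc]

/-- Multiplication by `⟨f, ·⟩^z` is an analytic family of invertible operators. -/
theorem exists_coeffWeight (hε : 0 < ε) (hγ : 0 < γ) (hγ1 : γ ≤ 1) {f : Vec d}
    (hf : f ∈ simplex d) : ∃ U : ℂ → (HolderSpace d ε γ →L[ℂ] HolderSpace d ε γ)ˣ,
      (∀ z φ v, ((U z : HolderSpace d ε γ →L[ℂ] HolderSpace d ε γ) φ).toFun v =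
        Complex.exp (z * Real.log (f ⬝ᵥ v)) * φ.toFun v) ∧
      (∀ z φ v, ((((U z)⁻¹ : (HolderSpace d ε γ →L[ℂ] HolderSpace d ε γ)ˣ) :
        HolderSpace d ε γ →L[ℂ] HolderSpace d ε γ) φ).toFun v =
        Complex.exp (-(z * Real.log (f ⬝ᵥ v))) * φ.toFun v) ∧
      (∀ z, AnalyticAt ℂ (fun z => (U z : HolderSpace d ε γ →L[ℂ] HolderSpace d ε γ)) z) ∧
      ∀ z, AnalyticAt ℂ (fun z => (((U z)⁻¹ : (HolderSpace d ε γ →L[ℂ] HolderSpace d ε γ)ˣ) :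
        HolderSpace d ε γ →L[ℂ] HolderSpace d ε γ)) z := by
  have := HolderSpace.completeSpace (d := d) hε hγ
  obtain ⟨T, hT⟩ := HolderSpace.exists_mul hε hγ (holderBound_log_dotProduct (γ := γ) hε hγ1 hf)
  have hT' : ∀ φ v, (T φ).toFun v = (Real.log (f ⬝ᵥ (v : Vec d)) : ℂ) * φ.toFun v := fun φ v =>
    (hT φ v).trans (by simp only [HolderSpace.ext_coe])
  have hzT : ∀ (z : ℂ) φ v, ((z • T) φ).toFun v = (z * Real.log (f ⬝ᵥ v)) * φ.toFun v :=
    fun z φ v => by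
      change (z • T φ).toFun v = _
      rw [HolderSpace.toFun_smul, hT' φ v, mul_assoc]
  have h1 := fun (z : ℂ) φ v =>
    exp_mul_toFun hε hγ (F := fun v => z * Real.log (f ⬝ᵥ v)) (hzT z) φ v
  have h2 : ∀ z φ v, ((NormedSpace.exp ((-z) • T)) φ).toFun v =
      Complex.exp (-(z * Real.log (f ⬝ᵥ v))) * φ.toFun v := fun z φ v => by
    rw [h1, neg_mul]
  have han : ∀ z, AnalyticAt ℂ (fun z : ℂ => NormedSpace.exp (z • T)) z := fun z =>
    (NormedSpace.exp_analytic (𝕂 := ℂ) (z • T)).comp (f := fun z : ℂ => z • T)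
      (analyticAt_id.smul analyticAt_const)
  refine ⟨fun z => ⟨NormedSpace.exp (z • T), NormedSpace.exp ((-z) • T), ?_, ?_⟩, h1, h2, han,
    fun z => (han (-z)).comp (f := fun z : ℂ => -z) analyticAt_id.neg⟩
  · refine ContinuousLinearMap.ext fun φ => HolderSpace.toFun_injective fun v => ?_
    change ((NormedSpace.exp (z • T)) ((NormedSpace.exp ((-z) • T)) φ)).toFun v = φ.toFun v
    rw [h1, h2, ← mul_assoc, ← Complex.exp_add, add_neg_cancel, Complex.exp_zero, one_mul]
  · refine ContinuousLinearMap.ext fun φ => HolderSpace.toFun_injective fun v => ?_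
    change ((NormedSpace.exp ((-z) • T)) ((NormedSpace.exp (z • T)) φ)).toFun v = φ.toFun v
    rw [h2, h1, ← mul_assoc, ← Complex.exp_add, neg_add_cancel, Complex.exp_zero, one_mul]

theorem conjOp_apply {E : Type*} [NormedAddCommGroup E] [NormedSpace ℂ E] (D : (E →L[ℂ] E)ˣ)
    (T : E →L[ℂ] E) (x : E) :
    conjOp D T x = ((D⁻¹ : (E →L[ℂ] E)ˣ) : E →L[ℂ] E) (T ((D : E →L[ℂ] E) x)) := rfl

theorem exp_mul_log_eq_rpow {x : ℝ} (hx : 0 < x) (s : ℝ) :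
    Complex.exp (s * Real.log x) = ((x ^ s : ℝ) : ℂ) := by
  rw [Real.rpow_def_of_pos hx, mul_comm]
  push_cast
  rfl

section

variable {μ : Measure (Mat d)} {s : ℝ}

theorem coeffOp_eq (hε : 0 < ε) (hμ : ∀ᵐ g ∂μ, Good ε g) {f : Vec d} (hf : f ∈ simplex d)
    (φ : Vec d → ℂ) {v : Vec d} (hv : v ∈ simplexGe d ε) :
    coeffOp μ s f φ v =
      transferOp μ s (fun u => ((f ⬝ᵥ u) ^ s : ℝ) • φ u) v / ((f ⬝ᵥ v) ^ s : ℝ) := by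
  rw [coeffOp, transferOp, ← integral_div]
  refine integral_congr_ae ?_
  filter_upwards [hμ] with g hg
  have h1 := vecNorm_mulVec_pos hg.pos hv.1
  have h2 := hε.trans_le ((hg.act_mem v hv.1).2 f hf)
  rw [dotProduct_mulVec_eq hg.pos hv.1, Real.mul_rpow h1.le h2.le]
  simp only [Complex.real_smul]
  push_cast
  ring

variable [IsProbabilityMeasure μ]

omit [IsProbabilityMeasure μ] in
theorem LeadingData.nuSF_rSF {α : ℝ} (hε : 0 < ε) (hμ : GoodLaw ε s α μ)
    (h : LeadingData ε s μ (kappa μ s) (nuS μ s) (rS μ s)) {f : Vec d} (hf : f ∈ simplex d) :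
    nuSF μ s f (fun v => (rSF μ s f v : ℂ)) = 1 := by
  have hne : ((∫ u, rS μ s u ∂(nuS μ s) : ℝ) : ℂ) ≠ 0 := by
    exact_mod_cast (h.integral_pos hε hμ).ne'
  rw [nuSF, div_eq_one_iff_eq hne, ← integral_complex_ofReal]
  refine integral_congr_ae ((h.law.ae_mem hμ).mono fun v hv => ?_)
  have h1 : ((f ⬝ᵥ v) ^ s : ℝ) ≠ 0 := (Real.rpow_pos_of_pos (hε.trans_le (hv.2 f hf)) s).ne'
  simp only [rSF, Complex.real_smul]
  rw [← Complex.ofReal_mul, mul_div_cancel₀ _ h1]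

omit [IsProbabilityMeasure μ] in
theorem LeadingData.piSF_eq {α : ℝ} (hε : 0 < ε) (hμ : GoodLaw ε s α μ)
    (h : LeadingData ε s μ (kappa μ s) (nuS μ s) (rS μ s)) {f : Vec d} (hf : f ∈ simplex d)
    (φ : Vec d → ℂ) : piSF μ s f φ = (∫ u, (rS μ s u : ℂ) * φ u ∂(nuS μ s)) /
      ((∫ u, rS μ s u ∂(nuS μ s) : ℝ) : ℂ) := by
  rw [piSF, nuSF]
  congr 1
  refine integral_congr_ae ((h.law.ae_mem hμ).mono fun v hv => ?_)
  have h1 : (((f ⬝ᵥ v) ^ s : ℝ) : ℂ) ≠ 0 := by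
    exact_mod_cast (Real.rpow_pos_of_pos (hε.trans_le (hv.2 f hf)) s).ne'
  simp only [rSF, Complex.real_smul, Complex.ofReal_div]
  field_simp

/-- The spectral decomposition of the transfer operators of the coefficients. -/
theorem LeadingData.coeffOp_split (hε : 0 < ε) (hε1 : ε < 1) (hd : 0 < d) (hγ : 0 < γ)
    (hγ1 : γ ≤ 1) (hμ : GoodLaw ε s (contr ε) μ)
    (h : LeadingData ε s μ (kappa μ s) (nuS μ s) (rS μ s)) {f : Vec d} (hf : f ∈ simplex d) :
    ∃ P M L : HolderSpace d ε γ →L[ℂ] HolderSpace d ε γ,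
      Represents P (coeffOp μ s f) ∧ Represents M (opM μ s f) ∧ Represents L (opLF μ s f) ∧
      SpectralSplit P (kappa μ s : ℂ) M L ∧
      spectralRadius ℂ L < ENNReal.ofReal (kappa μ s) ∧
      spectralRadius ℂ P = ENNReal.ofReal (kappa μ s) := by
  have hk := h.law.pos
  have hmem := h.law.ae_mem hμ
  obtain ⟨M, L, hM, hsplit, b, hb0, hbk, hb⟩ := h.exists_split hε hε1 hd hγ hγ1 hμ
  obtain ⟨U, hU, hU', -, -⟩ := exists_coeffWeight hε hγ hγ1 hf
  have hpow : ∀ v ∈ simplexGe d ε, Complex.exp (s * Real.log (f ⬝ᵥ v)) = ((f ⬝ᵥ v) ^ s : ℝ) :=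
    fun v hv => exp_mul_log_eq_rpow (hε.trans_le (hv.2 f hf)) s
  have hUext : ∀ φ : HolderSpace d ε γ, ∀ v ∈ simplexGe d ε,
      HolderSpace.ext ((U s : HolderSpace d ε γ →L[ℂ] HolderSpace d ε γ) φ) v =
        ((f ⬝ᵥ v) ^ s : ℝ) • φ.ext v := fun φ v hv => by
    rw [HolderSpace.ext_apply _ hv, hU, hpow v hv, HolderSpace.ext_apply _ hv, Complex.real_smul]
  have hconj : ∀ (T : HolderSpace d ε γ →L[ℂ] HolderSpace d ε γ) φ v,
      (conjOp (U s) T φ).toFun v =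
        (T ((U s : HolderSpace d ε γ →L[ℂ] HolderSpace d ε γ) φ)).toFun v /
          ((f ⬝ᵥ (v : Vec d)) ^ s : ℝ) := fun T φ v => by
    rw [conjOp_apply, hU', Complex.exp_neg, hpow v v.2, inv_mul_eq_div]
  have hP : ∀ φ v, (powOp ε γ μ s ((U s : HolderSpace d ε γ →L[ℂ] HolderSpace d ε γ) φ)).toFun v =
      transferOp μ s (fun u => ((f ⬝ᵥ u) ^ s : ℝ) • φ.ext u) v := fun φ v => by
    rw [hμ.represents_powOp hε hε1 hd hγ hγ1]
    exact hμ.transferOp_congr (hUext φ) v.2.1 s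
  have hint : ∀ φ : HolderSpace d ε γ,
      (∫ u, HolderSpace.ext ((U s : HolderSpace d ε γ →L[ℂ] HolderSpace d ε γ) φ) u ∂(nuS μ s)) =
        ∫ u, ((f ⬝ᵥ u) ^ s : ℝ) • φ.ext u ∂(nuS μ s) := fun φ =>
    integral_congr_ae (hmem.mono (hUext φ))
  have hkn : ‖(kappa μ s : ℂ)‖₊ = Real.toNNReal (kappa μ s) := by
    rw [← NNReal.coe_inj, coe_nnnorm, Complex.norm_real, Real.norm_of_nonneg hk.le,
      Real.coe_toNNReal _ hk.le]
  have hLk : spectralRadius ℂ L < ENNReal.ofReal (kappa μ s) :=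
    hb.trans_lt ((ENNReal.ofReal_lt_ofReal_iff hk).2 hbk)
  refine ⟨conjOp (U s) (powOp ε γ μ s), conjOp (U s) M, conjOp (U s) L, fun φ v => ?_,
    fun φ v => ?_, fun φ v => ?_, hsplit.conj (U s), ?_, ?_⟩
  · rw [hconj, coeffOp_eq hε hμ.good hf _ v.2, hP]
  · rw [hconj, hM, opM, nuSF, rSF, Complex.ofReal_div, ← mul_div_assoc, ← hint]
  · have e : L = powOp ε γ μ s - (kappa μ s : ℂ) • M := by rw [hsplit.eq]; abel
    rw [hconj, opLF, opL, e]
    change (powOp ε γ μ s _ - (kappa μ s : ℂ) • M _).toFun v / _ = _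
    rw [HolderSpace.toFun_sub, HolderSpace.toFun_smul, hP, hM, ← hint]
  · rw [spectralRadius_conj]; exact hLk
  · rw [spectralRadius_conj, hsplit.spectralRadius_eq (by rw [hkn]; exact hLk), hkn]
    rfl

omit [IsProbabilityMeasure μ] in
/-- The perturbed operators are conjugate, up to a scalar, to transfer operators with complex
exponent. -/
theorem LeadingData.perturbedOp_eq {α : ℝ} (hε : 0 < ε) (hμ : GoodLaw ε s α μ)
    (h : LeadingData ε s μ (kappa μ s) (nuS μ s) (rS μ s)) {f : Vec d} (hf : f ∈ simplex d)
    (z : ℂ) (φ : Vec d → ℂ) {v : Vec d} (hv : v ∈ simplexGe d ε) :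
    perturbedOp μ s z f φ v = Complex.exp (-(drift μ s : ℂ) * z) * (kappa μ s : ℂ)⁻¹ *
      (Complex.exp (-(z * Real.log (f ⬝ᵥ v))) * ((rS μ s v : ℂ)⁻¹ *
        profileOp μ (fun y => Complex.exp ((s + z) * y))
          (fun u => (rS μ s u : ℂ) * (Complex.exp (z * Real.log (f ⬝ᵥ u)) * φ u)) v)) := by
  have hk := h.law.pos
  have hmeas : Measurable fun g : Mat d => ENNReal.ofReal (coeffKernel μ s f g v) := by
    have h1 : ∀ x : Mat d → Vec d, Measurable x → Measurable fun g => f ⬝ᵥ x g := fun x hx => by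
      unfold dotProduct
      exact Finset.measurable_fun_sum _ fun i _ =>
        measurable_const.mul ((measurable_pi_apply i).comp hx)
    have h2 : Measurable fun g : Mat d => g.mulVec v :=
      Measurable.comp (g := fun p : Mat d × Vec d => p.1.mulVec p.2) (f := fun g => (g, v))
        measurable_mulVec measurable_prodMk_right
    have h3 := measurable_act_left (d := d) v
    refine ENNReal.measurable_ofReal.comp ?_
    unfold coeffKernel rSF
    exact ((h1 _ h2).pow_const s |>.div_const _).mul
      (((h.measurable.comp h3).div ((h1 _ h3).pow_const s)).div_const _)
  rw [perturbedOp, coeffLaw, integral_withDensity_eq_integral_toReal_smul hmeas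
    (Eventually.of_forall fun g => ENNReal.ofReal_lt_top), profileOp, ← integral_const_mul,
    ← integral_const_mul, ← integral_const_mul]
  refine integral_congr_ae ?_
  filter_upwards [hμ.good] with g hg
  have h1 := vecNorm_mulVec_pos hg.pos hv.1
  have hgv := hg.act_mem v hv.1
  have h2 := hε.trans_le (hgv.2 f hf)
  have h3 := hε.trans_le (hv.2 f hf)
  have h4 := h.pos hε hv.1
  have h5 := h.pos hε hgv.1
  have hrp := fun {x : ℝ} (hx : 0 < x) => Real.rpow_pos_of_pos hx s
  have ek : coeffKernel μ s f g v = vecNorm (g.mulVec v) ^ s * (kappa μ s)⁻¹ *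
      (rS μ s (act g v) * (rS μ s v)⁻¹) := by
    have h6 := hrp h2
    have h7 := hrp h3
    rw [coeffKernel, rSF, rSF, dotProduct_mulVec_eq hg.pos hv.1, Real.mul_rpow h1.le h2.le]
    field_simp
  have hek : 0 ≤ coeffKernel μ s f g v := by
    rw [ek]
    have := hrp h1
    positivity
  have e1 : Real.log (f ⬝ᵥ g.mulVec v / f ⬝ᵥ v) = Real.log (vecNorm (g.mulVec v)) +
      Real.log (f ⬝ᵥ act g v) - Real.log (f ⬝ᵥ v) := by
    rw [dotProduct_mulVec_eq hg.pos hv.1, Real.log_div (mul_pos h1 h2).ne' h3.ne',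
      Real.log_mul h1.ne' h2.ne']
  rw [ENNReal.toReal_ofReal hek, ek, e1, Complex.real_smul]
  push_cast
  rw [← exp_mul_log_eq_rpow h1]
  have e2 : Complex.exp (z * (Real.log (vecNorm (g.mulVec v)) + Real.log (f ⬝ᵥ act g v) -
      Real.log (f ⬝ᵥ v) - drift μ s)) = Complex.exp (-(drift μ s : ℂ) * z) *
      Complex.exp (-(z * Real.log (f ⬝ᵥ v))) * Complex.exp (z * Real.log (f ⬝ᵥ act g v)) *
      Complex.exp (z * Real.log (vecNorm (g.mulVec v))) := by
    rw [← Complex.exp_add, ← Complex.exp_add, ← Complex.exp_add]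
    congr 1
    ring
  rw [e2, add_mul, Complex.exp_add]
  ring

omit [IsProbabilityMeasure μ] in
/-- The operators `R_{s,z,f}` as conjugates of complex transfer operators. -/
theorem LeadingData.exists_conj (hε : 0 < ε) (hε1 : ε < 1) (hd : 0 < d) (hγ : 0 < γ)
    (hγ1 : γ ≤ 1) {α : ℝ} (hμ : GoodLaw ε s α μ)
    (h : LeadingData ε s μ (kappa μ s) (nuS μ s) (rS μ s)) {f : Vec d} (hf : f ∈ simplex d) :
    ∃ D : ℂ → (HolderSpace d ε γ →L[ℂ] HolderSpace d ε γ)ˣ,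
      (∀ z, AnalyticAt ℂ (fun z => (D z : HolderSpace d ε γ →L[ℂ] HolderSpace d ε γ)) z) ∧
      (∀ z, AnalyticAt ℂ (fun z => (((D z)⁻¹ : (HolderSpace d ε γ →L[ℂ] HolderSpace d ε γ)ˣ) :
        HolderSpace d ε γ →L[ℂ] HolderSpace d ε γ)) z) ∧
      (∀ z : ℂ, Integrable (fun g => matNorm g ^ (s + z.re)) μ →
        Represents ((Complex.exp (-(drift μ s : ℂ) * z) * (kappa μ s : ℂ)⁻¹) •
          conjOp (D z) (powOp ε γ μ (s + z))) (perturbedOp μ s z f)) ∧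
      ∀ M : HolderSpace d ε γ →L[ℂ] HolderSpace d ε γ,
        Represents M (fun φ v => (∫ u, φ u ∂(nuS μ s)) /
          ((∫ u, rS μ s u ∂(nuS μ s) : ℝ) : ℂ) * rS μ s v) →
        Represents (conjOp (D 0) M) (fun φ _ => piSF μ s f φ) := by
  obtain ⟨U, hU, hU', hUa, hUa'⟩ := exists_coeffWeight hε hγ hγ1 hf
  have hD0 : 0 ≤ |s| * (2 / ε) := mul_nonneg (abs_nonneg s) (by positivity)
  obtain ⟨B, H, -, -, hBH⟩ := h.logLip.holderBound (γ := γ) hD0 hγ1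
  obtain ⟨B', H', -, -, hBH'⟩ := h.logLip.inv.holderBound (γ := γ) hD0 hγ1
  have hrne : ∀ v ∈ simplexGe d ε, (rS μ s v : ℂ) ≠ 0 := fun v hv => by
    exact_mod_cast (h.pos hε hv.1).ne'
  obtain ⟨V, hV, hV'⟩ := exists_weight hε hγ (F := fun v => (rS μ s v : ℂ))
    (F' := fun v => ((rS μ s v)⁻¹ : ℝ)) ⟨B, H, hBH⟩ ⟨B', H', hBH'⟩ fun v hv => by
      rw [Complex.ofReal_inv, mul_inv_cancel₀ (hrne v hv)]
  have hDφ : ∀ z φ v, (((V * U z : (HolderSpace d ε γ →L[ℂ] HolderSpace d ε γ)ˣ) :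
      HolderSpace d ε γ →L[ℂ] HolderSpace d ε γ) φ).toFun v =
      (rS μ s v : ℂ) * (Complex.exp (z * Real.log (f ⬝ᵥ (v : Vec d))) * φ.toFun v) :=
    fun z φ v => by
      change ((V : HolderSpace d ε γ →L[ℂ] HolderSpace d ε γ)
        ((U z : HolderSpace d ε γ →L[ℂ] HolderSpace d ε γ) φ)).toFun v = _
      rw [hV, hU]
  have hDext : ∀ z (φ : HolderSpace d ε γ), ∀ v ∈ simplexGe d ε,
      HolderSpace.ext (((V * U z : (HolderSpace d ε γ →L[ℂ] HolderSpace d ε γ)ˣ) :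
        HolderSpace d ε γ →L[ℂ] HolderSpace d ε γ) φ) v =
      (rS μ s v : ℂ) * (Complex.exp (z * Real.log (f ⬝ᵥ v)) * φ.ext v) := fun z φ v hv => by
    rw [HolderSpace.ext_apply _ hv, hDφ, HolderSpace.ext_apply _ hv]
  have hconj : ∀ z T φ v, (conjOp (V * U z) T φ).toFun v =
      Complex.exp (-(z * Real.log (f ⬝ᵥ (v : Vec d)))) * ((rS μ s v : ℂ)⁻¹ *
        (T (((V * U z : (HolderSpace d ε γ →L[ℂ] HolderSpace d ε γ)ˣ) :
          HolderSpace d ε γ →L[ℂ] HolderSpace d ε γ) φ)).toFun v) := fun z T φ v => by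
    rw [conjOp_apply, mul_inv_rev, Units.val_mul, mul_apply_eq_comp, hU', hV', Complex.ofReal_inv]
  -- conjugation by the multiplication with `r_s ⟨f, ·⟩^z`
  refine ⟨fun z => V * U z, fun z => ?_, fun z => ?_, fun z hz φ v => ?_, fun M hM φ v => ?_⟩
  · simp only [Units.val_mul]
    exact analyticAt_const.mul (hUa z)
  · simp only [mul_inv_rev, Units.val_mul]
    exact (hUa' z).mul analyticAt_const
  · change ((Complex.exp (-(drift μ s : ℂ) * z) * (kappa μ s : ℂ)⁻¹) •
      conjOp (V * U z) (powOp ε γ μ (s + z)) φ).toFun v = _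
    rw [HolderSpace.toFun_smul, hconj, h.perturbedOp_eq hε hμ hf z _ v.2,
      represents_powOp hε hε1 hd hγ hγ1 hμ.good (by simpa using hz)]
    congr 3
    refine integral_congr_ae ?_
    filter_upwards [hμ.good] with g hg
    rw [hDext z φ _ (hg.act_mem v v.2.1)]
  · have hne := hrne v v.2
    have e := integral_congr_ae ((h.law.ae_mem hμ).mono (hDext 0 φ))
    simp only [zero_mul, Complex.exp_zero, one_mul] at e
    rw [hconj, hM]
    simp only [h.piSF_eq hε hμ hf, ← e, zero_mul, neg_zero, Complex.exp_zero, one_mul]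
    field_simp

end

/-! ### The perturbed operators near zero -/

section

variable {μ : Measure (Mat d)} {s : ℝ}

theorem isOpen_IInt : IsOpen (IInt μ) := isOpen_interior.union isOpen_interior

theorem integrable_of_mem_IInt (hs : s ∈ IInt μ) : Integrable (fun g => matNorm g ^ s) μ :=
  hs.elim (fun h => (interior_subset h).2) fun h => (interior_subset h).2

theorem GoodLaw.of_good (hε : 0 < ε) (hε1 : ε < 1) (hμ : ∀ᵐ g ∂μ, Good ε g)
    (hi : Integrable (fun g => matNorm g ^ s) μ) : GoodLaw ε s (contr ε) μ :=
  ⟨hμ, hμ.mono fun _ hg _ hu _ hv => hg.hilbertDist_act_le hε hε1 hu hv, hi⟩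

/-- The conclusions on the operators `R_{s,z,f}` for one exponent `s`, on a disc of radius `δ`, with
the bound `a` separating `λ_{s,z}` from the rest of the spectrum. -/
def SplitsNearZero (ε γ : ℝ) (μ : Measure (Mat d)) (s δ a : ℝ) : Prop :=
  (∀ z ∈ Metric.ball (0 : ℂ) δ, s + z.re ∈ IInt μ) ∧
  ∃ K lam : ℂ → ℂ, AnalyticOnNhd ℂ K (Metric.ball (s : ℂ) δ) ∧
    (∀ x : ℝ, |x - s| < δ → K x = kappa μ x) ∧
    (∀ z : ℂ, lam z = Complex.exp (-(drift μ s : ℂ) * z) * (K (s + z) / (kappa μ s : ℂ))) ∧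
    AnalyticOnNhd ℂ lam (Metric.ball 0 δ) ∧
    ∀ f ∈ simplex d,
      ∃ R Q N : ℂ → (HolderSpace d ε γ →L[ℂ] HolderSpace d ε γ),
        AnalyticOnNhd ℂ Q (Metric.ball 0 δ) ∧
        AnalyticOnNhd ℂ N (Metric.ball 0 δ) ∧
        Represents (Q 0) (fun φ _ => piSF μ s f φ) ∧
        ∀ z ∈ Metric.ball (0 : ℂ) δ,
          Represents (R z) (perturbedOp μ s z f) ∧
          (∀ n : ℕ, 1 ≤ n → R z ^ n = lam z ^ n • Q z + N z ^ n) ∧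
          IsRankOneProjection (Q z) ∧ Q z * N z = 0 ∧ N z * Q z = 0 ∧
          spectralRadius ℂ (N z) ≤ ENNReal.ofReal a ∧ a < ‖lam z‖

theorem SplitsNearZero.mono {δ δ' a : ℝ} (h : SplitsNearZero ε γ μ s δ a) (hδ : δ' ≤ δ) :
    SplitsNearZero ε γ μ s δ' a := by
  obtain ⟨h1, K, lam, hK, hKx, hlam, hlama, hf⟩ := h
  have hb : Metric.ball (0 : ℂ) δ' ⊆ Metric.ball 0 δ := Metric.ball_subset_ball hδ
  refine ⟨fun z hz => h1 z (hb hz), K, lam, hK.mono (Metric.ball_subset_ball hδ),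
    fun x hx => hKx x (hx.trans_le hδ), hlam, hlama.mono hb, fun f hfs => ?_⟩
  obtain ⟨R, Q, N, hQ, hN, h0, hz⟩ := hf f hfs
  exact ⟨R, Q, N, hQ.mono hb, hN.mono hb, h0, fun z hz' => hz z (hb hz')⟩

variable [IsProbabilityMeasure μ]

/-- Near the real exponent `s₀`, the leading eigenvalue `lam`, its eigenprojection `Q` and the
remainder `N` of the transfer operators depend analytically on the complex exponent, and the
spectral radius of `N` is at most `b`. Along real exponents the eigenvalue is `κ` and the projection
is `φ ↦ (ν_s(φ) / ν_s(r_s)) r_s`. -/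
structure AnalyticLeading (μ : Measure (Mat d)) (s₀ : ℝ) (lam : ℂ → ℂ)
    (Q N : ℂ → (HolderSpace d ε γ →L[ℂ] HolderSpace d ε γ)) (b : ℝ) : Prop where
  analyticAt_eigenvalue : AnalyticAt ℂ lam s₀
  analyticAt_proj : AnalyticAt ℂ Q s₀
  analyticAt_rem : AnalyticAt ℂ N s₀
  split : ∀ᶠ w in 𝓝 (s₀ : ℂ), SpectralSplit (powOp ε γ μ w) (lam w) (Q w) (N w) ∧
    spectralRadius ℂ (N w) ≤ ENNReal.ofReal b
  real : ∀ᶠ x : ℝ in 𝓝 s₀, lam x = kappa μ x ∧ Represents (Q x) (fun φ v =>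
    (∫ u, φ u ∂(nuS μ x)) / ((∫ u, rS μ x u ∂(nuS μ x) : ℝ) : ℂ) * rS μ x v)

omit [IsProbabilityMeasure μ] in
theorem AnalyticLeading.eventually {s₀ b : ℝ} {lam : ℂ → ℂ}
    {Q N : ℂ → (HolderSpace d ε γ →L[ℂ] HolderSpace d ε γ)} (hε : 0 < ε) (hγ : 0 < γ)
    (h : AnalyticLeading μ s₀ lam Q N b) : ∀ᶠ s in 𝓝 s₀, AnalyticLeading μ s lam Q N b := by
  have := HolderSpace.completeSpace (d := d) hε hγ
  have hof : Tendsto (fun x : ℝ => (x : ℂ)) (𝓝 s₀) (𝓝 (s₀ : ℂ)) :=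
    Complex.continuous_ofReal.continuousAt
  filter_upwards [hof.eventually h.analyticAt_eigenvalue.eventually_analyticAt,
    hof.eventually h.analyticAt_proj.eventually_analyticAt,
    hof.eventually h.analyticAt_rem.eventually_analyticAt,
    hof.eventually (eventually_eventually_nhds.2 h.split), eventually_eventually_nhds.2 h.real]
    with s h1 h2 h3 h4 h5 using ⟨h1, h2, h3, h4, h5⟩

theorem exists_analyticLeading (hε : 0 < ε) (hε1 : ε < 1) (hd : 0 < d) (hγ : 0 < γ) (hγ1 : γ ≤ 1)
    (hμ : ∀ᵐ g ∂μ, Good ε g) {s₀ : ℝ} (hs₀ : s₀ ∈ IInt μ) :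
    ∃ (lam : ℂ → ℂ) (Q N : ℂ → (HolderSpace d ε γ →L[ℂ] HolderSpace d ε γ)) (b : ℝ), 0 < b ∧
      b < kappa μ s₀ ∧ AnalyticLeading μ s₀ lam Q N b := by
  have := HolderSpace.completeSpace (d := d) hε hγ
  have hgood : ∀ s ∈ IInt μ, GoodLaw ε s (contr ε) μ := fun s hs =>
    GoodLaw.of_good hε hε1 hμ (integrable_of_mem_IInt hs)
  have hlead : ∀ s ∈ IInt μ, LeadingData ε s μ (kappa μ s) (nuS μ s) (rS μ s) := fun s hs =>
    ((hgood s hs).leading hε hε1 hd).2.1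
  have hI : ∀ᶠ x in 𝓝 s₀, x ∈ IInt μ := isOpen_IInt.mem_nhds hs₀
  obtain ⟨M, L, -, hsplit, b', hb'0, hb'k, hb'⟩ :=
    (hlead s₀ hs₀).exists_split hε hε1 hd hγ hγ1 (hgood s₀ hs₀)
  obtain ⟨b, hb'b, hbk⟩ := exists_between hb'k
  have hb0 : 0 < b := hb'0.trans hb'b
  have hk0 : 0 < kappa μ s₀ := hb0.trans hbk
  have hA : AnalyticAt ℂ (powOp ε γ μ) (s₀ : ℂ) := analyticAt_powOp hε hε1 hd hγ hγ1 hμ (by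
    rw [Complex.ofReal_re]
    exact hI.mono fun x hx => integrable_of_mem_IInt hx)
  obtain ⟨lam, Q, N, hlam, hQ, hN, hev⟩ := exists_analytic_split hA hsplit
    (hb'.trans_lt ((ENNReal.ofReal_lt_ofReal_iff hb0).2 hb'b))
    (by rwa [Complex.norm_real, Real.norm_of_nonneg hk0.le])
  refine ⟨lam, Q, N, b, hb0, hbk, hlam, hQ, hN, hev.mono fun w hw => ⟨hw.1, hw.2.1⟩, ?_⟩
  have hlt : ∀ {T : HolderSpace d ε γ →L[ℂ] HolderSpace d ε γ} {c : ℝ} {z : ℂ},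
      spectralRadius ℂ T ≤ ENNReal.ofReal c → 0 < c → c < ‖z‖ → spectralRadius ℂ T < ‖z‖₊ := by
    intro T c z h1 h2 h3
    refine h1.trans_lt ?_
    change _ < ‖z‖ₑ
    rw [← ofReal_norm]
    exact (ENNReal.ofReal_lt_ofReal_iff (h2.trans h3)).2 h3
  filter_upwards [hI, Complex.continuous_ofReal.continuousAt.eventually hev] with x hx hsx
  obtain ⟨M', L', hM', hsplit', c, hc0, hck, hc⟩ :=
    (hlead x hx).exists_split hε hε1 hd hγ hγ1 (hgood x hx)
  obtain ⟨e1, e2⟩ := hsx.1.unique hsplit' (hlt hsx.2.1 hb0 hsx.2.2) (hlt hc hc0 (by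
    rwa [Complex.norm_real, Real.norm_of_nonneg (hc0.trans hck).le]))
  exact ⟨e1, e2 ▸ hM'⟩

theorem continuousAt_kappa_drift (hε : 0 < ε) (hε1 : ε < 1) (hd : 0 < d) (hγ : 0 < γ)
    (hγ1 : γ ≤ 1) (hμ : ∀ᵐ g ∂μ, Good ε g) {s₀ : ℝ} (hs₀ : s₀ ∈ IInt μ) :
    ContinuousAt (kappa μ) s₀ ∧ ContinuousAt (drift μ) s₀ := by
  obtain ⟨lam, Q, N, b, hb0, hbk, hlam, -, -, -, hev⟩ :=
    exists_analyticLeading (γ := γ) hε hε1 hd hγ hγ1 hμ hs₀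
  have hk0 : 0 < kappa μ s₀ := hb0.trans hbk
  have hof : Tendsto (fun x : ℝ => (x : ℂ)) (𝓝 s₀) (𝓝 (s₀ : ℂ)) :=
    Complex.continuous_ofReal.continuousAt
  have he : kappa μ =ᶠ[𝓝 s₀] fun x => (lam x).re := hev.mono fun x hx => by
    simp only [hx.1, Complex.ofReal_re]
  have hre : ∀ {F : ℂ → ℂ}, AnalyticAt ℂ F s₀ → ContinuousAt (fun x : ℝ => (F x).re) s₀ :=
    fun hF => Complex.continuous_re.continuousAt.comp
      (ContinuousAt.comp (f := fun x : ℝ => (x : ℂ)) hF.continuousAt hof)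
  have hκ : ContinuousAt (kappa μ) s₀ := (hre hlam).congr he.symm
  refine ⟨hκ, ?_⟩
  have hd' : drift μ =ᶠ[𝓝 s₀] fun x => (deriv lam x).re / kappa μ x := by
    filter_upwards [he.eventuallyEq_nhds, hof.eventually hlam.eventually_analyticAt,
      hκ.eventually (lt_mem_nhds hk0)] with x hx hax hkx
    have h1 := (hax.differentiableAt.hasDerivAt.real_of_complex).congr_of_eventuallyEq hx
    exact (h1.log hkx.ne').deriv
  exact ((hre hlam.deriv).div hκ hk0.ne').congr hd'.symm

/-- The decomposition of `R_{s,z,f}`, locally uniformly in `s`. -/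
theorem AnalyticLeading.splitsNearZero (hε : 0 < ε) (hε1 : ε < 1) (hd : 0 < d) (hγ : 0 < γ)
    (hγ1 : γ ≤ 1) (hμ : ∀ᵐ g ∂μ, Good ε g) {s₀ : ℝ} (hs₀ : s₀ ∈ IInt μ) {lam : ℂ → ℂ}
    {Q N : ℂ → (HolderSpace d ε γ →L[ℂ] HolderSpace d ε γ)} {b : ℝ} (hb0 : 0 < b)
    (h : AnalyticLeading μ s₀ lam Q N b) {a : ℝ} (ha : b / kappa μ s₀ < a) (ha1 : a < 1) :
    ∃ δ > 0, ∀ s, |s - s₀| < δ → SplitsNearZero ε γ μ s δ a := by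
  have := HolderSpace.completeSpace (d := d) hε hγ
  obtain ⟨hlam, hQ, hN, hev, hreal⟩ := h
  obtain ⟨hκ, hq⟩ := continuousAt_kappa_drift (γ := γ) hε hε1 hd hγ hγ1 hμ hs₀
  have hk0 : 0 < kappa μ s₀ := (((GoodLaw.of_good hε hε1 hμ
    (integrable_of_mem_IInt hs₀)).leading hε hε1 hd).2.1).law.pos
  have hI : ∀ᶠ x in 𝓝 s₀, x ∈ IInt μ := isOpen_IInt.mem_nhds hs₀
  have hlam0 : lam s₀ = kappa μ s₀ := hreal.self_of_nhds.1
  have t1 : Tendsto (fun p : ℝ × ℂ => p.1) (𝓝 (s₀, 0)) (𝓝 s₀) := continuousAt_fst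
  have t2 : Tendsto (fun p : ℝ × ℂ => p.1 + p.2.re) (𝓝 (s₀, 0)) (𝓝 s₀) := by
    have h1 : ContinuousAt (fun p : ℝ × ℂ => p.1 + p.2.re) (s₀, 0) :=
      (continuous_fst.add (Complex.continuous_re.comp continuous_snd)).continuousAt
    simpa [ContinuousAt] using h1
  have t3 : Tendsto (fun p : ℝ × ℂ => (p.1 : ℂ) + p.2) (𝓝 (s₀, 0)) (𝓝 (s₀ : ℂ)) := by
    have h1 : ContinuousAt (fun p : ℝ × ℂ => (p.1 : ℂ) + p.2) (s₀, 0) :=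
      ((Complex.continuous_ofReal.comp continuous_fst).add continuous_snd).continuousAt
    simpa [ContinuousAt] using h1
  have t4 : Tendsto (fun p : ℝ × ℂ => ‖Complex.exp (-(drift μ p.1 : ℂ) * p.2)‖) (𝓝 (s₀, 0))
      (𝓝 1) := by
    have h1 : Tendsto (fun p : ℝ × ℂ => -(drift μ p.1 : ℂ) * p.2) (𝓝 (s₀, 0))
        (𝓝 (-(drift μ s₀ : ℂ) * 0)) :=
      ((Complex.continuous_ofReal.continuousAt.tendsto.comp (hq.tendsto.comp t1)).neg).mul
        continuousAt_snd
    simpa using (Complex.continuous_exp.continuousAt.tendsto.comp h1).norm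
  have t5 : Tendsto (fun p : ℝ × ℂ => kappa μ p.1) (𝓝 (s₀, 0)) (𝓝 (kappa μ s₀)) :=
    hκ.tendsto.comp t1
  have u1 : ∀ᶠ p : ℝ × ℂ in 𝓝 (s₀, 0),
      ‖Complex.exp (-(drift μ p.1 : ℂ) * p.2)‖ * (b / kappa μ p.1) < a := by
    refine (t4.mul (tendsto_const_nhds.div t5 hk0.ne')).eventually (gt_mem_nhds ?_)
    rwa [one_mul]
  have u2 : ∀ᶠ p : ℝ × ℂ in 𝓝 (s₀, 0),
      a < ‖Complex.exp (-(drift μ p.1 : ℂ) * p.2)‖ * (‖lam (p.1 + p.2)‖ / kappa μ p.1) := by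
    have h1 := (hlam.continuousAt.tendsto.comp t3).norm
    refine (t4.mul (h1.div t5 hk0.ne')).eventually (lt_mem_nhds ?_)
    rwa [hlam0, Complex.norm_real, Real.norm_of_nonneg hk0.le, div_self hk0.ne', one_mul]
  obtain ⟨δ, hδ, hball⟩ := Metric.eventually_nhds_iff.1 (((t1.eventually hI).and
    ((t2.eventually hI).and ((t1.eventually hreal).and ((t2.eventually hreal).and
    (t3.eventually hev))))).and ((t3.eventually hlam.eventually_analyticAt).and
    ((t3.eventually hQ.eventually_analyticAt).and ((t3.eventually hN.eventually_analyticAt).and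
    (u1.and u2)))))
  refine ⟨δ, hδ, fun s hs => ?_⟩
  have hsz : ∀ z ∈ Metric.ball (0 : ℂ) δ, dist (s, z) (s₀, (0 : ℂ)) < δ := fun z hz =>
    max_lt (by rwa [Real.dist_eq]) hz
  have h0 : (0 : ℂ) ∈ Metric.ball (0 : ℂ) δ := Metric.mem_ball_self hδ
  obtain ⟨⟨hsI, -, hsr, -, -⟩, -⟩ := hball (hsz 0 h0)
  have hg := GoodLaw.of_good hε hε1 hμ (integrable_of_mem_IInt hsI)
  have hl := (hg.leading hε hε1 hd).2.1
  have hk := hl.law.pos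
  have hadd : ∀ z, AnalyticAt ℂ (fun z : ℂ => (s : ℂ) + z) z := fun z =>
    analyticAt_const.add analyticAt_id
  have hexp : ∀ z, AnalyticAt ℂ (fun z => Complex.exp (-(drift μ s : ℂ) * z)) z := fun z =>
    (analyticAt_const.mul analyticAt_id).cexp
  refine ⟨fun z hz => (hball (hsz z hz)).1.2.1, lam,
    fun z => Complex.exp (-(drift μ s : ℂ) * z) * (lam (s + z) / (kappa μ s : ℂ)),
    fun w hw => ?_, fun x hx => ?_, fun z => rfl, fun z hz => ?_, fun f hf => ?_⟩
  · have h1 := hball (hsz (w - s) (by rw [mem_ball_zero_iff]; exact mem_ball_iff_norm.1 hw))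
    have h2 := h1.2.1
    simpa using h2
  · have h1 := hball (hsz ((x - s : ℝ) : ℂ) (by
      rw [mem_ball_zero_iff, Complex.norm_real]; exact hx))
    have h2 := h1.1.2.2.2.1.1
    simp only [Complex.ofReal_re, add_sub_cancel] at h2
    exact h2
  · exact (hexp z).mul (((hball (hsz z hz)).2.1.comp (f := fun z : ℂ => (s : ℂ) + z)
      (hadd z)).div_const)
  · obtain ⟨D, hD, hD', hrep, hpi⟩ := hl.exists_conj (γ := γ) hε hε1 hd hγ hγ1 hg hf
    set c : ℂ → ℂ := fun z => Complex.exp (-(drift μ s : ℂ) * z) * (kappa μ s : ℂ)⁻¹ with hc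
    have hcn : ∀ z, ‖c z‖ = ‖Complex.exp (-(drift μ s : ℂ) * z)‖ / kappa μ s := fun z => by
      rw [hc, norm_mul, norm_inv, Complex.norm_real, Real.norm_of_nonneg hk.le, div_eq_mul_inv]
    refine ⟨fun z => c z • conjOp (D z) (powOp ε γ μ (s + z)), fun z => conjOp (D z) (Q (s + z)),
      fun z => c z • conjOp (D z) (N (s + z)), fun z hz => ?_, fun z hz => ?_, ?_, fun z hz => ?_⟩
    · have h1 := (hball (hsz z hz)).2.2.1.comp (f := fun z : ℂ => (s : ℂ) + z) (hadd z)
      exact ((hD' z).mul h1).mul (hD z)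
    · have h1 := (hball (hsz z hz)).2.2.2.1.comp (f := fun z : ℂ => (s : ℂ) + z) (hadd z)
      exact ((hexp z).mul analyticAt_const).smul (((hD' z).mul h1).mul (hD z))
    · have h1 := hpi _ hsr.2
      simpa using h1
    · obtain ⟨⟨-, hzI, -, -, hsp, hρ⟩, -, -, -, hu1, hu2⟩ := hball (hsz z hz)
      have hs1 := (hsp.conj (D z)).smul (c z)
      have hcl : c z * lam (s + z) =
          Complex.exp (-(drift μ s : ℂ) * z) * (lam (s + z) / (kappa μ s : ℂ)) := by
        rw [hc]; ring
      rw [hcl] at hs1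
      refine ⟨hrep z (integrable_of_mem_IInt hzI), fun n hn => hs1.pow hn, hs1.isRankOneProjection,
        hs1.proj_mul, hs1.mul_proj, ?_, ?_⟩
      · refine (spectralRadius_smul_le (c z) hb0.le (T := conjOp (D z) (N (s + z))) (by
          rw [spectralRadius_conj]; exact hρ)).trans (ENNReal.ofReal_le_ofReal ?_)
        rw [hcn, div_mul_eq_mul_div, mul_div_assoc]
        exact hu1.le
      · rw [norm_mul, norm_div, Complex.norm_real, Real.norm_of_nonneg hk.le]
        exact hu2

/-- The decomposition of `R_{s,z,f}`, uniformly on compact sets of exponents. -/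
theorem exists_splitsNearZero (hε : 0 < ε) (hε1 : ε < 1) (hd : 0 < d) (hγ : 0 < γ)
    (hμ : ∀ᵐ g ∂μ, Good ε g) {J : Set ℝ} (hJ : IsCompact J) (hJI : J ⊆ IInt μ)
    (hγ1 : ∀ s ∈ J, γ ≤ 1) :
    ∃ δ : ℝ, 0 < δ ∧ ∃ a : ℝ, 0 ≤ a ∧ a < 1 ∧ ∀ s ∈ J, SplitsNearZero ε γ μ s δ a := by
  -- a common bound for the spectral radii, relative to `κ`
  have hβ : ∃ β < (1 : ℝ), ∀ s ∈ J, ∃ (lam : ℂ → ℂ)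
      (Q N : ℂ → (HolderSpace d ε γ →L[ℂ] HolderSpace d ε γ)) (b : ℝ), 0 < b ∧
      b / kappa μ s < β ∧ AnalyticLeading μ s lam Q N b := by
    refine hJ.induction_on (p := fun t => ∃ β < (1 : ℝ), ∀ s ∈ t, ∃ (lam : ℂ → ℂ)
      (Q N : ℂ → (HolderSpace d ε γ →L[ℂ] HolderSpace d ε γ)) (b : ℝ), 0 < b ∧
      b / kappa μ s < β ∧ AnalyticLeading μ s lam Q N b) ⟨0, one_pos, by simp⟩ ?_ ?_ ?_
    · rintro t t' htt' ⟨β, hβ, h⟩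
      exact ⟨β, hβ, fun s hs => h s (htt' hs)⟩
    · rintro t t' ⟨β, hβ, h⟩ ⟨β', hβ', h'⟩
      refine ⟨max β β', max_lt hβ hβ', fun s hs => hs.elim (fun hs => ?_) fun hs => ?_⟩
      · obtain ⟨lam, Q, N, b, h1, h2, h3⟩ := h s hs
        exact ⟨lam, Q, N, b, h1, h2.trans_le (le_max_left _ _), h3⟩
      · obtain ⟨lam, Q, N, b, h1, h2, h3⟩ := h' s hs
        exact ⟨lam, Q, N, b, h1, h2.trans_le (le_max_right _ _), h3⟩
    · intro s₀ hs₀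
      obtain ⟨lam, Q, N, b, hb0, hbk, h⟩ :=
        exists_analyticLeading (γ := γ) hε hε1 hd hγ (hγ1 s₀ hs₀) hμ (hJI hs₀)
      obtain ⟨β, h1, h2⟩ := exists_between ((div_lt_one (hb0.trans hbk)).2 hbk)
      have hκ := (continuousAt_kappa_drift hε hε1 hd hγ (hγ1 s₀ hs₀) hμ (hJI hs₀)).1
      have h3 : ∀ᶠ s in 𝓝 s₀, b / kappa μ s < β :=
        (tendsto_const_nhds.div hκ.tendsto (hb0.trans hbk).ne').eventually (gt_mem_nhds h1)
      exact ⟨_, mem_nhdsWithin_of_mem_nhds (h3.and (h.eventually hε hγ)), β, h2, fun s hs =>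
        ⟨lam, Q, N, b, hb0, hs.1, hs.2⟩⟩
  obtain ⟨β, hβ1, hβ⟩ := hβ
  have ha0 := le_max_left β 0
  have ha1 := max_lt hβ1 one_pos
  suffices h : ∃ δ : ℝ, 0 < δ ∧ ∀ s ∈ J, SplitsNearZero ε γ μ s δ (max β 0) by
    obtain ⟨δ, hδ, h⟩ := h
    exact ⟨δ, hδ, max β 0, le_max_right β 0, ha1, h⟩
  refine hJ.induction_on (p := fun t => ∃ δ : ℝ, 0 < δ ∧
    ∀ s ∈ t, SplitsNearZero ε γ μ s δ (max β 0)) ⟨1, one_pos, by simp⟩ ?_ ?_ ?_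
  · rintro t t' htt' ⟨δ, hδ, h⟩
    exact ⟨δ, hδ, fun s hs => h s (htt' hs)⟩
  · rintro t t' ⟨δ, hδ, h⟩ ⟨δ', hδ', h'⟩
    refine ⟨min δ δ', lt_min hδ hδ', fun s hs => hs.elim (fun hs => ?_) fun hs => ?_⟩
    · exact (h s hs).mono (min_le_left _ _)
    · exact (h' s hs).mono (min_le_right _ _)
  · intro s₀ hs₀
    obtain ⟨lam, Q, N, b, hb0, hb, h⟩ := hβ s₀ hs₀
    obtain ⟨δ, hδ, h1⟩ := h.splitsNearZero hε hε1 hd hγ (hγ1 s₀ hs₀) hμ (hJI hs₀) hb0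
      (hb.trans_le ha0) ha1
    exact ⟨_, mem_nhdsWithin_of_mem_nhds (Metric.ball_mem_nhds s₀ hδ), δ, hδ, fun s hs =>
      h1 s (by rwa [← Real.dist_eq])⟩

end

/-! ### Peripheral eigenvectors from a Lasota–Yorke inequality -/

/-- A spectral value that is a limit of regular values is an approximate eigenvalue. -/
theorem exists_approx_eigenvector {E : Type*} [NormedAddCommGroup E] [NormedSpace ℂ E]
    [CompleteSpace E] {T : E →L[ℂ] E} {z : ℂ} (hz : z ∈ spectrum ℂ T)
    (hacc : ∃ᶠ w in 𝓝 z, w ∉ spectrum ℂ T) {η : ℝ} (hη : 0 < η) :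
    ∃ x : E, ‖x‖ = 1 ∧ ‖T x - z • x‖ ≤ η := by
  by_contra! hcon
  have hlow : ∀ x : E, η * ‖x‖ ≤ ‖T x - z • x‖ := fun x => by
    rcases eq_or_ne x 0 with rfl | hx
    · simp
    have hx0 : ‖x‖ ≠ 0 := norm_ne_zero_iff.2 hx
    have h1 := hcon ((‖x‖⁻¹ : ℂ) • x) (by
      rw [norm_smul, norm_inv, Complex.norm_real, norm_norm, inv_mul_cancel₀ hx0])
    have e : T ((‖x‖⁻¹ : ℂ) • x) - z • ((‖x‖⁻¹ : ℂ) • x) = (‖x‖⁻¹ : ℂ) • (T x - z • x) := by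
      rw [map_smul, smul_comm z, smul_sub]
    rw [e, norm_smul, norm_inv, Complex.norm_real, norm_norm, inv_mul_eq_div,
      lt_div_iff₀ (norm_pos_iff.2 hx)] at h1
    exact h1.le
  obtain ⟨w, hw, hwz⟩ := (hacc.and_eventually
    (Metric.ball_mem_nhds z (half_pos (half_pos hη)))).exists
  replace hwz : ‖w - z‖ < η / 2 / 2 := by rw [← dist_eq_norm]; exact hwz
  obtain ⟨u, hu⟩ := spectrum.notMem_iff.1 hw
  have halg : ∀ (c : ℂ) (x : E), algebraMap ℂ (E →L[ℂ] E) c x = c • x := fun c x => by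
    rw [Algebra.algebraMap_eq_smul_one]; rfl
  have hu1 : ∀ x, ((u : (E →L[ℂ] E)ˣ) : E →L[ℂ] E) x = w • x - T x := fun x => by
    rw [hu, sub_apply, halg]
  have hinv : ‖((u⁻¹ : (E →L[ℂ] E)ˣ) : E →L[ℂ] E)‖ ≤ (η / 2)⁻¹ := by
    refine ContinuousLinearMap.opNorm_le_bound _ (by positivity) fun y => ?_
    set x := ((u⁻¹ : (E →L[ℂ] E)ˣ) : E →L[ℂ] E) y with hx
    have hux : w • x - T x = y := by
      rw [← hu1, hx]
      exact DFunLike.congr_fun u.mul_inv y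
    have h1 := hlow x
    have e : T x - z • x = (w - z) • x - y := by rw [← hux, sub_smul]; abel
    rw [e] at h1
    have h2 := h1.trans (norm_sub_le _ _)
    rw [norm_smul] at h2
    have h3 := mul_le_mul_of_nonneg_right hwz.le (norm_nonneg x)
    rw [inv_mul_eq_div, le_div_iff₀ (half_pos hη)]
    nlinarith [norm_nonneg x]
  refine hz ?_
  rcases subsingleton_or_nontrivial (E →L[ℂ] E) with hsub | hnon
  · exact isUnit_of_subsingleton _
  refine ⟨Units.ofNearby u (algebraMap ℂ (E →L[ℂ] E) z - T) ?_, rfl⟩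
  rw [hu, sub_sub_sub_cancel_right, ← map_sub, Algebra.algebraMap_eq_smul_one, norm_smul,
    norm_sub_rev]
  have h1 : ‖(1 : E →L[ℂ] E)‖ ≤ 1 := ContinuousLinearMap.norm_id_le
  calc ‖w - z‖ * ‖(1 : E →L[ℂ] E)‖ ≤ ‖w - z‖ := mul_le_of_le_one_right (norm_nonneg _) h1
    _ < η / 2 := by linarith
    _ ≤ _ := by
      rw [le_inv_comm₀ (half_pos hη) (Units.norm_pos _)]
      exact hinv

/-- A Lasota–Yorke inequality with contraction factor `θ < 1` makes every spectral value of maximal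
modulus at least one an eigenvalue: approximate eigenvectors do not degenerate in the supremum norm,
and converge uniformly along a subsequence by the theorem of Arzelà–Ascoli. -/
theorem exists_peripheral_eigenvector (hε : 0 < ε) (hγ : 0 < γ)
    {A : HolderSpace d ε γ →L[ℂ] HolderSpace d ε γ} {θ C : ℝ} (hθ0 : 0 ≤ θ) (hθ : θ < 1)
    (hC : 0 ≤ C) (hsup : ∀ φ, (A φ).supNorm ≤ φ.supNorm)
    (hLY : ∀ φ, (A φ).semi ≤ θ * φ.semi + C * φ.supNorm)
    (hA : 1 ≤ spectralRadius ℂ A) : ∃ (z : ℂ) (φ : HolderSpace d ε γ), 1 ≤ ‖z‖ ∧ φ ≠ 0 ∧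
      A φ = z • φ := by
  have := HolderSpace.completeSpace (d := d) hε hγ
  rcases subsingleton_or_nontrivial (HolderSpace d ε γ →L[ℂ] HolderSpace d ε γ) with hsub | hnon
  · have h0 : spectralRadius ℂ A = 0 := by
      rw [Subsingleton.elim A 0]; exact spectrum.spectralRadius_zero
    rw [h0] at hA
    simp at hA
  obtain ⟨z, hz, hzρ⟩ := spectrum.exists_nnnorm_eq_spectralRadius A
  have hz1 : 1 ≤ ‖z‖ := by
    rw [← hzρ] at hA
    exact_mod_cast hA
  have hz0 : 0 < ‖z‖ := one_pos.trans_le hz1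
  have hacc : ∃ᶠ w in 𝓝 z, w ∉ spectrum ℂ A := by
    have ht : Tendsto (fun n : ℕ => (1 + 1 / ((n : ℂ) + 1)) * z) atTop (𝓝 z) := by
      have := (tendsto_one_div_add_atTop_nhds_zero_nat (𝕜 := ℂ)).const_add 1 |>.mul_const z
      simpa using this
    refine ht.frequently (Eventually.of_forall fun n => ?_).frequently
    refine fun hmem => ?_
    have h1 : (‖(1 + 1 / ((n : ℂ) + 1)) * z‖₊ : ENNReal) ≤ spectralRadius ℂ A :=
      le_iSup₂ (α := ENNReal) (f := fun z (_ : z ∈ spectrum ℂ A) => (‖z‖₊ : ENNReal)) _ hmem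
    rw [← hzρ, ENNReal.coe_le_coe] at h1
    have h2 : ‖(1 + 1 / ((n : ℂ) + 1)) * z‖ ≤ ‖z‖ := h1
    have h3 : (1 + 1 / ((n : ℂ) + 1)) = ((1 + 1 / ((n : ℝ) + 1) : ℝ) : ℂ) := by push_cast; rfl
    have h4 : 0 < 1 / ((n : ℝ) + 1) := by positivity
    rw [norm_mul, h3, Complex.norm_real, Real.norm_of_nonneg (by positivity)] at h2
    nlinarith
  have hη : ∀ n : ℕ, 0 < (1 - θ) / 2 * (1 / ((n : ℝ) + 1)) := fun n =>
    mul_pos (by linarith) (by positivity)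
  choose ψ hψ1 hψη using fun n => exists_approx_eigenvector hz hacc (hη n)
  have hηle : ∀ n : ℕ, (1 - θ) / 2 * (1 / ((n : ℝ) + 1)) ≤ (1 - θ) / 2 := fun n =>
    mul_le_of_le_one_right (by linarith) (by
      rw [div_le_one (by positivity)]; linarith [Nat.cast_nonneg (α := ℝ) n])
  -- the supremum norms stay away from zero
  set c₀ := (1 - θ) / (2 * (1 + C)) with hc₀
  have hc₀pos : 0 < c₀ := div_pos (by linarith) (by linarith)
  have hlow : ∀ n, c₀ ≤ (ψ n).supNorm := fun n => by
    have h1 : ‖z • ψ n‖ ≤ ‖A (ψ n)‖ + (1 - θ) / 2 := by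
      have e : z • ψ n = A (ψ n) - (A (ψ n) - z • ψ n) := by abel
      rw [e]
      exact (norm_sub_le _ _).trans (add_le_add le_rfl ((hψη n).trans (hηle n)))
    rw [norm_smul, hψ1, mul_one] at h1
    have h2 := hψ1 n
    rw [HolderSpace.norm_eq] at h1 h2
    have h3 := hsup (ψ n)
    have h4 := hLY (ψ n)
    have h5 := (ψ n).supNorm_nonneg
    rw [hc₀, div_le_iff₀ (by linarith)]
    have h6 : (ψ n).semi = 1 - (ψ n).supNorm := by linarith
    rw [h6] at h4
    nlinarith
  let F : ℕ → BoundedContinuousFunction (simplexGe d ε) ℂ := fun n =>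
    BoundedContinuousFunction.mkOfCompact ⟨(ψ n).toFun, (ψ n).2.1⟩
  have hψH : ∀ n, ∀ u v : simplexGe d ε, ‖(ψ n).toFun u - (ψ n).toFun v‖ ≤
      hilbertDist (u : Vec d) (v : Vec d) ^ γ := fun n u v => by
    have h1 := ((ψ n).holderBound hγ).2 u u.2 v v.2
    rwa [hψ1, one_mul, HolderSpace.ext_coe, HolderSpace.ext_coe] at h1
  have hcomp : IsCompact (closure (range F)) := by
    refine BoundedContinuousFunction.arzela_ascoli (Metric.closedBall (0 : ℂ) 1)
      (isCompact_closedBall _ _) (range F) ?_ ?_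
    · rintro _ v ⟨n, rfl⟩
      rw [mem_closedBall_zero_iff, ← hψ1 n]
      exact (ψ n).norm_toFun_le v
    · refine Metric.equicontinuous_of_continuity_modulus (fun t => (2 / ε * t) ^ γ) ?_ _ ?_
      · have h1 : Continuous fun t : ℝ => (2 / ε * t) ^ γ :=
          Continuous.rpow_const (by fun_prop) fun _ => Or.inr hγ.le
        have := h1.tendsto 0
        simpa [Real.zero_rpow hγ.ne'] using this
      · rintro u v ⟨_, n, rfl⟩
        rw [dist_eq_norm]
        exact (hψH n u v).trans (Real.rpow_le_rpow (hilbertDist_nonneg u.2.1 v.2.1)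
          (hilbertDist_le_dist hε u.2 v.2) hγ.le)
  obtain ⟨Φ, -, j, hj, hlim⟩ := hcomp.tendsto_subseq (x := F) fun n => subset_closure ⟨n, rfl⟩
  have hdist : Tendsto (fun n => dist (F (j n)) Φ) atTop (𝓝 0) := tendsto_iff_dist_tendsto_zero.1
    hlim
  have hpt : ∀ v, Tendsto (fun n => (ψ (j n)).toFun v) atTop (𝓝 (Φ v)) := fun v =>
    tendsto_iff_dist_tendsto_zero.2 (squeeze_zero (fun _ => dist_nonneg)
      (fun n => BoundedContinuousFunction.dist_coe_le_dist (f := F (j n)) (g := Φ) v) hdist)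
  let φ : HolderSpace d ε γ := ⟨fun v => Φ v, Φ.continuous,
    ⟨‖Φ‖, by rintro _ ⟨v, rfl⟩; exact Φ.norm_coe_le_norm v⟩,
    ⟨1, by
      rintro _ ⟨p, rfl⟩
      refine HolderSpace.holderBound_range zero_le_one (fun u v => ?_) p
      rw [one_mul]
      exact le_of_tendsto ((hpt u).sub (hpt v)).norm (Eventually.of_forall fun n => hψH _ u v)⟩⟩
  have hφ : ∀ v, φ.toFun v = Φ v := fun v => rfl
  have hdiff : ∀ n, (ψ (j n) - φ).supNorm ≤ dist (F (j n)) Φ := fun n =>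
    HolderSpace.supNorm_le dist_nonneg fun v => by
      rw [HolderSpace.toFun_sub, hφ, ← dist_eq_norm]
      exact BoundedContinuousFunction.dist_coe_le_dist (f := F (j n)) (g := Φ) v
  refine ⟨z, φ, hz1, ?_, HolderSpace.toFun_injective fun v => ?_⟩
  · intro h0
    refine absurd (ge_of_tendsto hdist (Eventually.of_forall fun n => ?_)) (not_le.2 hc₀pos)
    have h1 := hdiff n
    rw [h0, sub_zero] at h1
    exact (hlow (j n)).trans h1
  · have h1 : Tendsto (fun n => (A (ψ (j n))).toFun v) atTop (𝓝 ((A φ).toFun v)) := by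
      refine tendsto_iff_dist_tendsto_zero.2 (squeeze_zero (fun _ => dist_nonneg) (fun n => ?_)
        hdist)
      rw [dist_eq_norm, ← HolderSpace.toFun_sub, ← map_sub]
      exact ((A (ψ (j n) - φ)).norm_toFun_le_supNorm v).trans ((hsup _).trans (hdiff n))
    have h2 : Tendsto (fun n => (A (ψ (j n)) - z • ψ (j n)).toFun v) atTop (𝓝 0) := by
      refine squeeze_zero_norm (fun n => (HolderSpace.norm_toFun_le _ v).trans (hψη (j n))) ?_
      have h3 : Tendsto (fun n : ℕ => (1 - θ) / 2 * (1 / ((n : ℝ) + 1))) atTop (𝓝 0) := by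
        simpa using (tendsto_one_div_add_atTop_nhds_zero_nat (𝕜 := ℝ)).const_mul ((1 - θ) / 2)
      exact h3.comp hj.tendsto_atTop
    have h4 := h1.sub h2
    simp only [HolderSpace.toFun_sub, HolderSpace.toFun_smul, sub_sub_cancel, sub_zero] at h4
    exact tendsto_nhds_unique h4 ((hpt v).const_mul z)

/-! ### Twisted Markov operators -/

/-- The Markov operator `φ ↦ P_s(r φ) / (k r)`, twisted by the character `‖g v‖^{it}`. -/
def twistOp (μ : Measure (Mat d)) (s t k : ℝ) (r : Vec d → ℝ) (φ : Vec d → ℂ) (v : Vec d) : ℂ :=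
  ((k * r v : ℝ) : ℂ)⁻¹ * ∫ g, (vecNorm (g.mulVec v) ^ s * r (act g v) : ℝ) •
    (Complex.exp (t * Complex.I * Real.log (vecNorm (g.mulVec v))) * φ (act g v)) ∂μ

theorem norm_exp_mul_I (t x : ℝ) : ‖Complex.exp (t * Complex.I * x)‖ = 1 := by
  rw [show (t : ℂ) * Complex.I * x = ((t * x : ℝ) : ℂ) * Complex.I by push_cast; ring,
    Complex.norm_exp_ofReal_mul_I]

theorem norm_exp_mul_I_sub_le (t x y : ℝ) :
    ‖Complex.exp (t * Complex.I * x) - Complex.exp (t * Complex.I * y)‖ ≤ |t| * |x - y| := by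
  have e : Complex.exp (t * Complex.I * x) - Complex.exp (t * Complex.I * y) =
      Complex.exp (t * Complex.I * y) * (Complex.exp (Complex.I * ((t * (x - y) : ℝ) : ℂ)) -
        1) := by
    rw [mul_sub, ← Complex.exp_add, mul_one]
    congr 2
    push_cast
    ring
  rw [e, norm_mul, norm_exp_mul_I, one_mul, ← abs_mul, ← Real.norm_eq_abs]
  exact Real.norm_exp_I_mul_ofReal_sub_one_le

section

variable {μ : Measure (Mat d)} {s t k : ℝ} {ν : Measure (Vec d)} {r : Vec d → ℝ}
  [IsProbabilityMeasure μ]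

omit [IsProbabilityMeasure μ] in
theorem LeadingData.integrable_weight {α : ℝ} (hε : 0 < ε) (hε1 : ε < 1) (hμ : GoodLaw ε s α μ)
    (h : LeadingData ε s μ k ν r) {v : Vec d} (hv : v ∈ simplex d) :
    Integrable (fun g => vecNorm (g.mulVec v) ^ s * r (act g v)) μ :=
  hμ.integrable_transferReal hε hε1 h.measurable h.logLip hv

omit [IsProbabilityMeasure μ] in
theorem LeadingData.weight_pos {α : ℝ} (hε : 0 < ε) (hμ : GoodLaw ε s α μ)
    (h : LeadingData ε s μ k ν r) {v : Vec d} (hv : v ∈ simplex d) :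
    ∀ᵐ g ∂μ, 0 < vecNorm (g.mulVec v) ^ s * r (act g v) := by
  filter_upwards [hμ.good] with g hg
  exact mul_pos (Real.rpow_pos_of_pos (vecNorm_mulVec_pos hg.pos hv) _)
    (h.pos hε (hg.act_mem v hv).1)

theorem measurable_character (t : ℝ) (v : Vec d) : Measurable fun g : Mat d =>
    Complex.exp (t * Complex.I * Real.log (vecNorm (g.mulVec v))) := by
  have h1 : Measurable fun g : Mat d => Real.log (vecNorm (g.mulVec v)) :=
    Real.measurable_log.comp (measurable_vecNorm_left v)
  exact Complex.measurable_exp.comp (measurable_const.mul (Complex.measurable_ofReal.comp h1))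

omit [IsProbabilityMeasure μ] in
theorem LeadingData.integrable_twist {α : ℝ} (hε : 0 < ε) (hε1 : ε < 1) (hμ : GoodLaw ε s α μ)
    (h : LeadingData ε s μ k ν r) {φ : Vec d → ℂ} (hφ : Measurable φ) {B : ℝ}
    (hB : ∀ v ∈ simplexGe d ε, ‖φ v‖ ≤ B) {v : Vec d} (hv : v ∈ simplex d) :
    Integrable (fun g => (vecNorm (g.mulVec v) ^ s * r (act g v) : ℝ) •
      (Complex.exp (t * Complex.I * Real.log (vecNorm (g.mulVec v))) * φ (act g v))) μ := by
  have hi := h.integrable_weight hε hε1 hμ hv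
  refine Integrable.mono' (hi.norm.mul_const B) (hi.aestronglyMeasurable.smul
    ((measurable_character t v).mul (hφ.comp (measurable_act_left v))).aestronglyMeasurable) ?_
  filter_upwards [hμ.good] with g hg
  rw [norm_smul, norm_mul (Complex.exp _), norm_exp_mul_I, one_mul]
  exact mul_le_mul_of_nonneg_left (hB _ (hg.act_mem v hv)) (norm_nonneg _)

omit [IsProbabilityMeasure μ] in
theorem LeadingData.norm_integral_twist_le {α : ℝ} (hε : 0 < ε) (hε1 : ε < 1)
    (hμ : GoodLaw ε s α μ) (h : LeadingData ε s μ k ν r) {φ : Vec d → ℂ} {B : ℝ}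
    (hB : ∀ v ∈ simplexGe d ε, ‖φ v‖ ≤ B) {v : Vec d} (hv : v ∈ simplex d) :
    ‖∫ g, (vecNorm (g.mulVec v) ^ s * r (act g v) : ℝ) •
      (Complex.exp (t * Complex.I * Real.log (vecNorm (g.mulVec v))) * φ (act g v)) ∂μ‖ ≤
        k * r v * B := by
  rw [← h.eigen v hv, transferReal, ← integral_mul_const]
  refine norm_integral_le_of_norm_le ((h.integrable_weight hε hε1 hμ hv).mul_const B) ?_
  filter_upwards [hμ.good, h.weight_pos hε hμ hv] with g hg hw
  rw [norm_smul, norm_mul (Complex.exp _), norm_exp_mul_I, one_mul, Real.norm_of_nonneg hw.le]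
  exact mul_le_mul_of_nonneg_left (hB _ (hg.act_mem v hv)) hw.le

omit [IsProbabilityMeasure μ] in
theorem LeadingData.norm_twistOp_le {α : ℝ} (hε : 0 < ε) (hε1 : ε < 1) (hμ : GoodLaw ε s α μ)
    (h : LeadingData ε s μ k ν r) {φ : Vec d → ℂ} {B : ℝ}
    (hB : ∀ v ∈ simplexGe d ε, ‖φ v‖ ≤ B) {v : Vec d} (hv : v ∈ simplex d) :
    ‖twistOp μ s t k r φ v‖ ≤ B := by
  have hkr : 0 < k * r v := mul_pos h.law.pos (h.pos hε hv)
  rw [twistOp, norm_mul, norm_inv, Complex.norm_real, Real.norm_of_nonneg hkr.le,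
    inv_mul_le_iff₀ hkr]
  exact h.norm_integral_twist_le hε hε1 hμ hB hv

theorem exp_mul_sub_one_le {E x : ℝ} (hE : 0 ≤ E) (hx0 : 0 ≤ x) (hx1 : x ≤ 1) :
    Real.exp (E * x) - 1 ≤ E * Real.exp E * x := by
  have h1 := Real.add_one_le_exp (-(E * x))
  have h2 := Real.exp_pos (E * x)
  have h3 : Real.exp (E * x) ≤ Real.exp E := Real.exp_le_exp.2 (by nlinarith)
  have h4 : Real.exp (-(E * x)) * Real.exp (E * x) = 1 := by rw [← Real.exp_add]; simp
  have h5 : 0 ≤ E * x := by positivity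
  nlinarith

theorem inv_mul_sub_inv_mul {k a b : ℝ} (hk : k ≠ 0) (ha : a ≠ 0) (hb : b ≠ 0) (x y : ℂ) :
    ((k * a : ℝ) : ℂ)⁻¹ * x - ((k * b : ℝ) : ℂ)⁻¹ * y =
      ((k * b : ℝ) : ℂ)⁻¹ * (x - y) + (((b - a) / (b * (k * a)) : ℝ) : ℂ) * x := by
  have h1 : (a : ℂ) ≠ 0 := by exact_mod_cast ha
  have h2 : (b : ℂ) ≠ 0 := by exact_mod_cast hb
  have h3 : (k : ℂ) ≠ 0 := by exact_mod_cast hk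
  push_cast
  field_simp
  ring

omit [IsProbabilityMeasure μ] in
/-- The Lasota–Yorke inequality for the twisted operators. -/
theorem LeadingData.exists_twistOp_sub_le (hε : 0 < ε) (hε1 : ε < 1) (hγ : 0 < γ) (hγ1 : γ ≤ 1)
    (hμ : GoodLaw ε s (contr ε) μ) (h : LeadingData ε s μ k ν r) (t : ℝ) :
    ∃ C : ℝ, 0 ≤ C ∧ ∀ φ : Vec d → ℂ, Measurable φ → ∀ B H : ℝ, 0 ≤ B → 0 ≤ H →
      HolderBound ε γ φ B H → ∀ u ∈ simplexGe d ε, ∀ v ∈ simplexGe d ε,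
        ‖twistOp μ s t k r φ u - twistOp μ s t k r φ v‖ ≤
          (contr ε ^ γ * H + C * B) * hilbertDist u v ^ γ := by
  have hα0 := contr_nonneg hε hε1
  have hk := h.law.pos
  set D := |s| * (2 / ε) with hD
  have hD0 : 0 ≤ D := mul_nonneg (abs_nonneg s) (by positivity)
  set E := |s| * (2 / ε) + contr ε * D with hE
  have hE0 : 0 ≤ E := add_nonneg hD0 (mul_nonneg hα0 hD0)
  set K := E * Real.exp E with hK
  have hK0 : 0 ≤ K := by positivity
  refine ⟨K * (1 + Real.exp D) + |t| * (2 / ε) + D * Real.exp D * Real.exp D, by positivity,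
    fun φ hφ B H hB0 hH0 hBH u hu v hv => ?_⟩
  set x := hilbertDist u v with hx
  have hx0 : 0 ≤ x := hilbertDist_nonneg hu.1 hv.1
  have hx1 : x ≤ 1 := hilbertDist_le_one
  have hxγ : x ≤ x ^ γ := hilbertDist_le_rpow hγ1 hu.1 hv.1
  have hru := h.pos hε hu.1
  have hrv := h.pos hε hv.1
  have hruv := h.logLip.le u hu v hv
  have hrvu := h.logLip.le v hv u hu
  rw [hilbertDist_comm v u] at hrvu
  have hDx := exp_mul_sub_one_le hD0 hx0 hx1
  have hD1 : 1 ≤ Real.exp D := Real.one_le_exp hD0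
  have hDxD : Real.exp (D * x) ≤ Real.exp D := Real.exp_le_exp.2 (by nlinarith)
  have hru' : r u ≤ Real.exp D * r v := hruv.trans (mul_le_mul_of_nonneg_right hDxD hrv.le)
  set W : Vec d → Mat d → ℝ := fun w g => vecNorm (g.mulVec w) ^ s * r (act g w) with hW
  set F : Vec d → Mat d → ℂ := fun w g =>
    Complex.exp (t * Complex.I * Real.log (vecNorm (g.mulVec w))) * φ (act g w) with hF
  have hWu := h.integrable_weight hε hε1 hμ hu.1
  have hWv := h.integrable_weight hε hε1 hμ hv.1
  have hTu := h.integrable_twist (t := t) hε hε1 hμ hφ hBH.1 hu.1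
  have hTv := h.integrable_twist (t := t) hε hε1 hμ hφ hBH.1 hv.1
  -- the numerators
  have hnum : ‖(∫ g, W u g • F u g ∂μ) - ∫ g, W v g • F v g ∂μ‖ ≤
      k * r v * ((K * (1 + Real.exp D) * B + |t| * (2 / ε) * B) * x +
        contr ε ^ γ * H * x ^ γ) := by
    rw [← integral_sub hTu hTv]
    have hbd : ∀ᵐ g ∂μ, ‖W u g • F u g - W v g • F v g‖ ≤ (W u g + W v g) * (K * x * B) +
        W v g * (|t| * (2 / ε) * x * B + contr ε ^ γ * H * x ^ γ) := by
      have hvu := hμ.density_le hε hD0 h.logLip hv hu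
      rw [hilbertDist_comm v u] at hvu
      filter_upwards [hμ.good, hμ.contracts, hμ.density_le hε hD0 h.logLip hu hv, hvu,
        h.weight_pos hε hμ hu.1, h.weight_pos hε hμ hv.1] with g hg hc h1 h2 h3 h4
      have hau := hg.act_mem u hu.1
      have hav := hg.act_mem v hv.1
      have hEx := exp_mul_sub_one_le hE0 hx0 hx1
      have a1 : |W u g - W v g| ≤ K * x * (W u g + W v g) := by
        have b0 : 0 ≤ K * x := by positivity
        have b1 : W u g ≤ Real.exp (E * x) * W v g := h1
        have b2 : W v g ≤ Real.exp (E * x) * W u g := h2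
        have b3 := mul_le_mul_of_nonneg_right hEx h3.le
        have b4 := mul_le_mul_of_nonneg_right hEx h4.le
        have b5 := mul_nonneg b0 h3.le
        have b6 := mul_nonneg b0 h4.le
        rw [abs_le]
        constructor
        · change -(K * x * (W u g + W v g)) ≤ _
          nlinarith
        · change _ ≤ K * x * (W u g + W v g)
          nlinarith
      have a2 : ‖F u g‖ ≤ B := by
        rw [hF, norm_mul, norm_exp_mul_I, one_mul]
        exact hBH.1 _ hau
      have a3 : ‖F u g - F v g‖ ≤ |t| * (2 / ε) * x * B + contr ε ^ γ * H * x ^ γ := by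
        have e : F u g - F v g = (Complex.exp (t * Complex.I * Real.log (vecNorm (g.mulVec u))) -
            Complex.exp (t * Complex.I * Real.log (vecNorm (g.mulVec v)))) * φ (act g u) +
            Complex.exp (t * Complex.I * Real.log (vecNorm (g.mulVec v))) *
              (φ (act g u) - φ (act g v)) := by rw [hF]; ring
        rw [e]
        refine (norm_add_le _ _).trans (add_le_add ?_ ?_)
        · rw [norm_mul]
          refine mul_le_mul ((norm_exp_mul_I_sub_le t _ _).trans ?_) (hBH.1 _ hau) (norm_nonneg _)
            (by positivity)
          rw [mul_assoc]
          exact mul_le_mul_of_nonneg_left (abs_log_vecNorm_sub_le hε hg.pos hu hv) (abs_nonneg t)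
        · rw [norm_mul, norm_exp_mul_I, one_mul]
          refine (hBH.2 _ hau _ hav).trans ?_
          rw [mul_comm _ H, mul_assoc, ← Real.mul_rpow hα0 hx0]
          exact mul_le_mul_of_nonneg_left (Real.rpow_le_rpow (hilbertDist_nonneg hau.1 hav.1)
            (hc u hu.1 v hv.1) hγ.le) hH0
      have e : W u g • F u g - W v g • F v g =
          (W u g - W v g) • F u g + W v g • (F u g - F v g) := by
        rw [sub_smul, smul_sub]; abel
      rw [e]
      refine (norm_add_le _ _).trans (add_le_add ?_ ?_)
      · rw [norm_smul, Real.norm_eq_abs]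
        refine (mul_le_mul a1 a2 (norm_nonneg _) ((abs_nonneg _).trans a1)).trans (le_of_eq ?_)
        ring
      · rw [norm_smul, Real.norm_of_nonneg h4.le]
        exact mul_le_mul_of_nonneg_left a3 h4.le
    have hi1 : Integrable (fun g => (W u g + W v g) * (K * x * B)) μ :=
      (hWu.add hWv).mul_const _
    have hi2 : Integrable (fun g => W v g * (|t| * (2 / ε) * x * B + contr ε ^ γ * H * x ^ γ)) μ :=
      hWv.mul_const _
    refine (norm_integral_le_of_norm_le (hi1.add hi2) hbd).trans ?_
    have eu : ∫ g, W u g ∂μ = k * r u := h.eigen u hu.1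
    have ev : ∫ g, W v g ∂μ = k * r v := h.eigen v hv.1
    have euv : ∫ g, (W u g + W v g) ∂μ = k * r u + k * r v := by
      rw [← eu, ← ev]; exact integral_add hWu hWv
    refine (integral_add hi1 hi2).trans_le ?_
    rw [integral_mul_const, integral_mul_const, euv, ev]
    have b1 : (k * r u + k * r v) * (K * x * B) ≤ k * r v * (1 + Real.exp D) * (K * x * B) := by
      refine mul_le_mul_of_nonneg_right ?_ (by positivity)
      nlinarith
    linarith
  have hTu' := h.norm_integral_twist_le (t := t) hε hε1 hμ hBH.1 hu.1
  -- the denominators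
  have hku : 0 < k * r u := mul_pos hk hru
  have hkv : 0 < k * r v := mul_pos hk hrv
  have e : twistOp μ s t k r φ u - twistOp μ s t k r φ v =
      ((k * r v : ℝ) : ℂ)⁻¹ * ((∫ g, W u g • F u g ∂μ) - ∫ g, W v g • F v g ∂μ) +
        (((r v - r u) / (r v * (k * r u)) : ℝ) : ℂ) * ∫ g, W u g • F u g ∂μ := by
    exact inv_mul_sub_inv_mul hk.ne' hru.ne' hrv.ne' _ _
  have hden : |r v - r u| ≤ D * Real.exp D * Real.exp D * x * r v := by
    have b1 := mul_le_mul_of_nonneg_right hDx hru.le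
    have b2 := mul_le_mul_of_nonneg_right hDx hrv.le
    have b3 : 0 ≤ D * Real.exp D * x := by positivity
    have b4 := mul_le_mul_of_nonneg_left hru' b3
    have b5 := mul_le_mul_of_nonneg_right hD1 (mul_nonneg b3 hrv.le)
    rw [abs_le]
    constructor <;> linarith
  rw [e]
  refine (norm_add_le _ _).trans ?_
  rw [norm_mul, norm_mul, norm_inv, Complex.norm_real, Complex.norm_real,
    Real.norm_of_nonneg hkv.le, Real.norm_eq_abs, abs_div, abs_of_pos (mul_pos hrv hku)]
  have c1 : (k * r v)⁻¹ * ‖(∫ g, W u g • F u g ∂μ) - ∫ g, W v g • F v g ∂μ‖ ≤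
      (K * (1 + Real.exp D) * B + |t| * (2 / ε) * B) * x + contr ε ^ γ * H * x ^ γ := by
    rw [inv_mul_le_iff₀ hkv]
    exact hnum
  have c2 : |r v - r u| / (r v * (k * r u)) * ‖∫ g, W u g • F u g ∂μ‖ ≤
      D * Real.exp D * Real.exp D * B * x := by
    rw [div_mul_eq_mul_div, div_le_iff₀ (mul_pos hrv hku)]
    calc _ ≤ (D * Real.exp D * Real.exp D * x * r v) * (k * r u * B) :=
          mul_le_mul hden hTu' (norm_nonneg _) (by positivity)
      _ = _ := by ring
  refine (add_le_add c1 c2).trans ?_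
  have c3 : 0 ≤ K * (1 + Real.exp D) * B + |t| * (2 / ε) * B + D * Real.exp D * Real.exp D * B := by
    positivity
  have c4 := mul_le_mul_of_nonneg_left hxγ c3
  linarith

end

/-! ### Invariant sets and the stationary measure -/

section

variable {μ : Measure (Mat d)}

/-- An identity that holds almost surely and is continuous in the matrix holds on the support. -/
theorem eq_on_supp_of_ae (hμ : ∀ᵐ g ∂μ, Good ε g) {F : Mat d → ℂ} {c : ℂ}
    (hae : ∀ᵐ g ∂μ, F g = c) {g : Mat d} (hg : g ∈ supp μ)
    (hF : ContinuousWithinAt F {g | Good ε g} g) : F g = c := by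
  by_contra hne
  have h1 : ∀ᶠ g' in 𝓝[{g | Good ε g}] g, F g' ≠ c := hF.eventually_ne hne
  rw [eventually_nhdsWithin_iff] at h1
  have h2 := (Measure.mem_support_iff_forall g).1 hg.1 _ h1
  refine h2.ne' (measure_mono_null (t := {g' | ¬ (Good ε g' ∧ F g' = c)}) ?_ (hμ.and hae))
  exact fun g' hg' hcon => hg' hcon.1 hcon.2

theorem continuousAt_vecNorm_mulVec (g : Mat d) (v : Vec d) :
    ContinuousAt (fun g : Mat d => vecNorm (g.mulVec v)) g := by
  refine Continuous.continuousAt ?_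
  simp only [vecNorm]
  exact continuous_finsetSum _ fun i _ => (continuous_apply i |>.comp
    (continuous_id.matrix_mulVec continuous_const)).abs

theorem continuousAt_act {g : Mat d} (hg : IsPositive g) {v : Vec d} (hv : v ∈ simplex d) :
    ContinuousAt (fun g : Mat d => act g v) g :=
  ((continuousAt_vecNorm_mulVec g v).inv₀ (vecNorm_mulVec_pos hg hv).ne').smul
    (continuous_id.matrix_mulVec continuous_const).continuousAt

theorem GoodLaw.of_good_zero [IsFiniteMeasure μ] (hε : 0 < ε) (hε1 : ε < 1)
    (hμ : ∀ᵐ g ∂μ, Good ε g) : GoodLaw ε 0 (contr ε) μ :=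
  GoodLaw.of_good hε hε1 hμ (by simp only [Real.rpow_zero]; exact integrable_const _)

variable [IsProbabilityMeasure μ]

theorem kappa_zero : kappa μ 0 = 1 := by
  have h : ∀ n, normMoment μ 0 n = 1 := fun n => by simp [normMoment]
  simp only [kappa, h, Real.one_rpow]
  exact tendsto_const_nhds.limUnder_eq

/-- The stationary measure is carried by every closed invariant subset of `𝒮_ε`. -/
theorem support_nuS_subset (hε : 0 < ε) (hε1 : ε < 1) (hd : 0 < d) (hμ : ∀ᵐ g ∂μ, Good ε g)
    {E : Set (Vec d)} (hE : IsClosed E) (hEne : E.Nonempty) (hES : E ⊆ simplexGe d ε)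
    (hinv : ∀ᵐ g ∂μ, ∀ v ∈ E, act g v ∈ E) : (nuS μ 0).support ⊆ E := by
  have h0 := GoodLaw.of_good_zero hε hε1 hμ
  have hl := (h0.leading hε hε1 hd).2.1
  have hcs := HolderSpace.completeSpace (d := d) (γ := 1) hε one_pos
  have hmem := hl.law.ae_mem h0
  have hp := hl.law.prob
  obtain ⟨e, he⟩ := hEne
  have hLip : ∀ u ∈ simplexGe d ε, ∀ v ∈ simplexGe d ε,
      |Metric.infDist u E - Metric.infDist v E| ≤ 2 * hilbertDist u v ^ (1 : ℝ) :=
    fun u hu v hv => by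
      rw [Real.rpow_one, abs_le]
      have h1 := Metric.infDist_le_infDist_add_dist (s := E) (x := u) (y := v)
      have h2 := Metric.infDist_le_infDist_add_dist (s := E) (x := v) (y := u)
      have h3 := dist_le_hilbertDist hu.1 hv.1
      rw [dist_comm] at h2
      constructor <;> linarith
  -- the distance to `E` is Hölder, and its iterates under the operator vanish on `E`
  set F : Vec d → ℂ := fun v => (Metric.infDist v E : ℂ) with hF
  have hFB : HolderBound ε 1 F 2 2 := by
    refine ⟨fun v hv => ?_, fun u hu v hv => ?_⟩
    · rw [hF, Complex.norm_real, Real.norm_of_nonneg Metric.infDist_nonneg]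
      refine (Metric.infDist_le_dist_of_mem he).trans
        ((dist_le_hilbertDist hv.1 (hES he).1).trans ?_)
      have : hilbertDist v e ≤ 1 := hilbertDist_le_one
      linarith
    · rw [hF, ← Complex.ofReal_sub, Complex.norm_real]
      exact hLip u hu v hv
  set ψ : HolderSpace d ε 1 := HolderSpace.mk hε one_pos F ⟨2, 2, hFB⟩ with hψ
  have hiter : ∀ n, ∀ v ∈ E, (transferOp μ 0)^[n] ψ.ext v = 0 := fun n => by
    induction n with
    | zero =>
      intro v hv
      rw [Function.iterate_zero_apply, hψ, HolderSpace.mk_ext _ _ _ _ (hES hv)]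
      simp only [hF, Metric.infDist_zero_of_mem hv, Complex.ofReal_zero]
    | succ n ih =>
      intro v hv
      rw [Function.iterate_succ_apply']
      refine integral_eq_zero_of_ae ?_
      filter_upwards [hinv] with g hg
      rw [ih _ (hg v hv), smul_zero]; rfl
  obtain ⟨M, L, hM, hsplit, b, hb0, hb1, hb⟩ :=
    hl.exists_split hε hε1 hd one_pos le_rfl h0
  rw [kappa_zero] at hb1
  obtain ⟨n, hn⟩ := exists_norm_pow_lt (hb.trans_lt
    ((ENNReal.ofReal_lt_ofReal_iff one_pos).2 hb1))
  rw [one_pow] at hn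
  have hMe : (M ψ).toFun ⟨e, hES he⟩ = 0 := by
    have hbound : ∀ j : ℕ, ‖(M ψ).toFun ⟨e, hES he⟩‖ ≤ ‖L ^ (n + 1)‖ ^ (j + 1) * ‖ψ‖ := fun j => by
      have h1 := hsplit.pow (n := (n + 1) * (j + 1)) (Nat.mul_pos n.succ_pos j.succ_pos)
      have h2 := h0.powOp_pow hε hε1 hd one_pos le_rfl ((n + 1) * (j + 1)) ψ ⟨e, hES he⟩
      rw [h1, hiter _ e he, kappa_zero, Complex.ofReal_one, one_pow, one_smul] at h2
      change (M ψ + (L ^ ((n + 1) * (j + 1))) ψ).toFun _ = 0 at h2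
      rw [HolderSpace.toFun_add] at h2
      rw [eq_neg_of_add_eq_zero_left h2, norm_neg]
      refine (HolderSpace.norm_toFun_le _ _).trans ((ContinuousLinearMap.le_opNorm _ _).trans ?_)
      rw [pow_mul]
      exact mul_le_mul_of_nonneg_right (norm_pow_le' _ j.succ_pos) (norm_nonneg ψ)
    have ht : Tendsto (fun j : ℕ => ‖L ^ (n + 1)‖ ^ (j + 1) * ‖ψ‖) atTop (𝓝 0) := by
      simpa using ((tendsto_pow_atTop_nhds_zero_of_lt_one (norm_nonneg _) hn).comp
        (tendsto_add_atTop_nat 1)).mul_const ‖ψ‖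
    exact norm_le_zero_iff.1 (ge_of_tendsto ht (Eventually.of_forall hbound))
  have hr0 : ((∫ u, rS μ 0 u ∂(nuS μ 0) : ℝ) : ℂ) ≠ 0 := by
    exact_mod_cast (hl.integral_pos hε h0).ne'
  have hre : (rS μ 0 e : ℂ) ≠ 0 := by exact_mod_cast (hl.pos hε (hES he).1).ne'
  rw [hM] at hMe
  have hint : ∫ v, Metric.infDist v E ∂(nuS μ 0) = 0 := by
    have h1 : ∫ v, ψ.ext v ∂(nuS μ 0) = 0 := by
      rcases mul_eq_zero.1 hMe with h | h
      · exact (div_eq_zero_iff.1 h).resolve_right hr0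
      · exact absurd h hre
    have h2 : ∫ v, ψ.ext v ∂(nuS μ 0) = ((∫ v, Metric.infDist v E ∂(nuS μ 0) : ℝ) : ℂ) := by
      rw [← integral_complex_ofReal]
      exact integral_congr_ae (hmem.mono fun v hv => HolderSpace.mk_ext hε one_pos _ _ hv)
    exact_mod_cast h2.symm.trans h1
  have hi : Integrable (fun v => Metric.infDist v E) (nuS μ 0) := by
    have := (integrable_of_bounded hmem (Complex.measurable_ofReal.comp
      (Metric.continuous_infDist_pt E).measurable) ⟨2, hFB.1⟩).re
    simpa using this
  rw [integral_eq_zero_iff_of_nonneg (fun v => Metric.infDist_nonneg) hi] at hint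
  refine Measure.support_subset_of_isClosed hE ?_
  filter_upwards [hint] with v hv
  exact (hE.mem_iff_infDist_zero ⟨e, he⟩).2 hv

theorem exists_angle {z : ℂ} (hz : ‖z‖ = 1) :
    ∃ θ ∈ Ico 0 (2 * Real.pi), Complex.exp (Complex.I * (θ : ℝ)) = z := by
  have h1 : Complex.exp (Complex.I * (Complex.arg z : ℝ)) = z := by
    have := Complex.norm_mul_exp_arg_mul_I z
    rwa [hz, Complex.ofReal_one, one_mul, mul_comm] at this
  have h2 := Complex.arg_mem_Ioc z
  have h3 := Real.pi_pos
  rcases le_or_gt 0 (Complex.arg z) with h | h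
  · exact ⟨Complex.arg z, ⟨h, by linarith [h2.2]⟩, h1⟩
  · refine ⟨Complex.arg z + 2 * Real.pi, ⟨by linarith [h2.1], by linarith⟩, ?_⟩
    push_cast
    rw [mul_add, Complex.exp_add, h1, mul_comm Complex.I, Complex.exp_two_pi_mul_I, mul_one]

/-- A function of constant modulus on a closed invariant set that is an eigenfunction of the twisted
action contradicts non-arithmeticity. -/
theorem NonArithmetic.false_of_cocycle (hNA : NonArithmetic μ) (hε : 0 < ε) (hε1 : ε < 1)
    (hd : 0 < d) (hμ : ∀ᵐ g ∂μ, Good ε g) (hsupp : ∀ᵐ g ∂μ, g ∈ supp μ) {t : ℝ} (ht : 0 < t)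
    {z : ℂ} (hz : ‖z‖ = 1) {φ : Vec d → ℂ} {m : ℝ} (hm : 0 < m) {E : Set (Vec d)} (hE : IsClosed E)
    (hEne : E.Nonempty) (hES : E ⊆ simplexGe d ε) (hφ : ∀ v ∈ E, ‖φ v‖ = m)
    (hcoc : ∀ g ∈ supp μ, ∀ v ∈ E, act g v ∈ E ∧
      Complex.exp (t * Complex.I * Real.log (vecNorm (g.mulVec v))) * φ (act g v) = z * φ v) :
    False := by
  have h0 := GoodLaw.of_good_zero hε hε1 hμ
  have hl := (h0.leading hε hε1 hd).2.1
  have hsub := support_nuS_subset hε hε1 hd hμ hE hEne hES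
    (hsupp.mono fun g hg v hv => (hcoc g hg v hv).1)
  have heig : IsEigenmeasure (transferOp μ 0) 1 (nuS μ 0) := by
    have := hl.law.isEigenmeasure hε hε1 h0
    rwa [kappa_zero] at this
  obtain ⟨θ, hθ, hθz⟩ := exists_angle hz
  refine hNA _ heig ⟨t, ht, θ, hθ, fun v => Complex.arg (φ v), fun g hg v hv => ?_⟩
  have hvE := hsub hv
  obtain ⟨h1, h2⟩ := hcoc g hg v hvE
  have hpos := vecNorm_mulVec_pos hg.2 (hES hvE).1
  have harg : ∀ w ∈ E, Complex.exp (Complex.I * (Complex.arg (φ w) : ℝ)) = (m : ℂ)⁻¹ * φ w :=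
    fun w hw => by
      have h3 := Complex.norm_mul_exp_arg_mul_I (φ w)
      rw [hφ w hw, mul_comm (Complex.arg (φ w) : ℂ)] at h3
      exact (eq_inv_mul_iff_mul_eq₀ (by exact_mod_cast hm.ne')).2 h3
  rw [harg _ h1, harg _ hvE, hθz, Complex.cpow_def_of_ne_zero (by exact_mod_cast hpos.ne'),
    ← Complex.ofReal_log hpos.le, mul_comm (Real.log _ : ℂ), mul_left_comm, h2]
  ring

/-- If the average of a function bounded by `m` has modulus at least `m`, the function is almost
surely constant. -/
theorem ae_eq_of_le_norm_average {Ω : Type*} [MeasurableSpace Ω] {P : Measure Ω} {p : Ω → ℝ}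
    {F : Ω → ℂ} {m : ℝ} {y : ℂ} (hp : Integrable p P) (hp0 : ∀ᵐ x ∂P, 0 < p x)
    (hc : 0 < ∫ x, p x ∂P) (hpF : Integrable (fun x => p x • F x) P) (hF : ∀ᵐ x ∂P, ‖F x‖ ≤ m)
    (hy : ∫ x, p x • F x ∂P = (∫ x, p x ∂P) • y) (hmy : m ≤ ‖y‖) :
    ‖y‖ = m ∧ ∀ᵐ x ∂P, F x = y := by
  have hle : ‖y‖ ≤ m := by
    have h1 : ‖∫ x, p x • F x ∂P‖ ≤ ∫ x, p x * m ∂P := by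
      refine norm_integral_le_of_norm_le (hp.mul_const m) ?_
      filter_upwards [hp0, hF] with x h1 h2
      rw [norm_smul, Real.norm_of_nonneg h1.le]
      exact mul_le_mul_of_nonneg_left h2 h1.le
    rw [hy, norm_smul, Real.norm_of_nonneg hc.le, integral_mul_const] at h1
    exact le_of_mul_le_mul_left h1 hc
  have hym : ‖y‖ = m := le_antisymm hle hmy
  refine ⟨hym, ?_⟩
  -- the weighted integral of the nonnegative function `m² - Re (ȳ F)` vanishes
  have hi : Integrable (fun x => p x * (m ^ 2 - ((starRingEnd ℂ) y * F x).re)) P := by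
    have h1 := (hpF.const_mul ((starRingEnd ℂ) y)).re
    refine ((hp.mul_const (m ^ 2)).sub h1).congr (Eventually.of_forall fun x => ?_)
    simp only [Pi.sub_apply, RCLike.re_to_complex, Complex.real_smul]
    rw [mul_left_comm, Complex.re_ofReal_mul]
    ring
  have hnn : ∀ᵐ x ∂P, 0 ≤ p x * (m ^ 2 - ((starRingEnd ℂ) y * F x).re) := by
    filter_upwards [hp0, hF] with x h1 h2
    have h3 := Complex.re_le_norm ((starRingEnd ℂ) y * F x)
    rw [norm_mul, Complex.norm_conj, hym] at h3
    have h4 : 0 ≤ m := (norm_nonneg _).trans h2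
    exact mul_nonneg h1.le (by nlinarith)
  have hint : ∫ x, p x * (m ^ 2 - ((starRingEnd ℂ) y * F x).re) ∂P = 0 := by
    have h1 := hpF.const_mul ((starRingEnd ℂ) y)
    have h2 : ∫ x, p x * (m ^ 2 - ((starRingEnd ℂ) y * F x).re) ∂P =
        ∫ x, (p x * m ^ 2 - RCLike.re ((starRingEnd ℂ) y * p x • F x)) ∂P := by
      refine integral_congr_ae (Eventually.of_forall fun x => ?_)
      simp only [RCLike.re_to_complex, Complex.real_smul]
      rw [mul_left_comm, Complex.re_ofReal_mul]
      ring
    rw [h2, integral_sub (hp.mul_const _) h1.re, integral_re h1, integral_mul_const,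
      integral_const_mul, hy, Complex.real_smul, mul_left_comm, RCLike.re_to_complex,
      Complex.re_ofReal_mul, ← Complex.normSq_eq_conj_mul_self, Complex.ofReal_re,
      Complex.normSq_eq_norm_sq, hym, sub_self]
  rw [integral_eq_zero_iff_of_nonneg_ae hnn hi] at hint
  filter_upwards [hint, hp0, hF] with x h1 h2 h3
  have h4 : ((starRingEnd ℂ) y * F x).re = m ^ 2 := by
    have := (mul_eq_zero.1 h1).resolve_left h2.ne'
    linarith
  have h5 : ‖F x - y‖ ^ 2 ≤ 0 := by
    rw [← Complex.normSq_eq_norm_sq, Complex.normSq_sub, Complex.normSq_eq_norm_sq,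
      Complex.normSq_eq_norm_sq, hym, mul_comm (F x), h4]
    nlinarith [norm_nonneg (F x)]
  have h6 : ‖F x - y‖ = 0 := by nlinarith [norm_nonneg (F x - y)]
  exact sub_eq_zero.1 (norm_eq_zero.1 h6)

end

/-! ### The operators on the imaginary axis -/

section

variable {μ : Measure (Mat d)} {s t k : ℝ} {ν : Measure (Vec d)} {r : Vec d → ℝ}

theorem HolderSpace.continuousOn_ext (φ : HolderSpace d ε γ) :
    ContinuousOn φ.ext (simplexGe d ε) := by
  rw [continuousOn_iff_continuous_domRestrict]
  have h : (simplexGe d ε).domRestrict φ.ext = φ.toFun := funext φ.ext_coe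
  rw [h]
  exact φ.2.1

theorem continuousWithinAt_character_mul (t : ℝ) (φ : HolderSpace d ε γ) {g : Mat d}
    (hg : Good ε g) {v : Vec d} (hv : v ∈ simplex d) :
    ContinuousWithinAt (fun g : Mat d => Complex.exp (t * Complex.I *
      Real.log (vecNorm (g.mulVec v))) * φ.ext (act g v)) {g | Good ε g} g := by
  have h1 : ContinuousAt (fun g : Mat d => Real.log (vecNorm (g.mulVec v))) g :=
    (continuousAt_vecNorm_mulVec g v).log (vecNorm_mulVec_pos hg.pos hv).ne'
  have h2 : ContinuousAt (fun g : Mat d => Complex.exp (t * Complex.I *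
      Real.log (vecNorm (g.mulVec v)))) g :=
    Complex.continuous_exp.continuousAt.comp
      (continuousAt_const.mul (Complex.continuous_ofReal.continuousAt.comp h1))
  have h3 : ContinuousWithinAt (fun g : Mat d => φ.ext (act g v)) {g | Good ε g} g :=
    ContinuousWithinAt.comp (f := fun g : Mat d => act g v)
      (φ.continuousOn_ext _ (hg.act_mem v hv)) (continuousAt_act hg.pos hv).continuousWithinAt
      fun g' (hg' : Good ε g') => hg'.act_mem v hv
  exact h2.continuousWithinAt.mul h3

variable [IsProbabilityMeasure μ]

omit [IsProbabilityMeasure μ] in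
/-- Up to conjugation with the multiplication by `r`, the operator with exponent `s + it` is `k`
times the twisted Markov operator. -/
theorem LeadingData.exists_represents_twistOp (hε : 0 < ε) (hε1 : ε < 1) (hd : 0 < d) (hγ : 0 < γ)
    (hγ1 : γ ≤ 1) {α : ℝ} (hμ : GoodLaw ε s α μ) (h : LeadingData ε s μ k ν r) (t : ℝ) :
    ∃ V : (HolderSpace d ε γ →L[ℂ] HolderSpace d ε γ)ˣ,
      Represents ((k : ℂ)⁻¹ • conjOp V (powOp ε γ μ (s + t * Complex.I))) (twistOp μ s t k r) := by
  have hD0 : 0 ≤ |s| * (2 / ε) := mul_nonneg (abs_nonneg s) (by positivity)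
  obtain ⟨B, H, -, -, hBH⟩ := h.logLip.holderBound (γ := γ) hD0 hγ1
  obtain ⟨B', H', -, -, hBH'⟩ := h.logLip.inv.holderBound (γ := γ) hD0 hγ1
  obtain ⟨V, hV, hV'⟩ := exists_weight hε hγ (F := fun v => (r v : ℂ))
    (F' := fun v => ((r v)⁻¹ : ℝ)) ⟨B, H, hBH⟩ ⟨B', H', hBH'⟩ fun v hv => by
      rw [Complex.ofReal_inv, mul_inv_cancel₀ (by exact_mod_cast (h.pos hε hv.1).ne')]
  have hrep := represents_powOp hε hε1 hd hγ hγ1 hμ.good (w := s + t * Complex.I)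
    (by simpa using hμ.integrable)
  refine ⟨V, fun φ v => ?_⟩
  change (k : ℂ)⁻¹ * (conjOp V (powOp ε γ μ (s + t * Complex.I)) φ).toFun v = _
  rw [conjOp_apply, hV', hrep, twistOp, ← mul_assoc, Complex.ofReal_inv, ← mul_inv,
    ← Complex.ofReal_mul, profileOp]
  congr 1
  refine integral_congr_ae ?_
  filter_upwards [hμ.good] with g hg
  have hact := hg.act_mem v v.2.1
  rw [HolderSpace.ext_apply _ hact, hV, HolderSpace.ext_apply _ hact, add_mul, Complex.exp_add,
    exp_mul_log_eq_rpow (vecNorm_mulVec_pos hg.pos v.2.1), Complex.real_smul]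
  push_cast
  ring

/-- For a non-arithmetic law, the twisted Markov operators have no eigenvalue of modulus at least
one. On the set where the modulus of an eigenfunction is maximal, equality in the triangle
inequality makes the eigenfunction a solution of the cohomological equation. -/
theorem LeadingData.not_peripheral (hε : 0 < ε) (hε1 : ε < 1) (hd : 0 < d) {α : ℝ}
    (hμ : GoodLaw ε s α μ) (h : LeadingData ε s μ k ν r) (hNA : NonArithmetic μ)
    (hsupp : ∀ᵐ g ∂μ, g ∈ supp μ) (hgood : ∀ g ∈ supp μ, Good ε g) (ht : t ≠ 0) {z : ℂ}
    (hz : 1 ≤ ‖z‖) {φ : HolderSpace d ε γ} (hφ : φ ≠ 0)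
    (heig : ∀ v ∈ simplexGe d ε, twistOp μ s t k r φ.ext v = z * φ.ext v) : False := by
  obtain ⟨v₀, hv₀⟩ : ∃ v, φ.toFun v ≠ 0 := by
    by_contra! hcon
    exact hφ (HolderSpace.toFun_injective hcon)
  obtain ⟨vm, -, hvm⟩ := isCompact_univ.exists_isMaxOn ⟨v₀, mem_univ v₀⟩
    (φ.2.1.norm.continuousOn (s := univ))
  set m := ‖φ.toFun vm‖ with hmdef
  have hle : ∀ v ∈ simplexGe d ε, ‖φ.ext v‖ ≤ m := fun v hv => by
    rw [φ.ext_apply hv]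
    exact hvm (mem_univ (⟨v, hv⟩ : simplexGe d ε))
  have hm : 0 < m := (norm_pos_iff.2 hv₀).trans_le (by
    have := hle v₀ v₀.2
    rwa [φ.ext_coe] at this)
  set E : Set (Vec d) := Subtype.val '' {v : simplexGe d ε | ‖φ.toFun v‖ = m} with hEdef
  have hEc : IsClosed E :=
    ((isClosed_eq φ.2.1.norm continuous_const).isCompact.image continuous_subtype_val).isClosed
  have hES : E ⊆ simplexGe d ε := by rintro _ ⟨v, -, rfl⟩; exact v.2
  have hEm : ∀ v ∈ E, ‖φ.ext v‖ = m := by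
    rintro _ ⟨v, hv, rfl⟩
    rw [φ.ext_coe]
    exact hv
  have hmemE : ∀ v ∈ simplexGe d ε, ‖φ.ext v‖ = m → v ∈ E := fun v hv hvm' =>
    ⟨⟨v, hv⟩, by rwa [φ.ext_apply hv] at hvm', rfl⟩
  have hEne : E.Nonempty := ⟨vm, vm, rfl, rfl⟩
  have key : ∀ v ∈ E, ‖z * φ.ext v‖ = m ∧ ∀ g ∈ supp μ,
      Complex.exp (t * Complex.I * Real.log (vecNorm (g.mulVec v))) * φ.ext (act g v) =
        z * φ.ext v := fun v hv => by
    have hvS := hES hv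
    have hkr : 0 < k * r v := mul_pos h.law.pos (h.pos hε hvS.1)
    have hp : ∫ g, vecNorm (g.mulVec v) ^ s * r (act g v) ∂μ = k * r v := h.eigen v hvS.1
    have hI := heig v hvS
    rw [twistOp, inv_mul_eq_iff_eq_mul₀ (by exact_mod_cast hkr.ne')] at hI
    obtain ⟨h1, h2⟩ := ae_eq_of_le_norm_average (m := m) (h.integrable_weight hε hε1 hμ hvS.1)
      (h.weight_pos hε hμ hvS.1) (by rw [hp]; exact hkr)
      (h.integrable_twist (t := t) hε hε1 hμ φ.measurable_ext hle hvS.1)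
      (by
        filter_upwards [hμ.good] with g hg
        rw [norm_mul, norm_exp_mul_I, one_mul]
        exact hle _ (hg.act_mem v hvS.1))
      (by rw [hI, hp, Complex.real_smul])
      (by
        rw [norm_mul, hEm v hv]
        exact le_mul_of_one_le_left hm.le hz)
    exact ⟨h1, fun g hg => eq_on_supp_of_ae hμ.good h2 hg
      (continuousWithinAt_character_mul t φ (hgood g hg) hvS.1)⟩
  obtain ⟨e, he⟩ := hEne
  have hz1 : ‖z‖ = 1 := by
    have h1 := (key e he).1
    rw [norm_mul, hEm e he] at h1
    exact (mul_eq_right₀ hm.ne').1 h1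
  have hEact : ∀ g ∈ supp μ, ∀ v ∈ E, act g v ∈ E := fun g hg v hv => by
    obtain ⟨h1, h2⟩ := key v hv
    refine hmemE _ ((hgood g hg).act_mem v (hES hv).1) ?_
    rw [← h1, ← h2 g hg, norm_mul, norm_exp_mul_I, one_mul]
  rcases ht.lt_or_gt with ht | ht
  · refine hNA.false_of_cocycle (φ := fun v => (starRingEnd ℂ) (φ.ext v)) (t := -t)
      (z := (starRingEnd ℂ) z) hε hε1 hd hμ.good hsupp (by linarith)
      (by rw [Complex.norm_conj, hz1]) hm hEc ⟨e, he⟩ hES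
      (fun v hv => by rw [Complex.norm_conj, hEm v hv]) fun g hg v hv => ⟨hEact g hg v hv, ?_⟩
    have h1 := congrArg (starRingEnd ℂ) ((key v hv).2 g hg)
    rw [map_mul, map_mul, ← Complex.exp_conj, map_mul, map_mul, Complex.conj_ofReal,
      Complex.conj_ofReal, Complex.conj_I] at h1
    rw [← h1]
    congr 2
    push_cast
    ring
  · exact hNA.false_of_cocycle hε hε1 hd hμ.good hsupp ht hz1 hm hEc ⟨e, he⟩ hES hEm
      fun g hg v hv => ⟨hEact g hg v hv, (key v hv).2 g hg⟩

/-- For a non-arithmetic law, the spectral radius of the operator with exponent `s + it`, `t ≠ 0`,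
is smaller than the one for `t = 0`. -/
theorem LeadingData.spectralRadius_powOp_lt (hε : 0 < ε) (hε1 : ε < 1) (hd : 0 < d) (hγ : 0 < γ)
    (hγ1 : γ ≤ 1) (hμ : GoodLaw ε s (contr ε) μ) (h : LeadingData ε s μ k ν r)
    (hNA : NonArithmetic μ) (hsupp : ∀ᵐ g ∂μ, g ∈ supp μ) (hgood : ∀ g ∈ supp μ, Good ε g)
    (ht : t ≠ 0) :
    ∃ b, 0 < b ∧ b < k ∧
      spectralRadius ℂ (powOp ε γ μ (s + t * Complex.I)) < ENNReal.ofReal b := by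
  have hcs := HolderSpace.completeSpace (d := d) hε hγ
  have hk := h.law.pos
  obtain ⟨V, hV⟩ := h.exists_represents_twistOp (γ := γ) hε hε1 hd hγ hγ1 hμ t
  set A := (k : ℂ)⁻¹ • conjOp V (powOp ε γ μ (s + t * Complex.I)) with hA
  have hA1 : spectralRadius ℂ A < 1 := by
    by_contra! hcon
    obtain ⟨C, hC, hLY⟩ := h.exists_twistOp_sub_le hε hε1 hγ hγ1 hμ t
    have hθ0 : 0 ≤ contr ε ^ γ := Real.rpow_nonneg (contr_nonneg hε hε1) _
    obtain ⟨z, φ, hz, hφ, heig⟩ := exists_peripheral_eigenvector hε hγ hθ0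
      (Real.rpow_lt_one (contr_nonneg hε hε1) (contr_lt_one hε) hγ) hC
      (fun φ => HolderSpace.supNorm_le φ.supNorm_nonneg fun v => by
        rw [hV]
        exact h.norm_twistOp_le hε hε1 hμ (φ.holderBound_supNorm_semi hγ).1 v.2.1)
      (fun φ => HolderSpace.semi_le (add_nonneg (mul_nonneg hθ0 φ.semi_nonneg)
          (mul_nonneg hC φ.supNorm_nonneg)) fun u v => by
        rw [hV, hV]
        exact hLY φ.ext φ.measurable_ext _ _ φ.supNorm_nonneg φ.semi_nonneg
          (φ.holderBound_supNorm_semi hγ) u u.2 v v.2) hcon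
    refine h.not_peripheral hε hε1 hd hμ hNA hsupp hgood ht hz hφ fun v hv => ?_
    rw [← hV φ ⟨v, hv⟩, heig, φ.ext_apply hv]
    rfl
  obtain ⟨b, hb1, hb2⟩ := ENNReal.lt_iff_exists_real_btwn.1 hA1 |>.imp fun b hb => hb.2
  have hb0 : 0 < b := ENNReal.ofReal_pos.1 (bot_le.trans_lt hb1)
  have hb1' : b < 1 := by rwa [← ENNReal.ofReal_one, ENNReal.ofReal_lt_ofReal_iff one_pos] at hb2
  have hP : powOp ε γ μ (s + t * Complex.I) = conjOp V⁻¹ ((k : ℂ) • A) := by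
    rw [hA, smul_inv_smul₀ (by exact_mod_cast hk.ne')]
    simp only [conjOp, inv_inv, mul_assoc, Units.mul_inv, mul_one, Units.mul_inv_cancel_left]
  obtain ⟨c, hc1, hc2⟩ := exists_between ((mul_lt_iff_lt_one_right hk).2 hb1')
  refine ⟨c, (mul_pos hk hb0).trans hc1, hc2, ?_⟩
  rw [hP, spectralRadius_conj]
  refine (spectralRadius_smul_le _ hb0.le hb1.le).trans_lt ?_
  rw [Complex.norm_real, Real.norm_of_nonneg hk.le]
  exact (ENNReal.ofReal_lt_ofReal_iff ((mul_pos hk hb0).trans hc1)).2 hc1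

/-- The uniform bound on the spectral radii of the operators `R_{s,it,f}`. -/
theorem exists_spectralRadius_perturbedOp_le (hε : 0 < ε) (hε1 : ε < 1) (hd : 0 < d) (hγ : 0 < γ)
    (hNA : NonArithmetic μ) (hsupp : ∀ᵐ g ∂μ, g ∈ supp μ) (hgood : ∀ g ∈ supp μ, Good ε g)
    {J : Set ℝ} (hJ : IsCompact J) (hJI : J ⊆ IInt μ) (hγ1 : ∀ s ∈ J, γ ≤ 1) {T : Set ℝ}
    (hT : IsCompact T) (hT0 : (0 : ℝ) ∉ T) :
    ∃ a : ℝ, 0 ≤ a ∧ a < 1 ∧ ∀ f ∈ simplex d, ∀ s ∈ J, ∀ t ∈ T,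
      ∃ R : HolderSpace d ε γ →L[ℂ] HolderSpace d ε γ,
        Represents R (perturbedOp μ s (t * Complex.I) f) ∧
        spectralRadius ℂ R ≤ ENNReal.ofReal a := by
  have hcs := HolderSpace.completeSpace (d := d) hε hγ
  have hμ : ∀ᵐ g ∂μ, Good ε g := hsupp.mono hgood
  have hlaw : ∀ s ∈ IInt μ, GoodLaw ε s (contr ε) μ := fun s hs =>
    GoodLaw.of_good hε hε1 hμ (integrable_of_mem_IInt hs)
  have hlead : ∀ s ∈ IInt μ, LeadingData ε s μ (kappa μ s) (nuS μ s) (rS μ s) := fun s hs =>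
    ((hlaw s hs).leading hε hε1 hd).2.1
  -- a bound for the operators with exponents in a neighbourhood extends to compact sets
  have hunif : ∃ a : ℝ, 0 ≤ a ∧ a < 1 ∧ ∀ p ∈ J ×ˢ T, spectralRadius ℂ
      (powOp ε γ μ (p.1 + p.2 * Complex.I)) ≤ ENNReal.ofReal (a * kappa μ p.1) := by
    refine (hJ.prod hT).induction_on (p := fun S => ∃ a : ℝ, 0 ≤ a ∧ a < 1 ∧ ∀ p ∈ S, p ∈ J ×ˢ T →
      spectralRadius ℂ (powOp ε γ μ (p.1 + p.2 * Complex.I)) ≤ ENNReal.ofReal (a * kappa μ p.1))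
      ⟨0, le_rfl, one_pos, fun p hp => absurd hp (notMem_empty p)⟩ ?_ ?_ ?_ |>.imp
        fun a ha => ⟨ha.1, ha.2.1, fun p hp => ha.2.2 p hp hp⟩
    · rintro S S' hSS ⟨a, ha0, ha1, ha⟩
      exact ⟨a, ha0, ha1, fun p hp => ha p (hSS hp)⟩
    · rintro S S' ⟨a, ha0, ha1, ha⟩ ⟨a', ha0', ha1', ha'⟩
      refine ⟨max a a', le_max_of_le_left ha0, max_lt ha1 ha1', fun p hp hpJ => ?_⟩
      have hk := (hlead p.1 (hJI hpJ.1)).law.pos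
      rcases hp with hp | hp
      · exact (ha p hp hpJ).trans (ENNReal.ofReal_le_ofReal
          (mul_le_mul_of_nonneg_right (le_max_left _ _) hk.le))
      · exact (ha' p hp hpJ).trans (ENNReal.ofReal_le_ofReal
          (mul_le_mul_of_nonneg_right (le_max_right _ _) hk.le))
    · rintro ⟨s₀, t₀⟩ ⟨hs₀, ht₀⟩
      have hsI := hJI hs₀
      have ht₀' : t₀ ≠ 0 := fun h0 => hT0 (h0 ▸ ht₀)
      have hk := (hlead s₀ hsI).law.pos
      obtain ⟨b, hb0, hbk, hb⟩ := (hlead s₀ hsI).spectralRadius_powOp_lt (t := t₀) (γ := γ) hε hε1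
        hd hγ
        (hγ1 s₀ hs₀) (hlaw s₀ hsI) hNA hsupp hgood ht₀'
      obtain ⟨n, hn⟩ := exists_norm_pow_lt hb
      obtain ⟨a, ha1, ha2⟩ := exists_between ((div_lt_one hk).2 hbk)
      have hcont : ContinuousAt (fun p : ℝ × ℝ => powOp ε γ μ (p.1 + p.2 * Complex.I))
        (s₀, t₀) := by
        have h1 : ContinuousAt (powOp ε γ μ) (s₀ + t₀ * Complex.I) :=
          (analyticAt_powOp hε hε1 hd hγ (hγ1 s₀ hs₀) hμ (by
            have : (s₀ + t₀ * Complex.I : ℂ).re = s₀ := by simp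
            rw [this]
            filter_upwards [isOpen_IInt.mem_nhds hsI] with s hs
              using integrable_of_mem_IInt hs)).continuousAt
        have h2 : Continuous fun p : ℝ × ℝ => (p.1 + p.2 * Complex.I : ℂ) :=
          (Complex.continuous_ofReal.comp continuous_fst).add
            ((Complex.continuous_ofReal.comp continuous_snd).mul continuous_const)
        exact ContinuousAt.comp (f := fun p : ℝ × ℝ => (p.1 + p.2 * Complex.I : ℂ))
          (g := powOp ε γ μ) h1 h2.continuousAt
      have e1 : ∀ᶠ p : ℝ × ℝ in 𝓝 (s₀, t₀),
          ‖powOp ε γ μ (p.1 + p.2 * Complex.I) ^ (n + 1)‖ < b ^ (n + 1) :=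
        (hcont.pow (n + 1)).norm.eventually_lt continuousAt_const hn
      have hkc : ContinuousAt (fun p : ℝ × ℝ => a * kappa μ p.1) (s₀, t₀) :=
        continuousAt_const.mul (ContinuousAt.comp (f := fun p : ℝ × ℝ => p.1)
          (continuousAt_kappa_drift (γ := γ) hε hε1 hd hγ (hγ1 s₀ hs₀) hμ hsI).1 continuousAt_fst)
      have e2 : ∀ᶠ p : ℝ × ℝ in 𝓝 (s₀, t₀), b < a * kappa μ p.1 :=
        continuousAt_const.eventually_lt hkc (by rwa [div_lt_iff₀ hk] at ha1)
      refine ⟨_, mem_nhdsWithin_of_mem_nhds (e1.and e2), a, (div_pos hb0 hk).le.trans ha1.le, ha2,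
        fun p hp _ => ?_⟩
      exact (spectralRadius_le_of_norm_pow_le hb0.le hp.1.le).trans
        (ENNReal.ofReal_le_ofReal hp.2.le)
  obtain ⟨a, ha0, ha1, ha⟩ := hunif
  refine ⟨a, ha0, ha1, fun f hf s hs t ht => ?_⟩
  have hsI := hJI hs
  have hk := (hlead s hsI).law.pos
  obtain ⟨D, -, -, hD, -⟩ := (hlead s hsI).exists_conj (γ := γ) hε hε1 hd hγ (hγ1 s hs)
    (hlaw s hsI) hf
  refine ⟨_, hD (t * Complex.I) (by simpa using integrable_of_mem_IInt hsI), ?_⟩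
  have h1 : spectralRadius ℂ (conjOp (D (t * Complex.I)) (powOp ε γ μ (s + t * Complex.I))) ≤
      ENNReal.ofReal (a * kappa μ s) := by
    rw [spectralRadius_conj]
    exact ha (s, t) ⟨hs, ht⟩
  refine (spectralRadius_smul_le _ (mul_nonneg ha0 hk.le) h1).trans (ENNReal.ofReal_le_ofReal ?_)
  have h2 : ‖Complex.exp (-(drift μ s : ℂ) * (t * Complex.I)) * (kappa μ s : ℂ)⁻¹‖ =
      (kappa μ s)⁻¹ := by
    rw [show -(drift μ s : ℂ) * (t * Complex.I) = ((-(drift μ s) * t : ℝ) : ℂ) * Complex.I by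
      push_cast; ring, norm_mul, Complex.norm_exp_ofReal_mul_I, one_mul, norm_inv,
        Complex.norm_real,
      Real.norm_of_nonneg hk.le]
  rw [h2, mul_comm a, inv_mul_cancel_left₀ hk.ne']

end

/-! ### Adapted constants -/

section

variable {μ : Measure (Mat d)}

/-- If the entries of a positive matrix are comparable, then so are the coordinates of the points of
its image. -/
theorem act_mem_simplexGe_of_entries_le {g : Mat d} (hg : IsPositive g) {c : ℝ} (hc : 0 < c)
    (hd : 0 < d) (h : ∀ i j k l, g i j / g k l ≤ c) {v : Vec d} (hv : v ∈ simplex d) :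
    act g v ∈ simplexGe d (c * d)⁻¹ := by
  have hd' : (0 : ℝ) < d := by exact_mod_cast hd
  refine (act_mem_simplexGe_iff hg hv).2 fun i => ?_
  have hle : ∀ k, g.mulVec v k ≤ c * g.mulVec v i := fun k => by
    simp only [Matrix.mulVec, dotProduct, Finset.mul_sum]
    refine Finset.sum_le_sum fun j _ => ?_
    rw [← mul_assoc]
    exact mul_le_mul_of_nonneg_right ((div_le_iff₀ (hg i j)).1 (h k j i j)) (hv.1 j)
  have hsum := Finset.sum_le_sum fun k (_ : k ∈ Finset.univ) => hle k
  rw [← vecNorm_mulVec hg hv, Finset.sum_const, Finset.card_univ, Fintype.card_fin,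
    nsmul_eq_mul] at hsum
  rw [inv_mul_le_iff₀ (mul_pos hc hd')]
  linarith

theorem exists_adapted (hd : 2 ≤ d) (hA1 : FurstenbergKesten μ) :
    ∃ ε ∈ Ioo (0 : ℝ) 1, Adapted μ ε := by
  obtain ⟨c, hc, h⟩ := hA1
  have hc0 : 0 < c := one_pos.trans hc
  have hd' : (2 : ℝ) ≤ d := by exact_mod_cast hd
  have hd0 : 0 < d := by omega
  refine ⟨(c * d)⁻¹, ⟨inv_pos.2 (by positivity), inv_lt_one_of_one_lt₀ (by nlinarith)⟩,
    fun g hg v hv => ⟨?_, ?_⟩⟩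
  · exact act_mem_simplexGe_of_entries_le hg.2 hc0 hd0 (h g hg) hv
  · exact act_mem_simplexGe_of_entries_le hg.2.transpose hc0 hd0
      (fun i j k l => h g hg j i l k) hv

theorem Adapted.good (h : Adapted μ ε) : ∀ g ∈ supp μ, Good ε g := fun g hg =>
  ⟨hg.2, fun v hv => (h g hg v hv).1, fun v hv => (h g hg v hv).2⟩

theorem ae_mem_supp (hpos : ∀ᵐ g ∂μ, IsPositive g) : ∀ᵐ g ∂μ, g ∈ supp μ := by
  have : HereditarilyLindelofSpace (Mat d) :=
    inferInstanceAs (HereditarilyLindelofSpace (Fin d → Fin d → ℝ))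
  filter_upwards [Measure.support_mem_ae, hpos] with g h1 h2 using ⟨h1, h2⟩

end

end PosMat

end

theorem mainTheorem8 (d : ℕ) (hd : 2 ≤ d) (μ : Measure (PosMat.Mat d)) [IsProbabilityMeasure μ]
    (hpos : ∀ᵐ g ∂μ, PosMat.IsPositive g) (hA1 : PosMat.FurstenbergKesten μ) :
    -- suitable `ε` exist, and the results below hold for every one of them
    (∃ ε ∈ Ioo (0 : ℝ) 1, PosMat.Adapted μ ε) ∧
    ∀ ε ∈ Ioo (0 : ℝ) 1, PosMat.Adapted μ ε →
      -- the transfer operators of the coefficients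
      (∀ s ∈ PosMat.IInt μ,
        -- `κ(s)`, `ν_s`, `ν_s^*`, `r_s` are well defined
        Tendsto (fun n : ℕ => PosMat.normMoment μ s n ^ (1 / (n : ℝ))) atTop
          (𝓝 (PosMat.kappa μ s)) ∧
        (∃! ν, PosMat.IsEigenmeasure (PosMat.transferOp μ s) (PosMat.kappa μ s) ν) ∧
        (∃! ν, PosMat.IsEigenmeasure (PosMat.transferOpStar μ s) (PosMat.kappa μ s) ν) ∧
        ContinuousOn (PosMat.rS μ s) (PosMat.simplex d) ∧
        (∀ v ∈ PosMat.simplex d, 0 < PosMat.rS μ s v) ∧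
        (∀ v ∈ PosMat.simplex d, PosMat.transferOp μ s (fun u => (PosMat.rS μ s u : ℂ)) v =
          PosMat.kappa μ s * PosMat.rS μ s v) ∧
        ∀ γ : ℝ, 0 < γ → γ ≤ min |s| 1 → ∀ f ∈ PosMat.simplex d,
          ∃ P M L : PosMat.HolderSpace d ε γ →L[ℂ] PosMat.HolderSpace d ε γ,
            PosMat.Represents P (PosMat.coeffOp μ s f) ∧
            PosMat.Represents M (PosMat.opM μ s f) ∧
            PosMat.Represents L (PosMat.opLF μ s f) ∧
            (∀ n : ℕ, 1 ≤ n → P ^ n = (PosMat.kappa μ s : ℂ) ^ n • M + L ^ n) ∧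
            PosMat.nuSF μ s f (fun v => (PosMat.rSF μ s f v : ℂ)) = 1 ∧
            PosMat.IsRankOneProjection M ∧ M * L = 0 ∧ L * M = 0 ∧
            spectralRadius ℂ L < ENNReal.ofReal (PosMat.kappa μ s) ∧
            spectralRadius ℂ P = ENNReal.ofReal (PosMat.kappa μ s)) ∧
      -- the perturbed operators near `z = 0`
      (∀ J : Set ℝ, IsCompact J → J ⊆ PosMat.IInt μ →
        ∀ γ : ℝ, 0 < γ → (∀ s ∈ J, γ ≤ min |s| 1) →
          ∃ δ : ℝ, 0 < δ ∧ ∃ a : ℝ, 0 ≤ a ∧ a < 1 ∧ ∀ s ∈ J,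
            (∀ z ∈ Metric.ball (0 : ℂ) δ, s + z.re ∈ PosMat.IInt μ) ∧
            -- `K` is the holomorphic extension of `κ` to the disc of radius `δ` around `s`
            ∃ K lam : ℂ → ℂ, AnalyticOnNhd ℂ K (Metric.ball (s : ℂ) δ) ∧
              (∀ x : ℝ, |x - s| < δ → K x = PosMat.kappa μ x) ∧
              (∀ z : ℂ, lam z = Complex.exp (-(PosMat.drift μ s : ℂ) * z) *
                (K (s + z) / (PosMat.kappa μ s : ℂ))) ∧
              AnalyticOnNhd ℂ lam (Metric.ball 0 δ) ∧
              ∀ f ∈ PosMat.simplex d,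
                ∃ R Q N : ℂ → (PosMat.HolderSpace d ε γ →L[ℂ] PosMat.HolderSpace d ε γ),
                  AnalyticOnNhd ℂ Q (Metric.ball 0 δ) ∧
                  AnalyticOnNhd ℂ N (Metric.ball 0 δ) ∧
                  PosMat.Represents (Q 0) (fun φ _ => PosMat.piSF μ s f φ) ∧
                  ∀ z ∈ Metric.ball (0 : ℂ) δ,
                    PosMat.Represents (R z) (PosMat.perturbedOp μ s z f) ∧
                    (∀ n : ℕ, 1 ≤ n → R z ^ n = lam z ^ n • Q z + N z ^ n) ∧
                    PosMat.IsRankOneProjection (Q z) ∧ Q z * N z = 0 ∧ N z * Q z = 0 ∧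
                    spectralRadius ℂ (N z) ≤ ENNReal.ofReal a ∧ a < ‖lam z‖) ∧
      -- the perturbed operators on the imaginary axis away from `0`
      (PosMat.NonArithmetic μ →
        ∀ J : Set ℝ, IsCompact J → J ⊆ PosMat.IInt μ →
        ∀ γ : ℝ, 0 < γ → (∀ s ∈ J, γ ≤ min |s| 1) →
        ∀ T : Set ℝ, IsCompact T → (0 : ℝ) ∉ T →
          ∃ a : ℝ, 0 ≤ a ∧ a < 1 ∧ ∀ f ∈ PosMat.simplex d, ∀ s ∈ J, ∀ t ∈ T,
            ∃ R : PosMat.HolderSpace d ε γ →L[ℂ] PosMat.HolderSpace d ε γ,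
              PosMat.Represents R (PosMat.perturbedOp μ s (t * Complex.I) f) ∧
              spectralRadius ℂ R ≤ ENNReal.ofReal a) := by
  have hd0 : 0 < d := by omega
  have hsupp := PosMat.ae_mem_supp hpos
  refine ⟨PosMat.exists_adapted hd hA1, fun ε hεI hadapt => ?_⟩
  obtain ⟨hε, hε1⟩ := hεI
  have hgood := hadapt.good
  have hμ : ∀ᵐ g ∂μ, PosMat.Good ε g := hsupp.mono hgood
  refine ⟨fun s hs => ?_, fun J hJ hJI γ hγ hγs => ?_,
    fun hNA J hJ hJI γ hγ hγs T hT hT0 => ?_⟩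
  · have hlaw := PosMat.GoodLaw.of_good hε hε1 hμ (PosMat.integrable_of_mem_IInt hs)
    have hlawT := hlaw.transposeLaw hε hε1
    obtain ⟨hlim, h, hstar⟩ := hlaw.leading hε hε1 hd0
    have := hstar.prob
    refine ⟨hlim, ⟨_, h.law.isEigenmeasure hε hε1 hlaw, fun ν hν =>
        hlaw.eigenLaw_unique hε hε1 hd0 (hlaw.isEigenLaw_of_isEigenmeasure hε hε1 hd0 hν) h.law⟩,
      ⟨_, PosMat.isEigenmeasure_star_iff.2 (hstar.isEigenmeasure hε hε1 hlawT), fun ν hν =>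
        hlawT.eigenLaw_unique hε hε1 hd0 (hlawT.isEigenLaw_of_isEigenmeasure hε hε1 hd0
          (PosMat.isEigenmeasure_star_iff.1 hν)) hstar⟩,
      PosMat.continuousOn_momentFun hε (hstar.ae_mem hlawT), fun v hv => h.pos hε hv,
      fun v hv => ?_, fun γ hγ hγs f hf => ?_⟩
    · rw [PosMat.transferOp_ofReal, h.eigen v hv, Complex.ofReal_mul]
    · obtain ⟨P, M, L, hP, hM, hL, hsplit, hLr, hPr⟩ := h.coeffOp_split hε hε1 hd0 hγ
        (hγs.trans (min_le_right _ _)) hlaw hf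
      exact ⟨P, M, L, hP, hM, hL, fun n hn => hsplit.pow hn, h.nuSF_rSF hε hlaw hf,
        hsplit.isRankOneProjection, hsplit.proj_mul, hsplit.mul_proj, hLr, hPr⟩
  · exact PosMat.exists_splitsNearZero hε hε1 hd0 hγ hμ hJ hJI
      fun s hs => (hγs s hs).trans (min_le_right _ _)
  · exact PosMat.exists_spectralRadius_perturbedOp_le hε hε1 hd0 hγ hNA hsupp hgood hJ hJI
      (fun s hs => (hγs s hs).trans (min_le_right _ _)) hT hT0
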